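/- **Setting.** Let $G=(V,E)$ be a simple graph with $n$ vertices that is biconnected (at least three vertices, connected, and connected after the removal of any vertex), whose vertices are numbered with pairwise different natural numbers, and let $\varphi$ be a planar embedding of $G$ with a designated outer face, given by the circular order of the edges around each vertex. Assume that $(G,\varphi)$ is *almost triangulated*, i.e. the boundary of every inner face consists of exactly three vertices and three edges. The vertices on the outer face (the *coast*) have *height* $1$, and the vertices of height $i>1$ are those incident to the outer face after the removal of all vertices of height smaller than $i$. Assume that $\varphi$ is *$\ell$-outerplanar*: all heights are at most $\ell$. **Definitions.** A *crest* is a maximal connected set of vertices of the same height none of which is adjacent to a vertex of larger height. An *$s$-$t$-ridge* is a path from $s$ to $t$ whose minimum height, called its *depth*, is as large as possible among all $s$-$t$-paths. The *down vertex* of a vertex $u$ of height $q\ge 2$ is its neighbour of height $q-1$ with the smallest number; the edge between the two is a *down edge*; a *down path* consists of down edges (each traversed towards the down vertex) and ends in a vertex of the coast. Partition the neighbours of $u$ into maximal sets of neighbours that appear consecutively around $u$ and have either all height $q-1$ or all height at least $q$; the vertex with the smallest number in a set of the first kind is a *neighbourhood representant* around $u$. A *crest separator* is a pair $X=(P_1,P_2)$,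 where $P_1$ is a down path starting in some vertex $u$ and $P_2$ either is a down path starting in a neighbour of $u$ of the same height, or starts with the edge $\{u,v\}$ for a neighbourhood representant $v$ around $u$ different from the down vertex of $u$ and continues with the down path of $v$. Let $\mathcal S(G,\varphi)$ be the set of all crest separators. The *top vertices* of $X$ are the first vertices of $P_1$ and $P_2$. The *border edges* of $X$ are the edges of $P_1$ and $P_2$ and, if the first vertices differ, the edge between them; the *top edge* is the only border edge that is not a down edge. The *height* of $X$ is the maximum height of its vertices. For $\mathcal S\subseteq\mathcal S(G,\varphi)$, two inner faces are *$(\mathcal S,\varphi)$-connected* if one can be reached from the other through inner faces, where consecutive faces share a boundary edge that is not a border edge of a crest separator in $\mathcal S$. An *$(\mathcal S,\varphi)$-component* consists of the vertices and edges on the boundaries of the faces of a maximal nonempty set of pairwise $(\mathcal S,\varphi)$-connected inner faces. $X$ *goes strongly between* $A,B\subseteq V$ if $A$ and $B$ are contained in the vertex sets of different $(\{X\},\varphi)$-components and $A\cup B$ contains no vertex of $X$. $(G,\varphi,\mathcal S)$ with $\mathcal S\subseteq\mathcal S(G,\varphi)$ is a *good mountain structure* if * (a) for all crests $H_1\ne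 H_2$ and every ridge $R$ with one endpoint in $H_1$ and the other in $H_2$, there is an $X\in\mathcal S$ that goes strongly between $H_1$ and $H_2$, has height equal to the depth of $R$, and has as few top vertices as possible among all such crest separators in $\mathcal S(G,\varphi)$; * (b) no crest separator in $\mathcal S$ contains a vertex of a crest; * (c) each $(\mathcal S,\varphi)$-component contains vertices of a crest. The *mountain connection tree* is the graph whose nodes are the $(\mathcal S,\varphi)$-components, two of them being adjacent if and only if they have a common top edge of a crest separator in $\mathcal S$. **Statement.** There are a random access machine program (unit cost for every elementary operation) and a constant $c$ such that for all $n$, $\ell$ and all $(G,\varphi)$ as above, the program, given $(G,\varphi)$ (but not $\ell$), halts after at most $c\,\ell\, n$ steps and outputs a set $\mathcal S\subseteq\mathcal S(G,\varphi)$ (each crest separator written out as its two vertex sequences) such that $(G,\varphi,\mathcal S)$ is a good mountain structure, together with its mountain connection tree. Moreover, the mountain connection tree is indeed a tree, and each $(\mathcal S,\varphi)$-component contains all vertices of exactly one crest and no vertex of any other crest. -/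

import Mathlib

/-! ### Embedded planar graphs -/

/-- A connected simple graph together with a planar embedding and a numbering of its vertices by
pairwise different natural numbers.  The embedding is combinatorial: `rot d` is the dart (directed edge)
that follows `d` in the circular order of the edges around the tail of `d`; planarity is Euler's
formula; the outer face is the face that has the dart `outer` on its boundary. -/
structure PlaneGraph (V : Type*) where
  G : SimpleGraph V
  connected : G.Connected
  rot : Equiv.Perm G.Dart
  rot_fst : ∀ d, (rot d).fst = d.fst
  rot_sameCycle : ∀ d d' : G.Dart, d.fst = d'.fst → rot.SameCycle d d'
  outer : G.Dart
  /-- number of vertices + number of faces = number of edges + 2; the faces are the cycles of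
  the permutation that maps the dart `d` to the next dart of its facial walk -/
  euler : Nat.card V + Nat.card (Quotient (Equiv.Perm.SameCycle.setoid
      (SimpleGraph.Dart.symm_involutive.toPerm.trans rot))) = Nat.card G.edgeSet + 2
  num : V → ℕ
  num_injective : Function.Injective num

namespace PlaneGraph

variable {V : Type*} (M : PlaneGraph V)

/-- The next dart on the boundary of the face to which a dart belongs.  The cycles of this
permutation are the faces. -/
def face : Equiv.Perm M.G.Dart :=
  SimpleGraph.Dart.symm_involutive.toPerm.trans M.rot

/-- The darts on the boundaries of the inner faces. -/
def InnerDart : Type _ := {d : M.G.Dart // ¬ M.face.SameCycle M.outer d}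

/-- Every inner face is bounded by three vertices and three edges. -/
def AlmostTriangulated : Prop :=
  ∀ d : M.G.Dart, ¬ M.face.SameCycle M.outer d → M.face (M.face (M.face d)) = d

/-- At least three vertices, connected, and still connected after the removal of any vertex. -/
def Biconnected : Prop :=
  3 ≤ Nat.card V ∧ M.G.Connected ∧ ∀ v : V, (M.G.induce {v}ᶜ).Connected

/-- The darts of the original faces that are contained in the outer face of the embedded graph
obtained by removing the vertices in `R`: the removal of an edge merges the faces on
its two sides. -/
inductive InOuterFace (R : Set V) : M.G.Dart → Prop
  | outer : InOuterFace R M.outer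
  | next (d : M.G.Dart) : InOuterFace R d → InOuterFace R (M.face d)
  | merge (d : M.G.Dart) : InOuterFace R d → (d.fst ∈ R ∨ d.snd ∈ R) → InOuterFace R d.symm

/-- The vertices incident to the outer face after the removal of the vertices in `R`. -/
def coast (R : Set V) : Set V :=
  {v | v ∉ R ∧ ∃ d : M.G.Dart, d.fst = v ∧ M.InOuterFace R d}

/-- The vertices of height at most `i`. -/
def upTo : ℕ → Set V
  | 0 => ∅
  | i + 1 => upTo i ∪ M.coast (upTo i)

/-- The height of a vertex: coast vertices have height 1, and the vertices of height `i > 1` form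
the coast of what remains after the removal of all vertices of smaller height. -/
noncomputable def height (v : V) : ℕ := sInf {i | v ∈ M.upTo i}

/-- All vertices have height at most `l`. -/
def IsOuterplanar (l : ℕ) : Prop := ∀ v, v ∈ M.upTo l

/-! ### Crests and ridges -/

/-- A maximal connected set of vertices of the same height, no vertex of which is adjacent to a
vertex of larger height. -/
def IsCrest (H : Set V) : Prop :=
  Maximal (fun A : Set V => (M.G.induce A).Connected ∧
    ∀ u ∈ A, ∀ v ∈ A, M.height u = M.height v) H ∧
  ∀ u ∈ H, ∀ w, M.G.Adj u w → M.height w ≤ M.height u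

/-- The minimum height of a vertex of a walk; for a ridge, this is its depth. -/
noncomputable def depth {s t : V} (p : M.G.Walk s t) : ℕ := sInf {i | ∃ v ∈ p.support, M.height v = i}

/-- A path whose minimum height is as large as possible among all paths with the same endpoints. -/
def IsRidge {s t : V} (p : M.G.Walk s t) : Prop :=
  p.IsPath ∧ ∀ q : M.G.Walk s t, q.IsPath → M.depth q ≤ M.depth p

/-! ### Crest separators -/

/-- `v` is the down vertex of `u`: among the neighbours of `u` whose height is one smaller than
the height of `u`, it has the smallest number. -/
def IsDownVertex (u v : V) : Prop :=
  (M.G.Adj u v ∧ M.height v + 1 = M.height u) ∧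
  ∀ w, M.G.Adj u w → M.height w + 1 = M.height u → M.num v ≤ M.num w

/-- A path of down edges that ends in a vertex of the coast. -/
def IsDownPath (l : List V) : Prop :=
  l.IsChain M.IsDownVertex ∧ ∃ v ∈ l.getLast?, v ∈ M.coast ∅

/-- The dart leads to a vertex whose height is one smaller than the height of its tail. -/
def IsLowDart (d : M.G.Dart) : Prop := M.height d.snd + 1 = M.height d.fst

/-- The heads of `d` and `d'` are in the same set `S` of the partition of the neighbours of their
common tail `u`, where `S` consists of vertices of height one smaller than the height of `u`. -/
def SameLowBlock : M.G.Dart → M.G.Dart → Prop :=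
  Relation.EqvGen fun d d' => M.IsLowDart d ∧ M.IsLowDart d' ∧ d' = M.rot d

/-- `v` is a neighbourhood representant around `u`: it has the smallest number within a maximal
set of neighbours of `u` that appear consecutively around `u` and all have height one smaller
than the height of `u`. -/
def IsRepresentant (u v : V) : Prop :=
  ∃ d : M.G.Dart, d.fst = u ∧ d.snd = v ∧ 2 ≤ M.height u ∧ M.IsLowDart d ∧
    ∀ d' : M.G.Dart, M.SameLowBlock d d' → M.num v ≤ M.num d'.snd

/-- The set of all crest separators `(P₁, P₂)`: `P₁` is a down path that starts in some vertex
`u`, and either `P₂` is a down path that starts in a neighbour of `u` of the same height, or `P₂`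
starts with the edge to a neighbourhood representant `v` around `u` that is not the down vertex
of `u` and continues with the down path of `v`. -/
def crestSeparators : Set (List V × List V) :=
  {X | ∃ u v : V, ∃ l₁ l₂ : List V, X.1 = u :: l₁ ∧ M.IsDownPath (u :: l₁) ∧
    M.IsDownPath (v :: l₂) ∧
    ((M.G.Adj u v ∧ M.height v = M.height u ∧ X.2 = v :: l₂) ∨
     (M.IsRepresentant u v ∧ ¬ M.IsDownVertex u v ∧ X.2 = u :: v :: l₂))}

/-- The vertices of a crest separator. -/
def sepVerts (X : List V × List V) : Set V := {v | v ∈ X.1 ∨ v ∈ X.2}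

/-- The top vertices: the first vertices of the two paths. -/
def topVerts (X : List V × List V) : Set V := {v | X.1.head? = some v ∨ X.2.head? = some v}

/-- The edges of a path that is given as a list of vertices. -/
def pathEdges (l : List V) : Set (Sym2 V) := {e | ∃ a b, [a, b] <:+: l ∧ e = s(a, b)}

/-- The border edges: the edges of both paths, and the edge that connects the first vertices of
the paths if these are different. -/
def borderEdges (X : List V × List V) : Set (Sym2 V) :=
  pathEdges X.1 ∪ pathEdges X.2 ∪
    {e | ∃ a b, X.1.head? = some a ∧ X.2.head? = some b ∧ a ≠ b ∧ e = s(a, b)}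

/-- The top edge: the only border edge that is not a down edge. -/
def IsTopEdge (X : List V × List V) (e : Sym2 V) : Prop :=
  e ∈ borderEdges X ∧ ¬ ∃ a b, M.IsDownVertex a b ∧ e = s(a, b)

/-- The maximum height of a vertex of a crest separator. -/
noncomputable def sepHeight (X : List V × List V) : ℕ :=
  ((X.1 ++ X.2).map M.height).foldr max 0

/-! ### Components -/

/-- One step between inner faces, expressed through darts: along the boundary of the same face,
or to the other side of an edge that is not a border edge of a crest separator in `S`. -/
def FaceStep (S : Set (List V × List V)) (d d' : M.InnerDart) : Prop :=
  d'.1 = M.face d.1 ∨ (d'.1 = d.1.symm ∧ ∀ X ∈ S, d.1.edge ∉ borderEdges X)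

/-- The `(S, φ)`-components: the maximal nonempty sets of inner faces any two of which are
connected by a sequence of steps. -/
def Component (S : Set (List V × List V)) : Type _ := Quot (M.FaceStep S)

/-- The vertices of a component: those on the boundary of at least one of its faces. -/
def compVerts {S : Set (List V × List V)} (C : M.Component S) : Set V :=
  {v | ∃ d : M.InnerDart, Quot.mk _ d = C ∧ d.1.fst = v}

/-- The edges of a component: those on the boundary of at least one of its faces. -/
def compEdges {S : Set (List V × List V)} (C : M.Component S) : Set (Sym2 V) :=
  {e | ∃ d : M.InnerDart, Quot.mk _ d = C ∧ d.1.edge = e}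

/-- `X` goes strongly between `A` and `B`: the two sets lie in the two different components into
which `X` alone splits the graph, and they contain no vertex of `X`. -/
def GoesStronglyBetween (X : List V × List V) (A B : Set V) : Prop :=
  (∃ C D : M.Component {X}, C ≠ D ∧ A ⊆ M.compVerts C ∧ B ⊆ M.compVerts D) ∧
  Disjoint (A ∪ B) (sepVerts X)

/-! ### Mountain structures -/

/-- `X` is a crest separator of height `i` that goes strongly between `A` and `B`. -/
def SeparatesAt (i : ℕ) (A B : Set V) (X : List V × List V) : Prop :=
  X ∈ M.crestSeparators ∧ M.sepHeight X = i ∧ M.GoesStronglyBetween X A B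

/-- Property (a): for every ridge `R` between different crests, `S` contains a crest separator
that goes strongly between them, whose height is the depth of `R`, and that has as few top
vertices as possible among all such crest separators of the graph. -/
def IsMountainStructure (S : Set (List V × List V)) : Prop :=
  M.AlmostTriangulated ∧ M.Biconnected ∧ S ⊆ M.crestSeparators ∧
  ∀ H₁ H₂ : Set V, M.IsCrest H₁ → M.IsCrest H₂ → H₁ ≠ H₂ →
    ∀ s ∈ H₁, ∀ t ∈ H₂, ∀ R : M.G.Walk s t, M.IsRidge R →
      ∃ X ∈ S, M.SeparatesAt (M.depth R) H₁ H₂ X ∧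
        ∀ Y, M.SeparatesAt (M.depth R) H₁ H₂ Y → (topVerts X).ncard ≤ (topVerts Y).ncard

/-- A mountain structure is good if moreover (b) no crest separator in `S` contains a vertex of a
crest and (c) every component contains vertices of a crest. -/
def IsGoodMountainStructure (S : Set (List V × List V)) : Prop :=
  M.IsMountainStructure S ∧
  (∀ X ∈ S, ∀ H, M.IsCrest H → Disjoint H (sepVerts X)) ∧
  (∀ C : M.Component S, ∃ H, M.IsCrest H ∧ (H ∩ M.compVerts C).Nonempty)

/-- The mountain connection tree: its nodes are the components; two of them are adjacent if they
have a common top edge of a crest separator in `S`. -/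
def mountainConnectionTree (S : Set (List V × List V)) : SimpleGraph (M.Component S) where
  Adj C D := C ≠ D ∧ ∃ X ∈ S, ∃ e, M.IsTopEdge X e ∧ e ∈ M.compEdges C ∧ e ∈ M.compEdges D
  symm := ⟨fun _ _ ⟨h, X, hX, e, he, h₁, h₂⟩ => ⟨h.symm, X, hX, e, he, h₂, h₁⟩⟩
  loopless := ⟨fun _ h => h.1 rfl⟩

end PlaneGraph

/-! ### Random access machines -/

/-- The memory: registers, and arrays of natural numbers. -/
structure RamState where
  reg : ℕ → ℕ
  arr : ℕ → ℕ → ℕ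

namespace RamState

def setReg (s : RamState) (x v : ℕ) : RamState :=
  { s with reg := Function.update s.reg x v }

def setArr (s : RamState) (a i v : ℕ) : RamState :=
  { s with arr := Function.update s.arr a (Function.update (s.arr a) i v) }

end RamState

/-- Programs of a random access machine.  A program names finitely many registers `x`, `y` and
arrays `a`.  The arithmetic operations are successor and predecessor only. -/
inductive RamProgram
  /-- `x := c` -/
  | const (x c : ℕ)
  /-- `x := y` -/
  | copy (x y : ℕ)
  /-- `x := x + 1` -/
  | succ (x : ℕ)
  /-- `x := x - 1`, where `0 - 1 = 0` -/
  | pred (x : ℕ)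
  /-- `x := a[y]` -/
  | load (x a y : ℕ)
  /-- `a[x] := y` -/
  | store (a x y : ℕ)
  | seq (p q : RamProgram)
  /-- `if x < y then p else q` -/
  | ite (x y : ℕ) (p q : RamProgram)
  /-- `while x < y do p` -/
  | while (x y : ℕ) (p : RamProgram)

open RamProgram in
/-- `RunsIn p s k s'`: started in the state `s`, the program `p` halts after `k` steps in the
state `s'`.  Every elementary operation and every test takes one step. -/
inductive RunsIn : RamProgram → RamState → ℕ → RamState → Prop
  | const (s : RamState) (x c : ℕ) : RunsIn (const x c) s 1 (s.setReg x c)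
  | copy (s : RamState) (x y : ℕ) : RunsIn (copy x y) s 1 (s.setReg x (s.reg y))
  | succ (s : RamState) (x : ℕ) : RunsIn (succ x) s 1 (s.setReg x (s.reg x + 1))
  | pred (s : RamState) (x : ℕ) : RunsIn (pred x) s 1 (s.setReg x (s.reg x - 1))
  | load (s : RamState) (x a y : ℕ) : RunsIn (load x a y) s 1 (s.setReg x (s.arr a (s.reg y)))
  | store (s : RamState) (a x y : ℕ) :
      RunsIn (store a x y) s 1 (s.setArr a (s.reg x) (s.reg y))
  | seq {s s' s'' : RamState} {p q : RamProgram} {k k' : ℕ} :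
      RunsIn p s k s' → RunsIn q s' k' s'' → RunsIn (seq p q) s (k + k') s''
  | ite_true {s s' : RamState} {x y : ℕ} {p q : RamProgram} {k : ℕ} :
      s.reg x < s.reg y → RunsIn p s k s' → RunsIn (ite x y p q) s (k + 1) s'
  | ite_false {s s' : RamState} {x y : ℕ} {p q : RamProgram} {k : ℕ} :
      ¬ s.reg x < s.reg y → RunsIn q s k s' → RunsIn (ite x y p q) s (k + 1) s'
  | while_true {s s' s'' : RamState} {x y : ℕ} {p : RamProgram} {k k' : ℕ} :
      s.reg x < s.reg y → RunsIn p s k s' → RunsIn (RamProgram.while x y p) s' k' s'' →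
      RunsIn (RamProgram.while x y p) s (k + k' + 1) s''
  | while_false {s : RamState} {x y : ℕ} {p : RamProgram} :
      ¬ s.reg x < s.reg y → RunsIn (RamProgram.while x y p) s 1 s

namespace RamState

open Classical in
/-- The machine is given the embedded graph, with the vertices `0, …, n - 1` and the darts
`0, …, m - 1`, by `n` (register 0), `m` (register 1), a dart of the outer face (register 2), the
numbers of the vertices (array 0), and the tail, the reverse and the successor in the circular
order of every dart (arrays 1, 2, 3).  All other memory cells are 0. -/
noncomputable def input {n m : ℕ} (M : PlaneGraph (Fin n)) (dart : M.G.Dart ≃ Fin m) : RamState where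
  reg x := if x = 0 then n else if x = 1 then m else if x = 2 then dart M.outer else 0
  arr a i :=
    if a = 0 then (if h : i < n then M.num ⟨i, h⟩ else 0)
    else if h : i < m then
      if a = 1 then (dart.symm ⟨i, h⟩).fst
      else if a = 2 then dart (dart.symm ⟨i, h⟩).symm
      else if a = 3 then dart (M.rot (dart.symm ⟨i, h⟩))
      else 0
    else 0

/-- The `j`-th list of vertices in the output: the entries `i` of array 5 with
`o j ≤ i < o (j + 1)`, where `o` is array 4. -/
def outPath (s : RamState) (j : ℕ) : List ℕ :=
  (List.range (s.arr 4 (j + 1) - s.arr 4 j)).map fun i => s.arr 5 (s.arr 4 j + i)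

/-- The output contains every crest separator in `S` exactly once, both paths written out as
lists of vertices; register 3 holds the number of these crest separators. -/
def OutputsSeparators {n : ℕ} (s : RamState) (S : Set (List (Fin n) × List (Fin n))) : Prop :=
  ∃ X : Fin (s.reg 3) → List (Fin n) × List (Fin n),
    Function.Injective X ∧ Set.range X = S ∧
    ∀ i, (X i).1.map Fin.val = s.outPath (2 * i) ∧ (X i).2.map Fin.val = s.outPath (2 * i + 1)

/-- The output contains the mountain connection tree: the number of nodes in register 4; the node
(component) of every dart of an inner face in array 6; the number of edges in register 5; and
the edges, each exactly once, as pairs of entries of arrays 7 and 8. -/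
def OutputsTree {n m : ℕ} (s : RamState) (M : PlaneGraph (Fin n)) (dart : M.G.Dart ≃ Fin m)
    (S : Set (List (Fin n) × List (Fin n))) : Prop :=
  ∃ node : M.Component S ≃ Fin (s.reg 4),
    (∀ d : M.InnerDart, s.arr 6 (dart d.1) = node (Quot.mk _ d)) ∧
    ((List.range (s.reg 5)).map fun j => s(s.arr 7 j, s.arr 8 j)).Nodup ∧
    {e | e ∈ (List.range (s.reg 5)).map fun j => s(s.arr 7 j, s.arr 8 j)} =
      Sym2.map (fun C => (node C : ℕ)) '' (M.mountainConnectionTree S).edgeSet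

end RamState

set_option linter.unusedSectionVars false
set_option linter.unusedSimpArgs false

/-! ### Connectivity of faces -/

namespace PlaneGraph

variable {V : Type*} (M : PlaneGraph V)

/-! Reduction to a tree. In an almost triangulated graph the heights are distances from the coast
plus one (`mem_upTo_succ`), so every vertex off the coast has a down vertex. The down edges together
with the outer cycle minus one edge form a spanning tree (`IsNice.exists_parentTree_blocked`). By
Euler's formula the edges outside a spanning tree form a spanning tree of the dual graph
(`ParentTree.conn`, `ParentTree.not_conn`). Hence the edges that are neither down edges nor on the
outer face form a tree on the inner faces, the dual tree. The border of a crest separator contains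
at most one edge of it, the top edge. A down edge that lies on no border can be bypassed by turning
around its higher end (`IsNice.cross_down`). So the components of a set of crest separators are the
components of the dual tree without the top edges (`IsNice.component_eq_iff`), and choosing crest
separators means choosing edges of a tree.

The choice. A dual tree edge of height `q` has weight `2 q + 1` if it is horizontal and `2 q` if it
leads to a neighbourhood representant. All other steps have a larger weight `top`; this includes the
edges that cannot be top edges, and possibly edges to representants at vertices of crests. As in
Kruskal's algorithm the edges are added by decreasing weight, and an edge is selected if both parts
that it joins contain a vertex higher than the edge (`Selection`).

Why it works. Without horizontal edges of height at most `k`, the faces around a connected set of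
vertices higher than `k` cannot be left (`IsNice.joined_touches`). Therefore two vertices of
different crests come together exactly at the depth of the ridges between them, and the edge where
this happens is selected (`IsNice.exists_sel_between`). Since `2 q + 1` is processed before `2 q`, a
horizontal edge makes the connection only if no edge to a representant of the same height would
separate the two; this is the minimality of the number of top vertices (`IsNice.ncard_topVerts_le`).
A crest cannot be entered from above, so no selected separator meets one (`IsNice.disjoint_crest`).
The highest plateau of a component is a crest, because no selected edge of that height borders on
the component (`IsNice.exists_crest_conn`), and different crests are separated
(`IsNice.crest_unique`). The connection tree arises from the dual tree by contracting the edges that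
are not selected.

Running time. Triangulation gives `m ≤ 6 n` for the number `m` of darts (`IsNice.card_dart_le`).
Heights take at most `l` sweeps over the darts. There are at most `2 (l + 1)` weights. For each of
them the parts are computed anew in linear time from a breadth-first tree of the dual tree; within
one weight, processing by decreasing index makes updates of these parts unnecessary
(`rep_above_par`), so that no union-find structure is needed. Each separator is written in time
proportional to `l`. -/

theorem face_apply (d : M.G.Dart) : M.face d = M.rot d.symm := rfl

theorem face_symm (d : M.G.Dart) : M.face d.symm = M.rot d := by
  rw [face_apply, SimpleGraph.Dart.symm_symm]

theorem face_fst (d : M.G.Dart) : (M.face d).fst = d.snd := by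
  rw [face_apply, rot_fst]; rfl

/-- One step between darts: along a face, or across an edge that is not in `B`. -/
def Link (B : Set (Sym2 V)) (d d' : M.G.Dart) : Prop :=
  d' = M.face d ∨ (d' = d.symm ∧ d.edge ∉ B)

/-- Two darts are connected by steps along faces and across edges that are not in `B`. -/
def Conn (B : Set (Sym2 V)) : M.G.Dart → M.G.Dart → Prop := Relation.EqvGen (M.Link B)

variable {M}

namespace Conn

variable {B B' : Set (Sym2 V)} {d d' d'' : M.G.Dart}

theorem refl (d : M.G.Dart) : M.Conn B d d := Relation.EqvGen.refl d

theorem symm (h : M.Conn B d d') : M.Conn B d' d := Relation.EqvGen.symm _ _ h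

theorem trans (h : M.Conn B d d') (h' : M.Conn B d' d'') : M.Conn B d d'' :=
  Relation.EqvGen.trans _ _ _ h h'

theorem face (d : M.G.Dart) : M.Conn B d (M.face d) := Relation.EqvGen.rel _ _ (Or.inl rfl)

theorem cross (h : d.edge ∉ B) : M.Conn B d d.symm := Relation.EqvGen.rel _ _ (Or.inr ⟨rfl, h⟩)

theorem rot_of_cross (h : M.Conn B d d.symm) : M.Conn B d (M.rot d) :=
  h.trans (by simpa [face_symm] using Conn.face (B := B) d.symm)

theorem rot (h : d.edge ∉ B) : M.Conn B d (M.rot d) := (cross h).rot_of_cross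

theorem lift (r : M.G.Dart → M.G.Dart → Prop) (hr : Equivalence r)
    (hf : ∀ d, r d (M.face d)) (hc : ∀ d, d.edge ∉ B → r d d.symm) (h : M.Conn B d d') : r d d' := by
  induction h with
  | rel x y h =>
    rcases h with rfl | ⟨rfl, h⟩
    · exact hf _
    · exact hc _ h
  | refl x => exact hr.refl x
  | symm x y _ ih => exact hr.symm ih
  | trans x y z _ _ ih ih' => exact hr.trans ih ih'

theorem equivalence (B : Set (Sym2 V)) : Equivalence (M.Conn B) := ⟨refl, symm, trans⟩

theorem mono (hB : B ⊆ B') (h : M.Conn B' d d') : M.Conn B d d' :=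
  h.lift _ (equivalence B) face fun _ h => cross fun h' => h (hB h')

end Conn

/-- Rotation around a vertex, interrupted after the dart `a`. -/
theorem rot_induction [Finite V] {a : M.G.Dart} {p : M.G.Dart → Prop} (h0 : p (M.rot a))
    (h : ∀ d : M.G.Dart, d.fst = a.fst → d ≠ a → p d → p (M.rot d)) (d : M.G.Dart)
    (hd : d.fst = a.fst) : p d := by
  have hfin : Finite M.G.Dart := by
    classical
    have := Fintype.ofFinite V
    infer_instance
  obtain ⟨k, hk⟩ := (M.rot_sameCycle (M.rot a) d (by rw [M.rot_fst, hd])).exists_nat_pow_eq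
  have key : ∀ k : ℕ, ((M.rot ^ k) (M.rot a)).fst = a.fst ∧ p ((M.rot ^ k) (M.rot a)) := by
    intro k
    induction k with
    | zero => exact ⟨M.rot_fst a, h0⟩
    | succ k ih =>
      rw [pow_succ', Equiv.Perm.mul_apply]
      refine ⟨by rw [M.rot_fst, ih.1], ?_⟩
      by_cases hk : (M.rot ^ k) (M.rot a) = a
      · rwa [hk]
      · exact h _ ih.1 hk ih.2
  rw [← hk]
  exact (key k).2

theorem finite_dart [Finite V] : Finite M.G.Dart := by
  classical
  have := Fintype.ofFinite V
  infer_instance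

theorem exists_dart (v : V) (h : ∃ w : V, w ≠ v) : ∃ d : M.G.Dart, d.fst = v := by
  obtain ⟨w, hw⟩ := h
  obtain ⟨p⟩ := M.connected.preconnected v w
  cases p with
  | nil => exact absurd rfl hw
  | cons h p => exact ⟨⟨(_, _), h⟩, rfl⟩

variable (M) in
theorem exists_dart_fst (v : V) : ∃ d : M.G.Dart, d.fst = v := by
  refine exists_dart v ?_
  by_cases h : M.outer.fst = v
  · exact ⟨M.outer.snd, fun h' => M.outer.adj.ne (h.trans h'.symm)⟩
  · exact ⟨_, h⟩

/-- If both sides of all edges are connected, then all faces are. -/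
theorem conn_of_cross [Finite V] {B : Set (Sym2 V)} (h : ∀ d : M.G.Dart, M.Conn B d d.symm)
    (d d' : M.G.Dart) : M.Conn B d d' := by
  have h1 : ∀ d d' : M.G.Dart, d.fst = d'.fst → M.Conn B d d' := by
    intro d d' hd
    have := rot_induction (a := d) (p := fun x => M.Conn B d x) ((h d).rot_of_cross)
      (fun x _ _ hx => hx.trans (h x).rot_of_cross) d' hd.symm
    exact this
  have h2 : ∀ (u v : V) (p : M.G.Walk u v) (d d' : M.G.Dart), d.fst = u → d'.fst = v →
      M.Conn B d d' := by
    intro u v p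
    induction p with
    | nil => intro d d' hd hd'; exact h1 _ _ (hd.trans hd'.symm)
    | cons e p ih =>
      intro d d' hd hd'
      let x : M.G.Dart := ⟨(_, _), e⟩
      exact (h1 d x hd).trans ((Conn.face x).trans (ih _ _ (M.face_fst x) hd'))
  obtain ⟨p⟩ := M.connected.preconnected d.fst d'.fst
  exact h2 _ _ p _ _ rfl rfl

/-! ### Spanning trees and their complements in the dual graph -/

variable (M) in
/-- A spanning tree, given by the darts towards the parents. -/
structure ParentTree where
  root : V
  up : V → M.G.Dart
  rank : V → ℕ
  up_fst : ∀ v, v ≠ root → (up v).fst = v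
  rank_lt : ∀ v, v ≠ root → rank (up v).snd < rank v

namespace ParentTree

variable (T : M.ParentTree)

def edges : Set (Sym2 V) := {e | ∃ v, v ≠ T.root ∧ (T.up v).edge = e}

/-- Walking once around the subtree below `v` leads from one side of the edge above `v` to the
other. Turning around `v`, every other edge of `B` leads to a child, whose two sides are connected
by induction. The induction parameter `n` bounds by how much any rank exceeds that of `v`. -/
theorem cross_up [Finite V] {B : Set (Sym2 V)} (hB : B ⊆ T.edges) (n : ℕ) : ∀ v, v ≠ T.root → 
    (∀ w, T.rank w ≤ T.rank v + n) → M.Conn B (T.up v) (T.up v).symm := by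
  induction n using Nat.strong_induction_on with
  | _ n ih =>
    intro v hv hn
    have h := rot_induction (a := T.up v) (p := fun x => M.Conn B (M.rot (T.up v)) x)
      (Conn.refl _) ?_ (T.up v) rfl
    · refine (Conn.trans ?_ h).symm
      simpa [face_symm] using Conn.face (B := B) (T.up v).symm
    · intro x hx hxv hc
      refine hc.trans (Conn.rot_of_cross ?_)
      by_cases hxB : x.edge ∈ B
      · obtain ⟨w, hw, hwx⟩ := hB hxB
        rw [SimpleGraph.dart_edge_eq_iff] at hwx
        rw [T.up_fst v hv] at hx
        rcases hwx with hwx | hwx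
        · have := T.up_fst w hw
          rw [hwx, hx] at this
          exact absurd (this ▸ hwx.symm) hxv
        · have h1 := T.rank_lt w hw
          have h2 : (T.up w).snd = v := by rw [hwx]; exact hx
          rw [h2] at h1
          have h3 := hn w
          have := ih (n - (T.rank w - T.rank v)) (by omega) w hw (fun u => by have := hn u; omega)
          rw [hwx, SimpleGraph.Dart.symm_symm] at this
          exact this.symm
      · exact Conn.cross hxB

theorem conn [Finite V] (d d' : M.G.Dart) : M.Conn T.edges d d' := by
  refine conn_of_cross (fun d => ?_) d d'
  by_cases hd : d.edge ∈ T.edges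
  · obtain ⟨v, hv, h⟩ := hd
    have := Fintype.ofFinite V
    have := T.cross_up (B := T.edges) subset_rfl (∑ w, T.rank w) v hv (fun w => by
      have := Finset.single_le_sum (f := T.rank) (fun _ _ => Nat.zero_le _) (Finset.mem_univ w)
      omega)
    rw [SimpleGraph.dart_edge_eq_iff] at h
    rcases h with h | h
    · rwa [h] at this
    · rw [h, SimpleGraph.Dart.symm_symm] at this
      exact this.symm
  · exact Conn.cross hd

theorem ncard_edges [Finite V] : T.edges.ncard + 1 = Nat.card V := by
  have h1 : T.edges = (fun v => (T.up v).edge) '' {T.root}ᶜ := by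
    ext e; simp [edges]
  rw [h1, Set.InjOn.ncard_image]
  · rw [← Set.ncard_singleton T.root, add_comm, Set.ncard_add_ncard_compl]
  · intro v hv w hw h
    simp only at h
    rw [SimpleGraph.dart_edge_eq_iff] at h
    have hv' := T.up_fst v hv
    have hw' := T.up_fst w hw
    rcases h with h | h
    · rw [← hv', h, hw']
    · have h1 := T.rank_lt v hv
      have h2 := T.rank_lt w hw
      have h3 : (T.up v).snd = w := by rw [h]; exact hw'
      have h4 : (T.up w).snd = v := by rw [← hv', h]; rfl
      rw [h3] at h1; rw [h4] at h2
      omega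

theorem edges_subset : T.edges ⊆ M.G.edgeSet := by
  rintro e ⟨v, -, rfl⟩
  exact (T.up v).edge_mem

/-- An edge outside a spanning tree is a bridge of the dual graph of the complement of the tree. -/
theorem not_conn [Finite V] (d : M.G.Dart) (hd : d.edge ∉ T.edges) :
    ¬ M.Conn (insert d.edge T.edges) d d.symm := by
  -- Otherwise the faces would stay connected across `|E| - |V|` edges only. Euler's formula gives
  -- `|F| = |E| - |V| + 2`, and connecting `|F|` faces takes at least `|F| - 1` edges.
  intro hc
  set B := insert d.edge T.edges with hB
  have hall : ∀ x y, M.Conn B x y := by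
    intro x y
    refine (T.conn x y).lift _ (Conn.equivalence B) Conn.face fun z hz => ?_
    by_cases hzd : z.edge = d.edge
    · rw [SimpleGraph.dart_edge_eq_iff] at hzd
      rcases hzd with rfl | rfl
      · exact hc
      · rw [SimpleGraph.Dart.symm_symm]; exact hc.symm
    · exact Conn.cross (by simp [hB, hzd, hz])
  let F := Quotient (Equiv.Perm.SameCycle.setoid M.face)
  let q : M.G.Dart → F := Quotient.mk _
  have hfin : Finite M.G.Dart := finite_dart
  have hq : ∀ x, q (M.face x) = q x := fun x =>
    Quotient.sound ((Equiv.Perm.SameCycle.refl _ _).apply_left)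
  -- The dual graph without the edges in `B`. Passing to a simple graph drops loops and parallel
  -- edges, which preserves connectedness and can only lower the number of edges.
  let D : SimpleGraph F :=
    { Adj := fun f g => f ≠ g ∧ ∃ x : M.G.Dart, x.edge ∉ B ∧ q x = f ∧ q x.symm = g
      symm := ⟨fun f g ⟨h, x, hx, h1, h2⟩ =>
        ⟨h.symm, x.symm, by simpa using hx, h2, by simpa using h1⟩⟩
      loopless := ⟨fun f h => h.1 rfl⟩ }
  have hD : D.Connected := by
    have : Nonempty F := ⟨q d⟩
    refine ⟨fun f g => ?_⟩
    induction f using Quotient.inductionOn with | _ x =>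
    induction g using Quotient.inductionOn with | _ y =>
    refine (hall x y).lift (fun x y => D.Reachable (q x) (q y))
      ⟨fun _ => SimpleGraph.Reachable.refl _, fun h => h.symm, fun h h' => h.trans h'⟩ ?_ ?_
    · intro x; rw [hq]
    · intro x hx
      by_cases hxx : q x = q x.symm
      · rw [hxx]
      · exact SimpleGraph.Adj.reachable ⟨hxx, x, hx, rfl, rfl⟩
  have hcard := hD.card_vert_le_card_edgeSet_add_one
  have hle : Nat.card D.edgeSet ≤ (M.G.edgeSet \ B).ncard := by
    have hch : ∀ e : D.edgeSet, ∃ x : M.G.Dart, x.edge ∉ B ∧ s(q x, q x.symm) = e.1 := by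
      rintro ⟨e, he⟩
      induction e with | _ f g =>
      obtain ⟨-, x, hx, h1, h2⟩ := he
      exact ⟨x, hx, congrArg₂ (fun a b => s(a, b)) h1 h2⟩
    choose c hc1 hc2 using hch
    have : Finite M.G.edgeSet := inferInstance
    have hfs : (M.G.edgeSet \ B).Finite := Set.toFinite _
    rw [← Nat.card_coe_set_eq (M.G.edgeSet \ B)]
    refine Nat.card_le_card_of_injective (fun e => ⟨(c e).edge, (c e).edge_mem, hc1 e⟩) ?_
    intro e e' h
    have h' : (c e).edge = (c e').edge := congrArg Subtype.val h
    rw [SimpleGraph.dart_edge_eq_iff] at h'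
    apply Subtype.ext
    rw [← hc2 e, ← hc2 e']
    rcases h' with h' | h'
    · rw [h']
    · rw [h', SimpleGraph.Dart.symm_symm, Sym2.eq_swap]
  have hBs : B ⊆ M.G.edgeSet := Set.insert_subset d.edge_mem T.edges_subset
  have h1 : (M.G.edgeSet \ B).ncard + B.ncard = M.G.edgeSet.ncard :=
    Set.ncard_sdiff_add_ncard_of_subset hBs
  have h2 : B.ncard = T.edges.ncard + 1 := Set.ncard_insert_of_notMem hd (Set.toFinite _)
  have h3 := T.ncard_edges
  have h4 := M.euler
  rw [← Nat.card_coe_set_eq M.G.edgeSet] at h1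
  change Nat.card V + Nat.card F = _ at h4
  omega

end ParentTree

end PlaneGraph

/-! ### The outer face of a biconnected graph -/

namespace PlaneGraph

variable {V : Type*} {M : PlaneGraph V}

variable (M) in
/-- The dart belongs to the outer face. -/
def OuterDart (d : M.G.Dart) : Prop := M.face.SameCycle M.outer d

theorem outerDart_outer : M.OuterDart M.outer := Equiv.Perm.SameCycle.refl _ _

theorem outerDart_face {d : M.G.Dart} : M.OuterDart (M.face d) ↔ M.OuterDart d :=
  Equiv.Perm.sameCycle_apply_right

theorem Conn.of_sameCycle [Finite V] {B : Set (Sym2 V)} {d d' : M.G.Dart}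
    (h : M.face.SameCycle d d') : M.Conn B d d' := by
  have := finite_dart (M := M)
  obtain ⟨k, rfl⟩ := h.exists_nat_pow_eq
  induction k with
  | zero => exact Conn.refl _
  | succ k ih =>
    rw [pow_succ', Equiv.Perm.mul_apply]
    exact (ih ⟨k, rfl⟩).trans (Conn.face _)

/-- Removing `a.fst` leaves a connected graph; shortest paths in it towards `a.snd` define the
parents. Then `a.fst` is attached as the root with `a.snd` as its only child, so `a` is the only
tree edge at `a.fst`. -/
theorem exists_parentTree (hb : M.Biconnected) (a : M.G.Dart) :
    ∃ T : M.ParentTree, ∀ e ∈ T.edges, a.fst ∈ e → e = a.edge := by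
  classical
  let H := M.G.induce {a.fst}ᶜ
  have hH : H.Connected := hb.2.2 a.fst
  let u : ({a.fst}ᶜ : Set V) := ⟨a.snd, fun h => a.adj.ne (Set.mem_singleton_iff.1 h).symm⟩
  let rk : V → ℕ := fun w => if h : w ∈ ({a.fst}ᶜ : Set V) then H.dist ⟨w, h⟩ u + 1 else 0
  have hex : ∀ w, ∃ d : M.G.Dart, w ≠ a.fst → d.fst = w ∧ rk d.snd < rk w ∧
      (a.fst ∈ d.edge → d.edge = a.edge) := by
    intro w
    by_cases hw : w = a.fst
    · exact ⟨a, fun h => absurd hw h⟩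
    by_cases hwu : w = a.snd
    · refine ⟨a.symm, fun _ => ⟨hwu.symm, ?_, fun _ => a.edge_symm⟩⟩
      have h1 : rk a.symm.snd = 0 := dif_neg (by simp)
      have h2 : rk w = H.dist ⟨w, hw⟩ u + 1 := dif_pos _
      omega
    · obtain ⟨p, hp⟩ := hH.exists_walk_length_eq_dist ⟨w, hw⟩ u
      have hne : (⟨w, hw⟩ : ({a.fst}ᶜ : Set V)) ≠ u := fun h => hwu (congrArg Subtype.val h)
      clear_value u
      cases p with
      | nil => exact absurd rfl hne
      | @cons _ x _ e p =>
        have e' : M.G.Adj w x.1 := e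
        refine ⟨⟨(w, x.1), e'⟩, fun _ => ⟨rfl, ?_, fun h => ?_⟩⟩
        · have h1 : rk x.1 = H.dist x u + 1 := dif_pos x.2
          have h2 : rk w = H.dist ⟨w, hw⟩ u + 1 := dif_pos _
          have h3 := SimpleGraph.dist_le p
          simp only [SimpleGraph.Walk.length_cons] at hp
          change rk x.1 < _
          omega
        · have h' : a.fst ∈ s(w, x.1) := h
          rw [Sym2.mem_iff] at h'
          rcases h' with h' | h'
          · exact absurd h'.symm hw
          · exact absurd h'.symm x.2
  choose up hup using hex
  refine ⟨⟨a.fst, up, rk, fun v hv => (hup v hv).1, fun v hv => (hup v hv).2.1⟩, ?_⟩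
  rintro e ⟨v, hv, rfl⟩ h
  exact (hup v hv).2.2 h

theorem fst_mem_edge (d : M.G.Dart) : d.fst ∈ d.edge := Sym2.mem_mk_left _ _

theorem snd_mem_edge (d : M.G.Dart) : d.snd ∈ d.edge := Sym2.mem_mk_right _ _

theorem dart_eq_of_edge_eq {d d' : M.G.Dart} (h : d.edge = d'.edge) (h' : d.fst = d'.fst) :
    d = d' := by
  rw [SimpleGraph.dart_edge_eq_iff] at h
  rcases h with h | h
  · exact h
  · exact absurd (h'.symm.trans (congrArg (fun x : M.G.Dart => x.fst) h)) d'.adj.ne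

/-- The outer face visits every vertex at most once. -/
theorem outerDart_unique [Finite V] (hb : M.Biconnected) {d d' : M.G.Dart} (hd : M.OuterDart d)
    (hd' : M.OuterDart d') (h : d.fst = d'.fst) : d = d' := by
  -- Take a tree that uses no edge at the common tail except `d'`. The outer face connects `d` to
  -- `d'`, and turning from `d` to `d'` around the tail connects the other side of `d` to `d'`
  -- without crossing the tree or `d`. But an edge outside the tree is a bridge of the dual.
  by_contra hne
  obtain ⟨T, hT⟩ := exists_parentTree hb d'
  have hdT : ∀ x : M.G.Dart, x.fst = d'.fst → x ≠ d' → x.edge ∉ T.edges := fun x hx hxd hxT =>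
    hxd (dart_eq_of_edge_eq (hT _ hxT (hx ▸ fst_mem_edge x)) hx)
  refine T.not_conn d (hdT d h hne) ?_
  set B := insert d.edge T.edges
  have hdd : M.Conn B d d' := Conn.of_sameCycle (hd.symm.trans hd')
  have h1 : M.Conn B d.symm (M.rot d) := face_symm (M := M) d ▸ Conn.face d.symm
  -- The rotation continues beyond `d'`; the second alternative records that `d'` has been met,
  -- after which nothing more has to be shown.
  have := rot_induction (a := d) (p := fun x => M.Conn B d.symm x ∨ M.Conn B d.symm d')
    (Or.inl h1) (fun x hx hxd hp => ?_) d' h.symm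
  · exact hdd.trans (this.elim id id).symm
  · rcases hp with hp | hp
    · by_cases hx' : x = d'
      · exact Or.inr (hx' ▸ hp)
      · refine Or.inl (hp.trans (Conn.rot ?_))
        rintro (hx2 | hx2)
        · exact hxd (dart_eq_of_edge_eq hx2 hx)
        · exact hdT x (hx.trans h) hx' hx2
    · exact Or.inr hp

theorem exists_adj_ne (hb : M.Biconnected) (u v : V) : ∃ w, M.G.Adj u w ∧ w ≠ v := by
  by_cases huv : u = v
  · obtain ⟨d, hd⟩ := M.exists_dart_fst u
    exact ⟨d.snd, hd ▸ d.adj, fun h => d.adj.ne (by rw [hd, h, huv])⟩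
  have hfin : Finite V := Nat.finite_of_card_ne_zero (by have := hb.1; omega)
  have : ∃ w, w ≠ u ∧ w ≠ v := by
    by_contra! hc
    have h1 : (Set.univ : Set V) ⊆ {u, v} := fun w _ => by
      by_cases hw : w = u
      · exact Or.inl hw
      · exact Or.inr (hc w hw)
    have h2 := Set.ncard_le_ncard h1
    have h3 := hb.1
    rw [Set.ncard_univ, Set.ncard_pair huv] at h2
    omega
  obtain ⟨w, hwu, hwv⟩ := this
  obtain ⟨p⟩ := (hb.2.2 v).preconnected ⟨u, huv⟩ ⟨w, hwv⟩
  cases p with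
  | nil => exact absurd rfl hwu
  | @cons _ x _ e p => exact ⟨x.1, e, x.2⟩

theorem rot_ne [Finite V] (hb : M.Biconnected) (d : M.G.Dart) : M.rot d ≠ d := by
  intro h
  obtain ⟨w, hw, hwd⟩ := exists_adj_ne hb d.fst d.snd
  have := rot_induction (a := d) (p := fun x => x = d) h
    (fun x _ hx hxd => absurd hxd hx) ⟨(d.fst, w), hw⟩ rfl
  exact hwd (congrArg (fun x : M.G.Dart => x.snd) this)

theorem not_outerDart_symm [Finite V] (hb : M.Biconnected) {d : M.G.Dart} (hd : M.OuterDart d) :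
    ¬ M.OuterDart d.symm := by
  intro h
  have h1 : M.OuterDart (M.rot d) := by rw [← face_symm, outerDart_face]; exact h
  exact rot_ne hb d (outerDart_unique hb h1 hd (M.rot_fst d))

theorem exists_inner_fst [Finite V] (hb : M.Biconnected) (v : V) :
    ∃ d : M.G.Dart, ¬ M.OuterDart d ∧ d.fst = v := by
  obtain ⟨d, rfl⟩ := M.exists_dart_fst v
  by_cases hd : M.OuterDart d
  · exact ⟨M.rot d, fun h => rot_ne hb d (outerDart_unique hb h hd (M.rot_fst d)), M.rot_fst d⟩
  · exact ⟨d, hd, rfl⟩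

/-! ### Heights -/

theorem mem_coast_empty [Finite V] {v : V} :
    v ∈ M.coast ∅ ↔ ∃ d : M.G.Dart, d.fst = v ∧ M.OuterDart d := by
  have hfin : Finite M.G.Dart := finite_dart
  have h : ∀ d : M.G.Dart, M.InOuterFace ∅ d ↔ M.OuterDart d := by
    intro d
    constructor
    · intro h
      induction h with
      | outer => exact outerDart_outer
      | next d _ ih => exact outerDart_face.2 ih
      | merge d _ h _ => simp at h
    · intro h
      obtain ⟨j, rfl⟩ := h.exists_nat_pow_eq
      clear h
      induction j with
      | zero => exact InOuterFace.outer
      | succ j ih => rw [pow_succ', Equiv.Perm.mul_apply]; exact InOuterFace.next _ ih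
  simp [coast, h]

theorem InOuterFace.mono {R R' : Set V} (h : R ⊆ R') {d : M.G.Dart} (hd : M.InOuterFace R d) :
    M.InOuterFace R' d := by
  induction hd with
  | outer => exact outer
  | next d _ ih => exact next d ih
  | merge d _ h' ih => exact merge d ih (h'.imp (fun x => h x) fun x => h x)

theorem upTo_mono {i j : ℕ} (h : i ≤ j) : M.upTo i ⊆ M.upTo j := by
  induction h with
  | refl => exact subset_rfl
  | step _ ih => exact ih.trans Set.subset_union_left

theorem mem_upTo_one [Finite V] {v : V} :
    v ∈ M.upTo 1 ↔ ∃ d : M.G.Dart, d.fst = v ∧ M.OuterDart d := by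
  rw [← mem_coast_empty]
  simp [upTo]

/-- The vertices on the boundary of the face of a dart, if this face is a triangle. -/
def triVerts (d : M.G.Dart) : Set V := {d.fst, d.snd, (M.face d).snd}

theorem face_face_snd (hA : M.AlmostTriangulated) {d : M.G.Dart} (hd : ¬ M.OuterDart d) :
    (M.face (M.face d)).snd = d.fst := by
  rw [← M.face_fst, hA d hd]

theorem triVerts_face (hA : M.AlmostTriangulated) {d : M.G.Dart} (hd : ¬ M.OuterDart d) :
    triVerts (M.face d) = triVerts d := by
  ext v
  simp only [triVerts, face_fst, face_face_snd hA hd, Set.mem_insert_iff, Set.mem_singleton_iff]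
  tauto

theorem adj_of_mem_triVerts (hA : M.AlmostTriangulated) {d : M.G.Dart} (hd : ¬ M.OuterDart d)
    {u v : V} (hu : u ∈ triVerts d) (hv : v ∈ triVerts d) : u = v ∨ M.G.Adj u v := by
  have h1 := d.adj
  have h2 := (M.face d).adj
  have h3 := (M.face (M.face d)).adj
  rw [face_fst] at h2 h3
  rw [face_face_snd hA hd] at h3
  simp only [triVerts, Set.mem_insert_iff, Set.mem_singleton_iff] at hu hv
  have := h1.symm
  have := h2.symm
  have := h3.symm
  rcases hu with rfl | rfl | rfl <;> rcases hv with rfl | rfl | rfl <;> tauto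

/-- Once `r` is removed, all edges at `r` are gone, so the outer face swallows the faces at `r` one
after the other in the order around `r`. -/
theorem inOuterFace_of_mem_upTo {i : ℕ} {r : V} (hr : r ∈ M.upTo i) [Finite V] (d : M.G.Dart)
    (hd : d.fst = r) : M.InOuterFace (M.upTo i) d := by
  have h1 : ∃ j < i, r ∈ M.coast (M.upTo j) := by
    induction i with
    | zero => simp [upTo] at hr
    | succ i ih =>
      rcases hr with hr | hr
      · obtain ⟨j, hj, h⟩ := ih hr
        exact ⟨j, by omega, h⟩
      · exact ⟨i, by omega, hr⟩
  obtain ⟨j, hj, -, a, rfl, ha⟩ := h1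
  have hrot : ∀ x : M.G.Dart, x.fst = a.fst → M.InOuterFace (M.upTo i) x →
      M.InOuterFace (M.upTo i) (M.rot x) := fun x hx hxi => by
    rw [← face_symm]
    exact (hxi.merge _ (Or.inl (hx ▸ hr))).next
  exact rot_induction (p := M.InOuterFace (M.upTo i))
    (hrot a rfl (ha.mono (upTo_mono hj.le))) (fun x hx _ hxi => hrot x hx hxi) d hd

/-- An inner face that has been merged into the outer face has a removed vertex, and as it is a
triangle, its remaining vertices are neighbours of that vertex. Conversely, all faces at a removed
vertex are merged. Thus heights are distances from the coast, plus one. -/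
theorem mem_upTo_succ [Finite V] (hA : M.AlmostTriangulated) {i : ℕ} {v : V} :
    v ∈ M.upTo (i + 2) ↔ v ∈ M.upTo (i + 1) ∨ ∃ u ∈ M.upTo (i + 1), M.G.Adj u v := by
  set R := M.upTo (i + 1) with hR
  constructor
  · rintro (h | ⟨hv, d, rfl, hd⟩)
    · exact Or.inl h
    · have key : ∀ d, M.InOuterFace R d → M.OuterDart d ∨ ∃ u ∈ R, u ∈ triVerts d := by
        intro d hd
        induction hd with
        | outer => exact Or.inl outerDart_outer
        | next d _ ih =>
          rw [outerDart_face]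
          by_cases hd : M.OuterDart d
          · exact Or.inl hd
          · rwa [triVerts_face hA hd]
        | merge d _ h _ =>
          refine Or.inr ?_
          rcases h with h | h
          · exact ⟨_, h, Or.inr (Or.inl rfl)⟩
          · exact ⟨_, h, Or.inl rfl⟩
      by_cases hdo : M.OuterDart d
      · exact absurd (upTo_mono (by omega) (mem_upTo_one.2 ⟨d, rfl, hdo⟩)) hv
      · rcases key d hd with h | ⟨u, hu, hut⟩
        · exact absurd h hdo
        · rcases adj_of_mem_triVerts hA hdo hut (Or.inl rfl : d.fst ∈ triVerts d) with h | h
          · exact Or.inl (h ▸ hu)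
          · exact Or.inr ⟨u, hu, h⟩
  · rintro (h | ⟨u, hu, huv⟩)
    · exact Or.inl h
    · by_cases hv : v ∈ R
      · exact Or.inl hv
      · refine Or.inr ⟨hv, ⟨(v, u), huv.symm⟩, rfl, ?_⟩
        exact (inOuterFace_of_mem_upTo hu ⟨(u, v), huv⟩ rfl).merge _ (Or.inl hu)

section Height

variable [Finite V] {l : ℕ} (hl : M.IsOuterplanar l)
include hl

omit [Finite V] in
theorem mem_upTo_iff {v : V} {i : ℕ} : v ∈ M.upTo i ↔ M.height v ≤ i :=
  ⟨fun h => Nat.sInf_le h, fun h => upTo_mono h (Nat.sInf_mem (s := {i | v ∈ M.upTo i}) ⟨l, hl v⟩)⟩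

omit [Finite V] in
theorem height_le (v : V) : M.height v ≤ l := (mem_upTo_iff hl).1 (hl v)

omit [Finite V] in
theorem one_le_height (v : V) : 1 ≤ M.height v := by
  by_contra h
  have : v ∈ M.upTo 0 := (mem_upTo_iff hl).2 (by omega)
  exact this

theorem height_eq_one_iff {v : V} :
    M.height v = 1 ↔ ∃ d : M.G.Dart, d.fst = v ∧ M.OuterDart d := by
  rw [← mem_upTo_one, mem_upTo_iff hl]
  have := one_le_height hl v
  omega

theorem mem_coast_iff {v : V} : v ∈ M.coast ∅ ↔ M.height v = 1 := by
  rw [height_eq_one_iff hl, mem_coast_empty]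

theorem height_le_of_adj (hA : M.AlmostTriangulated) {u v : V} (h : M.G.Adj u v) :
    M.height v ≤ M.height u + 1 := by
  have h1 := one_le_height hl u
  obtain ⟨i, hi⟩ : ∃ i, M.height u = i + 1 := ⟨_, (Nat.sub_add_cancel h1).symm⟩
  rw [← mem_upTo_iff hl, hi, mem_upTo_succ hA]
  exact Or.inr ⟨u, (mem_upTo_iff hl).2 hi.le, h⟩

theorem exists_adj_height (hA : M.AlmostTriangulated) {v : V} (h : 2 ≤ M.height v) :
    ∃ u, M.G.Adj v u ∧ M.height u + 1 = M.height v := by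
  obtain ⟨i, hi⟩ : ∃ i, M.height v = i + 2 := ⟨_, (Nat.sub_add_cancel h).symm⟩
  have h1 := (mem_upTo_iff hl).2 hi.le
  rw [mem_upTo_succ hA] at h1
  rcases h1 with h1 | ⟨u, hu, huv⟩
  · have := (mem_upTo_iff hl).1 h1
    omega
  · have h2 := (mem_upTo_iff hl).1 hu
    have h3 := height_le_of_adj hl hA huv
    exact ⟨u, huv.symm, by omega⟩

theorem exists_isDownVertex (hA : M.AlmostTriangulated) {v : V} (h : 2 ≤ M.height v) :
    ∃ u, M.IsDownVertex v u := by
  obtain ⟨u, hu, hmin⟩ := Set.exists_min_image {u | M.G.Adj v u ∧ M.height u + 1 = M.height v}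
    M.num (Set.toFinite _) (exists_adj_height hl hA h)
  exact ⟨u, hu, fun w hw hw' => hmin w ⟨hw, hw'⟩⟩

end Height

theorem IsDownVertex.unique {u v w : V} (h : M.IsDownVertex u v) (h' : M.IsDownVertex u w) :
    v = w :=
  M.num_injective (le_antisymm (h.2 _ h'.1.1 h'.1.2) (h'.2 _ h.1.1 h.1.2))

end PlaneGraph

/-! ### The dual tree of an almost triangulated graph -/

namespace PlaneGraph

variable {V : Type*} {M : PlaneGraph V}

variable (M) in
/-- The assumptions on the embedded graph. -/
structure IsNice (l : ℕ) : Prop where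
  tri : M.AlmostTriangulated
  bic : M.Biconnected
  outer : M.IsOuterplanar l

variable (M) in
def downEdges : Set (Sym2 V) := {e | ∃ a b, M.IsDownVertex a b ∧ e = s(a, b)}

variable (M) in
def outerEdges : Set (Sym2 V) := {e | ∃ d, M.OuterDart d ∧ d.edge = e}

variable (M) in
/-- The edges that do not correspond to edges of the dual tree. -/
def blocked : Set (Sym2 V) := M.downEdges ∪ M.outerEdges

variable [Finite V] {l : ℕ}

namespace IsNice

variable (hM : M.IsNice l)
include hM

theorem outerDart_fst_height {d : M.G.Dart} (hd : M.OuterDart d) : M.height d.fst = 1 :=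
  (height_eq_one_iff hM.outer).2 ⟨d, rfl, hd⟩

omit [Finite V] in
theorem two_le_of_isDownVertex {a b : V} (h : M.IsDownVertex a b) : 2 ≤ M.height a := by
  have := one_le_height hM.outer b
  have := h.1.2
  omega

/-- The parent of a vertex off the coast is its down vertex, that of a coast vertex is its successor
on the outer cycle, which visits each vertex once. The tail of `outer` is the root, so `outer` is
the only blocked edge that the tree may leave out. -/
theorem exists_parentTree_blocked :
    ∃ T : M.ParentTree, T.edges ⊆ M.blocked ∧ M.blocked ⊆ insert M.outer.edge T.edges := by
  classical
  have hfin := finite_dart (M := M)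
  have := Fintype.ofFinite V
  have hup : ∀ v, ∃ d : M.G.Dart, d.fst = v ∧ (M.height v = 1 → M.OuterDart d) ∧
      (2 ≤ M.height v → M.IsDownVertex v d.snd) := by
    intro v
    have h1 := one_le_height hM.outer v
    rcases h1.eq_or_lt with h | h
    · obtain ⟨d, hd, ho⟩ := (height_eq_one_iff hM.outer).1 h.symm
      exact ⟨d, hd, fun _ => ho, fun h' => by omega⟩
    · obtain ⟨u, hu⟩ := exists_isDownVertex hM.outer hM.tri h
      exact ⟨⟨(v, u), hu.1.1⟩, rfl, fun h' => by omega, fun _ => hu⟩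
  choose up hup1 hup2 hup3 using hup
  -- The number of steps along the outer face until `outer` is reached ranks the coast; adding the
  -- bound `N` ranks all other vertices above it.
  let k : M.G.Dart → ℕ := fun d => sInf {k | (M.face ^ k) d = M.outer}
  let N := ∑ v, k (up v)
  have hN : ∀ v, k (up v) ≤ N := fun v =>
    Finset.single_le_sum (f := fun v => k (up v)) (fun _ _ => Nat.zero_le _) (Finset.mem_univ v)
  let rk : V → ℕ := fun v => if M.height v = 1 then k (up v) else N + M.height v
  have hrk : ∀ v, v ≠ M.outer.fst → rk (up v).snd < rk v := by
    intro v hv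
    have h1 := one_le_height hM.outer v
    rcases h1.eq_or_lt with h | h
    · have ho := hup2 v h.symm
      have ho' : M.OuterDart (M.face (up v)) := outerDart_face.2 ho
      have hs : M.height (up v).snd = 1 := by
        rw [← face_fst]; exact hM.outerDart_fst_height ho'
      have h2 : up (up v).snd = M.face (up v) :=
        outerDart_unique hM.bic (hup2 _ hs) ho' (by rw [hup1, face_fst])
      simp only [rk, h.symm, hs, if_true, h2]
      obtain ⟨j, hj⟩ := (show M.face.SameCycle (up v) M.outer from ho.symm).exists_nat_pow_eq
      have hmem : (M.face ^ k (up v)) (up v) = M.outer :=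
        Nat.sInf_mem (s := {k | (M.face ^ k) (up v) = M.outer}) ⟨j, hj⟩
      have hpos : k (up v) ≠ 0 := by
        intro h0
        rw [h0] at hmem
        apply hv
        rw [← hmem]
        exact (hup1 v).symm
      obtain ⟨i, hi⟩ := Nat.exists_eq_succ_of_ne_zero hpos
      rw [hi, pow_succ, Equiv.Perm.mul_apply] at hmem
      have : k (M.face (up v)) ≤ i := Nat.sInf_le hmem
      omega
    · have hd := hup3 v h
      have h2 := hd.1.2
      simp only [rk]
      rw [if_neg (by omega : ¬ M.height v = 1)]
      split_ifs with h3
      · have := hN (up v).snd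
        omega
      · omega
  refine ⟨⟨M.outer.fst, up, rk, fun v _ => hup1 v, hrk⟩, ?_, ?_⟩
  · rintro e ⟨v, hv, rfl⟩
    have h1 := one_le_height hM.outer v
    rcases h1.eq_or_lt with h | h
    · exact Or.inr ⟨_, hup2 v h.symm, rfl⟩
    · refine Or.inl ⟨v, (up v).snd, hup3 v h, ?_⟩
      change s((up v).fst, (up v).snd) = s(v, (up v).snd)
      rw [hup1 v]
  · rintro e (⟨a, b, hab, rfl⟩ | ⟨d, hd, rfl⟩)
    · have h2 := hM.two_le_of_isDownVertex hab
      refine Or.inr ⟨a, fun h => ?_, ?_⟩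
      · have := hM.outerDart_fst_height outerDart_outer
        rw [← (show a = M.outer.fst from h)] at this
        omega
      · have h3 := (hup3 a h2).unique hab
        have h4 := hup1 a
        change s((up a).fst, (up a).snd) = _
        rw [h3, h4]
    · have h1 : up d.fst = d :=
        outerDart_unique hM.bic (hup2 _ (hM.outerDart_fst_height hd)) hd (hup1 _)
      by_cases h : d.fst = M.outer.fst
      · exact Or.inl (by rw [outerDart_unique hM.bic hd outerDart_outer h])
      · exact Or.inr ⟨d.fst, h, congrArg SimpleGraph.Dart.edge h1⟩

omit [Finite V] hM in
theorem not_outerDart_symm_of_notMem {d : M.G.Dart} (h : d.edge ∉ M.outerEdges) :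
    ¬ M.OuterDart d.symm := fun h' => h ⟨_, h', by simp⟩

/-- The dual tree is connected. -/
theorem conn_blocked {d d' : M.G.Dart} (hd : ¬ M.OuterDart d) (hd' : ¬ M.OuterDart d') :
    M.Conn M.blocked d d' := by
  classical
  obtain ⟨T, -, hT⟩ := hM.exists_parentTree_blocked
  -- `f` contracts the outer face into the inner face on the other side of `outer`. As this is the
  -- only blocked edge that a walk avoiding the tree can cross, the image of such a walk stays in
  -- inner faces and crosses no blocked edge.
  let f : M.G.Dart → M.G.Dart := fun x => if M.OuterDart x then M.outer.symm else x
  have hos : ¬ M.OuterDart M.outer.symm := not_outerDart_symm hM.bic outerDart_outer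
  have h := (T.conn d d').lift (fun x y => M.Conn M.blocked (f x) (f y))
    ⟨fun _ => Conn.refl _, Conn.symm, Conn.trans⟩ ?_ ?_
  · simpa [f, hd, hd'] using h
  · intro x
    by_cases hx : M.OuterDart x
    · simp only [f, hx, outerDart_face.2 hx, if_true]; exact Conn.refl _
    · have : ¬ M.OuterDart (M.face x) := fun h => hx (outerDart_face.1 h)
      simp only [f, hx, this, if_false]; exact Conn.face _
  · intro x hx
    by_cases hxb : x.edge ∈ M.blocked
    · have h1 := (hT hxb).resolve_right hx
      rw [SimpleGraph.dart_edge_eq_iff] at h1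
      rcases h1 with rfl | rfl
      · simp only [f, outerDart_outer, hos, if_true, if_false]; exact Conn.refl _
      · simp only [f, outerDart_outer, hos, SimpleGraph.Dart.symm_symm, if_true, if_false]
        exact Conn.refl _
    · have h1 : ¬ M.OuterDart x := fun h => hxb (Or.inr ⟨_, h, rfl⟩)
      have h2 := not_outerDart_symm_of_notMem (d := x) (fun h => hxb (Or.inr h))
      simp only [f, h1, h2, if_false]; exact Conn.cross hxb

/-- The edges of the dual tree are bridges. -/
theorem not_conn_cross {d : M.G.Dart} (hd : d.edge ∉ M.blocked) :
    ¬ M.Conn (insert d.edge M.blocked) d d.symm := by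
  obtain ⟨T, hT, -⟩ := hM.exists_parentTree_blocked
  exact fun h => T.not_conn d (fun h' => hd (hT h')) (h.mono (Set.insert_subset_insert hT))

end IsNice

/-! ### Down paths and crest separators -/

omit [Finite V] in
theorem exists_of_mem_pathEdges {l : List V} (hl : l.IsChain M.IsDownVertex) {e : Sym2 V}
    (he : e ∈ pathEdges l) : ∃ a b, M.IsDownVertex a b ∧ e = s(a, b) ∧ a ∈ l ∧ b ∈ l := by
  obtain ⟨a, b, ⟨s, t, rfl⟩, rfl⟩ := he
  refine ⟨a, b, ?_, rfl, by simp, by simp⟩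
  simp only [List.append_assoc, List.cons_append, List.nil_append] at hl
  exact (List.isChain_cons_cons.1 (List.isChain_append.1 hl).2.1).1

omit [Finite V] in
theorem pathEdges_cons_cons (u v : V) (l : List V) :
    pathEdges (u :: v :: l) = insert s(u, v) (pathEdges (v :: l)) := by
  ext e
  simp only [pathEdges, Set.mem_ofPred_eq, Set.mem_insert_iff]
  constructor
  · rintro ⟨a, b, h, rfl⟩
    rw [List.infix_cons_iff] at h
    rcases h with h | h
    · rw [List.cons_prefix_cons, List.cons_prefix_cons] at h
      rw [h.1, h.2.1]
      exact Or.inl rfl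
    · exact Or.inr ⟨a, b, h, rfl⟩
  · rintro (rfl | ⟨a, b, h, rfl⟩)
    · exact ⟨u, v, ⟨[], l, rfl⟩, rfl⟩
    · exact ⟨a, b, h.trans (List.suffix_cons _ _).isInfix, rfl⟩

namespace IsNice

variable (hM : M.IsNice l)
include hM

/-- A down path continues at each vertex that has a down vertex, because it ends only on the coast,
where there is none. -/
theorem edge_mem_pathEdges {p : List V} (hp : M.IsDownPath p) {a b : V} (ha : a ∈ p)
    (hab : M.IsDownVertex a b) : s(a, b) ∈ pathEdges p := by
  obtain ⟨s, t, rfl⟩ := List.append_of_mem ha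
  obtain ⟨hc, v, hv, hvc⟩ := hp
  cases t with
  | nil =>
    rw [List.getLast?_append] at hv
    simp only [List.getLast?_singleton, Option.some_or, Option.mem_def, Option.some.injEq] at hv
    subst hv
    rw [mem_coast_iff hM.outer] at hvc
    have := hM.two_le_of_isDownVertex hab
    omega
  | cons c t =>
    have h1 := (List.isChain_cons_cons.1 (List.isChain_append.1 hc).2.1).1
    rw [hab.unique h1]
    exact ⟨a, c, ⟨s, t, by simp⟩, rfl⟩

end IsNice

omit [Finite V] in
theorem height_le_head {a : V} {p : List V} (h : (a :: p).IsChain M.IsDownVertex) :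
    ∀ x ∈ a :: p, M.height x ≤ M.height a := by
  induction p generalizing a with
  | nil => simp
  | cons b p ih =>
    rw [List.isChain_cons_cons] at h
    intro x hx
    rcases List.mem_cons.1 hx with rfl | hx
    · exact le_rfl
    · have := ih h.2 x hx
      have := h.1.1.2
      omega

variable (M) in
/-- The data of a crest separator with top edge `{u, v}`. -/
structure SepData (X : List V × List V) (u v : V) (p q : List V) : Prop where
  adj : M.G.Adj u v
  left : M.IsDownPath (u :: p)
  right : M.IsDownPath (v :: q)
  border : borderEdges X = insert s(u, v) (pathEdges (u :: p) ∪ pathEdges (v :: q))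
  verts : ∀ x, x ∈ sepVerts X ↔ x ∈ u :: p ∨ x ∈ v :: q
  top : s(u, v) ∉ M.downEdges
  sepHeight : M.sepHeight X = M.height u
  kind : (M.height v = M.height u ∧ topVerts X = {u, v}) ∨
    (M.IsRepresentant u v ∧ topVerts X = {u})

omit [Finite V] in
theorem foldr_max_eq (L : List ℕ) (m : ℕ) (hm : m ∈ L) (h : ∀ x ∈ L, x ≤ m) :
    L.foldr max 0 = m := by
  apply le_antisymm
  · clear hm
    induction L with
    | nil => simp
    | cons a L ih =>
      simp only [List.foldr_cons, max_le_iff]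
      exact ⟨h a (by simp), ih fun x hx => h x (by simp [hx])⟩
  · clear h
    induction L with
    | nil => simp at hm
    | cons a L ih =>
      simp only [List.foldr_cons, le_max_iff]
      rcases List.mem_cons.1 hm with rfl | hm
      · exact Or.inl le_rfl
      · exact Or.inr (ih hm)

omit [Finite V] in
theorem IsRepresentant.low {u v : V} (h : M.IsRepresentant u v) :
    M.G.Adj u v ∧ M.height v + 1 = M.height u := by
  obtain ⟨d, rfl, rfl, -, h, -⟩ := h
  exact ⟨d.adj, h⟩

-- Both kinds of crest separators consist of an edge and the down paths of its two ends. They differ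
-- only in whether this edge counts as the first edge of the second path, which decides about the
-- number of top vertices.
omit [Finite V] in
theorem exists_sepData {X : List V × List V} (hX : X ∈ M.crestSeparators) :
    ∃ u v p q, M.SepData X u v p q := by
  obtain ⟨u, v, p, q, h1, hp, hq, h⟩ := hX
  obtain ⟨X1, X2⟩ := X
  simp only at h1 h
  subst h1
  refine ⟨u, v, p, q, ?_⟩
  have hp' := height_le_head hp.1
  have hq' := height_le_head hq.1
  rcases h with ⟨huv, hh, rfl⟩ | ⟨hr, hd, rfl⟩
  · refine ⟨huv, hp, hq, ?_, fun x => Iff.rfl, ?_, ?_, Or.inl ⟨hh, ?_⟩⟩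
    · ext e
      simp only [borderEdges, Set.mem_union, Set.mem_ofPred_eq, List.head?_cons, Option.some.injEq,
        Set.mem_insert_iff]
      constructor
      · rintro (h | ⟨a, b, rfl, rfl, -, rfl⟩)
        · exact Or.inr h
        · exact Or.inl rfl
      · rintro (rfl | h)
        · exact Or.inr ⟨u, v, rfl, rfl, huv.ne, rfl⟩
        · exact Or.inl h
    · rintro ⟨a, b, hab, he⟩
      have := hab.1.2
      rw [Sym2.eq_iff] at he
      rcases he with ⟨rfl, rfl⟩ | ⟨rfl, rfl⟩ <;> omega
    · refine foldr_max_eq _ _ (by simp) ?_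
      intro x hx
      obtain ⟨y, hy, rfl⟩ := List.mem_map.1 hx
      rcases List.mem_append.1 hy with hy | hy
      · exact hp' y hy
      · exact (hq' y hy).trans hh.le
    · ext x
      simp [topVerts, eq_comm]
  · have hlow := hr.low
    refine ⟨hlow.1, hp, hq, ?_, fun x => ?_, ?_, ?_, Or.inr ⟨hr, ?_⟩⟩
    · ext e
      simp only [borderEdges, Set.mem_union, Set.mem_ofPred_eq, List.head?_cons, Option.some.injEq,
        Set.mem_insert_iff, pathEdges_cons_cons]
      constructor
      · rintro ((h | h | h) | ⟨a, b, rfl, rfl, h, rfl⟩)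
        · exact Or.inr (Or.inl h)
        · exact Or.inl h
        · exact Or.inr (Or.inr h)
        · exact absurd rfl h
      · tauto
    · simp only [sepVerts, Set.mem_ofPred_eq, List.mem_cons]
      tauto
    · rintro ⟨a, b, hab, he⟩
      have := hab.1.2
      rw [Sym2.eq_iff] at he
      rcases he with ⟨rfl, rfl⟩ | ⟨rfl, rfl⟩
      · exact hd hab
      · omega
    · refine foldr_max_eq _ _ (by simp) ?_
      intro x hx
      obtain ⟨y, hy, rfl⟩ := List.mem_map.1 hx
      rcases List.mem_append.1 hy with hy | hy
      · exact hp' y hy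
      · rcases List.mem_cons.1 hy with rfl | hy
        · exact le_rfl
        · have := hq' y hy
          omega
    · ext x
      simp [topVerts, eq_comm]

namespace SepData

variable {X : List V × List V} {u v : V} {p q : List V} (h : M.SepData X u v p q)
include h

omit [Finite V]

theorem isTopEdge_iff {e : Sym2 V} : M.IsTopEdge X e ↔ e = s(u, v) := by
  rw [IsTopEdge, h.border]
  constructor
  · rintro ⟨rfl | he | he, hd⟩
    · rfl
    · obtain ⟨a, b, hab, rfl, -⟩ := exists_of_mem_pathEdges h.left.1 he
      exact absurd ⟨a, b, hab, rfl⟩ hd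
    · obtain ⟨a, b, hab, rfl, -⟩ := exists_of_mem_pathEdges h.right.1 he
      exact absurd ⟨a, b, hab, rfl⟩ hd
  · rintro rfl
    exact ⟨Set.mem_insert _ _, h.top⟩

theorem height_v_le : M.height v ≤ M.height u := by
  rcases h.kind with h | h
  · exact h.1.le
  · have := h.1.low.2
    omega

theorem height_le {x : V} (hx : x ∈ sepVerts X) : M.height x ≤ M.height u := by
  rcases (h.verts x).1 hx with hx | hx
  · exact height_le_head h.left.1 x hx
  · exact (height_le_head h.right.1 x hx).trans h.height_v_le

theorem mem_sepVerts_of_border {e : Sym2 V} (he : e ∈ borderEdges X) {x : V} (hx : x ∈ e) :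
    x ∈ sepVerts X := by
  rw [h.verts]
  rw [h.border] at he
  rcases he with rfl | he | he
  · rcases Sym2.mem_iff.1 hx with rfl | rfl <;> simp
  · obtain ⟨a, b, -, rfl, ha, hb⟩ := exists_of_mem_pathEdges h.left.1 he
    rcases Sym2.mem_iff.1 hx with rfl | rfl
    · exact Or.inl ha
    · exact Or.inl hb
  · obtain ⟨a, b, -, rfl, ha, hb⟩ := exists_of_mem_pathEdges h.right.1 he
    rcases Sym2.mem_iff.1 hx with rfl | rfl
    · exact Or.inr ha
    · exact Or.inr hb

end SepData

theorem IsNice.edge_mem_border (hM : M.IsNice l) {X : List V × List V}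
    (hX : X ∈ M.crestSeparators) {a b : V} (ha : a ∈ sepVerts X) (hab : M.IsDownVertex a b) :
    s(a, b) ∈ borderEdges X := by
  obtain ⟨u, v, p, q, h⟩ := exists_sepData hX
  rw [h.border]
  rcases (h.verts a).1 ha with ha | ha
  · exact Or.inr (Or.inl (hM.edge_mem_pathEdges h.left ha hab))
  · exact Or.inr (Or.inr (hM.edge_mem_pathEdges h.right ha hab))

/-! ### The components in terms of the dual tree -/

variable (M) in
def tops (S : Set (List V × List V)) : Set (Sym2 V) := {e | ∃ X ∈ S, M.IsTopEdge X e}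

def borders (S : Set (List V × List V)) : Set (Sym2 V) := {e | ∃ X ∈ S, e ∈ borderEdges X}

namespace IsNice

variable (hM : M.IsNice l) {S : Set (List V × List V)} (hS : S ⊆ M.crestSeparators)
include hM

omit [Finite V] hM in
theorem conn_outer {B : Set (Sym2 V)} (hB : M.outerEdges ⊆ B) {d d' : M.G.Dart}
    (h : M.Conn B d d') : M.OuterDart d ↔ M.OuterDart d' := by
  refine h.lift (fun x y => M.OuterDart x ↔ M.OuterDart y)
    ⟨fun _ => Iff.rfl, Iff.symm, Iff.trans⟩ (fun x => outerDart_face.symm) fun x hx => ?_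
  have h1 : ¬ M.OuterDart x := fun h => hx (hB ⟨_, h, rfl⟩)
  have h2 := not_outerDart_symm_of_notMem (d := x) (fun h => hx (hB h))
  exact ⟨fun h => absurd h h1, fun h => absurd h h2⟩

include hS

/-- If a separator contained the higher end `d.fst`, it would contain the down edge `d` too, since
down vertices are unique. So no border touches `d.fst`, and one can turn around it from one side of
`d` to the other: an edge there that is blocked is a down edge of a higher neighbour, for which
induction on the distance of the height from `l` applies. -/
theorem cross_down (n : ℕ) : ∀ d : M.G.Dart, l ≤ M.height d.fst + n →
    M.IsDownVertex d.fst d.snd → d.edge ∉ borders S → M.Conn (M.blocked ∪ M.tops S) d d.symm := by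
  induction n with
  | zero | succ n ih => 
    intro d hn hd hdS
    have hns : ∀ X ∈ S, d.fst ∉ sepVerts X := fun X hX hdX =>
      hdS ⟨X, hX, hM.edge_mem_border (hS hX) hdX hd⟩
    have hout : ∀ x : M.G.Dart, M.OuterDart x → x.fst ≠ d.fst := by
      intro x hx h
      have h1 := hM.outerDart_fst_height hx
      have h2 := hM.two_le_of_isDownVertex hd
      rw [h] at h1
      omega
    have h := rot_induction (a := d) (p := fun x => M.Conn (M.blocked ∪ M.tops S) (M.rot d) x)
      (Conn.refl _) ?_ d rfl
    · refine (Conn.trans ?_ h).symm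
      simpa [face_symm] using Conn.face (B := M.blocked ∪ M.tops S) d.symm
    · intro x hx hxd hc
      refine hc.trans (Conn.rot_of_cross ?_)
      by_cases hxe : x.edge ∈ M.blocked ∪ M.tops S
      · rcases hxe with (⟨a, b, hab, he⟩ | ⟨y, hy, he⟩) | ⟨X, hX, he⟩
        · have he' : s(x.fst, x.snd) = s(a, b) := he
          rw [Sym2.eq_iff] at he'
          rcases he' with ⟨rfl, rfl⟩ | ⟨rfl, rfl⟩
          · rw [hx] at hab
            refine absurd (dart_eq_of_edge_eq ?_ hx) hxd
            change s(x.fst, x.snd) = s(d.fst, d.snd)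
            rw [hx, hab.unique hd]
          · have h1 := hab.1.2
            rw [hx] at h1
            -- In the case `n = 0` the tail has the maximal height `l` and no neighbour can be
            -- higher; in the other case the induction hypothesis is applied to the higher
            -- neighbour.
            first
            | exact absurd (height_le hM.outer x.snd) (by omega)
            | refine (ih x.symm (by change l ≤ M.height x.snd + n; omega) hab ?_).symm.trans ?_
              · rintro ⟨X, hX, hxX⟩
                obtain ⟨u, v, p, q, hd⟩ := exists_sepData (hS hX)
                refine hns X hX (hd.mem_sepVerts_of_border hxX ?_)
                rw [SimpleGraph.Dart.edge_symm, ← hx]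
                exact fst_mem_edge x
              · exact Conn.refl _
        · rw [SimpleGraph.dart_edge_eq_iff] at he
          rcases he with rfl | rfl
          · exact absurd hx (hout _ hy)
          · refine absurd ?_ (hout _ (outerDart_face.2 hy))
            rw [face_fst]; exact hx
        · obtain ⟨u, v, p, q, hd⟩ := exists_sepData (hS hX)
          exact absurd (hd.mem_sepVerts_of_border he.1 (hx ▸ fst_mem_edge x)) (hns X hX)
      · exact Conn.cross hxe

/-- By `cross_down` it makes no difference whether all down edges are blocked or only those on
borders. The remaining border edges are the top edges. -/
theorem conn_borders_iff {d d' : M.G.Dart} :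
    M.Conn (M.outerEdges ∪ borders S) d d' ↔ M.Conn (M.blocked ∪ M.tops S) d d' := by
  constructor
  · intro h
    refine h.lift _ (Conn.equivalence _) Conn.face fun x hx => ?_
    by_cases hxd : x.edge ∈ M.downEdges
    · obtain ⟨a, b, hab, he⟩ := hxd
      have he' : s(x.fst, x.snd) = s(a, b) := he
      rw [Sym2.eq_iff] at he'
      rcases he' with ⟨rfl, rfl⟩ | ⟨rfl, rfl⟩
      · exact hM.cross_down hS l x (by omega) hab fun h => hx (Or.inr h)
      · have := hM.cross_down hS l x.symm (by omega) hab fun h => hx (Or.inr (by simpa using h))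
        rw [SimpleGraph.Dart.symm_symm] at this
        exact this.symm
    · refine Conn.cross ?_
      rintro ((h | h) | ⟨X, hX, h⟩)
      · exact hxd h
      · exact hx (Or.inl h)
      · exact hx (Or.inr ⟨X, hX, h.1⟩)
  · intro h
    refine h.mono ?_
    rintro e (h | ⟨X, hX, h⟩)
    · exact Or.inl (Or.inr h)
    · by_cases hed : e ∈ M.downEdges
      · exact Or.inl (Or.inl hed)
      · exact Or.inr ⟨X, hX, h, hed⟩

/-- Blocking the outer edges keeps every chain of steps that starts in an inner face inside inner
faces, so it is a chain of steps between inner darts. -/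
theorem component_eq_iff {d d' : M.InnerDart} :
    (Quot.mk _ d : M.Component S) = Quot.mk _ d' ↔
      M.Conn (M.blocked ∪ M.tops S) d.1 d'.1 := by
  rw [← hM.conn_borders_iff hS, Quot.eq]
  constructor
  · intro h
    induction h with
    | rel x y h =>
      rcases h with h | ⟨h, h'⟩
      · rw [h]; exact Conn.face _
      · rw [h]
        refine Conn.cross ?_
        rintro (⟨z, hz, he⟩ | ⟨X, hX, he⟩)
        · rw [SimpleGraph.dart_edge_eq_iff] at he
          rcases he with he | he
          · exact x.2 (he ▸ hz)
          · exact y.2 (h ▸ he ▸ hz)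
        · exact h' X hX he
    | refl x => exact Conn.refl _
    | symm x y _ ih => exact ih.symm
    | trans x y z _ _ ih ih' => exact ih.trans ih'
  · intro h
    have key : ∀ x y, M.Conn (M.outerEdges ∪ borders S) x y → ∀ (hx : ¬ M.OuterDart x)
        (hy : ¬ M.OuterDart y), Relation.EqvGen (M.FaceStep S) ⟨x, hx⟩ ⟨y, hy⟩ := by
      intro x y hxy
      induction hxy with
      | rel x y h =>
        intro hx hy
        refine Relation.EqvGen.rel _ _ ?_
        rcases h with h | ⟨h, h'⟩
        · exact Or.inl h
        · exact Or.inr ⟨h, fun X hX he => h' (Or.inr ⟨X, hX, he⟩)⟩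
      | refl x => intro hx hy; exact Relation.EqvGen.refl _
      | symm x y _ ih => intro hx hy; exact Relation.EqvGen.symm _ _ (ih hy hx)
      | trans x y z h h' ih ih' =>
        intro hx hz
        have hy : ¬ M.OuterDart y := fun hy =>
          hx ((conn_outer Set.subset_union_left h).2 hy)
        exact Relation.EqvGen.trans _ _ _ (ih hx hy) (ih' hy hz)
    exact key _ _ h d.2 d'.2

end IsNice

end PlaneGraph

/-! ### Crests -/

namespace PlaneGraph

variable {V : Type*} {M : PlaneGraph V} {l : ℕ}

variable (M) in
/-- There is a walk from `u` to `v` all of whose vertices but possibly the first have height at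
least `k`. -/
def HighReach (k : ℕ) : V → V → Prop :=
  Relation.ReflTransGen fun a b => M.G.Adj a b ∧ k ≤ M.height b

theorem HighReach.le_height {k : ℕ} {u v : V} (h : M.HighReach k u v) (hu : k ≤ M.height u) :
    k ≤ M.height v := by
  cases h with
  | refl => exact hu
  | tail _ h => exact h.2

theorem HighReach.symm {k : ℕ} {u v : V} (h : M.HighReach k u v) (hu : k ≤ M.height u) :
    M.HighReach k v u := by
  induction h with
  | refl => exact .refl
  | tail h h' ih => exact .head ⟨h'.1.symm, HighReach.le_height h hu⟩ ih

theorem HighReach.of_walk {k : ℕ} {u v : V} (p : M.G.Walk u v)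
    (hp : ∀ x ∈ p.support, k ≤ M.height x) : M.HighReach k u v := by
  induction p with
  | nil => exact .refl
  | cons e p ih =>
    simp only [SimpleGraph.Walk.support_cons, List.mem_cons, forall_eq_or_imp] at hp
    exact .head ⟨e, hp.2 _ p.start_mem_support⟩ (ih hp.2)

theorem HighReach.exists_walk {k : ℕ} {u v : V} (h : M.HighReach k u v) (hu : k ≤ M.height u) :
    ∃ p : M.G.Walk u v, p.IsPath ∧ ∀ x ∈ p.support, k ≤ M.height x := by
  classical
  suffices ∃ p : M.G.Walk u v, ∀ x ∈ p.support, k ≤ M.height x by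
    obtain ⟨p, hp⟩ := this
    exact ⟨p.toPath.1, p.toPath.2, fun x hx => hp x (p.support_toPath_subset_support hx)⟩
  induction h with
  | refl => exact ⟨.nil, by simpa using hu⟩
  | tail _ h ih =>
    obtain ⟨p, hp⟩ := ih
    refine ⟨p.concat h.1, fun x hx => ?_⟩
    rw [SimpleGraph.Walk.support_concat] at hx
    rcases List.mem_append.1 hx with hx | hx
    · exact hp x hx
    · rw [List.mem_singleton.1 hx]; exact h.2

namespace IsCrest

variable {H H' : Set V} (hH : M.IsCrest H)
include hH

theorem height_eq {u v : V} (hu : u ∈ H) (hv : v ∈ H) : M.height u = M.height v :=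
  hH.1.prop.2 u hu v hv

theorem height_le {u w : V} (hu : u ∈ H) (h : M.G.Adj u w) : M.height w ≤ M.height u :=
  hH.2 u hu w h

theorem nonempty : H.Nonempty := by
  obtain ⟨⟨x, hx⟩⟩ := hH.1.prop.1.nonempty
  exact ⟨x, hx⟩

/-- Adding the edge to the crest keeps it connected and level, so maximality applies. -/
theorem mem_of_adj {u w : V} (hu : u ∈ H) (h : M.G.Adj u w) (hw : M.height w = M.height u) :
    w ∈ H := by
  have h1 := hH.1.le_of_ge (y := H ∪ {u, w}) ⟨?_, ?_⟩ Set.subset_union_left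
  · exact h1 (Or.inr (Or.inr rfl))
  · exact SimpleGraph.induce_union_connected hH.1.prop.1.preconnected
      (SimpleGraph.induce_pair_connected_of_adj h).preconnected ⟨u, hu, Or.inl rfl⟩
  · have : ∀ x ∈ H ∪ {u, w}, M.height x = M.height u := by
      rintro x (hx | rfl | rfl)
      · exact hH.height_eq hx hu
      · rfl
      · exact hw
    intro x hx y hy
    rw [this x hx, this y hy]

theorem reach {u v : V} (hu : u ∈ H) (hv : v ∈ H) :
    Relation.ReflTransGen (fun a b => M.G.Adj a b ∧ b ∈ H) u v := by
  obtain ⟨p⟩ := hH.1.prop.1.preconnected ⟨u, hu⟩ ⟨v, hv⟩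
  have : ∀ (x y : H) (p : (M.G.induce H).Walk x y),
      Relation.ReflTransGen (fun a b => M.G.Adj a b ∧ b ∈ H) x.1 y.1 := by
    intro x y p
    induction p with
    | nil => exact .refl
    | @cons _ y _ e p ih => exact .head ⟨e, y.2⟩ ih
  exact this _ _ p

theorem highReach {u v : V} (hu : u ∈ H) (hv : v ∈ H) : M.HighReach (M.height u) u v := by
  have := hH.reach hu hv
  clear hv
  induction this with
  | refl => exact .refl
  | tail _ h ih => exact .tail ih ⟨h.1, (hH.height_eq hu h.2).le⟩

/-- A crest can be left only downwards: none of its neighbours is higher, and those of the same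
height belong to it. -/
theorem mem_of_highReach {k : ℕ} {u v : V} (hu : u ∈ H) (hk : M.height u ≤ k)
    (h : M.HighReach k u v) : v ∈ H := by
  induction h with
  | refl => exact hu
  | tail _ h ih =>
    have h1 := hH.height_le ih h.1
    have h2 := hH.height_eq ih hu
    exact hH.mem_of_adj ih h.1 (by have := h.2; omega)

theorem eq_of_mem (hH' : M.IsCrest H') {u : V} (hu : u ∈ H) (hu' : u ∈ H') : H = H' := by
  apply Set.Subset.antisymm
  · exact fun v hv => hH'.mem_of_highReach hu' le_rfl (hH.highReach hu hv)
  · exact fun v hv => hH.mem_of_highReach hu le_rfl (hH'.highReach hu' hv)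

end IsCrest

/-- The connected component of `v` within the vertices of the height of `v`. -/
def levelSet (M : PlaneGraph V) (v : V) : Set V :=
  {x | Relation.ReflTransGen (fun a b => M.G.Adj a b ∧ M.height b = M.height v) v x}

theorem height_of_mem_levelSet {v x : V} (hx : x ∈ M.levelSet v) : M.height x = M.height v := by
  cases hx with
  | refl => rfl
  | tail _ h => exact h.2

theorem isCrest_levelSet {v : V}
    (h : ∀ x ∈ M.levelSet v, ∀ w, M.G.Adj x w → M.height w ≤ M.height v) :
    M.IsCrest (M.levelSet v) := by
  refine ⟨⟨⟨?_, ?_⟩, ?_⟩, ?_⟩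
  · have : Nonempty (M.levelSet v) := ⟨⟨v, .refl⟩⟩
    have key : ∀ x (hx : x ∈ M.levelSet v),
        (M.G.induce (M.levelSet v)).Reachable ⟨v, .refl⟩ ⟨x, hx⟩ := by
      intro x hx
      induction hx with
      | refl => exact SimpleGraph.Reachable.refl _
      | tail hb h ih =>
        refine ih.trans (SimpleGraph.Adj.reachable ?_)
        exact h.1
    exact ⟨fun x y => (key x.1 x.2).symm.trans (key y.1 y.2)⟩
  · intro x hx y hy
    rw [height_of_mem_levelSet hx, height_of_mem_levelSet hy]
  · rintro A ⟨hA, hA'⟩ hle a ha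
    have hv : v ∈ A := hle .refl
    obtain ⟨p⟩ := hA.preconnected ⟨v, hv⟩ ⟨a, ha⟩
    have : ∀ (x y : A) (p : (M.G.induce A).Walk x y), x.1 ∈ M.levelSet v → y.1 ∈ M.levelSet v := by
      intro x y p
      induction p with
      | nil => exact id
      | @cons _ y _ e p ih => exact fun hx => ih (.tail hx ⟨e, hA' _ y.2 _ hv⟩)
    exact this _ _ p .refl
  · intro u hu w huw
    rw [height_of_mem_levelSet hu]
    exact h u hu w huw

/-! ### Facts about the faces around high vertices -/

variable [Finite V]

/-- The face of the dart has a vertex in `K`. -/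
def Touches (K : Set V) (d : M.G.Dart) : Prop := ∃ x ∈ K, x ∈ triVerts d

theorem snd_mem_triVerts (d : M.G.Dart) : d.snd ∈ triVerts d := Or.inr (Or.inl rfl)

theorem fst_mem_triVerts (d : M.G.Dart) : d.fst ∈ triVerts d := Or.inl rfl

namespace IsNice

variable (hM : M.IsNice l)
include hM

theorem touches_face {K : Set V} {d : M.G.Dart} (hd : ¬ M.OuterDart d) :
    Touches K (M.face d) ↔ Touches K d := by
  simp only [Touches, triVerts_face hM.tri hd]

/-- `K` consists of whole components of the vertices higher than `k`. All vertices of a triangle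
that touches `K` have height at least `k`, and the higher ones lie in `K`. So the crossed edge has
an end in `K`, which the face on the other side shares, unless both ends have height exactly `k`;
this is the case that `h` excludes. -/
theorem touches_symm {K : Set V} {k : ℕ} (hK : ∀ x ∈ K, k < M.height x)
    (hK' : ∀ x ∈ K, ∀ y, M.G.Adj x y → k < M.height y → y ∈ K) {d : M.G.Dart}
    (hd : ¬ M.OuterDart d) (h : M.height d.fst = M.height d.snd → k < M.height d.fst)
    (ht : Touches K d) : Touches K d.symm := by
  obtain ⟨x, hx, hxd⟩ := ht
  have hk := hK x hx
  have key : ∀ y ∈ triVerts d, (k < M.height y → y ∈ K) ∧ k ≤ M.height y := by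
    intro y hy
    rcases adj_of_mem_triVerts hM.tri hd hxd hy with rfl | hxy
    · exact ⟨fun _ => hx, hk.le⟩
    · have := height_le_of_adj hM.outer hM.tri hxy.symm
      exact ⟨fun h => hK' x hx y hxy h, by omega⟩
  have h1 := key _ (fst_mem_triVerts d)
  have h2 := key _ (snd_mem_triVerts d)
  by_cases h3 : k < M.height d.fst
  · exact ⟨_, h1.1 h3, snd_mem_triVerts d.symm⟩
  · by_cases h4 : k < M.height d.snd
    · exact ⟨_, h2.1 h4, fst_mem_triVerts d.symm⟩
    · exact absurd (h (by omega)) h3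

variable {X : List V × List V} (hX : X ∈ M.crestSeparators)
include hX

/-- An outer edge has both ends on the coast and a border edge has both ends on the separator, so no
edge at `v` is an obstacle. -/
theorem conn_around {v : V} (hv : 2 ≤ M.height v) (hvX : v ∉ sepVerts X) {d d' : M.G.Dart}
    (hd : d.fst = v) (hd' : d'.fst = v) : M.Conn (M.outerEdges ∪ borders {X}) d d' := by
  have hcross : ∀ x : M.G.Dart, x.fst = v → x.edge ∉ M.outerEdges ∪ borders {X} := by
    rintro x hx (⟨y, hy, he⟩ | ⟨Y, hY, he⟩)
    · rw [SimpleGraph.dart_edge_eq_iff] at he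
      rcases he with rfl | rfl
      · have := hM.outerDart_fst_height hy
        rw [hx] at this; omega
      · have := hM.outerDart_fst_height (outerDart_face.2 hy)
        rw [face_fst] at this
        change M.height x.fst = 1 at this
        rw [hx] at this; omega
    · rw [Set.mem_singleton_iff] at hY
      subst hY
      obtain ⟨u, w, p, q, h⟩ := exists_sepData hX
      exact hvX (h.mem_sepVerts_of_border he (hx ▸ fst_mem_edge x))
  exact rot_induction (a := d) (p := fun x => M.Conn (M.outerEdges ∪ borders {X}) d x)
    (Conn.rot (hcross d hd)) (fun x hx _ hc => hc.trans (Conn.rot (hcross x (hx.trans hd)))) d'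
    (hd'.trans hd.symm)

/-- A walk that avoids both the separator and the coast carries the faces along: at each vertex one
turns to the dart of the next edge. -/
theorem conn_of_highReach {k : ℕ} (hk : 2 ≤ k) {u v : V} (h : M.HighReach k u v)
    (hXk : ∀ w, M.HighReach k u w → w ∉ sepVerts X) (hu : k ≤ M.height u) {d d' : M.G.Dart}
    (hd : d.fst = u) (hd' : d'.fst = v) : M.Conn (M.outerEdges ∪ borders {X}) d d' := by
  induction h generalizing d' with
  | refl => exact hM.conn_around hX (hk.trans hu) (hXk _ .refl) hd hd'
  | @tail b c hb h ih =>
    let x : M.G.Dart := ⟨(b, c), h.1⟩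
    refine (ih (d' := x) rfl).trans ((Conn.face x).trans ?_)
    refine hM.conn_around hX (hk.trans h.2) (hXk _ (.tail hb h)) ?_ hd'
    rw [face_fst]

theorem conn_blocked_of_highReach {k : ℕ} (hk : 2 ≤ k) {u v : V} (h : M.HighReach k u v)
    (hXk : ∀ w, M.HighReach k u w → w ∉ sepVerts X) (hu : k ≤ M.height u) {d d' : M.G.Dart}
    (hd : d.fst = u) (hd' : d'.fst = v) : M.Conn (M.blocked ∪ M.tops {X}) d d' :=
  (hM.conn_borders_iff (Set.singleton_subset_iff.2 hX)).1
    (hM.conn_of_highReach hX hk h hXk hu hd hd')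

end IsNice

end PlaneGraph

/-! ### The crest separator of an edge -/

namespace PlaneGraph

variable {V : Type*} {M : PlaneGraph V} {l : ℕ}

open Classical in
variable (M) in
/-- The down vertex of `v`, or `v` itself if there is none. -/
noncomputable def down (v : V) : V := if h : ∃ u, M.IsDownVertex v u then h.choose else v

theorem IsDownVertex.down_eq {u v : V} (h : M.IsDownVertex u v) : M.down u = v := by
  have h' : ∃ v, M.IsDownVertex u v := ⟨v, h⟩
  rw [down, dif_pos h']
  exact h'.choose_spec.unique h

variable (M) in
noncomputable def downList : ℕ → V → List V
  | 0, v => [v]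
  | k + 1, v => v :: downList k (M.down v)

variable (M) in
/-- The down path of `v`. -/
noncomputable def downPath (v : V) : List V := M.downList (M.height v - 1) v

variable (M) in
/-- The dart of an edge that does not lead upwards. -/
noncomputable def orient (d : M.G.Dart) : M.G.Dart :=
  if M.height d.fst < M.height d.snd then d.symm else d

variable (M) in
/-- The crest separator whose top edge is the edge of a dart that does not lead upwards. -/
noncomputable def sepOf (d : M.G.Dart) : List V × List V :=
  (M.downPath d.fst, if M.height d.snd < M.height d.fst then d.fst :: M.downPath d.snd
    else M.downPath d.snd)

theorem orient_eq (d : M.G.Dart) : M.orient d = d ∨ M.orient d = d.symm := by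
  rw [orient]; split_ifs <;> simp

theorem edge_orient (d : M.G.Dart) : (M.orient d).edge = d.edge := by
  rcases orient_eq d with h | h <;> simp [h]

theorem height_orient (d : M.G.Dart) : M.height (M.orient d).snd ≤ M.height (M.orient d).fst := by
  rw [orient]
  split_ifs with h
  · exact h.le
  · exact not_lt.1 h

theorem downList_eq_cons (k : ℕ) (v : V) : ∃ p, M.downList k v = v :: p := by
  cases k <;> exact ⟨_, rfl⟩

variable [Finite V]

namespace IsNice

variable (hM : M.IsNice l)
include hM

theorem isDownVertex_down {v : V} (h : 2 ≤ M.height v) : M.IsDownVertex v (M.down v) := by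
  obtain ⟨u, hu⟩ := exists_isDownVertex hM.outer hM.tri h
  rwa [hu.down_eq]

theorem isDownPath_downList (k : ℕ) (v : V) (h : M.height v = k + 1) :
    M.IsDownPath (M.downList k v) := by
  induction k generalizing v with
  | zero => exact ⟨List.isChain_singleton _, v, rfl, (mem_coast_iff hM.outer).2 h⟩
  | succ k ih =>
    have hd := hM.isDownVertex_down (v := v) (by omega)
    obtain ⟨hc, w, hw, hwc⟩ := ih (M.down v) (by have := hd.1.2; omega)
    obtain ⟨p, hp⟩ := downList_eq_cons (M := M) k (M.down v)
    rw [downList]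
    rw [hp] at hc hw ⊢
    exact ⟨List.isChain_cons_cons.2 ⟨hd, hc⟩, w, by rw [List.getLast?_cons_cons]; exact hw, hwc⟩

theorem isDownPath_downPath (v : V) : ∃ p, M.downPath v = v :: p ∧ M.IsDownPath (v :: p) := by
  have h1 := one_le_height hM.outer v
  obtain ⟨p, hp⟩ := downList_eq_cons (M := M) (M.height v - 1) v
  refine ⟨p, hp, ?_⟩
  rw [← hp]
  exact hM.isDownPath_downList _ v (by omega)

theorem sepOf_mem {d : M.G.Dart} (hd : d.edge ∉ M.blocked)
    (h : M.height d.snd = M.height d.fst ∨ M.IsRepresentant d.fst d.snd) :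
    M.sepOf d ∈ M.crestSeparators := by
  obtain ⟨p, hp, hp'⟩ := hM.isDownPath_downPath d.fst
  obtain ⟨q, hq, hq'⟩ := hM.isDownPath_downPath d.snd
  refine ⟨d.fst, d.snd, p, q, hp, hp', hq', ?_⟩
  rcases h with h | h
  · refine Or.inl ⟨d.adj, h, ?_⟩
    simp [sepOf, h, hq]
  · refine Or.inr ⟨h, fun h' => hd (Or.inl ⟨_, _, h', rfl⟩), ?_⟩
    have := h.low.2
    simp only [sepOf, hq]
    rw [if_pos (by omega)]

theorem isTopEdge_sepOf {d : M.G.Dart} (hd : d.edge ∉ M.blocked) : M.IsTopEdge (M.sepOf d) d.edge := by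
  obtain ⟨p, hp, hp'⟩ := hM.isDownPath_downPath d.fst
  obtain ⟨q, hq, hq'⟩ := hM.isDownPath_downPath d.snd
  refine ⟨?_, fun h => hd (Or.inl h)⟩
  simp only [sepOf, hp, hq, borderEdges]
  split_ifs with h
  · exact Or.inl (Or.inr (by rw [pathEdges_cons_cons]; exact Or.inl rfl))
  · exact Or.inr ⟨d.fst, d.snd, rfl, rfl, d.adj.ne, rfl⟩

theorem sepOf_injective {d d' : M.G.Dart} (h : M.sepOf d = M.sepOf d') : d = d' := by
  obtain ⟨p, hp, -⟩ := hM.isDownPath_downPath d.fst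
  obtain ⟨q, hq, -⟩ := hM.isDownPath_downPath d.snd
  obtain ⟨p', hp', -⟩ := hM.isDownPath_downPath d'.fst
  obtain ⟨q', hq', -⟩ := hM.isDownPath_downPath d'.snd
  have h1 := congrArg Prod.fst h
  have h2 := congrArg Prod.snd h
  simp only [sepOf, hp, hp', hq, hq'] at h1 h2
  have h3 := (List.cons.inj h1).1
  have hn := d.adj.ne
  have hn' := d'.adj.ne
  refine dart_eq_of_edge_eq ?_ h3
  change s(_, _) = s(_, _)
  rw [h3]
  split_ifs at h2 with hc hc' hc'
  · rw [(List.cons.inj (List.cons.inj h2).2).1]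
  · exact absurd (h3.symm.trans (List.cons.inj h2).1) hn'
  · exact absurd (h3.trans (List.cons.inj h2).1.symm) hn
  · rw [(List.cons.inj h2).1]

end IsNice

/-! ### Search trees of the dual tree and the selected edges -/

variable (M) in
/-- A rooted spanning tree of the inner darts that consists of steps along faces and across edges of
the dual tree. -/
structure SearchTree where
  root : M.G.Dart
  par : M.G.Dart → M.G.Dart
  idx : M.G.Dart → ℕ
  inner_root : ¬ M.OuterDart root
  inner_par : ∀ a, ¬ M.OuterDart a → a ≠ root → ¬ M.OuterDart (par a)
  idx_lt : ∀ a, ¬ M.OuterDart a → a ≠ root → idx (par a) < idx a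
  link : ∀ a, ¬ M.OuterDart a → a ≠ root →
    a = M.face (par a) ∨ (a = (par a).symm ∧ a.edge ∉ M.blocked)

namespace SearchTree

variable (T : M.SearchTree)

def Node (a : M.G.Dart) : Prop := ¬ M.OuterDart a ∧ a ≠ T.root

/-- The step from the parent of `a` to `a` crosses an edge. -/
def Cross (a : M.G.Dart) : Prop := T.Node a ∧ a = (T.par a).symm

/-- The darts are connected by the steps to the nodes in `P`. -/
def Joined (P : Set M.G.Dart) : M.G.Dart → M.G.Dart → Prop :=
  Relation.EqvGen fun x y => T.Node x ∧ x ∈ P ∧ y = T.par x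

variable {T}

theorem Joined.equivalence (P : Set M.G.Dart) : Equivalence (T.Joined P) :=
  ⟨Relation.EqvGen.refl, fun h => Relation.EqvGen.symm _ _ h,
    fun h h' => Relation.EqvGen.trans _ _ _ h h'⟩

theorem Joined.step {P : Set M.G.Dart} {a : M.G.Dart} (ha : T.Node a) (h : a ∈ P) :
    T.Joined P a (T.par a) := Relation.EqvGen.rel _ _ ⟨ha, h, rfl⟩

theorem Joined.lift {P : Set M.G.Dart} (r : M.G.Dart → M.G.Dart → Prop) (hr : Equivalence r)
    (h : ∀ a, T.Node a → a ∈ P → r a (T.par a)) {x y : M.G.Dart} (hxy : T.Joined P x y) : r x y := by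
  induction hxy with
  | rel x y h' => obtain ⟨h1, h2, rfl⟩ := h'; exact h _ h1 h2
  | refl x => exact hr.refl x
  | symm x y _ ih => exact hr.symm ih
  | trans x y z _ _ ih ih' => exact hr.trans ih ih'

theorem Joined.mono {P Q : Set M.G.Dart} (h : P ⊆ Q) {x y : M.G.Dart} (hxy : T.Joined P x y) :
    T.Joined Q x y :=
  hxy.lift _ (equivalence Q) fun _ ha ha' => step ha (h ha')

theorem Joined.inner_iff {P : Set M.G.Dart} {x y : M.G.Dart} (h : T.Joined P x y) :
    M.OuterDart x ↔ M.OuterDart y :=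
  h.lift (fun x y => M.OuterDart x ↔ M.OuterDart y) ⟨fun _ => Iff.rfl, Iff.symm, Iff.trans⟩
    fun a ha _ => ⟨fun h => absurd h ha.1, fun h => absurd h (T.inner_par a ha.1 ha.2)⟩

/-- The step of `a` can only join the part of `a` with the part of its parent. -/
theorem joined_insert {P : Set M.G.Dart} {a x y : M.G.Dart} (h : T.Joined (insert a P) x y) :
    T.Joined P x y ∨ (T.Joined P x a ∧ T.Joined P (T.par a) y) ∨
      (T.Joined P x (T.par a) ∧ T.Joined P a y) := by
  have hE := Joined.equivalence (T := T) P
  induction h with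
  | rel x y h =>
    obtain ⟨h1, h2, rfl⟩ := h
    rcases h2 with rfl | h2
    · exact Or.inr (Or.inl ⟨hE.refl _, hE.refl _⟩)
    · exact Or.inl (Joined.step h1 h2)
  | refl x => exact Or.inl (hE.refl x)
  | symm x y _ ih =>
    rcases ih with h | h | h
    · exact Or.inl (hE.symm h)
    · exact Or.inr (Or.inr ⟨hE.symm h.2, hE.symm h.1⟩)
    · exact Or.inr (Or.inl ⟨hE.symm h.2, hE.symm h.1⟩)
  | trans x y z _ _ ih ih' =>
    have tr := @hE.trans
    have sy := @hE.symm
    rcases ih with h | h | h <;> rcases ih' with h' | h' | h'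
    · exact Or.inl (tr h h')
    · exact Or.inr (Or.inl ⟨tr h h'.1, h'.2⟩)
    · exact Or.inr (Or.inr ⟨tr h h'.1, h'.2⟩)
    · exact Or.inr (Or.inl ⟨h.1, tr h.2 h'⟩)
    · exact Or.inr (Or.inl ⟨h.1, h'.2⟩)
    · exact Or.inl (tr h.1 h'.2)
    · exact Or.inr (Or.inr ⟨h.1, tr h.2 h'⟩)
    · exact Or.inl (tr h.1 h'.2)
    · exact Or.inr (Or.inr ⟨h.1, h'.2⟩)

theorem joined_root (a : M.G.Dart) (ha : ¬ M.OuterDart a) : T.Joined Set.univ a T.root := by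
  induction h : T.idx a using Nat.strong_induction_on generalizing a with
  | _ n ih =>
    by_cases har : a = T.root
    · rw [har]; exact (Joined.equivalence _).refl _
    · exact (Joined.equivalence _).trans (Joined.step ⟨ha, har⟩ trivial)
        (ih _ (h ▸ T.idx_lt a ha har) _ (T.inner_par a ha har) rfl)

theorem joined_all {a b : M.G.Dart} (ha : ¬ M.OuterDart a) (hb : ¬ M.OuterDart b) :
    T.Joined Set.univ a b :=
  (Joined.equivalence _).trans (joined_root a ha) ((Joined.equivalence _).symm (joined_root b hb))

/-- If the tree crossed an edge in both directions, each of its darts would be the parent of the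
other, contrary to `idx_lt`. -/
theorem eq_of_edge_eq {a b : M.G.Dart} (ha : T.Cross a) (hb : T.Cross b) (h : a.edge = b.edge) :
    a = b := by
  rw [SimpleGraph.dart_edge_eq_iff] at h
  rcases h with h | h
  · exact h
  · have h1 := T.idx_lt a ha.1.1 ha.1.2
    have h2 := T.idx_lt b hb.1.1 hb.1.2
    have h3 : T.par a = b := by
      have := ha.2
      rw [h] at this
      exact (SimpleGraph.Dart.symm_involutive.injective this).symm ▸ by rw [← h]
    have h4 : T.par b = a := by
      rw [h]
      conv_rhs => rw [hb.2]
      simp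
    rw [h3] at h1
    rw [h4] at h2
    omega

end SearchTree

namespace IsNice

variable (hM : M.IsNice l) {T : M.SearchTree}
include hM

theorem face_ne_symm (d : M.G.Dart) : M.face d ≠ d.symm := rot_ne hM.bic d.symm

theorem edge_notMem_blocked {a : M.G.Dart} (ha : T.Cross a) : a.edge ∉ M.blocked := by
  rcases T.link a ha.1.1 ha.1.2 with h | h
  · exact absurd (h.symm.trans ha.2) (hM.face_ne_symm _)
  · exact h.2

theorem eq_face {a : M.G.Dart} (ha : T.Node a) (h : ¬ T.Cross a) : a = M.face (T.par a) :=
  (T.link a ha.1 ha.2).resolve_right fun h' => h ⟨ha, h'.1⟩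

theorem conn_of_joined {P : Set M.G.Dart} {E : Set (Sym2 V)}
    (hP : ∀ a ∈ P, T.Cross a → a.edge ∉ E) {x y : M.G.Dart} (h : T.Joined P x y) :
    M.Conn (M.blocked ∪ E) x y := by
  refine h.lift _ (Conn.equivalence _) fun a ha haP => ?_
  by_cases hc : T.Cross a
  · have h1 : T.par a = a.symm := by conv_rhs => rw [hc.2]
                                     simp
    rw [h1]
    exact Conn.cross fun h' => h'.elim (hM.edge_notMem_blocked hc) (hP a haP hc)
  · have := Conn.face (B := M.blocked ∪ E) (T.par a)
    rw [← hM.eq_face ha hc] at this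
    exact this.symm

/-- Removing a tree edge separates the two sides of a step. -/
theorem not_conn_par {a : M.G.Dart} (ha : T.Cross a) :
    ¬ M.Conn (M.blocked ∪ {a.edge}) a (T.par a) := by
  have h1 : T.par a = a.symm := by conv_rhs => rw [ha.2]
                                   simp
  rw [h1, Set.union_singleton]
  exact hM.not_conn_cross (hM.edge_notMem_blocked ha)

end IsNice

end PlaneGraph

/-! ### The selection of tree edges -/

namespace PlaneGraph

variable {V : Type*} {M : PlaneGraph V} {l : ℕ}

variable (M) in
/-- The tree edges that are selected when the edges are processed in the order of their keys: those that
join two parts both of which contain a dart whose tail is higher than the edge. The weight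
of an edge of height `q` is `2 q + 1` if it is horizontal, `2 q` if it leads to a neighbourhood
representant, and `top` otherwise. -/
structure Selection extends SearchTree M where
  key : M.G.Dart → ℕ
  wt : M.G.Dart → ℕ
  top : ℕ
  sel : Set M.G.Dart
  key_inj : ∀ a b, toSearchTree.Node a → toSearchTree.Node b → key a = key b → a = b
  wt_anti : ∀ a b, toSearchTree.Node a → toSearchTree.Node b → key a ≤ key b → wt b ≤ wt a
  wt_of_not_cross : ∀ a, toSearchTree.Node a → ¬ toSearchTree.Cross a → wt a = top
  wt_horizontal : ∀ a, toSearchTree.Cross a → M.height a.snd = M.height a.fst →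
    wt a = 2 * M.height a.fst + 1
  wt_slanted : ∀ a, toSearchTree.Cross a → M.IsLowDart (M.orient a) →
    (wt a = 2 * M.height (M.orient a).fst ∧
      M.IsRepresentant (M.orient a).fst (M.orient a).snd) ∨
    (wt a = top ∧ (M.IsRepresentant (M.orient a).fst (M.orient a).snd →
      ∃ H, M.IsCrest H ∧ (M.orient a).fst ∈ H))
  lt_top : ∀ v, 2 * M.height v + 1 < top
  mem_sel : ∀ a, a ∈ sel ↔ toSearchTree.Node a ∧ wt a < top ∧
    (∃ x, toSearchTree.Joined {b | key b < key a} x a ∧ wt a < 2 * M.height x.fst) ∧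
    ∃ x, toSearchTree.Joined {b | key b < key a} x (par a) ∧ wt a < 2 * M.height x.fst

theorem height_le_orient {a : M.G.Dart} {u : V} (hu : u ∈ a.edge) :
    M.height u ≤ M.height (M.orient a).fst := by
  have h := height_orient a
  rw [← edge_orient] at hu
  rcases Sym2.mem_iff.1 hu with rfl | rfl
  · exact le_rfl
  · exact h

variable [Finite V]

theorem cross_par {T : M.SearchTree} {a : M.G.Dart} (ha : T.Cross a) : T.par a = a.symm := by
  conv_rhs => rw [ha.2]
  simp

namespace IsNice

variable (hM : M.IsNice l) (D : M.Selection)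
include hM

theorem isLowDart_orient {a : M.G.Dart} (h : M.height a.snd ≠ M.height a.fst) :
    M.IsLowDart (M.orient a) := by
  have h1 := height_le_of_adj hM.outer hM.tri a.adj
  have h2 := height_le_of_adj hM.outer hM.tri a.adj.symm
  rw [orient, IsLowDart]
  split_ifs with h3
  · change M.height a.fst + 1 = M.height a.snd
    omega
  · omega

theorem cross_of_wt_lt {a : M.G.Dart} (ha : D.Node a) (h : D.wt a < D.top) : D.Cross a :=
  not_not.1 fun h' => h.ne (D.wt_of_not_cross a ha h')

theorem wt_cases {a : M.G.Dart} (ha : D.Node a) (h : D.wt a < D.top) :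
    (M.height (M.orient a).snd = M.height (M.orient a).fst ∧
      D.wt a = 2 * M.height (M.orient a).fst + 1) ∨
    (M.height (M.orient a).snd + 1 = M.height (M.orient a).fst ∧
      D.wt a = 2 * M.height (M.orient a).fst ∧
      M.IsRepresentant (M.orient a).fst (M.orient a).snd) := by
  have hc := hM.cross_of_wt_lt D ha h
  by_cases hh : M.height a.snd = M.height a.fst
  · have : M.orient a = a := by rw [orient, if_neg (by omega)]
    rw [this]
    exact Or.inl ⟨hh, D.wt_horizontal a hc hh⟩
  · have hl := hM.isLowDart_orient hh
    rcases D.wt_slanted a hc hl with h' | h'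
    · exact Or.inr ⟨hl, h'⟩
    · omega

theorem sepOf_orient {a : M.G.Dart} (ha : D.Node a) (h : D.wt a < D.top) :
    M.sepOf (M.orient a) ∈ M.crestSeparators ∧ M.IsTopEdge (M.sepOf (M.orient a)) a.edge := by
  have hb : (M.orient a).edge ∉ M.blocked := by
    rw [edge_orient]; exact hM.edge_notMem_blocked (hM.cross_of_wt_lt D ha h)
  refine ⟨hM.sepOf_mem hb ?_, ?_⟩
  · rcases hM.wt_cases D ha h with h | h
    · exact Or.inl h.1
    · exact Or.inr h.2.2
  · rw [← edge_orient a]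
    exact hM.isTopEdge_sepOf hb

theorem mem_sel_spec {a : M.G.Dart} (ha : a ∈ D.sel) : D.Node a ∧ D.wt a < D.top ∧ D.Cross a :=
  have h := (D.mem_sel a).1 ha
  ⟨h.1, h.2.1, hM.cross_of_wt_lt D h.1 h.2.1⟩

/-- Steps heavier than `2 k + 1` cross no horizontal edge of height at most `k`, and by
`touches_symm` such edges are the only exits from the faces that touch `K`. -/
theorem joined_touches {P : Set M.G.Dart} {k : ℕ} (hP : ∀ b ∈ P, D.Node b → 2 * k + 1 < D.wt b)
    {K : Set V} (hK : ∀ x ∈ K, k < M.height x)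
    (hK' : ∀ x ∈ K, ∀ y, M.G.Adj x y → k < M.height y → y ∈ K) {x y : M.G.Dart}
    (h : D.Joined P x y) : Touches K x ↔ Touches K y := by
  refine h.lift (fun x y => Touches K x ↔ Touches K y) ⟨fun _ => Iff.rfl, Iff.symm, Iff.trans⟩ ?_
  intro a ha haP
  have hi := D.inner_par a ha.1 ha.2
  by_cases hc : D.Cross a
  · have h1 : ∀ d : M.G.Dart, d = a ∨ d = a.symm → M.height d.fst = M.height d.snd →
        k < M.height d.fst := by
      intro d hd hh
      have h2 : M.height a.snd = M.height a.fst ∧ M.height d.fst = M.height a.fst := by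
        rcases hd with rfl | rfl
        · exact ⟨hh.symm, rfl⟩
        · exact ⟨hh, hh⟩
      have h3 := D.wt_horizontal a hc h2.1
      have h4 := hP a haP ha
      omega
    rw [cross_par hc] at hi ⊢
    constructor
    · exact hM.touches_symm hK hK' ha.1 (h1 a (Or.inl rfl))
    · intro ht
      simpa using hM.touches_symm hK hK' hi (h1 a.symm (Or.inr rfl)) ht
  · rw [hM.eq_face ha hc]
    have : D.par (M.face (D.par a)) = D.par a := by rw [← hM.eq_face ha hc]
    rw [this]
    exact hM.touches_face hi

/-- `joined_touches` with `K` the set of vertices that `x.fst` reaches without descending to height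
`k`. -/
theorem highReach_of_joined {P : Set M.G.Dart} {k : ℕ}
    (hP : ∀ b ∈ P, D.Node b → 2 * k + 1 < D.wt b) {x y : M.G.Dart} (h : D.Joined P x y)
    (hy : ¬ M.OuterDart y) (hx : k < M.height x.fst) {w : V} (hw : w ∈ triVerts y)
    (hkw : k < M.height w) : M.HighReach (k + 1) x.fst w := by
  have h1 := (hM.joined_touches D hP (K := {v | M.HighReach (k + 1) x.fst v})
    (fun v hv => HighReach.le_height hv hx) (fun v hv w hvw hw => .tail hv ⟨hvw, hw⟩) h).1
    ⟨x.fst, .refl, fst_mem_triVerts x⟩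
  obtain ⟨z, hz, hzy⟩ := h1
  rcases adj_of_mem_triVerts hM.tri hy hzy hw with rfl | hzw
  · exact hz
  · exact .tail hz ⟨hzw, hkw⟩

/-- With `k` one less than the height of `z`, the tail of `x` would reach `z` without going below
the level of the crest. Walks of this kind that end in a crest lie in it, but `x.fst` is higher than
the crest. -/
theorem crest_not_joined {H : Set V} (hH : M.IsCrest H) {z : V} (hz : z ∈ H) {P : Set M.G.Dart}
    (hP : ∀ b ∈ P, D.Node b → 2 * M.height z ≤ D.wt b) {x y : M.G.Dart} (h : D.Joined P x y)
    (hy : ¬ M.OuterDart y) (hx : M.height z < M.height x.fst) (hzy : z ∈ triVerts y) : False := by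
  have h1 := one_le_height hM.outer z
  have h2 := hM.highReach_of_joined D (k := M.height z - 1)
    (fun b hb hb' => by have := hP b hb hb'; omega) h hy (by omega) hzy (by omega)
  rw [Nat.sub_add_cancel h1] at h2
  have h3 := hH.height_eq hz (hH.mem_of_highReach hz le_rfl (h2.symm hx.le))
  omega

-- Steps are admitted in the order of their keys until the two darts are joined; as keys are
-- injective, the last admission adds a single step `a`.
omit hM in
theorem exists_first_joined {A B : M.G.Dart} (hA : ¬ M.OuterDart A) (hB : ¬ M.OuterDart B)
    (hAB : A ≠ B) : ∃ a, D.Node a ∧ ¬ D.Joined {b | D.key b < D.key a} A B ∧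
      D.Joined (insert a {b | D.key b < D.key a}) A B := by
  classical
  have hfin := finite_dart (M := M)
  have hex : ∃ i, D.Joined {b | D.key b < i} A B := by
    obtain ⟨N, hN⟩ := (Set.finite_range D.key).bddAbove
    refine ⟨N + 1, (SearchTree.joined_all hA hB).mono fun b _ => ?_⟩
    exact Nat.lt_succ_of_le (hN ⟨b, rfl⟩)
  have hmin := @Nat.find_min _ _ hex
  have hspec := Nat.find_spec hex
  generalize Nat.find hex = i at hmin hspec
  have hE := fun P => SearchTree.Joined.equivalence (T := D.toSearchTree) P
  cases i with
  | zero =>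
    refine absurd (hspec.lift Eq ⟨fun _ => rfl, Eq.symm, Eq.trans⟩ fun a _ h => ?_) hAB
    simp at h
  | succ i =>
    have hn := hmin (Nat.lt_succ_self i)
    by_cases ha : ∃ a, D.Node a ∧ D.key a = i
    · obtain ⟨a, ha, rfl⟩ := ha
      refine ⟨a, ha, hn, hspec.lift _ (hE _) fun b hb hbk => SearchTree.Joined.step hb ?_⟩
      rcases (Nat.lt_succ_iff.1 hbk).eq_or_lt with h | h
      · exact Or.inl (D.key_inj _ _ hb ha h)
      · exact Or.inr h
    · refine absurd (hspec.lift _ (hE _) fun b hb hbk => SearchTree.Joined.step hb ?_) hn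
      rcases (Nat.lt_succ_iff.1 hbk).eq_or_lt with h | h
      · exact absurd ⟨b, hb, h⟩ ha
      · exact h

omit hM in
theorem tops_singleton {X : List V × List V} (hX : X ∈ M.crestSeparators) {e : Sym2 V}
    (he : M.IsTopEdge X e) : M.tops {X} = {e} := by
  obtain ⟨u, v, p, q, h⟩ := exists_sepData hX
  have h1 := h.isTopEdge_iff.1 he
  ext e'
  simp [tops, h.isTopEdge_iff, h1]

/-- The edge at which two darts in different crests are joined. -/
theorem exists_sel_between {A B : M.G.Dart} (hA : ¬ M.OuterDart A) (hB : ¬ M.OuterDart B) {k : ℕ}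
    (hkA : k < M.height A.fst) (hkB : k < M.height B.fst) (h1 : M.HighReach k A.fst B.fst)
    (h2 : ¬ M.HighReach (k + 1) A.fst B.fst) :
    ∃ a ∈ D.sel, M.height (M.orient a).fst = k ∧
      D.Joined (insert a {b | D.key b < D.key a}) A B ∧
      ¬ M.Conn (M.blocked ∪ {a.edge}) A B := by
  -- The step `a` at which the parts of `A` and `B` meet is the wanted one. If it were heavier than
  -- `2 k + 1`, then `A` and `B` would be connected above `k` by `highReach_of_joined`. If its edge
  -- were lower than `k`, its separator would avoid a connection of `A` and `B` at height `k`,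
  -- although removing its edge separates them. It is selected because `A` and `B` themselves
  -- witness a higher tail on either side.
  obtain ⟨a, ha, hn, hj⟩ := exists_first_joined D hA hB
    (fun h => h2 (h ▸ Relation.ReflTransGen.refl))
  have hwt : D.wt a ≤ 2 * k + 1 := by
    by_contra hc
    refine h2 (hM.highReach_of_joined D (k := k) ?_ hj hB hkA (fst_mem_triVerts B) hkB)
    rintro b (rfl | hb) hb'
    · omega
    · have := D.wt_anti b a hb' ha (le_of_lt hb)
      omega
  have htop : D.wt a < D.top := by have := D.lt_top A.fst; omega
  have hc := hM.cross_of_wt_lt D ha htop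
  have hcn : ∀ {x y}, D.Joined {b | D.key b < D.key a} x y →
      M.Conn (M.blocked ∪ {a.edge}) x y := fun h =>
    hM.conn_of_joined (fun b hb hbc hba => by
      rw [SearchTree.eq_of_edge_eq hbc hc hba] at hb
      exact lt_irrefl _ (show D.key a < D.key a from hb)) h
  have hsep : ¬ M.Conn (M.blocked ∪ {a.edge}) A B := by
    intro h
    rcases (SearchTree.joined_insert hj).resolve_left hn with h' | h'
    · exact hM.not_conn_par hc ((hcn h'.1).symm.trans (h.trans (hcn h'.2).symm))
    · exact hM.not_conn_par hc ((hcn h'.2).trans (h.symm.trans (hcn h'.1)))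
  have hk : M.height (M.orient a).fst = k := by
    apply le_antisymm
    · rcases hM.wt_cases D ha htop with h | h <;> omega
    · by_contra hlt
      obtain ⟨hX, hXa⟩ := hM.sepOf_orient D ha htop
      have h3 := one_le_height hM.outer (M.orient a).fst
      have := hM.conn_blocked_of_highReach hX (by omega : 2 ≤ k) h1 ?_ hkA.le rfl rfl
      · rw [tops_singleton hX hXa] at this
        exact hsep this
      · intro w hw hwX
        obtain ⟨u, v, p, q, hd⟩ := exists_sepData hX
        have h4 := hd.height_le hwX
        have h5 := hw.le_height hkA.le
        have h6 : M.height u ≤ _ := height_le_orient (a := a) (u := u)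
          (by rw [hd.isTopEdge_iff.1 hXa]; exact Sym2.mem_mk_left _ _)
        omega
  refine ⟨a, (D.mem_sel a).2 ⟨ha, htop, ?_⟩, hk, hj, hsep⟩
  have hs : ∀ {x y}, D.Joined {b | D.key b < D.key a} x y → D.Joined {b | D.key b < D.key a} y x :=
    (SearchTree.Joined.equivalence _).symm
  rcases (SearchTree.joined_insert hj).resolve_left hn with h' | h'
  · exact ⟨⟨A, h'.1, by omega⟩, ⟨B, hs h'.2, by omega⟩⟩
  · exact ⟨⟨B, hs h'.2, by omega⟩, ⟨A, h'.1, by omega⟩⟩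

/-- Among the crest separators of the same height, the selected one has as few top vertices as
possible. -/
theorem ncard_topVerts_le {A B : M.G.Dart} {a : M.G.Dart} (ha : a ∈ D.sel)
    (hkA : M.height (M.orient a).fst < M.height A.fst)
    (hj : D.Joined (insert a {b | D.key b < D.key a}) A B)
    {X Y : List V × List V} (hX : X ∈ M.crestSeparators) (hXa : M.IsTopEdge X a.edge)
    (hY : Y ∈ M.crestSeparators) (hYh : M.sepHeight Y = M.height (M.orient a).fst)
    (hYn : ¬ M.Conn (M.blocked ∪ M.tops {Y}) A B) :
    (topVerts X).ncard ≤ (topVerts Y).ncard := by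
  obtain ⟨ha1, hat, hac⟩ := hM.mem_sel_spec D ha
  obtain ⟨u, v, p, q, hdX⟩ := exists_sepData hX
  obtain ⟨u', v', p', q', hdY⟩ := exists_sepData hY
  rw [hdY.sepHeight] at hYh
  have hle : D.wt a = 2 * M.height u' ∨ D.wt a = 2 * M.height u' + 1 := by
    rcases hM.wt_cases D ha1 hat with h | h <;> omega
  rcases hdX.kind with ⟨hhX, htX⟩ | ⟨-, htX⟩
  · rcases hdY.kind with ⟨-, htY⟩ | ⟨hrY, -⟩
    · rw [htX, htY, Set.ncard_pair hdX.adj.ne, Set.ncard_pair hdY.adj.ne]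
    -- The case of a horizontal top edge of `X` although `Y` has a single top vertex. With `q` the
    -- common height, only steps of weight at least `2 q + 1` have joined `A` and `B`. If the top
    -- edge of `Y` is not among them, `Y` does not separate `A` from `B`. If it is, its weight is
    -- not `2 q`, so its higher end lies in a crest, and the part of `A` cannot have reached that
    -- vertex from above.
    · exfalso
      have hah : M.height a.snd = M.height a.fst := by
        have : s(a.fst, a.snd) = s(u, v) := hdX.isTopEdge_iff.1 hXa
        rcases Sym2.eq_iff.1 this with h | h <;> rw [h.1, h.2]
        · exact hhX
        · exact hhX.symm
      have hwa := D.wt_horizontal a hac hah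
      have hle2 : D.wt a = 2 * M.height u' + 1 := by omega
      rw [tops_singleton hY (hdY.isTopEdge_iff.2 rfl)] at hYn
      have hPw : ∀ b ∈ insert a {b | D.key b < D.key a}, D.Node b → 2 * M.height u' + 1 ≤ D.wt b := by
        rintro b (rfl | hb) hb'
        · omega
        · have := D.wt_anti b a hb' ha1 (le_of_lt hb)
          omega
      by_cases hb : ∃ b ∈ insert a {b | D.key b < D.key a}, D.Cross b ∧ b.edge = s(u', v')
      · obtain ⟨b, hbP, hbc, hbe⟩ := hb
        have hj' : D.Joined (insert b (insert a {b | D.key b < D.key a} \ {b})) A B := by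
          rwa [Set.insert_sdiff_singleton, Set.insert_eq_of_mem hbP]
        have hlow := hrY.low.2
        have hob : (M.orient b).fst = u' ∧ (M.orient b).snd = v' := by
          have h1 : s((M.orient b).fst, (M.orient b).snd) = s(u', v') := by
            rw [← hbe]; exact edge_orient b
          have h2 := height_orient b
          rcases Sym2.eq_iff.1 h1 with h | h
          · exact h
          · rw [h.1, h.2] at h2; omega
        have hu'b : u' ∈ triVerts b ∧ u' ∈ triVerts b.symm := by
          have : u' ∈ b.edge := by rw [hbe]; exact Sym2.mem_mk_left _ _
          rcases Sym2.mem_iff.1 this with h | h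
          · rw [h]; exact ⟨fst_mem_triVerts b, snd_mem_triVerts b.symm⟩
          · rw [h]; exact ⟨snd_mem_triVerts b, fst_mem_triVerts b.symm⟩
        have hw := D.wt_slanted b hbc (by rw [IsLowDart, hob.1, hob.2]; exact hlow)
        rw [hob.1, hob.2] at hw
        rcases hw with ⟨hw, -⟩ | ⟨-, hw⟩
        · have := hPw b hbP hbc.1
          omega
        · obtain ⟨H, hH, huH⟩ := hw hrY
          have hx : ∀ y, ¬ M.OuterDart y → u' ∈ triVerts y →
              ¬ D.Joined (insert a {b | D.key b < D.key a} \ {b}) A y := fun y hy huy hjy =>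
            hM.crest_not_joined D hH huH (fun c hc hc' => by have := hPw c hc.1 hc'; omega) hjy hy
              (by omega) huy
          rcases SearchTree.joined_insert hj' with h | h | h
          · refine hYn (hM.conn_of_joined (fun c hc hcc hce => ?_) h)
            exact hc.2 (SearchTree.eq_of_edge_eq hcc hbc (Eq.trans hce hbe.symm))
          · exact hx b hbc.1.1 hu'b.1 h.1
          · refine hx _ (D.inner_par b hbc.1.1 hbc.1.2) ?_ h.1
            rw [cross_par hbc]
            exact hu'b.2
      · exact hYn (hM.conn_of_joined (fun c hc hcc hce => hb ⟨c, hc, hcc, hce⟩) hj)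
  · rw [htX, Set.ncard_singleton, Nat.one_le_iff_ne_zero, Ne, Set.ncard_eq_zero (Set.toFinite _)]
    rcases hdY.kind with ⟨-, h⟩ | ⟨-, h⟩ <;> rw [h]
    · exact (Set.insert_nonempty _ _).ne_empty
    · exact (Set.singleton_nonempty _).ne_empty

omit hM [Finite V] in
theorem eq_or_exists_down_of_mem {u : V} {p : List V} (h : (u :: p).IsChain M.IsDownVertex) {z : V}
    (hz : z ∈ u :: p) : z = u ∨ ∃ y, M.IsDownVertex y z := by
  induction p generalizing u with
  | nil => exact Or.inl (by simpa using hz)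
  | cons b p ih =>
    rw [List.isChain_cons_cons] at h
    rcases List.mem_cons.1 hz with rfl | hz
    · exact Or.inl rfl
    · rcases ih h.2 hz with rfl | h'
      · exact Or.inr ⟨u, h.1⟩
      · exact Or.inr h'

/-- A vertex of a crest is not a down vertex, so it could lie on `X` only as an end of the top edge,
and then at the height of that edge. But a selected edge was joined to a dart with a higher tail by
steps at least as heavy, which `crest_not_joined` forbids. -/
theorem disjoint_crest {a : M.G.Dart} (ha : a ∈ D.sel) {X : List V × List V}
    (hX : X ∈ M.crestSeparators) (hXa : M.IsTopEdge X a.edge) {H : Set V} (hH : M.IsCrest H) :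
    Disjoint H (sepVerts X) := by
  rw [Set.disjoint_left]
  intro z hz hzX
  obtain ⟨ha1, hat, hac⟩ := hM.mem_sel_spec D ha
  obtain ⟨u, v, p, q, hd⟩ := exists_sepData hX
  have hn : ¬ ∃ y, M.IsDownVertex y z := by
    rintro ⟨y, hy⟩
    have h1 := hH.height_le hz hy.1.1.symm
    have h2 := hy.1.2
    omega
  have hze : z ∈ a.edge := by
    rw [hd.isTopEdge_iff.1 hXa, Sym2.mem_iff]
    rcases (hd.verts z).1 hzX with h | h
    · exact Or.inl ((eq_or_exists_down_of_mem hd.left.1 h).resolve_right hn)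
    · exact Or.inr ((eq_or_exists_down_of_mem hd.right.1 h).resolve_right hn)
  have hzh : M.height z = M.height (M.orient a).fst := by
    apply le_antisymm (height_le_orient hze)
    rw [← edge_orient] at hze
    rcases Sym2.mem_iff.1 hze with h | h
    · rw [h]
    · rw [h]; exact hH.height_le (h ▸ hz) (M.orient a).adj.symm
  obtain ⟨x, hx, hxh⟩ := ((D.mem_sel a).1 ha).2.2.1
  have hw : 2 * M.height z ≤ D.wt a := by rcases hM.wt_cases D ha1 hat with h | h <;> omega
  refine hM.crest_not_joined D hH hz (fun b hb hb' => ?_) hx ha1.1 (by omega) ?_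
  · exact hw.trans (D.wt_anti b a hb' ha1 (le_of_lt hb))
  · rcases Sym2.mem_iff.1 hze with h | h
    · rw [h]; exact fst_mem_triVerts a
    · rw [h]; exact snd_mem_triVerts a

end IsNice

namespace Selection

/-- The edges of the selected steps. -/
def selEdges (D : M.Selection) : Set (Sym2 V) := {e | ∃ a ∈ D.sel, a.edge = e}

end Selection

namespace IsNice

variable (hM : M.IsNice l) (D : M.Selection)
include hM

/-- Every component contains a crest. -/
theorem exists_crest_conn {x₀ : M.G.Dart} (hx₀ : ¬ M.OuterDart x₀) :
    ∃ H, M.IsCrest H ∧ ∀ v ∈ H, ∃ d, M.Conn (M.blocked ∪ D.selEdges) x₀ d ∧ d.fst = v := by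
  set C : Set M.G.Dart := {d | M.Conn (M.blocked ∪ D.selEdges) x₀ d} with hC
  have hfin := finite_dart (M := M)
  -- The crest will be the plateau of a highest vertex of the component `C`.
  obtain ⟨x, hx, hmax⟩ := Set.exists_max_image C (fun d => M.height d.fst) (Set.toFinite _)
    ⟨x₀, Conn.refl _⟩
  set q := M.height x.fst
  have hin : ∀ d ∈ C, ¬ M.OuterDart d := fun d hd h => hx₀ ((conn_outer
    (Set.subset_union_right.trans Set.subset_union_left) hd).2 h)
  have hface : ∀ d, M.face d ∈ C ↔ d ∈ C := fun d =>
    ⟨fun h => Conn.trans h (Conn.face d).symm, fun h => Conn.trans h (Conn.face d)⟩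
  have hsnd : ∀ d ∈ C, M.height d.snd ≤ q := fun d hd => by
    rw [← face_fst]; exact hmax _ ((hface d).2 hd)
  have hedge : ∀ d ∈ C, ∀ a : M.G.Dart, d.edge = a.edge → M.height (M.orient a).fst ≤ q := by
    intro d hd a h
    have h1 : (M.orient a).fst ∈ d.edge := by rw [h, ← edge_orient a]; exact fst_mem_edge _
    rcases Sym2.mem_iff.1 h1 with h | h <;> rw [h]
    · exact hmax d hd
    · exact hsnd d hd
  -- No selected edge of the maximal height `q` has a side in `C`. By induction on the key, the part
  -- that such a step found on that side contains no earlier exit from `C`, hence lies in `C`; yet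
  -- it contains a dart whose tail is higher than `q`.
  have hcl : ∀ n, ∀ a ∈ D.sel, D.key a = n → M.height (M.orient a).fst = q →
      a ∉ C ∧ D.par a ∉ C := by
    intro n
    induction n using Nat.strong_induction_on with
    | _ n ih =>
      rintro a ha rfl haq
      obtain ⟨ha1, hat, hac⟩ := hM.mem_sel_spec D ha
      have hwa : 2 * q ≤ D.wt a := by rcases hM.wt_cases D ha1 hat with h | h <;> omega
      have hj : ∀ {y z}, D.Joined {b | D.key b < D.key a} y z → (y ∈ C ↔ z ∈ C) := by
        intro y z h
        refine h.lift (fun y z => y ∈ C ↔ z ∈ C) ⟨fun _ => Iff.rfl, Iff.symm, Iff.trans⟩ ?_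
        intro b hb hbk
        by_cases hbc : D.Cross b
        · rw [cross_par hbc]
          by_cases hbe : b.edge ∈ D.selEdges
          · obtain ⟨a', ha', hbe⟩ := hbe
            have := SearchTree.eq_of_edge_eq (hM.mem_sel_spec D ha').2.2 hbc hbe
            subst this
            have hw := D.wt_anti _ _ hb ha1 (le_of_lt hbk)
            have hq : q ≤ M.height (M.orient a').fst := by
              rcases hM.wt_cases D hb (hM.mem_sel_spec D ha').2.1 with h | h <;> omega
            have key : ∀ d ∈ C, d.edge = a'.edge → a' ∉ C ∧ a'.symm ∉ C := fun d hd he => by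
              rw [← cross_par hbc]
              exact ih _ hbk a' ha' rfl (le_antisymm (hedge d hd a' he) hq)
            exact ⟨fun h => absurd h (key _ h rfl).1,
              fun h => absurd h (key _ h a'.edge_symm).2⟩
          · have := Conn.cross (M := M) (B := M.blocked ∪ D.selEdges) (d := b)
              (fun h => h.elim (hM.edge_notMem_blocked hbc) hbe)
            exact ⟨fun h => Conn.trans h this, fun h => Conn.trans h this.symm⟩
        · have := (hface (D.par b)).symm
          rw [← hM.eq_face hb hbc] at this
          exact this.symm
      obtain ⟨-, -, ⟨y, hy, hyh⟩, ⟨z, hz, hzh⟩⟩ := (D.mem_sel a).1 ha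
      constructor
      · intro h
        have := hmax y ((hj hy).2 h)
        omega
      · intro h
        have := hmax z ((hj hz).2 h)
        omega
  -- Consequently no edge of the dual tree with an end of height `q` leads out of `C`.
  have hsymm : ∀ d ∈ C, d.edge ∉ M.blocked → (M.height d.fst = q ∨ M.height d.snd = q) →
      d.symm ∈ C := by
    intro d hd hdb hdq
    by_cases hde : d.edge ∈ D.selEdges
    · exfalso
      obtain ⟨a, ha, hde⟩ := hde
      have h1 := hedge d hd a hde.symm
      have h2 : q ≤ M.height (M.orient a).fst := by
        rcases hdq with h | h <;> rw [← h] <;> apply height_le_orient <;> rw [hde]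
        · exact fst_mem_edge d
        · exact snd_mem_edge d
      have h3 := hcl _ a ha rfl (le_antisymm h1 h2)
      rw [cross_par (hM.mem_sel_spec D ha).2.2] at h3
      rw [SimpleGraph.dart_edge_eq_iff] at hde
      rcases hde with rfl | rfl
      · exact h3.1 hd
      · rw [SimpleGraph.Dart.symm_symm] at h3
        exact h3.2 hd
    · exact Conn.trans hd (Conn.cross fun h => h.elim hdb hde)
  -- It suffices that `C` contains all darts around each of its vertices of height `q`: then the
  -- plateau and all neighbours of the plateau belong to `C`, and none of them is higher than `q`.
  -- For `q = 1` not all these darts need to be inner, and the alternative is that `C` has all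
  -- vertices.
  suffices hsuff : ∃ v₀, (∃ d ∈ C, d.fst = v₀) ∧ M.height v₀ = q ∧
      ∀ d ∈ C, M.height d.fst = q → ∀ d' : M.G.Dart, d'.fst = d.fst →
        (d' ∈ C ∨ (q = 1 ∧ ∀ v, (∃ d ∈ C, d.fst = v))) by
    obtain ⟨v₀, hv₀, hv₀q, hs⟩ := hsuff
    have hlev : ∀ v ∈ M.levelSet v₀, ∃ d ∈ C, d.fst = v := by
      intro v hv
      induction hv with
      | refl => exact hv₀
      | @tail b c hb h ih =>
        obtain ⟨d, hd, rfl⟩ := ih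
        rcases hs d hd (by rw [height_of_mem_levelSet hb, hv₀q]) ⟨(d.fst, c), h.1⟩ rfl with h' | h'
        · exact ⟨_, (hface _).2 h', by rw [face_fst]⟩
        · exact h'.2 c
    refine ⟨M.levelSet v₀, isCrest_levelSet fun v hv w hvw => ?_, hlev⟩
    obtain ⟨d, hd, rfl⟩ := hlev v hv
    rcases hs d hd (by rw [height_of_mem_levelSet hv, hv₀q]) ⟨(d.fst, w), hvw⟩ rfl with h' | h'
    · rw [hv₀q]; exact hsnd _ h'
    · obtain ⟨d', hd', rfl⟩ := h'.2 w
      rw [hv₀q]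
      exact hmax d' hd'
  refine ⟨x.fst, ⟨x, hx, rfl⟩, rfl, fun d hd hdq d' hd' => ?_⟩
  have hq1 : 1 ≤ q := one_le_height hM.outer _
  rcases hq1.eq_or_lt with hq | hq
  -- All tails in `C` have height 1, so no edge of the dual tree leads out of `C`, and `C` is
  -- everything since the dual tree is connected.
  · refine Or.inr ⟨hq.symm, fun v => ?_⟩
    obtain ⟨y, hy, rfl⟩ := exists_inner_fst hM.bic v
    refine ⟨y, ?_, rfl⟩
    refine ((hM.conn_blocked hx₀ hy).lift (fun y z => y ∈ C ↔ z ∈ C)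
      ⟨fun _ => Iff.rfl, Iff.symm, Iff.trans⟩ (fun d => (hface d).symm) ?_).1 (Conn.refl _)
    have key : ∀ d : M.G.Dart, d.edge ∉ M.blocked → d ∈ C → d.symm ∈ C := fun d hd hdC =>
      hsymm d hdC hd (Or.inl (by
        have h1 := hmax d hdC
        have h2 := one_le_height hM.outer d.fst
        omega))
    intro d hd
    refine ⟨key d hd, fun h => ?_⟩
    simpa using key d.symm (by simpa using hd) h
  · refine Or.inl ?_
    have hdown := hM.isDownVertex_down (v := d.fst) (by omega)
    let a : M.G.Dart := ⟨(d.fst, M.down d.fst), hdown.1.1⟩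
    have hnb : ∀ y : M.G.Dart, y.fst = d.fst → y ≠ a → M.height y.snd ≤ q → y.edge ∉ M.blocked := by
      rintro y hy hya hyq (⟨b, c, hbc, he⟩ | ⟨z, hz, he⟩)
      · rcases Sym2.eq_iff.1 (show s(y.fst, y.snd) = s(b, c) from he) with ⟨rfl, rfl⟩ | ⟨rfl, rfl⟩
        · refine hya (dart_eq_of_edge_eq ?_ hy)
          change s(y.fst, y.snd) = s(d.fst, M.down d.fst)
          rw [hy] at hbc ⊢
          rw [hbc.unique hdown]
        · have := hbc.1.2
          rw [hy] at this
          omega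
      · have h1 : ∀ u ∈ z.edge, M.height u = 1 := by
          intro u hu
          rcases Sym2.mem_iff.1 hu with rfl | rfl
          · exact hM.outerDart_fst_height hz
          · rw [← face_fst]; exact hM.outerDart_fst_height (outerDart_face.2 hz)
        have := h1 d.fst (by rw [he, ← hy]; exact fst_mem_edge y)
        omega
    have hrot : ∀ y : M.G.Dart, M.rot y ∈ C ↔ y.symm ∈ C := fun y => by
      rw [← face_symm]; exact hface _
    have key := rot_induction (a := a) (p := fun y => y ∈ C ↔ M.rot a ∈ C) Iff.rfl
      (fun y hy hya hp => by
        rw [← hp, hrot]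
        constructor
        · intro h
          have h1 : M.height y.snd ≤ q := hmax _ h
          have := hsymm y.symm h (by simpa using hnb y hy hya h1) (Or.inr (by
            change M.height y.fst = q
            rw [hy]; exact hdq))
          simpa using this
        · intro h
          exact hsymm y h (hnb y hy hya (hsnd y h)) (Or.inl (by rw [hy]; exact hdq)))
    exact (key d' hd').2 ((key d rfl).1 hd)

end IsNice

end PlaneGraph

/-! ### The selected edges form a good mountain structure -/

namespace PlaneGraph

variable {V : Type*} {M : PlaneGraph V} {l : ℕ}

theorem depth_le {s t : V} (p : M.G.Walk s t) {x : V} (hx : x ∈ p.support) :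
    M.depth p ≤ M.height x := Nat.sInf_le ⟨x, hx, rfl⟩

theorem le_depth {s t : V} (p : M.G.Walk s t) {k : ℕ} (h : ∀ x ∈ p.support, k ≤ M.height x) :
    k ≤ M.depth p := by
  obtain ⟨x, hx, hx'⟩ := Nat.sInf_mem (s := {i | ∃ v ∈ p.support, M.height v = i})
    ⟨_, s, p.start_mem_support, rfl⟩
  exact (h x hx).trans hx'.le

namespace Selection

/-- The crest separators of the selected edges. -/
noncomputable def seps (D : M.Selection) : Set (List V × List V) :=
  (fun a => M.sepOf (M.orient a)) '' D.sel

end Selection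

variable (M) in
/-- The component of the face of an inner dart. -/
def comp (S : Set (List V × List V)) (d : M.G.Dart) (hd : ¬ M.OuterDart d) : M.Component S :=
  Quot.mk _ ⟨d, hd⟩

theorem exists_comp {S : Set (List V × List V)} (C : M.Component S) :
    ∃ d, ∃ hd : ¬ M.OuterDart d, C = M.comp S d hd := by
  induction C using Quot.ind with
  | _ d => exact ⟨d.1, d.2, rfl⟩

theorem mem_compVerts {S : Set (List V × List V)} {d : M.G.Dart} (hd : ¬ M.OuterDart d) :
    d.fst ∈ M.compVerts (M.comp S d hd) := ⟨⟨d, hd⟩, rfl, rfl⟩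

variable [Finite V]

namespace IsNice

variable (hM : M.IsNice l) (D : M.Selection)
include hM

theorem seps_subset : D.seps ⊆ M.crestSeparators := by
  rintro X ⟨a, ha, rfl⟩
  have h := hM.mem_sel_spec D ha
  exact (hM.sepOf_orient D h.1 h.2.1).1

theorem isTopEdge_of_mem_sel {a : M.G.Dart} (ha : a ∈ D.sel) :
    M.IsTopEdge (M.sepOf (M.orient a)) a.edge :=
  have h := hM.mem_sel_spec D ha
  (hM.sepOf_orient D h.1 h.2.1).2

theorem eq_of_isTopEdge {a : M.G.Dart} (ha : a ∈ D.sel) {e : Sym2 V}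
    (he : M.IsTopEdge (M.sepOf (M.orient a)) e) : e = a.edge := by
  obtain ⟨u, v, p, q, h⟩ := exists_sepData (hM.seps_subset D ⟨a, ha, rfl⟩)
  rw [h.isTopEdge_iff.1 he, h.isTopEdge_iff.1 (hM.isTopEdge_of_mem_sel D ha)]

theorem tops_seps : M.tops D.seps = D.selEdges := by
  ext e
  constructor
  · rintro ⟨_, ⟨a, ha, rfl⟩, he⟩
    exact ⟨a, ha, (hM.eq_of_isTopEdge D ha he).symm⟩
  · rintro ⟨a, ha, rfl⟩
    exact ⟨_, ⟨a, ha, rfl⟩, hM.isTopEdge_of_mem_sel D ha⟩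

theorem comp_eq_iff {d d' : M.G.Dart} (hd : ¬ M.OuterDart d) (hd' : ¬ M.OuterDart d') :
    M.comp D.seps d hd = M.comp D.seps d' hd' ↔ M.Conn (M.blocked ∪ D.selEdges) d d' := by
  rw [← hM.tops_seps]
  exact hM.component_eq_iff (hM.seps_subset D)

theorem conn_of_mem_compVerts {d : M.G.Dart} (hd : ¬ M.OuterDart d) {v : V}
    (hv : v ∈ M.compVerts (M.comp D.seps d hd)) :
    ∃ d', ¬ M.OuterDart d' ∧ d'.fst = v ∧ M.Conn (M.blocked ∪ D.selEdges) d d' := by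
  obtain ⟨d', h, rfl⟩ := hv
  exact ⟨d'.1, d'.2, rfl, ((hM.comp_eq_iff D d'.2 hd).1 h).symm⟩

/-- A walk that nowhere descends below the height of a crest cannot leave this crest, so between
different crests the walk must go below both. -/
theorem crest_facts {H₁ H₂ : Set V} (h1 : M.IsCrest H₁) (h2 : M.IsCrest H₂) (hne : H₁ ≠ H₂) {s t : V}
    (hs : s ∈ H₁) (ht : t ∈ H₂) {k : ℕ} (hk : M.HighReach k s t) (hks : k ≤ M.height s) :
    k < M.height s ∧ k < M.height t := by
  constructor
  · by_contra hc
    exact hne (h1.eq_of_mem h2 (h1.mem_of_highReach hs (not_lt.1 hc) hk) ht)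
  · by_contra hc
    exact hne (h1.eq_of_mem h2 hs (h2.mem_of_highReach ht (not_lt.1 hc) (hk.symm hks)))

/-- Different crests lie in different components. -/
theorem crest_unique {H₁ H₂ : Set V} (h1 : M.IsCrest H₁) (h2 : M.IsCrest H₂) {x y : M.G.Dart}
    (hx : ¬ M.OuterDart x) (hy : ¬ M.OuterDart y) (hx1 : x.fst ∈ H₁) (hy2 : y.fst ∈ H₂)
    (h : M.Conn (M.blocked ∪ D.selEdges) x y) : H₁ = H₂ := by
  classical
  by_contra hne
  -- The largest `k` for which the two tails are connected without going below `k` is the depth of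
  -- the ridges between them.
  let P : ℕ → Prop := fun k => M.HighReach k x.fst y.fst ∧ k ≤ M.height x.fst
  have hP1 : P 1 := by
    obtain ⟨p⟩ := M.connected.preconnected x.fst y.fst
    exact ⟨HighReach.of_walk p fun _ _ => one_le_height hM.outer _, one_le_height hM.outer _⟩
  have hl1 := (one_le_height hM.outer x.fst).trans (height_le hM.outer _)
  obtain ⟨hk, hkx⟩ := Nat.findGreatest_spec (P := P) hl1 hP1
  have hmax := Nat.findGreatest_is_greatest (P := P) (n := l) (k := Nat.findGreatest P l + 1)
    (Nat.lt_succ_self _)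
  generalize Nat.findGreatest P l = k at hk hkx hmax
  have hf := hM.crest_facts h1 h2 hne hx1 hy2 hk hkx
  have hk' : ¬ M.HighReach (k + 1) x.fst y.fst := fun h =>
    hmax (hf.1.trans_le (height_le hM.outer _)) ⟨h, hf.1⟩
  obtain ⟨a, ha, -, -, hsep⟩ := hM.exists_sel_between D hx hy hf.1 hf.2 hk hk'
  refine hsep (h.mono (Set.union_subset_union_right _ ?_))
  rintro _ rfl
  exact ⟨a, ha, rfl⟩

theorem crest_of_component (C : M.Component D.seps) : ∃ H, M.IsCrest H ∧ H ⊆ M.compVerts C ∧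
    ∀ H', M.IsCrest H' → (H' ∩ M.compVerts C).Nonempty → H' = H := by
  obtain ⟨d, hd, rfl⟩ := exists_comp C
  obtain ⟨H, hH, hHd⟩ := hM.exists_crest_conn D hd
  have hin : ∀ {d'}, M.Conn (M.blocked ∪ D.selEdges) d d' → ¬ M.OuterDart d' := fun h h' =>
    hd ((conn_outer (Set.subset_union_right.trans Set.subset_union_left) h).2 h')
  refine ⟨H, hH, fun v hv => ?_, fun H' hH' hne => ?_⟩
  · obtain ⟨d', hd', rfl⟩ := hHd v hv
    rw [(hM.comp_eq_iff D hd (hin hd')).2 hd']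
    exact mem_compVerts _
  · obtain ⟨v, hv, hvC⟩ := hne
    obtain ⟨d', hd', rfl, hc⟩ := hM.conn_of_mem_compVerts D hd hvC
    obtain ⟨w, hw⟩ := hH.nonempty
    obtain ⟨d'', hd'', rfl⟩ := hHd w hw
    exact hM.crest_unique D hH' hH hd' (hin hd'') hv hw (hc.symm.trans hd'')

/-- Each crest is connected within its own height, above all vertices of `X`, so it lies in one
component of `X`; that these differ is needed for one pair of darts only. -/
theorem goesStronglyBetween {H₁ H₂ : Set V} (h1 : M.IsCrest H₁) (h2 : M.IsCrest H₂)
    {X : List V × List V} (hX : X ∈ M.crestSeparators) {x y : M.G.Dart} (hx : ¬ M.OuterDart x)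
    (hy : ¬ M.OuterDart y) (hx1 : x.fst ∈ H₁) (hy2 : y.fst ∈ H₂)
    (hxX : M.sepHeight X < M.height x.fst) (hyX : M.sepHeight X < M.height y.fst)
    (hsep : ¬ M.Conn (M.blocked ∪ M.tops {X}) x y) : M.GoesStronglyBetween X H₁ H₂ := by
  have hX' : {X} ⊆ M.crestSeparators := Set.singleton_subset_iff.2 hX
  obtain ⟨u, v, p, q, hd⟩ := exists_sepData hX
  rw [hd.sepHeight] at hxX hyX
  have hu := one_le_height hM.outer u
  have key : ∀ H, M.IsCrest H → ∀ z : M.G.Dart, ∀ hz : ¬ M.OuterDart z, z.fst ∈ H →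
      M.height u < M.height z.fst → H ⊆ M.compVerts (M.comp {X} z hz) := by
    intro H hH z hz hzH hzu w hw
    obtain ⟨d, hdo, rfl⟩ := exists_inner_fst hM.bic w
    have h3 : M.comp {X} z hz = M.comp {X} d hdo := by
      refine (hM.component_eq_iff hX').2 ?_
      refine hM.conn_blocked_of_highReach hX (by omega) (hH.highReach hzH hw) ?_ le_rfl rfl rfl
      intro a ha haX
      have h4 := hd.height_le haX
      have h5 := ha.le_height le_rfl
      omega
    rw [h3]
    exact mem_compVerts _
  refine ⟨⟨M.comp {X} x hx, M.comp {X} y hy, fun h => hsep ((hM.component_eq_iff hX').1 h),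
    key _ h1 x hx hx1 hxX, key _ h2 y hy hy2 hyX⟩, ?_⟩
  rw [Set.disjoint_left]
  intro a ha haX
  have h4 := hd.height_le haX
  rcases ha with ha | ha
  · rw [h1.height_eq ha hx1] at h4; omega
  · rw [h2.height_eq ha hy2] at h4; omega

theorem isGoodMountainStructure : M.IsGoodMountainStructure D.seps := by
  refine ⟨⟨hM.tri, hM.bic, hM.seps_subset D, ?_⟩, ?_, fun C => ?_⟩
  · intro H₁ H₂ h1 h2 hne s hs t ht R hR
    have hk : M.HighReach (M.depth R) s t := HighReach.of_walk R fun x hx => depth_le R hx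
    have hks : M.depth R ≤ M.height s := depth_le R R.start_mem_support
    have hf := hM.crest_facts h1 h2 hne hs ht hk hks
    have hk' : ¬ M.HighReach (M.depth R + 1) s t := by
      intro h
      obtain ⟨p, hp, hp'⟩ := h.exists_walk hf.1
      have h3 := le_depth p hp'
      have h4 := hR.2 p hp
      omega
    obtain ⟨x, hx, rfl⟩ := exists_inner_fst hM.bic s
    obtain ⟨y, hy, rfl⟩ := exists_inner_fst hM.bic t
    obtain ⟨a, ha, hak, hj, hsep⟩ := hM.exists_sel_between D hx hy hf.1 hf.2 hk hk'
    have hX := hM.seps_subset D ⟨a, ha, rfl⟩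
    have hXa := hM.isTopEdge_of_mem_sel D ha
    have hXh : M.sepHeight (M.sepOf (M.orient a)) = M.depth R := by
      obtain ⟨u, v, p, q, hd⟩ := exists_sepData hX
      rw [hd.sepHeight, ← hak]
      have he := hd.isTopEdge_iff.1 hXa
      apply le_antisymm
      · exact height_le_orient (by rw [he]; exact Sym2.mem_mk_left _ _)
      · have : (M.orient a).fst ∈ s(u, v) := by
          rw [← he, ← edge_orient a]; exact fst_mem_edge _
        rcases Sym2.mem_iff.1 this with h | h <;> rw [h]
        exact hd.height_v_le
    refine ⟨_, ⟨a, ha, rfl⟩, ⟨hX, hXh, ?_⟩, ?_⟩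
    · refine hM.goesStronglyBetween h1 h2 hX hx hy hs ht (hXh ▸ hf.1) (hXh ▸ hf.2) ?_
      rwa [tops_singleton hX hXa]
    · rintro Y ⟨hY, hYh, ⟨C, E, hCE, hC, hE⟩, -⟩
      refine hM.ncard_topVerts_le D ha (hak ▸ hf.1) hj hX hXa hY (hYh.trans hak.symm) fun hc => hCE ?_
      have hY' : {Y} ⊆ M.crestSeparators := Set.singleton_subset_iff.2 hY
      have hYt : M.Conn (M.blocked ∪ M.tops {Y}) x y := hc
      obtain ⟨u, v, p, q, hd⟩ := exists_sepData hY
      have hYu : M.height u = M.depth R := by rw [← hd.sepHeight, hYh]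
      have hu := one_le_height hM.outer u
      -- All faces at a vertex higher than `Y` lie in the same component of `Y`, so the components
      -- that contain the two crests are those of `x` and `y`.
      have around : ∀ z : M.G.Dart, ∀ hz : ¬ M.OuterDart z, M.depth R < M.height z.fst →
          ∀ C : M.Component {Y}, z.fst ∈ M.compVerts C → C = M.comp {Y} z hz := by
        rintro z hz hzh C ⟨d, rfl, hdz⟩
        refine (hM.component_eq_iff hY').2 ((hM.conn_borders_iff hY').1 ?_)
        refine hM.conn_around hY (v := z.fst) (by omega) (fun h => ?_) hdz rfl
        have := hd.height_le h
        omega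
      rw [around x hx hf.1 C (hC hs), around y hy hf.2 E (hE ht)]
      exact (hM.component_eq_iff hY').2 hYt
  · rintro _ ⟨a, ha, rfl⟩ H hH
    exact hM.disjoint_crest D ha (hM.seps_subset D ⟨a, ha, rfl⟩) (hM.isTopEdge_of_mem_sel D ha) hH
  · obtain ⟨H, hH, hHC, -⟩ := hM.crest_of_component D C
    obtain ⟨v, hv⟩ := hH.nonempty
    exact ⟨H, hH, v, hv, hHC hv⟩

theorem inner_of_mem_sel {a : M.G.Dart} (ha : a ∈ D.sel) :
    ¬ M.OuterDart a ∧ ¬ M.OuterDart (D.par a) :=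
  have h := (hM.mem_sel_spec D ha).1
  ⟨h.1, D.inner_par a h.1 h.2⟩

theorem comp_ne_comp_par {a : M.G.Dart} (ha : a ∈ D.sel) :
    M.comp D.seps a (hM.inner_of_mem_sel D ha).1 ≠
      M.comp D.seps (D.par a) (hM.inner_of_mem_sel D ha).2 := by
  intro h
  rw [hM.comp_eq_iff] at h
  refine hM.not_conn_par (hM.mem_sel_spec D ha).2.2
    (h.mono (Set.union_subset_union_right _ ?_))
  rintro _ rfl
  exact ⟨a, ha, rfl⟩

/-- The only darts on the top edge of the separator of `a` are `a` and `D.par a`, so a common top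
edge of two components is a selected step between them. -/
theorem mem_edgeSet_mountainConnectionTree {e : Sym2 (M.Component D.seps)} :
    e ∈ (M.mountainConnectionTree D.seps).edgeSet ↔ ∃ a, ∃ ha : a ∈ D.sel,
      e = s(M.comp D.seps a (hM.inner_of_mem_sel D ha).1,
        M.comp D.seps (D.par a) (hM.inner_of_mem_sel D ha).2) := by
  constructor
  · induction e with | _ C E =>
    rintro ⟨hne, _, ⟨a, ha, rfl⟩, e, he, ⟨d, hd, hde⟩, ⟨d', hd', hde'⟩⟩
    simp only at hd hd' hne
    have hea := hM.eq_of_isTopEdge D ha he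
    have key : ∀ z : M.InnerDart, z.1.edge = e → 
        (Quot.mk _ z : M.Component D.seps) = M.comp D.seps a (hM.inner_of_mem_sel D ha).1 ∨
        (Quot.mk _ z : M.Component D.seps) = M.comp D.seps (D.par a) (hM.inner_of_mem_sel D ha).2 := by
      rintro ⟨z, hz⟩ hze
      rw [hea, SimpleGraph.dart_edge_eq_iff, ← cross_par (hM.mem_sel_spec D ha).2.2] at hze
      rcases hze with h | h
      · left; simp only at h; subst h; rfl
      · right; simp only at h; subst h; rfl
    refine ⟨a, ha, ?_⟩
    rw [← hd, ← hd']
    rw [← hd, ← hd'] at hne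
    rcases key d hde with h | h <;> rcases key d' hde' with h' | h'
    · exact absurd (h.trans h'.symm) hne
    · rw [h, h']
    · rw [h, h', Sym2.eq_swap]
    · exact absurd (h.trans h'.symm) hne
  · rintro ⟨a, ha, rfl⟩
    refine ⟨hM.comp_ne_comp_par D ha, _, ⟨a, ha, rfl⟩, a.edge, hM.isTopEdge_of_mem_sel D ha,
      ⟨⟨a, _⟩, rfl, rfl⟩, ⟨⟨D.par a, _⟩, rfl, ?_⟩⟩
    change (D.par a).edge = _
    rw [cross_par (hM.mem_sel_spec D ha).2.2]
    exact a.edge_symm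

/-- Each step of the search tree either stays in a component or, if it is selected, follows an edge
of the connection tree. Outer darts are sent to an arbitrary component, because the steps never meet
them. -/
theorem connected_mountainConnectionTree : (M.mountainConnectionTree D.seps).Connected := by
  classical
  have : Nonempty (M.Component D.seps) := ⟨M.comp D.seps D.root D.inner_root⟩
  refine ⟨fun C E => ?_⟩
  obtain ⟨x, hx, rfl⟩ := exists_comp C
  obtain ⟨y, hy, rfl⟩ := exists_comp E
  let f : M.G.Dart → M.Component D.seps := fun d =>
    if h : M.OuterDart d then M.comp D.seps D.root D.inner_root else M.comp D.seps d h
  have hf : ∀ d (h : ¬ M.OuterDart d), f d = M.comp D.seps d h := fun d h => dif_neg h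
  rw [← hf, ← hf]
  refine (SearchTree.joined_all (T := D.toSearchTree) hx hy).lift
    (fun x y => (M.mountainConnectionTree D.seps).Reachable (f x) (f y))
    ⟨fun _ => SimpleGraph.Reachable.refl _, fun h => h.symm, fun h h' => h.trans h'⟩ ?_
  intro a ha _
  by_cases has : a ∈ D.sel
  · refine SimpleGraph.Adj.reachable ?_
    rw [← SimpleGraph.mem_edgeSet, hM.mem_edgeSet_mountainConnectionTree]
    exact ⟨a, has, by rw [hf, hf]⟩
  · have : f a = f (D.par a) := by
      rw [hf a ha.1, hf _ (D.inner_par a ha.1 ha.2), hM.comp_eq_iff]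
      refine hM.conn_of_joined (P := {a}) ?_ (SearchTree.Joined.step ha rfl)
      rintro _ rfl hc ⟨b, hb, hba⟩
      rw [SearchTree.eq_of_edge_eq (hM.mem_sel_spec D hb).2.2 hc hba] at hb
      exact has hb
    rw [this]

/-- The components are the parts of the search tree without the selected steps. -/
theorem conn_iff_joined {x y : M.G.Dart} (hx : ¬ M.OuterDart x) (hy : ¬ M.OuterDart y) :
    M.Conn (M.blocked ∪ D.selEdges) x y ↔ D.Joined D.selᶜ x y := by
  constructor
  · intro h
    have hfin := finite_dart (M := M)
    -- The selected steps are removed one at a time. Each is a bridge, and `x` and `y` are connected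
    -- without its edge, so they cannot lie on different sides of it.
    have key : ∀ Q : Set M.G.Dart, Q ⊆ D.sel → D.Joined (D.selᶜ ∪ Q) x y → D.Joined D.selᶜ x y := by
      intro Q
      induction Q, Set.toFinite Q using Set.Finite.induction_on with
      | empty => intro _ h; simpa using h
      | @insert a Q haQ _ ih =>
        intro hQ hj
        have haS : a ∈ D.sel := hQ (Set.mem_insert _ _)
        have hac := (hM.mem_sel_spec D haS).2.2
        rw [Set.union_insert] at hj
        have hcn : ∀ {u v}, D.Joined (D.selᶜ ∪ Q) u v → M.Conn (M.blocked ∪ {a.edge}) u v := fun h =>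
          hM.conn_of_joined (fun b hb hbc hba => by
            rw [SearchTree.eq_of_edge_eq hbc hac hba] at hb
            exact hb.elim (fun h => h haS) haQ) h
        have hxy : M.Conn (M.blocked ∪ {a.edge}) x y := h.mono (Set.union_subset_union_right _ (by
          rintro _ rfl
          exact ⟨a, haS, rfl⟩))
        rcases SearchTree.joined_insert hj with h' | h' | h'
        · exact ih (fun b hb => hQ (Set.mem_insert_of_mem _ hb)) h'
        · exact absurd ((hcn h'.1).symm.trans (hxy.trans (hcn h'.2).symm)) (hM.not_conn_par hac)
        · exact absurd ((hcn h'.2).trans (hxy.symm.trans (hcn h'.1))) (hM.not_conn_par hac)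
    refine key D.sel subset_rfl ((SearchTree.joined_all hx hy).mono ?_)
    rw [Set.compl_union_self]
  · refine hM.conn_of_joined ?_
    rintro b hb hbc ⟨a, ha, hab⟩
    rw [SearchTree.eq_of_edge_eq (hM.mem_sel_spec D ha).2.2 hbc hab] at ha
    exact hb ha

-- Each inner face has three darts, so `3 (|F| - 1) ≤ 2 |E|`; with Euler's formula this gives `|E| ≤
-- 3 |V| - 3`.
omit D in
theorem card_dart_le : Nat.card M.G.Dart ≤ 6 * Nat.card V := by
  classical
  have := Fintype.ofFinite V
  have hfin := finite_dart (M := M)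
  let F := Quotient (Equiv.Perm.SameCycle.setoid M.face)
  let q : M.G.Dart → F := Quotient.mk _
  have hq : ∀ x y, q x = q y ↔ M.face.SameCycle x y := fun x y => Quotient.eq
  have hF : Finite F := Quotient.finite _
  have h1 : Nat.card M.G.Dart = 2 * Nat.card M.G.edgeSet := by
    rw [Nat.card_eq_fintype_card, M.G.dart_card_eq_twice_card_edges, Nat.card_eq_fintype_card,
      SimpleGraph.edgeFinset_card]
  have h2 : Nat.card {f : F // f ≠ q M.outer} * 3 ≤ Nat.card M.G.Dart := by
    let g : {f : F // f ≠ q M.outer} × Fin 3 → M.G.Dart := fun p => (M.face ^ (p.2 : ℕ)) p.1.1.out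
    have hg : Function.Injective g := by
      rintro ⟨f, i⟩ ⟨f', j⟩ h
      have hs : ∀ (f : {f : F // f ≠ q M.outer}) (i : Fin 3), q (g (f, i)) = f.1 := by
        intro f i
        conv_rhs => rw [← Quotient.out_eq f.1]
        exact (hq _ _).2 (Equiv.Perm.sameCycle_pow_left.2 (Equiv.Perm.SameCycle.refl _ _))
      have hf : f = f' := Subtype.ext (by rw [← hs f i, ← hs f' j, h])
      subst hf
      have ho : ¬ M.OuterDart f.1.out := fun ho => f.2 (by
        rw [← Quotient.out_eq f.1]
        exact (hq _ _).2 ho.symm)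
      have h3 := hM.tri _ ho
      set d := f.1.out
      have e1 : M.face d ≠ d := fun h => d.adj.ne (by
        have := congrArg (fun x : M.G.Dart => x.fst) h
        simp only [face_fst] at this
        exact this.symm)
      have e2 : M.face (M.face d) ≠ M.face d := fun h => e1 (M.face.injective h)
      have e3 : M.face (M.face d) ≠ d := fun h => by rw [h] at h3; exact e1 h3
      simp only [g] at h
      fin_cases i <;> fin_cases j <;> first | rfl | (simp [pow_succ] at h; tauto)
    have := Nat.card_le_card_of_injective g hg
    rwa [Nat.card_prod, Nat.card_eq_fintype_card (α := Fin 3), Fintype.card_fin] at this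
  have h3 : Nat.card F = Nat.card {f : F // f ≠ q M.outer} + 1 := by
    have := Fintype.ofFinite F
    have := Fintype.card_subtype_compl (fun f : F => f = q M.outer)
    rw [Fintype.card_subtype_eq] at this
    have hpos : 0 < Fintype.card F := Fintype.card_pos_iff.2 ⟨q M.outer⟩
    rw [Nat.card_eq_fintype_card, Nat.card_eq_fintype_card]
    have h4 : Fintype.card {f : F // f ≠ q M.outer} = Fintype.card F - 1 := by convert this
    omega
  have h4 := M.euler
  change Nat.card V + Nat.card F = _ at h4
  omega

end IsNice

end PlaneGraph

/-! ### Reasoning about programs -/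

namespace RamState

@[simp] theorem reg_setReg (s : RamState) (x v y : ℕ) :
    (s.setReg x v).reg y = if y = x then v else s.reg y := by
  simp [setReg, Function.update_apply]

@[simp] theorem arr_setReg (s : RamState) (x v : ℕ) : (s.setReg x v).arr = s.arr := rfl

@[simp] theorem reg_setArr (s : RamState) (a i v : ℕ) : (s.setArr a i v).reg = s.reg := rfl

@[simp] theorem arr_setArr_self (s : RamState) (a i v j : ℕ) :
    (s.setArr a i v).arr a j = if j = i then v else s.arr a j := by
  simp [setArr, Function.update_apply]

@[simp] theorem arr_setArr_of_ne (s : RamState) {a b : ℕ} (i v : ℕ) (h : b ≠ a) :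
    (s.setArr a i v).arr b = s.arr b := by
  simp [setArr, Function.update_of_ne h]

end RamState

namespace RamProgram

infixr:67 " ;; " => RamProgram.seq

/-- A program that changes only the register `x`. -/
def nop (x : ℕ) : RamProgram := copy x x

/-- `if x = y then p else q` -/
def ifEq (x y : ℕ) (p q : RamProgram) : RamProgram := ite x y q (ite y x q p)

/-- `for i = 0, …, N - 1 do p` -/
def forUp (i N : ℕ) (p : RamProgram) : RamProgram := const i 0 ;; RamProgram.while i N (p ;; succ i)

/-- `for i = N - 1, …, L do p` -/
def forDown (i N L : ℕ) (p : RamProgram) : RamProgram :=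
  copy i N ;; RamProgram.while L i (pred i ;; p)

/-- The final state of a program without loops. -/
def exec : RamProgram → RamState → RamState
  | const x c, s => s.setReg x c
  | copy x y, s => s.setReg x (s.reg y)
  | succ x, s => s.setReg x (s.reg x + 1)
  | pred x, s => s.setReg x (s.reg x - 1)
  | load x a y, s => s.setReg x (s.arr a (s.reg y))
  | store a x y, s => s.setArr a (s.reg x) (s.reg y)
  | seq p q, s => exec q (exec p s)
  | ite x y p q, s => if s.reg x < s.reg y then exec p s else exec q s
  | RamProgram.while _ _ _, s => s

/-- A bound for the running time of a program without loops. -/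
def cost : RamProgram → ℕ
  | seq p q => cost p + cost q
  | ite _ _ p q => max (cost p) (cost q) + 1
  | _ => 1

/-- The program has no loops. -/
def straight : RamProgram → Bool
  | seq p q => straight p && straight q
  | ite _ _ p q => straight p && straight q
  | RamProgram.while _ _ _ => false
  | _ => true

/-- The registers that the program may change. -/
def regs : RamProgram → List ℕ
  | const x _ | copy x _ | succ x | pred x | load x _ _ => [x]
  | store _ _ _ => []
  | seq p q | ite _ _ p q => regs p ++ regs q
  | RamProgram.while _ _ p => regs p

/-- The arrays that the program may change. -/
def arrs : RamProgram → List ℕ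
  | store a _ _ => [a]
  | seq p q | ite _ _ p q => arrs p ++ arrs q
  | RamProgram.while _ _ p => arrs p
  | _ => []

/-- The states agree except for the registers and arrays that the program may change. -/
def Frame (p : RamProgram) (s s' : RamState) : Prop :=
  (∀ x, x ∉ p.regs → s'.reg x = s.reg x) ∧ ∀ a, a ∉ p.arrs → s'.arr a = s.arr a

theorem Frame.refl (p : RamProgram) (s : RamState) : Frame p s s := ⟨fun _ _ => rfl, fun _ _ => rfl⟩

theorem Frame.trans {p : RamProgram} {s s' s'' : RamState} (h : Frame p s s')
    (h' : Frame p s' s'') : Frame p s s'' :=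
  ⟨fun x hx => (h'.1 x hx).trans (h.1 x hx), fun a ha => (h'.2 a ha).trans (h.2 a ha)⟩

theorem Frame.mono {p q : RamProgram} {s s' : RamState} (h : Frame p s s')
    (hr : p.regs ⊆ q.regs) (ha : p.arrs ⊆ q.arrs) : Frame q s s' :=
  ⟨fun x hx => h.1 x fun hx' => hx (hr hx'), fun a h' => h.2 a fun h'' => h' (ha h'')⟩

/-- What a program does not write is read off from its syntax, so invariants need to mention only
what changes. -/
theorem frame_of_runsIn {p : RamProgram} {s s' : RamState} {k : ℕ} (h : RunsIn p s k s') :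
    Frame p s s' := by
  induction h with
  | const s x c | copy s x y | succ s x | pred s x | load s x a y =>
    refine ⟨fun z hz => ?_, fun _ _ => rfl⟩
    simp only [regs, List.mem_singleton] at hz
    simp [hz]
  | store s a x y =>
    refine ⟨fun _ _ => rfl, fun b hb => ?_⟩
    simp only [arrs, List.mem_singleton] at hb
    simp [hb]
  | seq _ _ ih ih' =>
    exact (ih.mono (by simp [regs]) (by simp [arrs])).trans (ih'.mono (by simp [regs]) (by simp [arrs]))
  | ite_true _ _ ih => exact ih.mono (by simp [regs]) (by simp [arrs])
  | ite_false _ _ ih => exact ih.mono (by simp [regs]) (by simp [arrs])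
  | while_true _ _ _ ih ih' => exact (ih.mono (by simp [regs]) (by simp [arrs])).trans ih'
  | while_false _ => exact Frame.refl _ _

/-- Started in `s`, the program halts after at most `t` steps in a state that satisfies `Q`. -/
def Halts (p : RamProgram) (s : RamState) (t : ℕ) (Q : RamState → Prop) : Prop :=
  ∃ k s', RunsIn p s k s' ∧ k ≤ t ∧ Q s'

namespace Halts

variable {p q : RamProgram} {s : RamState} {t t' : ℕ} {Q R : RamState → Prop}

theorem mono (h : Halts p s t Q) (ht : t ≤ t') (hQ : ∀ s', Q s' → R s') : Halts p s t' R := by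
  obtain ⟨k, s', h1, h2, h3⟩ := h
  exact ⟨k, s', h1, h2.trans ht, hQ _ h3⟩

theorem frame (h : Halts p s t Q) : Halts p s t fun s' => Q s' ∧ Frame p s s' := by
  obtain ⟨k, s', h1, h2, h3⟩ := h
  exact ⟨k, s', h1, h2, h3, frame_of_runsIn h1⟩

theorem seq (h : Halts p s t fun s' => Halts q s' t' Q) : Halts (p ;; q) s (t + t') Q := by
  obtain ⟨k, s', h1, h2, k', s'', h3, h4, h5⟩ := h
  exact ⟨k + k', s'', RunsIn.seq h1 h3, add_le_add h2 h4, h5⟩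

theorem andThen {T : ℕ} (h : Halts p s t R)
    (h' : ∀ s', R s' → Frame p s s' → Halts q s' t' Q) (ht : t + t' ≤ T) : Halts (p ;; q) s T Q := by
  obtain ⟨k, s', h1, h2, h3⟩ := h
  obtain ⟨k', s'', h4, h5, h6⟩ := h' s' h3 (frame_of_runsIn h1)
  exact ⟨k + k', s'', RunsIn.seq h1 h4, by omega, h6⟩

theorem straight (hp : p.straight = true) (h : Q (p.exec s)) : Halts p s p.cost Q := by
  induction p generalizing s Q with
  | const x c => exact ⟨_, _, RunsIn.const s x c, le_rfl, h⟩
  | copy x y => exact ⟨_, _, RunsIn.copy s x y, le_rfl, h⟩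
  | succ x => exact ⟨_, _, RunsIn.succ s x, le_rfl, h⟩
  | pred x => exact ⟨_, _, RunsIn.pred s x, le_rfl, h⟩
  | load x a y => exact ⟨_, _, RunsIn.load s x a y, le_rfl, h⟩
  | store a x y => exact ⟨_, _, RunsIn.store s a x y, le_rfl, h⟩
  | seq p q ihp ihq =>
    simp only [RamProgram.straight, Bool.and_eq_true] at hp
    exact seq (ihp hp.1 (ihq hp.2 h))
  | ite x y p q ihp ihq =>
    simp only [RamProgram.straight, Bool.and_eq_true] at hp
    simp only [exec] at h
    split_ifs at h with hxy
    · obtain ⟨k, s', h1, h2, h3⟩ := ihp hp.1 h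
      exact ⟨_, s', RunsIn.ite_true hxy h1, by simp only [cost]; omega, h3⟩
    · obtain ⟨k, s', h1, h2, h3⟩ := ihq hp.2 h
      exact ⟨_, s', RunsIn.ite_false hxy h1, by simp only [cost]; omega, h3⟩
  | _ => simp [RamProgram.straight] at hp

theorem straight_le (hp : p.straight = true) (ht : p.cost ≤ t) (h : Q (p.exec s)) : Halts p s t Q :=
  (straight hp h).mono ht fun _ h => h

theorem ite {x y : ℕ} (h1 : s.reg x < s.reg y → Halts p s t Q)
    (h2 : ¬ s.reg x < s.reg y → Halts q s t Q) : Halts (ite x y p q) s (t + 1) Q := by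
  by_cases h : s.reg x < s.reg y
  · obtain ⟨k, s', h3, h4, h5⟩ := h1 h
    exact ⟨_, s', RunsIn.ite_true h h3, by omega, h5⟩
  · obtain ⟨k, s', h3, h4, h5⟩ := h2 h
    exact ⟨_, s', RunsIn.ite_false h h3, by omega, h5⟩

/-- The measure bounds the number of rounds, each of which takes one test and at most `c` steps; the
final 1 is the failing test. The step receives `Frame p s s'`, so that unchanged data need not be
part of the invariant. -/
theorem while_loop {x y c : ℕ} {I : RamState → Prop} (μ : RamState → ℕ) (h0 : I s)
    (hstep : ∀ s', Frame p s s' → I s' → s'.reg x < s'.reg y →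
      Halts p s' c fun s'' => I s'' ∧ μ s'' < μ s') :
    Halts (RamProgram.while x y p) s ((c + 1) * μ s + 1) fun s' => I s' ∧ ¬ s'.reg x < s'.reg y := by
  have key : ∀ N s', μ s' ≤ N → Frame p s s' → I s' →
      Halts (RamProgram.while x y p) s' ((c + 1) * μ s' + 1)
        fun s' => I s' ∧ ¬ s'.reg x < s'.reg y := by
    intro N
    induction N with
    | zero =>
      intro s' hN hf hI
      refine ⟨1, s', RunsIn.while_false ?_, by omega, hI, ?_⟩ <;>
      · intro h
        obtain ⟨_, _, _, _, _, h'⟩ := hstep s' hf hI h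
        omega
    | succ N ih =>
      intro s' hN hf hI
      by_cases h : s'.reg x < s'.reg y
      · obtain ⟨k, s'', h1, h2, h3, h4⟩ := hstep s' hf hI h
        obtain ⟨k', s₃, h5, h6, h7⟩ := ih s'' (by omega) (hf.trans (frame_of_runsIn h1)) h3
        refine ⟨_, s₃, RunsIn.while_true h h1 h5, ?_, h7⟩
        have : (c + 1) * (μ s'' + 1) ≤ (c + 1) * μ s' := Nat.mul_le_mul_left _ h4
        rw [Nat.mul_add] at this
        omega
      · exact ⟨1, s', RunsIn.while_false h, by omega, hI, h⟩
  exact key _ s le_rfl (Frame.refl _ _) h0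

/-- `I j` refers to the state whose counter already holds `j`, hence the `setReg` after the body. A
round costs `c` and two more steps for the test and the increment. -/
theorem forUp {i N c : ℕ} {I : ℕ → RamState → Prop} (hi : i ∉ p.regs) (hN : N ∉ i :: p.regs)
    (h0 : I 0 (s.setReg i 0))
    (hstep : ∀ j, j < s.reg N → ∀ s', Frame (RamProgram.forUp i N p) s s' → s'.reg i = j → I j s' →
      Halts p s' c fun s'' => I (j + 1) (s''.setReg i (j + 1))) :
    Halts (RamProgram.forUp i N p) s ((c + 2) * s.reg N + 2) fun s' =>
      I (s.reg N) s' ∧ Frame (RamProgram.forUp i N p) s s' := by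
  simp only [List.mem_cons, not_or] at hN
  have hf0 : Frame (RamProgram.forUp i N p) s (s.setReg i 0) :=
    frame_of_runsIn (RunsIn.const s i 0) |>.mono (by simp [RamProgram.forUp, regs])
      (by simp [RamProgram.forUp, arrs])
  have hfp : ∀ s' s'', Frame (p ;; succ i) s' s'' → Frame (RamProgram.forUp i N p) s' s'' :=
    fun s' s'' h => h.mono (by simp [RamProgram.forUp, regs]) (by simp [RamProgram.forUp, arrs])
  have hNr : N ∉ (RamProgram.forUp i N p).regs := by simp [RamProgram.forUp, regs, hN]
  have hw := while_loop (p := p ;; succ i) (s := s.setReg i 0) (x := i) (y := N) (c := c + 1)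
    (I := fun s' => s'.reg i ≤ s.reg N ∧ I (s'.reg i) s') (fun s' => s.reg N - s'.reg i)
    (by simpa using h0) ?_
  · obtain ⟨k, s', h1, h2, h3, h4⟩ := hw
    have hf' := hf0.trans (hfp _ _ ((frame_of_runsIn h1).mono (by simp [regs]) (by simp [arrs])))
    have h5 : s'.reg i = s.reg N := by
      have := hf'.1 N hNr
      omega
    refine ⟨1 + k, s', RunsIn.seq (RunsIn.const s i 0) h1, ?_, h5 ▸ h3.2, hf'⟩
    simp only [RamState.reg_setReg, if_true, Nat.sub_zero] at h2
    have : (c + 1 + 1) * s.reg N = (c + 2) * s.reg N := rfl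
    omega
  · intro s' hf ⟨hle, hI⟩ hlt
    have hf' := hf0.trans (hfp _ _ hf)
    have hNs := hf'.1 N hNr
    obtain ⟨k, s'', h1, h2, h3⟩ := hstep (s'.reg i) (by omega) s' hf' rfl hI
    have hi' := (frame_of_runsIn h1).1 i hi
    refine ⟨k + 1, s''.setReg i (s''.reg i + 1), RunsIn.seq h1 (RunsIn.succ _ _), by omega, ?_, ?_⟩
    · rw [hi']
      simp only [RamState.reg_setReg, if_true]
      exact ⟨by omega, h3⟩
    · simp only [RamState.reg_setReg, if_true]
      omega

/-- The counter is decremented before the body, so the body is given the invariant of the state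
before the decrement. If `N` starts below `L`, no round takes place; therefore the final `j` equals
`L` only under the condition `L ≤ N`. -/
theorem forDown {i N L c : ℕ} {I : ℕ → RamState → Prop} (hi : i ∉ p.regs) (hL : L ∉ i :: p.regs)
    (h0 : I (s.reg N) (s.setReg i (s.reg N)))
    (hstep : ∀ j, s.reg L ≤ j → j < s.reg N → ∀ s', Frame (RamProgram.forDown i N L p) s s' →
      s'.reg i = j → I (j + 1) (s'.setReg i (j + 1)) → Halts p s' c fun s'' => I j s'') :
    Halts (RamProgram.forDown i N L p) s ((c + 2) * s.reg N + 2) fun s' =>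
      (∃ j, I j s' ∧ j ≤ s.reg L ∧ (s.reg L ≤ s.reg N → j = s.reg L)) ∧
        Frame (RamProgram.forDown i N L p) s s' := by
  simp only [List.mem_cons, not_or] at hL
  have hf0 : Frame (RamProgram.forDown i N L p) s (s.setReg i (s.reg N)) :=
    frame_of_runsIn (RunsIn.copy s i N) |>.mono (by simp [RamProgram.forDown, regs])
      (by simp [RamProgram.forDown, arrs])
  have hfp : ∀ s' s'', Frame (pred i ;; p) s' s'' → Frame (RamProgram.forDown i N L p) s' s'' :=
    fun s' s'' h => h.mono (by simp [RamProgram.forDown, regs]) (by simp [RamProgram.forDown, arrs])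
  have hLr : L ∉ (RamProgram.forDown i N L p).regs := by simp [RamProgram.forDown, regs, hL]
  have hw := while_loop (p := pred i ;; p) (s := s.setReg i (s.reg N)) (x := L) (y := i) (c := 1 + c)
    (I := fun s' => s'.reg i ≤ s.reg N ∧ I (s'.reg i) s' ∧
      (s.reg L ≤ s.reg N → s.reg L ≤ s'.reg i)) (fun s' => s'.reg i)
    (by simpa using h0) ?_
  · obtain ⟨k, s', h1, h2, h3, h4⟩ := hw
    have hf' := hf0.trans (hfp _ _ ((frame_of_runsIn h1).mono (by simp [regs]) (by simp [arrs])))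
    have h5 := hf'.1 L hLr
    refine ⟨1 + k, s', RunsIn.seq (RunsIn.copy s i N) h1, ?_, ⟨_, h3.2.1, by omega, fun h => ?_⟩, hf'⟩
    · simp only [RamState.reg_setReg, if_true] at h2
      have : (1 + c + 1) * s.reg N = (c + 2) * s.reg N := by ring
      omega
    · have := h3.2.2 h
      omega
  · intro s' hf ⟨hle, hI, hge⟩ hlt
    have hf' := hf0.trans (hfp _ _ hf)
    have hLs := hf'.1 L hLr
    have hpr : Frame (RamProgram.forDown i N L p) s' (s'.setReg i (s'.reg i - 1)) :=
      (frame_of_runsIn (RunsIn.pred s' i)).mono (by simp [RamProgram.forDown, regs])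
        (by simp [RamProgram.forDown, arrs])
    obtain ⟨k, s'', h1, h2, h3⟩ := hstep (s'.reg i - 1) (by omega) (by omega)
      (s'.setReg i (s'.reg i - 1)) (hf'.trans hpr) (by simp) (by
        have h6 : s'.reg i - 1 + 1 = s'.reg i := by omega
        have h7 : (s'.setReg i (s'.reg i - 1)).setReg i (s'.reg i) = s' := by
          simp [RamState.setReg]
        rw [h6, h7]
        exact hI)
    have hi' := (frame_of_runsIn h1).1 i hi
    simp only [RamState.reg_setReg, if_true] at hi'
    refine ⟨1 + k, s'', RunsIn.seq (RunsIn.pred _ _) h1, by omega, ⟨by omega, ?_, fun _ => by omega⟩,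
      by omega⟩
    rw [hi']
    exact h3

end Halts

end RamProgram

/-! ### The program: preparations -/

open RamProgram

namespace PlaneGraph

variable {n m : ℕ} {M : PlaneGraph (Fin n)}

/-- The input and the constants. -/
structure Given (dart : M.G.Dart ≃ Fin m) (s : RamState) : Prop where
  reg_m : s.reg 1 = m
  reg_outer : s.reg 2 = dart M.outer
  zero : s.reg 6 = 0
  one : s.reg 7 = 1
  two : s.reg 8 = 2
  num : ∀ v : Fin n, s.arr 0 v = M.num v
  tail : ∀ d, s.arr 1 (dart d) = d.fst
  symm : ∀ d, s.arr 2 (dart d) = dart d.symm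
  rot : ∀ d, s.arr 3 (dart d) = dart (M.rot d)

theorem Given.frame {dart : M.G.Dart ≃ Fin m} {s s' : RamState} (h : Given dart s) {p : RamProgram}
    (hf : Frame p s s') (hr : ∀ x ∈ [1, 2, 6, 7, 8], x ∉ p.regs)
    (ha : ∀ a ∈ [0, 1, 2, 3], a ∉ p.arrs) : Given dart s' := by
  simp only [List.mem_cons, List.not_mem_nil, or_false, forall_eq_or_imp, forall_eq] at hr ha
  obtain ⟨r1, r2, r6, r7, r8⟩ := hr
  obtain ⟨a0, a1, a2, a3⟩ := ha
  constructor
  · rw [hf.1 _ r1, h.reg_m]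
  · rw [hf.1 _ r2, h.reg_outer]
  · rw [hf.1 _ r6, h.zero]
  · rw [hf.1 _ r7, h.one]
  · rw [hf.1 _ r8, h.two]
  · rw [hf.2 _ a0]; exact h.num
  · rw [hf.2 _ a1]; exact h.tail
  · rw [hf.2 _ a2]; exact h.symm
  · rw [hf.2 _ a3]; exact h.rot

theorem exists_dart_code (dart : M.G.Dart ≃ Fin m) {j : ℕ} (h : j < m) : ∃ d, (dart d : ℕ) = j :=
  ⟨dart.symm ⟨j, h⟩, by simp⟩

theorem code_inj (dart : M.G.Dart ≃ Fin m) {d d' : M.G.Dart} :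
    (dart d : ℕ) = dart d' ↔ d = d' := by
  rw [Fin.val_inj, dart.injective.eq_iff]

theorem code_lt (dart : M.G.Dart ≃ Fin m) (d : M.G.Dart) : (dart d : ℕ) < m := (dart d).2

/-- The heads of the darts (array 13) and the successors along the faces (array 14). -/
def progFace : RamProgram :=
  forUp 9 1 (load 10 2 9 ;; load 11 1 10 ;; store 13 9 11 ;; load 11 3 10 ;; store 14 9 11)

structure HasFace (dart : M.G.Dart ≃ Fin m) (s : RamState) : Prop where
  head : ∀ d, s.arr 13 (dart d) = d.snd
  face : ∀ d, s.arr 14 (dart d) = dart (M.face d)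

theorem halts_progFace {dart : M.G.Dart ≃ Fin m} {s : RamState} (h : Given dart s) :
    Halts progFace s (7 * m + 2) (HasFace dart) := by
  refine (Halts.forUp (c := 5) (I := fun j s => ∀ d, (dart d : ℕ) < j →
    s.arr 13 (dart d) = d.snd ∧ s.arr 14 (dart d) = dart (M.face d)) (by decide) (by decide)
    (by simp) ?_).mono (by rw [h.reg_m]) fun s' hs => ?_
  · intro j hj s' hf hi hI
    rw [h.reg_m] at hj
    obtain ⟨d, rfl⟩ := exists_dart_code dart hj
    have h' := h.frame hf (by decide) (by decide)
    refine Halts.straight rfl ?_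
    intro d' hd'
    simp only [exec]
    simp [hi, h'.symm, h'.tail, h'.rot, code_inj]
    by_cases hdd : d' = d
    · subst hdd
      simp [face_apply]
    · have := hI d' (by have := mt (code_inj dart (d := d') (d' := d)).1 hdd; omega)
      simpa [hdd] using this
  · rw [h.reg_m] at hs
    exact ⟨fun d => (hs.1 d (code_lt dart d)).1, fun d => (hs.1 d (code_lt dart d)).2⟩

/-- The darts of the outer face (array 10) and the heights of the coast (array 9); in the following,
all heights are doubled. -/
def progCoast : RamProgram :=
  copy 10 2 ;; const 11 2 ;;
    forUp 9 1 (store 10 10 7 ;; load 12 1 10 ;; store 9 12 11 ;; load 10 14 10)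

theorem exists_pow_lt_iff (dart : M.G.Dart ≃ Fin m) (d : M.G.Dart) :
    (∃ i < m, (M.face ^ i) M.outer = d) ↔ M.OuterDart d := by
  classical
  constructor
  · rintro ⟨i, -, rfl⟩
    exact ⟨i, by simp⟩
  · intro h
    obtain ⟨i, hi⟩ := Equiv.Perm.SameCycle.exists_nat_pow_eq h
    have : ∃ i, (M.face ^ i) M.outer = d := ⟨i, hi⟩
    refine ⟨Nat.find this, ?_, Nat.find_spec this⟩
    -- If the first occurrence of `d` came after `m` or more steps, two of the darts at the steps
    -- `0, …, m` would coincide, and cutting out the cycle between them would give an earlier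
    -- occurrence.
    by_contra hm
    obtain ⟨a, b, hab, he⟩ := Fintype.exists_ne_map_eq_of_card_lt
      (fun a : Fin (m + 1) => dart ((M.face ^ (a : ℕ)) M.outer)) (by simp)
    wlog hlt : a < b generalizing a b
    · exact this b a hab.symm he.symm (lt_of_le_of_ne (not_lt.1 hlt) hab.symm)
    have he' := dart.injective he
    refine Nat.find_min this (m := Nat.find this - b + a) (by have := b.2; omega) ?_
    rw [pow_add, Equiv.Perm.mul_apply, he', ← Equiv.Perm.mul_apply, ← pow_add,
      Nat.sub_add_cancel (by have := b.2; omega)]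
    exact Nat.find_spec this

open Classical in
structure HasCoast (dart : M.G.Dart ≃ Fin m) (s : RamState) : Prop where
  out : ∀ d, s.arr 10 (dart d) = if M.OuterDart d then 1 else 0
  coast : ∀ v : Fin n, s.arr 9 v = if ∃ d : M.G.Dart, d.fst = v ∧ M.OuterDart d then 2 else 0

theorem halts_progCoast {dart : M.G.Dart ≃ Fin m} {s : RamState} (h : Given dart s)
    (h1 : HasFace dart s) (h9 : ∀ i, s.arr 9 i = 0) (h10 : ∀ i, s.arr 10 i = 0) :
    Halts progCoast s (6 * m + 4) (HasCoast dart) := by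
  classical
  refine (Halts.seq (Halts.straight rfl (Halts.seq (Halts.straight rfl (Halts.forUp (c := 4)
    (I := fun j s => s.reg 10 = dart ((M.face ^ j) M.outer) ∧ s.reg 11 = 2 ∧
    (∀ d, s.arr 10 (dart d) = if ∃ i < j, (M.face ^ i) M.outer = d then 1 else 0) ∧
    ∀ v : Fin n, s.arr 9 v = if ∃ i < j, ((M.face ^ i) M.outer).fst = v then 2 else 0)
    (by decide) (by decide) ?_ ?_))))).mono (t' := 6 * m + 4) ?_ fun s' hs => ?_
  · simp [exec, h9, h10, h.reg_outer]
  · intro j hj s' hf hi hI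
    obtain ⟨hI1, hI2, hI3, hI4⟩ := hI
    have hf' : Frame progCoast s s' := ((frame_of_runsIn (RunsIn.copy s 10 2)).mono
      (by decide) (by decide)).trans (((frame_of_runsIn (RunsIn.const _ 11 2)).mono
      (by decide) (by decide)).trans (hf.mono (by decide) (by decide)))
    have h' := h.frame hf' (by decide) (by decide)
    have hface : ∀ d, s'.arr 14 (dart d) = dart (M.face d) := by
      rw [hf'.2 14 (by decide)]; exact h1.face
    refine Halts.straight rfl ?_
    simp only [exec]
    simp [hI1, hI2, h'.one, h'.tail, hface, code_inj, pow_succ', hI3, hI4]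
    constructor
    · intro d
      by_cases hd : d = (M.face ^ j) M.outer
      · rw [if_pos hd, if_pos ⟨j, by omega, hd.symm⟩]
      · rw [if_neg hd]
        congr 1
        apply propext
        constructor
        · rintro ⟨i, hi, h⟩; exact ⟨i, by omega, h⟩
        · rintro ⟨i, hi, h⟩
          refine ⟨i, ?_, h⟩
          rcases hi.eq_or_lt with rfl | h'
          · exact absurd h.symm hd
          · exact h'
    · intro v
      by_cases hv : v = ((M.face ^ j) M.outer).fst
      · rw [if_pos (by rw [hv]), if_pos ⟨j, by omega, hv.symm⟩]
      · rw [if_neg (by rw [Fin.val_inj]; exact hv)]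
        congr 1
        apply propext
        constructor
        · rintro ⟨i, hi, h⟩; exact ⟨i, by omega, h⟩
        · rintro ⟨i, hi, h⟩
          refine ⟨i, ?_, h⟩
          rcases hi.eq_or_lt with rfl | h'
          · exact absurd h.symm hv
          · exact h'
  · simp [exec, cost, h.reg_m]; omega
  · have e : ((exec (const 11 2) (exec (copy 10 2) s))).reg 1 = m := by simp [exec, h.reg_m]
    rw [e] at hs
    obtain ⟨⟨-, -, h3, h4⟩, -⟩ := hs
    refine ⟨fun d => ?_, fun v => ?_⟩
    · rw [h3]
      simp only [exists_pow_lt_iff dart]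
    · rw [h4]
      congr 1
      apply propext
      constructor
      · rintro ⟨i, hi, h⟩; exact ⟨_, h, (exists_pow_lt_iff dart _).1 ⟨i, hi, rfl⟩⟩
      · rintro ⟨d, rfl, hd⟩
        obtain ⟨i, hi, rfl⟩ := (exists_pow_lt_iff dart d).2 hd
        exact ⟨i, hi, rfl⟩

end PlaneGraph

/-! ### The program: heights -/

open RamProgram

namespace PlaneGraph

variable {n m l : ℕ} {M : PlaneGraph (Fin n)}

/-- If the vertices `u` and `v` of the dart in register 9 satisfy `H[u] = k` and `H[v] = 0`, set
`H[v] := k + 2`. -/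
def progHeightStep : RamProgram :=
  load 10 1 9 ;; load 11 9 10 ;; load 12 13 9 ;; load 13 9 12 ;;
    ifEq 11 20 (ite 13 7 (copy 14 20 ;; succ 14 ;; succ 14 ;; store 9 12 14 ;; const 26 1) (nop 14))
      (nop 14)

/-- Doubled heights (array 9), and twice the first height that does not occur (register 20). -/
def progHeights : RamProgram :=
  const 20 2 ;; const 26 1 ;;
    RamProgram.while 6 26 (const 26 0 ;; forUp 9 1 progHeightStep ;; succ 20 ;; succ 20)

structure HasHeights (M : PlaneGraph (Fin n)) (l : ℕ) (s : RamState) : Prop where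
  height : ∀ v : Fin n, s.arr 9 v = 2 * M.height v
  lt_top : ∀ v : Fin n, 2 * M.height v + 1 < s.reg 20
  top_le : s.reg 20 ≤ 2 * (l + 1)

section
variable (hM : M.IsNice l)
include hM

theorem IsNice.exists_height {v : Fin n} {i : ℕ} (h1 : 1 ≤ i) (hi : i ≤ M.height v) :
    ∃ u, M.height u = i := by
  obtain ⟨k, hk⟩ := Nat.exists_eq_add_of_le hi
  induction k generalizing v with
  | zero => exact ⟨v, hk⟩
  | succ k ih =>
    obtain ⟨u, -, hu⟩ := exists_adj_height hM.outer hM.tri (v := v) (by omega)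
    exact ih (v := u) (by omega) (by omega)

/-- The vertices of height `i + 1` are the neighbours of those of height `i` that have no label yet.
The new label is `2 i + 2`, so labels given during the sweep do not satisfy the test for `2 i`.
Register 26 reports whether a new vertex was found. -/
theorem halts_progHeightLoop {dart : M.G.Dart ≃ Fin m} {s : RamState} {i : ℕ} (h : Given dart s)
    (h1 : HasFace dart s) (h20 : s.reg 20 = 2 * i) (h26 : s.reg 26 = 0) (hi1 : 1 ≤ i)
    (hH : ∀ v : Fin n, s.arr 9 v = if M.height v ≤ i then 2 * M.height v else 0) :
    Halts (forUp 9 1 progHeightStep) s (15 * m + 2) fun s' => s'.reg 20 = 2 * i ∧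
      (∀ v : Fin n, s'.arr 9 v = if M.height v ≤ i + 1 then 2 * M.height v else 0) ∧
      (s'.reg 26 = 0 ↔ ∀ v, M.height v ≠ i + 1) ∧ (s'.reg 26 = 0 ∨ s'.reg 26 = 1) := by
  classical
  refine (Halts.forUp (c := 12) (I := fun j s => s.reg 20 = 2 * i ∧
    (∀ v : Fin n, s.arr 9 v = if M.height v ≤ i ∨ (M.height v = i + 1 ∧ ∃ d : M.G.Dart,
      (dart d : ℕ) < j ∧ d.snd = v ∧ M.height d.fst = i) then 2 * M.height v else 0) ∧
    (s.reg 26 = 0 ↔ ¬ ∃ d : M.G.Dart, (dart d : ℕ) < j ∧ M.height d.snd = i + 1 ∧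
      M.height d.fst = i) ∧ (s.reg 26 = 0 ∨ s.reg 26 = 1)) (by decide) (by decide)
    ?_ ?_).mono (by rw [h.reg_m]; omega) fun s' hs => ?_
  · simp [h20, hH, h26]
  · rintro j hj s' hf hi ⟨hI1, hI2, hI3, hI4⟩
    rw [h.reg_m] at hj
    obtain ⟨d, rfl⟩ := exists_dart_code dart hj
    have h' := h.frame hf (by decide) (by decide)
    have hhead : ∀ d, s'.arr 13 (dart d) = d.snd := by rw [hf.2 13 (by decide)]; exact h1.head
    have hle := height_le_of_adj hM.outer hM.tri d.adj
    have p1 := one_le_height hM.outer d.fst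
    have p2 := one_le_height hM.outer d.snd
    have hu : s'.arr 9 d.fst = 2 * i ↔ M.height d.fst = i := by
      rw [hI2]
      split_ifs with hc
      · omega
      · have : M.height d.fst ≠ i := fun e => hc (Or.inl e.le)
        simp only [this, iff_false]; omega
    have hlt : ∀ d' : M.G.Dart, (dart d' : ℕ) < dart d + 1 ↔ (dart d' : ℕ) < dart d ∨ d' = d := by
      intro d'
      rw [← code_inj dart, Nat.lt_succ_iff_lt_or_eq]
    have keep : ¬ (M.height d.snd = i + 1 ∧ M.height d.fst = i) →
        (s'.reg 20 = 2 * i ∧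
        (∀ v : Fin n, s'.arr 9 v = if M.height v ≤ i ∨ (M.height v = i + 1 ∧ ∃ d' : M.G.Dart,
          (dart d' : ℕ) < dart d + 1 ∧ d'.snd = v ∧ M.height d'.fst = i) then 2 * M.height v
            else 0) ∧
        (s'.reg 26 = 0 ↔ ¬ ∃ d' : M.G.Dart, (dart d' : ℕ) < dart d + 1 ∧ M.height d'.snd = i + 1 ∧
          M.height d'.fst = i) ∧ (s'.reg 26 = 0 ∨ s'.reg 26 = 1)) := by
      intro hn
      refine ⟨hI1, fun v => ?_, ?_, hI4⟩
      · rw [hI2]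
        congr 1
        apply propext
        refine or_congr_right (and_congr_right fun hv => exists_congr fun d' => ?_)
        rw [hlt]
        constructor
        · rintro ⟨a, b⟩; exact ⟨Or.inl a, b⟩
        · rintro ⟨a | rfl, b⟩
          · exact ⟨a, b⟩
          · exact absurd ⟨b.1 ▸ hv, b.2⟩ hn
      · rw [hI3]
        refine not_congr (exists_congr fun d' => ?_)
        rw [hlt]
        constructor
        · rintro ⟨a, b⟩; exact ⟨Or.inl a, b⟩
        · rintro ⟨a | rfl, b⟩
          · exact ⟨a, b⟩
          · exact absurd b hn
    refine Halts.straight rfl ?_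
    by_cases hfi : M.height d.fst = i
    · have hr11 : s'.arr 9 d.fst = 2 * i := hu.2 hfi
      by_cases hv0 : s'.arr 9 d.snd = 0
      · have hsi : M.height d.snd = i + 1 := by
          rw [hI2] at hv0
          by_contra hne
          rw [if_pos (Or.inl (by omega))] at hv0
          omega
        simp [progHeightStep, exec, ifEq, nop, hi, h'.tail, hhead, hI1, h'.one, hr11, hv0]
        refine ⟨fun v => ?_, ⟨d, by omega, hsi, hfi⟩⟩
        by_cases hvd : v = d.snd
        · subst hvd
          rw [if_pos rfl, if_pos (Or.inr ⟨hsi, d, by omega, rfl, hfi⟩)]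
          omega
        · rw [if_neg (by rw [Fin.val_inj]; exact hvd), hI2]
          congr 1
          apply propext
          refine or_congr_right (and_congr_right fun hv => exists_congr fun d' => ?_)
          constructor
          · rintro ⟨a, b⟩; exact ⟨by omega, b⟩
          · rintro ⟨a, b⟩
            rcases (hlt d').1 (by omega) with h | rfl
            · exact ⟨h, b⟩
            · exact absurd b.1.symm hvd
      · have hk : ¬ s'.arr 9 d.snd < 1 := by omega
        by_cases hsi : M.height d.snd = i + 1
        · have hex : ∃ d' : M.G.Dart, (dart d' : ℕ) < dart d ∧ d'.snd = d.snd ∧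
              M.height d'.fst = i := by
            by_contra hne
            rw [hI2, if_neg (by rintro (a | a); · omega
                                exact hne a.2)] at hv0
            exact hv0 rfl
          simp [progHeightStep, exec, ifEq, nop, hi, h'.tail, hhead, hI1, h'.one, hr11, hv0]
          obtain ⟨d₀, h3, h4, h5⟩ := hex
          refine ⟨fun v => ?_, ?_, hI4⟩
          · rw [hI2]
            congr 1
            apply propext
            refine or_congr_right (and_congr_right fun hv => ?_)
            constructor
            · rintro ⟨d', a, b⟩; exact ⟨d', by omega, b⟩
            · rintro ⟨d', a, b⟩
              rcases (hlt d').1 (by omega) with h | rfl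
              · exact ⟨d', h, b⟩
              · exact ⟨d₀, h3, h4.trans b.1, h5⟩
          · rw [hI3]
            push Not
            constructor
            · intro hh
              exact absurd h5 (hh d₀ h3 (by rw [h4, hsi]))
            · intro hh d' hd'
              exact hh d' (by omega)
        · have := keep fun h => hsi h.1
          simpa [progHeightStep, exec, ifEq, nop, hi, h'.tail, hhead, hI1, h'.one, hr11, hv0] using
            this
    · have hr11 : ¬ s'.arr 9 d.fst = 2 * i := fun e => hfi (hu.1 e)
      have := keep fun h => hfi h.2
      rcases lt_or_gt_of_ne hr11 with e | e
      · simpa [progHeightStep, exec, ifEq, nop, hi, h'.tail, hI1, e] using this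
      · simpa [progHeightStep, exec, ifEq, nop, hi, h'.tail, hI1, e, e.le] using this
  · rw [h.reg_m] at hs
    obtain ⟨⟨g1, g2, g3, g4⟩, -⟩ := hs
    have hnb : ∀ v, M.height v = i + 1 → ∃ d : M.G.Dart, d.snd = v ∧ M.height d.fst = i := by
      intro v hv
      obtain ⟨u, hu, hu'⟩ := exists_adj_height hM.outer hM.tri (v := v) (by omega)
      exact ⟨⟨(u, v), hu.symm⟩, rfl, show M.height u = i by omega⟩
    refine ⟨g1, fun v => ?_, ?_, g4⟩
    · rw [g2]
      congr 1
      apply propext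
      constructor
      · rintro (h | h) <;> omega
      · intro h
        rcases Nat.lt_or_ge i (M.height v) with h' | h'
        · obtain ⟨d, hd⟩ := hnb v (by omega)
          exact Or.inr ⟨by omega, d, code_lt dart d, hd⟩
        · exact Or.inl h'
    · rw [g3]
      constructor
      · intro hn v hv
        obtain ⟨d, hd, hd'⟩ := hnb v hv
        exact hn ⟨d, code_lt dart d, hd ▸ hv, hd'⟩
      · rintro hn ⟨d, -, hd, -⟩
        exact hn _ hd

/-- Heights have no gaps (`IsNice.exists_height`), so the first sweep without a new vertex ends the
search. There are at most `l` sweeps although `l` is unknown to the program. -/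
theorem halts_progHeights {dart : M.G.Dart ≃ Fin m} {s : RamState} (h : Given dart s)
    (h1 : HasFace dart s) (h2 : HasCoast dart s) :
    Halts progHeights s ((15 * m + 6) * (l + 1) + 3) (HasHeights M l) := by
  classical
  refine (Halts.seq (Halts.straight rfl (Halts.seq (Halts.straight rfl (Halts.while_loop
    (c := 15 * m + 5) (I := fun s => s.reg 6 = 0 ∧ ∃ i, 1 ≤ i ∧ i ≤ l + 1 ∧ s.reg 20 = 2 * i ∧
      (∀ v : Fin n, s.arr 9 v = if M.height v ≤ i then 2 * M.height v else 0) ∧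
      (s.reg 26 = 0 → ∀ v, M.height v < i) ∧ (s.reg 26 = 0 ∨ s.reg 26 = 1) ∧
      (s.reg 26 ≠ 0 → i ≤ l)) (fun s => l + 1 - s.reg 20 / 2) ?_ ?_))))).mono
      (t' := (15 * m + 6) * (l + 1) + 3) ?_ fun s' hs => ?_
  · obtain ⟨v⟩ : Nonempty (Fin n) := ⟨M.outer.fst⟩
    have := height_le hM.outer v
    have := one_le_height hM.outer v
    refine ⟨by simp [exec, h.zero], 1, le_rfl, by omega, by simp [exec], fun v => ?_, by simp [exec], by simp [exec],
      fun _ => by omega⟩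
    have h3 := one_le_height hM.outer v
    simp only [exec, RamState.arr_setReg, h2.coast, ← height_eq_one_iff hM.outer]
    split_ifs <;> omega
  · rintro s' hf ⟨-, i, hi1, hi2, h20, hH, h0, h01, hil⟩ hlt
    have hf' : Frame progHeights s s' := ((frame_of_runsIn (RunsIn.const s 20 2)).mono
      (by decide) (by decide)).trans (((frame_of_runsIn (RunsIn.const _ 26 1)).mono
      (by decide) (by decide)).trans (hf.mono (by decide) (by decide)))
    have h' := h.frame hf' (by decide) (by decide)
    have h1' : HasFace dart s' :=
      ⟨by rw [hf'.2 13 (by decide)]; exact h1.head, by rw [hf'.2 14 (by decide)]; exact h1.face⟩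
    have hil' := hil (by omega)
    have hset : Frame (const 26 0) s' (s'.setReg 26 0) := frame_of_runsIn (RunsIn.const _ 26 0)
    refine (Halts.seq (t := 1) (t' := 15 * m + 4) (Halts.straight rfl (Halts.seq (t := 15 * m + 2)
      (t' := 2) ((halts_progHeightLoop hM (i := i) (h'.frame hset (by decide) (by decide))
      ⟨h1'.head, h1'.face⟩ (by simp [h20]) (by simp) hi1 hH).frame.mono le_rfl
      fun s'' hs => Halts.straight rfl ?_)))).mono (by omega) fun _ h => h
    obtain ⟨⟨g1, g2, g3, g4⟩, hf2⟩ := hs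
    refine ⟨⟨by simp [exec, hf2.1 6 (by decide), h'.zero], i + 1, by omega, by omega, by simp [exec, g1]; omega, by simpa [exec] using g2,
      ?_, by simpa [exec] using g4, ?_⟩, ?_⟩
    · intro h0 v
      have h0' := g3.1 (by simpa [exec] using h0)
      by_contra hv
      obtain ⟨u, hu⟩ := hM.exists_height (v := v) (i := i + 1) (by omega) (by omega)
      exact h0' u hu
    · intro h0
      by_contra hl
      refine h0 ?_
      simp only [exec, RamState.reg_setReg]
      simp
      rw [g3]
      intro v hv
      have := height_le hM.outer v
      omega
    · simp [exec, g1, h20]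
      omega
  · have : (15 * m + 5 + 1) * l ≤ (15 * m + 6) * (l + 1) := Nat.mul_le_mul_left _ (by omega)
    simp [exec, cost]
    omega
  · obtain ⟨⟨h6, i, hi1, hi2, h20, hH, h0, h01, hil⟩, hlt⟩ := hs
    have hz : s'.reg 26 = 0 := by omega
    refine ⟨fun v => ?_, fun v => ?_, by omega⟩
    · rw [hH, if_pos (h0 hz v).le]
    · have := h0 hz v
      omega

end

end PlaneGraph

/-! ### The program: minima over the darts that lead downwards -/

open RamProgram

namespace PlaneGraph

variable {n m l : ℕ} {M : PlaneGraph (Fin n)}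

theorem IsNice.isLowDart_iff (hM : M.IsNice l) (d : M.G.Dart) :
    M.IsLowDart d ↔ M.height d.snd < M.height d.fst := by
  have := height_le_of_adj hM.outer hM.tri d.adj.symm
  rw [IsLowDart]
  omega

/-- `r[x] := d + 1` for the dart in register 9, where register 13 holds `x`. -/
def progRecord (r : ℕ) : RamProgram := copy 15 9 ;; succ 15 ;; store r 13 15

/-- For every `x`, the code, increased by one, of a dart `d` with `k[d] = x` that leads downwards
and has a head with the smallest number is stored in `r[x]`. -/
def progArgminStep (k r : ℕ) : RamProgram :=
  load 10 1 9 ;; load 10 9 10 ;; load 11 13 9 ;; load 12 9 11 ;;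
    ite 12 10 (load 13 k 9 ;; load 14 r 13 ;;
      ite 6 14 (pred 14 ;; load 15 13 14 ;; load 15 0 15 ;; load 16 0 11 ;;
        ite 16 15 (progRecord r) (nop 15)) (progRecord r)) (nop 10)

def progArgmin (k r : ℕ) : RamProgram := forUp 9 1 (progArgminStep k r)

/-- Codes are stored increased by one, so that 0 can mean that there is no candidate. The predicate
`p` restricts the comparison to the darts processed so far. -/
structure HasArgmin (dart : M.G.Dart ≃ Fin m) (K : M.G.Dart → ℕ) (p : M.G.Dart → Prop) (f : ℕ → ℕ) :
    Prop where
  eq_zero : ∀ x, f x = 0 → ∀ d, p d → M.IsLowDart d → K d ≠ x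
  eq_succ : ∀ x, f x ≠ 0 → ∃ d, M.IsLowDart d ∧ K d = x ∧ f x = dart d + 1 ∧
    ∀ d', p d' → M.IsLowDart d' → K d' = x → M.num d.snd ≤ M.num d'.snd

theorem code_lt_succ (dart : M.G.Dart ≃ Fin m) {d d' : M.G.Dart} :
    (dart d' : ℕ) < dart d + 1 ↔ (dart d' : ℕ) < dart d ∨ d' = d := by
  rw [← code_inj dart, Nat.lt_succ_iff_lt_or_eq]

theorem HasArgmin.skip {dart : M.G.Dart ≃ Fin m} {K : M.G.Dart → ℕ} {d : M.G.Dart} {f : ℕ → ℕ}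
    (h : HasArgmin dart K (fun d' => (dart d' : ℕ) < dart d) f)
    (hd : M.IsLowDart d → ∃ d', M.IsLowDart d' ∧ f (K d) = dart d' + 1 ∧ K d' = K d ∧
      M.num d'.snd ≤ M.num d.snd) :
    HasArgmin dart K (fun d' => (dart d' : ℕ) < dart d + 1) f := by
  constructor
  · intro x hx d' hd' hl hK
    rcases (code_lt_succ dart).1 hd' with h' | rfl
    · exact h.1 x hx d' h' hl hK
    · obtain ⟨d₁, -, h1, -⟩ := hd hl
      rw [hK] at h1
      omega
  · intro x hx
    obtain ⟨d₁, h1, h2, h3, h4⟩ := h.2 x hx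
    refine ⟨d₁, h1, h2, h3, fun d' hd' hl hK => ?_⟩
    rcases (code_lt_succ dart).1 hd' with h' | rfl
    · exact h4 d' h' hl hK
    · obtain ⟨d₂, -, h5, -, h6⟩ := hd hl
      rw [hK, h3, Nat.add_right_cancel_iff, code_inj] at h5
      exact h5 ▸ h6

theorem HasArgmin.record {dart : M.G.Dart ≃ Fin m} {K : M.G.Dart → ℕ} {d : M.G.Dart} {f : ℕ → ℕ}
    (h : HasArgmin dart K (fun d' => (dart d' : ℕ) < dart d) f) (hl : M.IsLowDart d)
    (hd : f (K d) = 0 ∨ ∃ d', f (K d) = dart d' + 1 ∧ M.num d.snd ≤ M.num d'.snd) :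
    HasArgmin dart K (fun d' => (dart d' : ℕ) < dart d + 1)
      (fun x => if x = K d then dart d + 1 else f x) := by
  constructor
  · intro x hx d' hd' hl' hK
    split_ifs at hx with hxk
    rcases (code_lt_succ dart).1 hd' with h' | rfl
    · exact h.1 x hx d' h' hl' hK
    · exact hxk hK.symm
  · intro x hx
    by_cases hxk : x = K d
    · subst hxk
      refine ⟨d, hl, rfl, by simp, fun d' hd' hl' hK => ?_⟩
      rcases (code_lt_succ dart).1 hd' with h' | rfl
      · rcases hd with h0 | ⟨d₁, h1, h2⟩
        · exact absurd hK (h.1 _ h0 d' h' hl')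
        · obtain ⟨d₂, -, -, h5, h6⟩ := h.2 (K d) (by omega)
          rw [h1, Nat.add_right_cancel_iff, code_inj] at h5
          exact h2.trans (h5 ▸ h6 d' h' hl' hK)
      · exact le_rfl
    · simp only [if_neg hxk] at hx ⊢
      obtain ⟨d₁, h1, h2, h3, h4⟩ := h.2 x hx
      refine ⟨d₁, h1, h2, h3, fun d' hd' hl' hK => ?_⟩
      rcases (code_lt_succ dart).1 hd' with h' | rfl
      · exact h4 d' h' hl' hK
      · exact absurd hK.symm hxk

theorem halts_progArgmin (hM : M.IsNice l) {dart : M.G.Dart ≃ Fin m} {s : RamState}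
    {k r : ℕ} {K : M.G.Dart → ℕ} (h : Given dart s) (h13 : ∀ d, s.arr 13 (dart d) = d.snd)
    (hH : ∀ v : Fin n, s.arr 9 v = 2 * M.height v) (hK : ∀ d, s.arr k (dart d) = K d)
    (h0 : ∀ x, s.arr r x = 0) (hr : ∀ a ∈ [0, 1, 2, 3, 9, 13, k], a ≠ r) :
    Halts (progArgmin k r) s (18 * m + 2)
      fun s' => HasArgmin dart K (fun _ => True) (s'.arr r) := by
  have harr : ∀ a, a ≠ r → a ∉ (progArgmin k r).arrs := by
    intro a ha
    simpa [progArgmin, progArgminStep, progRecord, forUp, nop, arrs] using ha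
  have hne : ∀ a ∈ [0, 1, 2, 3], a ∉ (progArgmin k r).arrs := fun a ha =>
    harr a (hr a (by simp at ha ⊢; tauto))
  refine (Halts.forUp (c := 16)
    (I := fun j s => HasArgmin dart K (fun d => (dart d : ℕ) < j) (s.arr r))
    (by simp [progArgminStep, progRecord, nop, regs]) (by simp [progArgminStep, progRecord, nop, regs])
    ?_ ?_).mono (by rw [h.reg_m]) fun s' hs => ?_
  · exact ⟨fun x _ d hd => absurd hd (Nat.not_lt_zero _), fun x hx => absurd (h0 x) (by simpa using hx)⟩
  · intro j hj s' hf hi hI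
    rw [h.reg_m] at hj
    obtain ⟨d, rfl⟩ := exists_dart_code dart hj
    have h' := h.frame hf (by simp [progArgminStep, progRecord, forUp, nop, regs]) hne
    have hhead : ∀ d, s'.arr 13 (dart d) = d.snd := by
      rw [hf.2 13 (harr _ (hr _ (by simp)))]; exact h13
    have hH' : ∀ v : Fin n, s'.arr 9 v = 2 * M.height v := by
      rw [hf.2 9 (harr _ (hr _ (by simp)))]; exact hH
    have hK' : ∀ d, s'.arr k (dart d) = K d := by
      rw [hf.2 k (harr _ (hr _ (by simp)))]; exact hK
    have hrec : ∀ t : RamState, t.arr = s'.arr → t.reg 9 = dart d → t.reg 13 = K d →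
        M.IsLowDart d → (s'.arr r (K d) = 0 ∨
          ∃ d', s'.arr r (K d) = dart d' + 1 ∧ M.num d.snd ≤ M.num d'.snd) →
        HasArgmin dart K (fun d' => (dart d' : ℕ) < dart d + 1) ((exec (progRecord r) t).arr r) := by
      intro t ht1 ht2 ht3 hl hd
      have : (exec (progRecord r) t).arr r = fun x => if x = K d then (dart d : ℕ) + 1 else s'.arr r x := by
        funext x
        simp [progRecord, exec, ht1, ht2, ht3]
      rw [this]
      exact hI.record hl hd
    refine Halts.straight_le (by rfl)
      (by simp [progArgminStep, progRecord, nop, cost]) ?_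
    simp only [RamState.arr_setReg]
    by_cases hl : M.IsLowDart d
    · have hl' := (hM.isLowDart_iff d).1 hl
      by_cases hz : s'.arr r (K d) = 0
      · have hr' := hrec (exec (load 10 1 9 ;; load 10 9 10 ;; load 11 13 9 ;; load 12 9 11 ;;
          load 13 k 9 ;; load 14 r 13) s') (by simp [exec]) (by simp [exec, hi])
          (by simp [exec, hi, hK']) hl (Or.inl hz)
        simpa [progArgminStep, exec, hi, h'.tail, hhead, hH', hl', h'.zero, hK', hz] using hr'
      · obtain ⟨d₁, h1, h2, h3, h4⟩ := hI.2 _ hz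
        by_cases hlt : M.num d.snd < M.num d₁.snd
        · have hr' := hrec (exec (load 10 1 9 ;; load 10 9 10 ;; load 11 13 9 ;; load 12 9 11 ;;
            load 13 k 9 ;; load 14 r 13 ;; pred 14 ;; load 15 13 14 ;; load 15 0 15 ;;
            load 16 0 11) s') (by simp [exec]) (by simp [exec, hi])
            (by simp [exec, hi, hK']) hl (Or.inr ⟨d₁, h3, hlt.le⟩)
          simpa [progArgminStep, exec, hi, h'.tail, hhead, hH', hl', h'.zero, hK', h3, h'.num, hlt]
            using hr'
        · have hs := hI.skip fun _ => ⟨d₁, h1, h3, h2, not_lt.1 hlt⟩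
          simpa [progArgminStep, exec, hi, h'.tail, hhead, hH', hl', h'.zero, hK', h3, h'.num, hlt,
            nop] using hs
    · have hs := hI.skip fun h => absurd h hl
      have hl' := mt (hM.isLowDart_iff d).2 hl
      simpa [progArgminStep, exec, hi, h'.tail, hhead, hH', hl', nop] using hs
  · rw [h.reg_m] at hs
    exact ⟨fun x hx d _ => hs.1.1 x hx d (code_lt dart d), fun x hx => by
      obtain ⟨d, h1, h2, h3, h4⟩ := hs.1.2 x hx
      exact ⟨d, h1, h2, h3, fun d' _ => h4 d' (code_lt dart d')⟩⟩

end PlaneGraph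

/-! ### The program: breadth-first search -/

open RamProgram

namespace PlaneGraph

variable {n m l : ℕ} {M : PlaneGraph (Fin n)}

/-- If the dart `e` that the array `a` holds for the dart in register 10 is not labelled, it gets the
label in register 11 and is appended to the queue. -/
def progVisit (q par vis pos a : ℕ) : RamProgram :=
  load 12 a 10 ;; load 13 vis 12 ;;
    ite 6 13 (nop 14)
      (store vis 12 11 ;; store par 12 10 ;; store pos 12 21 ;; store q 21 12 ;; succ 21)

/-- Breadth-first search along the arrays `a₁` and `a₂`, where the queue, whose length is in
register 21, contains the seeds already. -/
def progSearch (q par vis pos a₁ a₂ : ℕ) : RamProgram :=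
  const 22 0 ;; RamProgram.while 22 21
    (load 10 q 22 ;; load 11 vis 10 ;; progVisit q par vis pos a₁ ;; progVisit q par vis pos a₂ ;;
      succ 22)

/-- The arrays of a breadth-first search with a queue of length `t`. -/
structure Search (dart : M.G.Dart ≃ Fin m) (f₁ f₂ : M.G.Dart → M.G.Dart) (seed : M.G.Dart → Prop)
    (q par vis pos : ℕ → ℕ) (t : ℕ) : Prop where
  queue : ∀ j < t, ∃ d, q j = dart d ∧ vis (dart d) ≠ 0 ∧ pos (dart d) = j
  visited : ∀ d, vis (dart d) ≠ 0 → pos (dart d) < t ∧ q (pos (dart d)) = dart d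
  parent : ∀ d, vis (dart d) ≠ 0 → ¬ seed d → ∃ p, vis (dart p) ≠ 0 ∧ vis (dart d) = vis (dart p) ∧
    pos (dart p) < pos (dart d) ∧ par (dart d) = dart p ∧ (d = f₁ p ∨ d = f₂ p)
  seed : ∀ d, seed d → vis (dart d) = dart d + 1

/-- The array `pos` recovers the position from the dart, so the queue holds no dart twice. -/
theorem Search.le {dart : M.G.Dart ≃ Fin m} {f₁ f₂ : M.G.Dart → M.G.Dart} {seed : M.G.Dart → Prop}
    {q par vis pos : ℕ → ℕ} {t : ℕ} (h : Search dart f₁ f₂ seed q par vis pos t) : t ≤ m := by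
  choose f hf using fun j : Fin t => h.queue j j.2
  have hinj : Function.Injective fun j => dart (f j) := by
    intro a b hab
    have hab' := dart.injective hab
    have h1 := (hf a).2.2
    rw [hab', (hf b).2.2] at h1
    exact Fin.ext h1.symm
  simpa using Fintype.card_le_of_injective _ hinj

/-- The new dart takes the last position, which keeps positions increasing from parent to child;
this later makes the position the index of a search tree. -/
theorem Search.push {dart : M.G.Dart ≃ Fin m} {f₁ f₂ : M.G.Dart → M.G.Dart} {seed : M.G.Dart → Prop}
    {q par vis pos q' par' vis' pos' : ℕ → ℕ} {t : ℕ} {p e : M.G.Dart}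
    (h : Search dart f₁ f₂ seed q par vis pos t) (hp : vis (dart p) ≠ 0) (he : vis (dart e) = 0)
    (hpe : e = f₁ p ∨ e = f₂ p) (hq : ∀ j, q' j = if j = t then (dart e : ℕ) else q j)
    (hpar : ∀ d, par' (dart d) = if d = e then (dart p : ℕ) else par (dart d))
    (hvis : ∀ d, vis' (dart d) = if d = e then vis (dart p) else vis (dart d))
    (hpos : ∀ d, pos' (dart d) = if d = e then t else pos (dart d)) :
    Search dart f₁ f₂ seed q' par' vis' pos' (t + 1) := by
  constructor
  · intro j hj
    by_cases hjt : j = t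
    · exact ⟨e, by simp [hq, hjt], by simpa [hvis] using hp, by simp [hpos, hjt]⟩
    · obtain ⟨d, h1, h2, h3⟩ := h.queue j (by omega)
      have hde : d ≠ e := fun h => h2 (h ▸ he)
      exact ⟨d, by simp [hq, hjt, h1], by simpa [hvis, hde] using h2, by simp [hpos, hde, h3]⟩
  · intro d hd
    by_cases hde : d = e
    · subst hde
      simp [hpos, hq]
    · rw [hvis, if_neg hde] at hd
      obtain ⟨h1, h2⟩ := h.visited d hd
      rw [hpos, if_neg hde, hq, if_neg h1.ne]
      exact ⟨by omega, h2⟩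
  · intro d hd hs
    have hpe' : p ≠ e := fun h => hp (h ▸ he)
    by_cases hde : d = e
    · subst hde
      refine ⟨p, by simpa [hvis, hpe'] using hp, by simp [hvis, hpe'], ?_, by simp [hpar], hpe⟩
      simpa [hpos, hpe'] using (h.visited p hp).1
    · rw [hvis, if_neg hde] at hd
      obtain ⟨p', h1, h2, h3, h4, h5⟩ := h.parent d hd hs
      have hpe'' : p' ≠ e := fun h => h1 (h ▸ he)
      exact ⟨p', by simpa [hvis, hpe''] using h1, by simp [hvis, hpe'', hde, h2],
        by simpa [hpos, hpe'', hde] using h3, by simp [hpar, hde, h4], h5⟩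
  · intro d hd
    have h1 := h.seed d hd
    have hde : d ≠ e := by rintro rfl; omega
    simp [hvis, hde, h1]

section
variable {q par vis pos : ℕ} (hnd : [q, par, vis, pos].Nodup)
include hnd

/-- Apart from the invariant, it is recorded that entries of visited darts stay unchanged and that
new darts go to the end of the queue. This allows two visits in a row for the same dart. -/
theorem halts_progVisit {dart : M.G.Dart ≃ Fin m} {s : RamState} {f₁ f₂ : M.G.Dart → M.G.Dart}
    {seed : M.G.Dart → Prop} {a : ℕ} {f : M.G.Dart → M.G.Dart} {d : M.G.Dart} (h6 : s.reg 6 = 0)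
    (hs : Search dart f₁ f₂ seed (s.arr q) (s.arr par) (s.arr vis) (s.arr pos) (s.reg 21))
    (h10 : s.reg 10 = dart d) (h11 : s.reg 11 = s.arr vis (dart d)) (hd : s.arr vis (dart d) ≠ 0)
    (hf : f d = f₁ d ∨ f d = f₂ d) (ha : s.arr a (dart d) = dart (f d)) :
    Halts (progVisit q par vis pos a) s 8 fun s' =>
      Search dart f₁ f₂ seed (s'.arr q) (s'.arr par) (s'.arr vis) (s'.arr pos) (s'.reg 21) ∧
      s'.arr vis (dart (f d)) ≠ 0 ∧ (∀ x, s.arr vis (dart x) ≠ 0 →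
        s'.arr vis (dart x) = s.arr vis (dart x) ∧ s'.arr pos (dart x) = s.arr pos (dart x)) ∧
      (∀ x, s.arr vis (dart x) = 0 → s'.arr vis (dart x) ≠ 0 → s.reg 21 ≤ s'.arr pos (dart x)) ∧
      s.reg 21 ≤ s'.reg 21 := by
  simp only [List.nodup_cons, List.mem_cons, List.not_mem_nil, or_false, not_or] at hnd
  obtain ⟨⟨n1, n2, n3⟩, ⟨n4, n5⟩, n6, -⟩ := hnd
  refine Halts.straight_le (by rfl) (by simp [progVisit, nop, cost]) ?_
  by_cases hz : s.arr vis (dart (f d)) = 0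
  · simp [progVisit, exec, h10, ha, hz, h6, h11, n1, n2, n3, n4, n5, n6, Ne.symm n1, Ne.symm n2,
      Ne.symm n3, Ne.symm n4, Ne.symm n5, Ne.symm n6]
    refine ⟨hs.push (e := f d) hd hz hf ?_ ?_ ?_ ?_, hd, ?_, ?_⟩
    · intro j
      simp [n1, n2, n3]
    · intro x
      simp [n1, n4, n5, Ne.symm n1, code_inj]
    · intro x
      simp [n2, n4, n6, Ne.symm n2, Ne.symm n4, Ne.symm n6, code_inj]
    · intro x
      simp [n3, n5, n6, Ne.symm n3, Ne.symm n5, Ne.symm n6, code_inj]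
    · intro x hx
      have : x ≠ f d := fun e => hx (e ▸ hz)
      simp [code_inj, this]
    · intro x hx hx'
      by_cases hxe : x = f d
      · simp [hxe]
      · simp [code_inj, hxe] at hx'
        exact absurd hx hx'
  · have hz' : 0 < s.arr vis (dart (f d)) := by omega
    simp [progVisit, exec, h10, ha, hz', h6, nop]
    exact ⟨hs, by omega, fun x h1 h2 => absurd h1 h2⟩

/-- The visited set is closed under `f₁` and `f₂` at all darts before the reading position, which
finally is the end of the queue. By `Search.le` there are at most `m` rounds. -/
theorem halts_progSearch {dart : M.G.Dart ≃ Fin m} {s : RamState} {f₁ f₂ : M.G.Dart → M.G.Dart}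
    {seed : M.G.Dart → Prop} {a₁ a₂ : ℕ} (h6 : s.reg 6 = 0)
    (hs : Search dart f₁ f₂ seed (s.arr q) (s.arr par) (s.arr vis) (s.arr pos) (s.reg 21))
    (ha₁ : ∀ d, s.arr a₁ (dart d) = dart (f₁ d)) (ha₂ : ∀ d, s.arr a₂ (dart d) = dart (f₂ d))
    (hn₁ : a₁ ∉ [q, par, vis, pos]) (hn₂ : a₂ ∉ [q, par, vis, pos]) :
    Halts (progSearch q par vis pos a₁ a₂) s (20 * m + 2) fun s' =>
      Search dart f₁ f₂ seed (s'.arr q) (s'.arr par) (s'.arr vis) (s'.arr pos) (s'.reg 21) ∧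
      ∀ d, s'.arr vis (dart d) ≠ 0 →
        s'.arr vis (dart (f₁ d)) ≠ 0 ∧ s'.arr vis (dart (f₂ d)) ≠ 0 := by
  have harrs : ∀ a, a ∉ [q, par, vis, pos] → ∀ b, a ∉ (progVisit q par vis pos b).arrs := by
    intro a ha b
    simp [progVisit, arrs, nop] at ha ⊢
    tauto
  refine (Halts.seq (t := 1) (t' := 20 * m + 1) (Halts.straight rfl ((Halts.while_loop (c := 19)
    (I := fun s => s.reg 6 = 0 ∧
      (∀ d, s.arr a₁ (dart d) = dart (f₁ d)) ∧ (∀ d, s.arr a₂ (dart d) = dart (f₂ d)) ∧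
      Search dart f₁ f₂ seed (s.arr q) (s.arr par) (s.arr vis) (s.arr pos) (s.reg 21) ∧
      s.reg 22 ≤ s.reg 21 ∧ ∀ d, s.arr vis (dart d) ≠ 0 → s.arr pos (dart d) < s.reg 22 →
        s.arr vis (dart (f₁ d)) ≠ 0 ∧ s.arr vis (dart (f₂ d)) ≠ 0) (fun s => m - s.reg 22)
    ?_ ?_).mono ?_ fun s' hs => ?_))).mono (by omega) fun _ h => h
  · simpa [exec, h6, ha₁, ha₂] using hs
  · rintro s₀ - ⟨h6, ha₁, ha₂, hs, hle, hcl⟩ hlt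
    obtain ⟨d, hq, hv, hpos⟩ := hs.queue _ hlt
    refine (Halts.seq (t := 1) (t' := 18) (Halts.straight rfl (Halts.seq (t := 1) (t' := 17)
      (Halts.straight rfl (Halts.seq (t := 8) (t' := 9) ((halts_progVisit (d := d) (f := f₁)
      (f₁ := f₁) (f₂ := f₂) (seed := seed) (dart := dart) hnd ?_ ?_ ?_ ?_ ?_ (Or.inl rfl) ?_).frame.mono
      le_rfl fun s₁ h₁ => ?_)))))).mono (by omega) fun _ h => h
    · simpa [exec] using h6
    · simpa [exec] using hs
    · simp [exec, hq]
    · simp [exec, hq]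
    · simpa [exec] using hv
    · simp [exec, ha₁]
    obtain ⟨⟨g1, g2, g3, g4, g5⟩, hf1⟩ := h₁
    simp only [exec, RamState.arr_setReg] at g3 g4 g5
    simp [hq] at g5
    have gd := g3 d hv
    refine Halts.seq (t := 8) (t' := 1) ((halts_progVisit (d := d) (f := f₂)
      (f₁ := f₁) (f₂ := f₂) (seed := seed) (dart := dart) hnd ?_ g1 ?_ ?_ ?_ (Or.inr rfl) ?_).frame.mono
      le_rfl fun s₂ h₂ => ?_)
    · rw [hf1.1 6 (by simp [progVisit, regs, nop])]; simpa [exec] using h6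
    · rw [hf1.1 10 (by simp [progVisit, regs, nop])]; simp [exec, hq]
    · rw [hf1.1 11 (by simp [progVisit, regs, nop]), gd.1]; simp [exec, hq]
    · rw [gd.1]; exact hv
    · rw [hf1.2 a₂ (harrs _ hn₂ _)]; simp [exec, ha₂]
    obtain ⟨⟨k1, k2, k3, k4, k5⟩, hf2⟩ := h₂
    have r22 : s₂.reg 22 = s₀.reg 22 := by
      rw [hf2.1 22 (by simp [progVisit, regs, nop]), hf1.1 22 (by simp [progVisit, regs, nop])]
      simp [exec]
    have e1 : s₂.reg 6 = 0 := by
      rw [hf2.1 6 (by simp [progVisit, regs, nop]), hf1.1 6 (by simp [progVisit, regs, nop])]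
      simpa [exec] using h6
    have e2 : s₂.arr a₁ = s₀.arr a₁ := by
      rw [hf2.2 a₁ (harrs _ hn₁ _), hf1.2 a₁ (harrs _ hn₁ _)]; rfl
    have e3 : s₂.arr a₂ = s₀.arr a₂ := by
      rw [hf2.2 a₂ (harrs _ hn₂ _), hf1.2 a₂ (harrs _ hn₂ _)]; rfl
    have hvis : ∀ x, s₀.arr vis (dart x) ≠ 0 → s₂.arr vis (dart x) ≠ 0 := by
      intro x hx
      have := (g3 x hx).1
      rw [(k3 x (by rw [this]; exact hx)).1, this]
      exact hx
    have hlt2 : s₀.reg 22 < s₂.reg 21 := by omega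
    refine Halts.straight rfl ?_
    simp only [exec, RamState.reg_setReg, RamState.arr_setReg, r22, e1, e2, e3]
    simp only [Nat.reduceEqDiff, if_false, if_true]
    have := k1.le
    refine ⟨⟨by trivial, ha₁, ha₂, k1, by omega, fun x hx hxp => ?_⟩, by omega⟩
    by_cases hx1 : s₁.arr vis (dart x) = 0
    · have := k4 x hx1 hx
      omega
    by_cases hx0 : s₀.arr vis (dart x) = 0
    · have := g4 x hx0 hx1
      rw [(k3 x hx1).2] at hxp
      simp [hq] at this
      omega
    · rw [(k3 x hx1).2, (g3 x hx0).2] at hxp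
      rcases Nat.lt_succ_iff_lt_or_eq.1 hxp with hlt' | heq
      · have := hcl x hx0 hlt'
        exact ⟨hvis _ this.1, hvis _ this.2⟩
      · have hxd : x = d := by
          rw [← code_inj dart, ← (hs.visited x hx0).2, heq, hq]
        subst hxd
        exact ⟨by rw [(k3 _ g2).1]; exact g2, k2⟩
  · simp [exec]
  · obtain ⟨⟨-, -, -, h1, h2, h3⟩, h4⟩ := hs
    exact ⟨h1, fun d hd => h3 d hd (by have := (h1.visited d hd).1; omega)⟩

end

end PlaneGraph

/-! ### The program: neighbourhood representants -/

open RamProgram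

namespace PlaneGraph

variable {n m l : ℕ} {M : PlaneGraph (Fin n)}

open Classical in
variable (M) in
/-- The next dart in the same block of darts that lead downwards. -/
noncomputable def nextLow (d : M.G.Dart) : M.G.Dart :=
  if M.IsLowDart d ∧ M.IsLowDart (M.rot d) then M.rot d else d

variable (M) in
/-- The first dart of a block of darts that lead downwards. -/
def FirstLow (d : M.G.Dart) : Prop := M.IsLowDart d ∧ ¬ M.IsLowDart (M.rot.symm d)

theorem SameLowBlock.fst_eq {d d' : M.G.Dart} (h : M.SameLowBlock d d') : d.fst = d'.fst := by
  induction h with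
  | rel x y h => rw [h.2.2, M.rot_fst]
  | refl => rfl
  | symm _ _ _ ih => exact ih.symm
  | trans _ _ _ _ _ ih ih' => exact ih.trans ih'

section Blocks

variable {dart : M.G.Dart ≃ Fin m} {q par vis pos : ℕ → ℕ} {t : ℕ}
  (hs : Search dart M.nextLow M.nextLow M.FirstLow q par vis pos t)
include hs

theorem Search.exists_rot_eq {d : M.G.Dart} (hd : vis (dart d) ≠ 0) (hf : ¬ M.FirstLow d) :
    ∃ p, M.IsLowDart p ∧ M.IsLowDart d ∧ d = M.rot p ∧ vis (dart p) ≠ 0 ∧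
      vis (dart d) = vis (dart p) ∧ pos (dart p) < pos (dart d) := by
  obtain ⟨p, h1, h2, h3, -, h4⟩ := hs.parent d hd hf
  have h4 : d = M.nextLow p := h4.elim id id
  rw [nextLow] at h4
  split_ifs at h4 with h
  · exact ⟨p, h.1, h4 ▸ h.2, h4, h1, h2, h3⟩
  · subst h4
    exact absurd h3 (lt_irrefl _)

theorem Search.vis_rot (hc : ∀ d, vis (dart d) ≠ 0 → vis (dart (M.nextLow d)) ≠ 0) {d : M.G.Dart}
    (h1 : M.IsLowDart d) (h2 : M.IsLowDart (M.rot d)) : vis (dart (M.rot d)) = vis (dart d) := by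
  have hf : ¬ M.FirstLow (M.rot d) := fun h => h.2 (by simpa using h1)
  by_cases hz : vis (dart (M.rot d)) = 0
  · by_contra hne
    have := hc d (by omega)
    rw [nextLow, if_pos ⟨h1, h2⟩] at this
    exact this hz
  · obtain ⟨p, -, -, h, -, h', -⟩ := hs.exists_rot_eq hz hf
    rw [h', M.rot.injective h]

theorem Search.vis_eq (hc : ∀ d, vis (dart d) ≠ 0 → vis (dart (M.nextLow d)) ≠ 0) {d d' : M.G.Dart}
    (h : M.SameLowBlock d d') : vis (dart d) = vis (dart d') := by
  induction h with
  | rel x y h => rw [h.2.2, hs.vis_rot hc h.1 (h.2.2 ▸ h.2.1)]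
  | refl => rfl
  | symm _ _ _ ih => exact ih.symm
  | trans _ _ _ _ _ ih ih' => exact ih.trans ih'

/-- Labels are inherited from parents, and going back along parents within the block ends in a seed,
whose label is its own code plus one. -/
theorem Search.exists_firstLow {d : M.G.Dart} (hd : vis (dart d) ≠ 0) :
    ∃ e, M.SameLowBlock e d ∧ vis (dart d) = dart e + 1 := by
  induction h : pos (dart d) using Nat.strong_induction_on generalizing d with
  | _ k ih =>
    by_cases hf : M.FirstLow d
    · exact ⟨d, Relation.EqvGen.refl _, hs.seed d hf⟩
    · obtain ⟨p, h1, h2, h3, h4, h5, h6⟩ := hs.exists_rot_eq hd hf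
      obtain ⟨e, h7, h8⟩ := ih _ (h ▸ h6) h4 rfl
      exact ⟨e, Relation.EqvGen.trans _ _ _ h7 (Relation.EqvGen.rel _ _ ⟨h1, h2, h3⟩), h5.trans h8⟩

theorem Search.sameLowBlock {d d' : M.G.Dart} (hd : vis (dart d) ≠ 0)
    (h : vis (dart d) = vis (dart d')) : M.SameLowBlock d d' := by
  obtain ⟨e, h1, h2⟩ := hs.exists_firstLow hd
  obtain ⟨e', h3, h4⟩ := hs.exists_firstLow (h ▸ hd)
  rw [h, h4, Nat.add_right_cancel_iff, code_inj] at h2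
  exact Relation.EqvGen.trans _ _ _ (Relation.EqvGen.symm _ _ h1) (h2 ▸ h3)

/-- A block without a label has no first dart. So going backwards around the vertex never leaves the
block, and it consists of all darts there. -/
theorem Search.isLowDart_of_vis_eq_zero
    (hc : ∀ d, vis (dart d) ≠ 0 → vis (dart (M.nextLow d)) ≠ 0) {d d' : M.G.Dart}
    (h1 : M.IsLowDart d) (h2 : vis (dart d) = 0) (hd : d'.fst = d.fst) : M.IsLowDart d' := by
  have hfin : Finite M.G.Dart := finite_dart
  obtain ⟨k, hk⟩ := (M.rot_sameCycle d' d hd).exists_nat_pow_eq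
  suffices M.IsLowDart d' ∧ vis (dart d') = 0 from this.1
  clear hd
  induction k generalizing d' with
  | zero => obtain rfl : d' = d := by simpa using hk
            exact ⟨h1, h2⟩
  | succ k ih =>
    obtain ⟨h3, h4⟩ := ih (d' := M.rot d') (by rw [← Equiv.Perm.mul_apply, ← pow_succ, hk])
    have h5 : M.IsLowDart d' := by
      by_contra h
      have := hs.seed (M.rot d') ⟨h3, by simpa using h⟩
      omega
    exact ⟨h5, by rw [← hs.vis_rot hc h5 h3, h4]⟩

/-- All darts of a block share their label, so a dart that is minimal for its label is minimal in
its block. This is true also for the label 0, which several blocks may have in common. -/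
theorem Search.isRepresentant_of_eq (hM : M.IsNice l)
    (hc : ∀ d, vis (dart d) ≠ 0 → vis (dart (M.nextLow d)) ≠ 0) {f : ℕ → ℕ}
    (hf : HasArgmin dart (fun d => vis (dart d)) (fun _ => True) f) {d : M.G.Dart}
    (hd : M.IsLowDart d) (h : f (vis (dart d)) = dart d + 1) : M.IsRepresentant d.fst d.snd := by
  obtain ⟨d₁, h1, h2, h3, h4⟩ := hf.eq_succ (vis (dart d)) (by omega)
  obtain rfl : d = d₁ := by rwa [h3, Nat.add_right_cancel_iff, code_inj, eq_comm] at h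
  refine ⟨d, rfl, rfl, ?_, hd, fun d' hd' => ?_⟩
  · have := one_le_height hM.outer d.snd
    have := hd
    rw [IsLowDart] at this
    omega
  by_cases hdd : d' = d
  · rw [hdd]
  have hl : M.IsLowDart d' := by
    clear h3 h4 hdd h
    have : M.IsLowDart d ↔ M.IsLowDart d' := by
      clear h1 h2 hd
      induction hd' with
      | rel x y h => exact iff_of_true h.1 h.2.1
      | refl => exact Iff.rfl
      | symm _ _ _ ih => exact ih.symm
      | trans _ _ _ _ _ ih ih' => exact ih.trans ih'
    exact this.1 hd
  exact h4 d' trivial hl (hs.vis_eq hc hd').symm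

/-- A nonzero label belongs to one block only, and as numbers are different, a representant in it is
the recorded dart. A low dart with label 0 starts in a vertex that has lower neighbours only and
thus is a crest by itself; only there can a representant be missed. -/
theorem Search.exists_isCrest_of_ne
    (hc : ∀ d, vis (dart d) ≠ 0 → vis (dart (M.nextLow d)) ≠ 0) {f : ℕ → ℕ}
    (hf : HasArgmin dart (fun d => vis (dart d)) (fun _ => True) f) {d : M.G.Dart}
    (hd : M.IsLowDart d) (h : f (vis (dart d)) ≠ dart d + 1) (hr : M.IsRepresentant d.fst d.snd) :
    ∃ H, M.IsCrest H ∧ d.fst ∈ H := by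
  obtain ⟨e, he1, he2, -, -, he3⟩ := hr
  obtain rfl : e = d := SimpleGraph.Dart.ext _ _ (Prod.ext he1 he2)
  by_cases hz : vis (dart e) = 0
  · have hlow : ∀ w, M.G.Adj e.fst w → M.height w < M.height e.fst := by
      intro w hw
      have : M.height w + 1 = M.height e.fst :=
        hs.isLowDart_of_vis_eq_zero hc (d' := ⟨(e.fst, w), hw⟩) hd hz rfl
      omega
    refine ⟨M.levelSet e.fst, isCrest_levelSet fun x hx w hw => ?_, .refl⟩
    have hx : x = e.fst := by
      clear hw
      induction hx with
      | refl => rfl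
      | tail _ h ih =>
        rw [ih] at h
        exact absurd h.2 (hlow _ h.1).ne
    subst hx
    exact (hlow w hw).le
  · have h0 : f (vis (dart e)) ≠ 0 := fun h0 => hf.eq_zero _ h0 e trivial hd rfl
    obtain ⟨d₁, h1, h2, h3, h4⟩ := hf.eq_succ _ h0
    have hb := hs.sameLowBlock hz h2.symm
    have hnum : e.snd = d₁.snd := M.num_injective (le_antisymm (he3 d₁ hb) (h4 e trivial hd rfl))
    have : e = d₁ := SimpleGraph.Dart.ext _ _ (Prod.ext hb.fst_eq hnum)
    exact absurd (this ▸ h3) h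

end Blocks

/-- The darts that lead downwards are marked in array 30. -/
def progLow : RamProgram :=
  forUp 9 1 (load 10 1 9 ;; load 10 9 10 ;; load 11 13 9 ;; load 11 9 11 ;;
    ite 11 10 (store 30 9 7) (store 30 9 6))

open Classical in
theorem halts_progLow (hM : M.IsNice l) {dart : M.G.Dart ≃ Fin m} {s : RamState} (h : Given dart s)
    (h13 : ∀ d, s.arr 13 (dart d) = d.snd) (hH : ∀ v : Fin n, s.arr 9 v = 2 * M.height v) :
    Halts progLow s (8 * m + 2) fun s' =>
      ∀ d, s'.arr 30 (dart d) = if M.IsLowDart d then 1 else 0 := by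
  refine (Halts.forUp (c := 6) (I := fun j s => ∀ d, (dart d : ℕ) < j →
    s.arr 30 (dart d) = if M.IsLowDart d then 1 else 0) (by decide) (by decide) (by simp) ?_).mono
    (by rw [h.reg_m]) fun s' hs d => hs.1 d (by rw [h.reg_m]; exact code_lt dart d)
  intro j hj s' hf hi hI
  rw [h.reg_m] at hj
  obtain ⟨d, rfl⟩ := exists_dart_code dart hj
  have h' := h.frame hf (by decide) (by decide)
  have hhead : ∀ d, s'.arr 13 (dart d) = d.snd := by rw [hf.2 13 (by decide)]; exact h13
  have hH' : ∀ v : Fin n, s'.arr 9 v = 2 * M.height v := by rw [hf.2 9 (by decide)]; exact hH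
  refine Halts.straight_le rfl (by decide) ?_
  by_cases hl : M.height d.snd < M.height d.fst <;>
  · intro d' hd'
    rw [code_lt_succ] at hd'
    by_cases hdd : d' = d
    · subst hdd
      simp [exec, hi, h'.tail, hhead, hH', hl, hM.isLowDart_iff, h'.one, h'.zero]
    · have := hI d' (hd'.resolve_right hdd)
      simpa [exec, hi, h'.tail, hhead, hH', hl, code_inj, hdd] using this

/-- The array 15 for `nextLow`, and the seeds for the labelling of the blocks. -/
def progSeeds : RamProgram :=
  forUp 9 1 (load 10 30 9 ;; load 11 3 9 ;; load 12 30 11 ;; store 15 9 9 ;;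
    ite 6 12 (ite 6 10 (store 15 9 11)
      (copy 13 11 ;; succ 13 ;; store 12 11 13 ;; store 28 11 21 ;; store 16 21 11 ;; succ 21))
      (nop 13))

theorem Search.push_seed {dart : M.G.Dart ≃ Fin m} {f₁ f₂ : M.G.Dart → M.G.Dart}
    {seed seed' : M.G.Dart → Prop}
    {q par vis pos q' vis' pos' : ℕ → ℕ} {t : ℕ} {e : M.G.Dart}
    (h : Search dart f₁ f₂ seed q par vis pos t) (he : vis (dart e) = 0)
    (hseed : ∀ d, seed' d ↔ seed d ∨ d = e)
    (hq : ∀ j, q' j = if j = t then (dart e : ℕ) else q j)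
    (hvis : ∀ d, vis' (dart d) = if d = e then (dart e : ℕ) + 1 else vis (dart d))
    (hpos : ∀ d, pos' (dart d) = if d = e then t else pos (dart d)) :
    Search dart f₁ f₂ seed' q' par vis' pos' (t + 1) := by
  constructor
  · intro j hj
    by_cases hjt : j = t
    · exact ⟨e, by simp [hq, hjt], by simp [hvis], by simp [hpos, hjt]⟩
    · obtain ⟨d, h1, h2, h3⟩ := h.queue j (by omega)
      have hde : d ≠ e := fun h => h2 (h ▸ he)
      exact ⟨d, by simp [hq, hjt, h1], by simpa [hvis, hde] using h2, by simp [hpos, hde, h3]⟩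
  · intro d hd
    by_cases hde : d = e
    · subst hde
      simp [hpos, hq]
    · rw [hvis, if_neg hde] at hd
      obtain ⟨h1, h2⟩ := h.visited d hd
      rw [hpos, if_neg hde, hq, if_neg h1.ne]
      exact ⟨by omega, h2⟩
  · intro d hd hs
    rw [hseed, not_or] at hs
    rw [hvis, if_neg hs.2] at hd
    obtain ⟨p', h1, h2, h3, h4, h5⟩ := h.parent d hd hs.1
    have hpe : p' ≠ e := fun h => h1 (h ▸ he)
    exact ⟨p', by simpa [hvis, hpe] using h1, by simp [hvis, hpe, hs.2, h2],
      by simpa [hpos, hpe, hs.2] using h3, h4, h5⟩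
  · intro d hd
    rw [hseed] at hd
    by_cases hde : d = e
    · simp [hvis, hde]
    · rw [hvis, if_neg hde, h.seed d (hd.resolve_right hde)]

-- Processing `d` decides about `M.rot d`. Hence a first dart becomes a seed when its predecessor in
-- the rotation is processed, which explains `M.rot.symm` in the invariant.
open Classical in
theorem halts_progSeeds {dart : M.G.Dart ≃ Fin m} {s : RamState} (h : Given dart s)
    (hlow : ∀ d, s.arr 30 (dart d) = if M.IsLowDart d then 1 else 0)
    (h12 : ∀ i, s.arr 12 i = 0) (h21 : s.reg 21 = 0) :
    Halts progSeeds s (14 * m + 2) fun s' =>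
      (∀ d, s'.arr 15 (dart d) = dart (M.nextLow d)) ∧
      Search dart M.nextLow M.nextLow M.FirstLow (s'.arr 16) (s'.arr 17) (s'.arr 12) (s'.arr 28)
        (s'.reg 21) := by
  refine (Halts.forUp (c := 12) (I := fun j s =>
    (∀ d, (dart d : ℕ) < j → s.arr 15 (dart d) = dart (M.nextLow d)) ∧
    Search dart M.nextLow M.nextLow (fun d => M.FirstLow d ∧ (dart (M.rot.symm d) : ℕ) < j) (s.arr 16)
      (s.arr 17) (s.arr 12) (s.arr 28) (s.reg 21) ∧
    ∀ d, s.arr 12 (dart d) ≠ 0 → M.FirstLow d ∧ (dart (M.rot.symm d) : ℕ) < j)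
    (by decide) (by decide) ?_ ?_).mono (by rw [h.reg_m]) fun s' hs => ?_
  · refine ⟨by simp, ?_, by simp [h12]⟩
    simp only [RamState.arr_setReg, RamState.reg_setReg]
    norm_num
    rw [h21]
    exact ⟨by simp, by simp [h12], by simp [h12], by simp⟩
  · rintro j hj s' hf hi ⟨hI1, hI2, hI3⟩
    rw [h.reg_m] at hj
    obtain ⟨d, rfl⟩ := exists_dart_code dart hj
    have h' := h.frame hf (by decide) (by decide)
    have hlow' : ∀ d, s'.arr 30 (dart d) = if M.IsLowDart d then 1 else 0 := by
      rw [hf.2 30 (by decide)]; exact hlow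
    have h15 : ∀ e, e = M.nextLow d → ∀ a : ℕ → ℕ, (∀ d', a (dart d') =
        if d' = d then (dart e : ℕ) else s'.arr 15 (dart d')) →
        ∀ d', (dart d' : ℕ) < dart d + 1 → a (dart d') = dart (M.nextLow d') := by
      rintro e rfl a ha d' hd'
      rw [ha]
      split_ifs with hdd
      · rw [hdd]
      · exact hI1 d' (((code_lt_succ dart).1 hd').resolve_right hdd)
    have hsame : ¬ M.FirstLow (M.rot d) → ∀ x, (M.FirstLow x ∧ (dart (M.rot.symm x) : ℕ) < dart d) ↔
        (M.FirstLow x ∧ (dart (M.rot.symm x) : ℕ) < dart d + 1) := by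
      intro hn x
      refine and_congr_right fun hx => ?_
      rw [code_lt_succ]
      refine ⟨Or.inl, fun h => h.resolve_right fun hxd => hn ?_⟩
      rwa [← hxd, Equiv.apply_symm_apply]
    refine Halts.straight_le rfl (by decide) ?_
    by_cases hl : M.IsLowDart (M.rot d)
    · by_cases hd : M.IsLowDart d
      · have hn := hsame fun h => h.2 (by simpa using hd)
        simp only [← hn]
        simp [exec, hi, h'.rot, hlow', hl, hd, h'.zero]
        refine ⟨?_, hI2, fun x hx => by simpa using hI3 x hx⟩
        have := h15 (M.rot d) (by rw [nextLow, if_pos ⟨hd, hl⟩])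
          (fun i => if i = dart d then (dart (M.rot d) : ℕ) else s'.arr 15 i)
          (by simp [code_inj])
        intro d' hd'
        have := this d' (by omega)
        by_cases hdd : d' = d
        · simpa [hdd] using this
        · simpa [hdd, code_inj] using this
      · have hfl : M.FirstLow (M.rot d) := ⟨hl, by simpa using hd⟩
        have hv0 : s'.arr 12 (dart (M.rot d)) = 0 := by
          by_contra hne
          have := (hI3 _ hne).2
          simp at this
        have hseed : ∀ x, (M.FirstLow x ∧ (dart (M.rot.symm x) : ℕ) < dart d + 1) ↔
            (M.FirstLow x ∧ (dart (M.rot.symm x) : ℕ) < dart d) ∨ x = M.rot d := by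
          intro x
          rw [code_lt_succ, Equiv.symm_apply_eq]
          constructor
          · rintro ⟨a, b | b⟩
            · exact Or.inl ⟨a, b⟩
            · exact Or.inr b
          · rintro (⟨a, b⟩ | rfl)
            · exact ⟨a, Or.inl b⟩
            · exact ⟨hfl, Or.inr rfl⟩
        simp only [hseed]
        simp [exec, hi, h'.rot, hlow', hl, hd, h'.zero]
        refine ⟨?_, hI2.push_seed (e := M.rot d) hv0 (fun _ => Iff.rfl) ?_ ?_ ?_, ?_⟩
        · intro d' hd'
          by_cases hdd : d' = d
          · simp [hdd, nextLow, hd]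
          · simpa [code_inj, hdd] using hI1 d' (by
              have := mt (code_inj dart (d := d') (d' := d)).1 hdd; omega)
        · intro j; simp
        · intro x; simp [code_inj]
        · intro x; simp [code_inj]
        · intro x hx
          by_cases hxd : x = M.rot d
          · exact Or.inr hxd
          · simp [code_inj, hxd] at hx
            exact Or.inl (by simpa using hI3 x hx)
    · have hn := hsame fun h => hl h.1
      simp only [← hn]
      simp [exec, hi, h'.rot, hlow', hl, h'.zero, nop]
      refine ⟨?_, hI2, fun x hx => by simpa using hI3 x hx⟩
      intro d' hd'
      by_cases hdd : d' = d
      · simp [hdd, nextLow, hl]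
      · simpa [code_inj, hdd] using hI1 d' (by
          have := mt (code_inj dart (d := d') (d' := d)).1 hdd; omega)
  · rw [h.reg_m] at hs
    obtain ⟨⟨h1, h2, -⟩, -⟩ := hs
    refine ⟨fun d => h1 d (code_lt dart d), ?_⟩
    have : (fun d => M.FirstLow d ∧ (dart (M.rot.symm d) : ℕ) < m) = M.FirstLow := by
      funext d
      simp [code_lt]
    rwa [this] at h2

end PlaneGraph

/-! ### The program: the edges of the dual tree and their weights -/

open RamProgram

namespace PlaneGraph

variable {n m l : ℕ} {M : PlaneGraph (Fin n)}

/-- The array 18 holds, for every label in the array 12, the best dart. -/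
def HasBest (M : PlaneGraph (Fin n)) (dart : M.G.Dart ≃ Fin m) (s : RamState) : Prop :=
  ∀ d, M.IsLowDart d → (s.arr 18 (s.arr 12 (dart d)) = dart d + 1 → M.IsRepresentant d.fst d.snd) ∧
    (s.arr 18 (s.arr 12 (dart d)) ≠ dart d + 1 → M.IsRepresentant d.fst d.snd →
      ∃ H, M.IsCrest H ∧ d.fst ∈ H)

def progBest : RamProgram := progLow ;; progSeeds ;; progSearch 16 17 12 28 15 15 ;; progArgmin 12 18

theorem halts_progBest (hM : M.IsNice l) {dart : M.G.Dart ≃ Fin m} {s : RamState} (h : Given dart s)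
    (h13 : ∀ d, s.arr 13 (dart d) = d.snd) (hH : ∀ v : Fin n, s.arr 9 v = 2 * M.height v)
    (h12 : ∀ i, s.arr 12 i = 0) (h18 : ∀ i, s.arr 18 i = 0) (h21 : s.reg 21 = 0) :
    Halts progBest s (60 * m + 8) (HasBest M dart) := by
  refine (halts_progLow hM h h13 hH).andThen (t' := 52 * m + 6) (fun s₁ a1 f1 => ?_) (by omega)
  have g1 := h.frame f1 (by decide) (by decide)
  refine (halts_progSeeds g1 a1 (by rw [f1.2 12 (by decide)]; exact h12)
    (by rw [f1.1 21 (by decide), h21])).andThen (t' := 38 * m + 4) (fun s₂ ⟨a2, b2⟩ f2 => ?_) (by omega)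
  have g2 := g1.frame f2 (by decide) (by decide)
  refine (halts_progSearch (dart := dart) (by decide) g2.zero b2 a2 a2 (by decide)
    (by decide)).andThen (t' := 18 * m + 2) (fun s₃ ⟨a3, b3⟩ f3 => ?_) (by omega)
  have g3 := g2.frame f3 (by decide) (by decide)
  refine (halts_progArgmin (k := 12) (r := 18) hM (K := fun d => s₃.arr 12 (dart d)) g3 ?_ ?_
      (fun _ => rfl) ?_ (by decide)).frame.mono le_rfl ?_
  · rw [f3.2 13 (by decide), f2.2 13 (by decide), f1.2 13 (by decide)]; exact h13
  · rw [f3.2 9 (by decide), f2.2 9 (by decide), f1.2 9 (by decide)]; exact hH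
  · rw [f3.2 18 (by decide), f2.2 18 (by decide), f1.2 18 (by decide)]; exact h18
  · rintro s₄ ⟨a4, f4⟩ d hd
    rw [f4.2 12 (by decide)]
    have hc := fun d hd => (b3 d hd).1
    exact ⟨a3.isRepresentant_of_eq hM hc a4 hd, a3.exists_isCrest_of_ne hc a4 hd⟩

/-- The weights of the edges (array 23). -/
def progWeights : RamProgram :=
  forUp 9 1 (load 10 1 9 ;; load 10 9 10 ;; load 11 13 9 ;; load 11 9 11 ;;
    ite 11 10 (load 13 12 9 ;; load 14 18 13 ;; copy 15 9 ;; succ 15 ;; load 16 2 9 ;;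
      ifEq 14 15 (store 23 9 10 ;; store 23 16 10) (store 23 9 20 ;; store 23 16 20))
    (ite 10 11 (nop 14) (succ 10 ;; store 23 9 10)))

/-- Both darts of a slanted edge need the weight, since the search tree may cross it in either
direction. A representant edge may have the weight `top` if its higher end lies in a crest; selected
separators avoid crests anyway. -/
structure HasWeights (M : PlaneGraph (Fin n)) (dart : M.G.Dart ≃ Fin m) (top : ℕ) (w : ℕ → ℕ) : Prop where
  horizontal : ∀ d : M.G.Dart, M.height d.snd = M.height d.fst → w (dart d) = 2 * M.height d.fst + 1
  slanted : ∀ d, M.IsLowDart d → w (dart d.symm) = w (dart d) ∧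
    ((w (dart d) = 2 * M.height d.fst ∧ M.IsRepresentant d.fst d.snd) ∨
    (w (dart d) = top ∧ (M.IsRepresentant d.fst d.snd → ∃ H, M.IsCrest H ∧ d.fst ∈ H)))

/-- A slanted edge is treated once, at its low dart, which writes the entries of both directions;
the dart that leads upwards is skipped, so that nothing is overwritten. -/
theorem halts_progWeights (hM : M.IsNice l) {dart : M.G.Dart ≃ Fin m} {s : RamState} (h : Given dart s)
    (h13 : ∀ d, s.arr 13 (dart d) = d.snd) (hH : ∀ v : Fin n, s.arr 9 v = 2 * M.height v)
    (hb : HasBest M dart s) :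
    Halts progWeights s (16 * m + 2) fun s' => HasWeights M dart (s.reg 20) (s'.arr 23) := by
  classical
  refine (Halts.forUp (c := 14) (I := fun j s' => s'.reg 20 = s.reg 20 ∧
    (∀ d : M.G.Dart, (dart d : ℕ) < j → M.height d.snd = M.height d.fst →
      s'.arr 23 (dart d) = 2 * M.height d.fst + 1) ∧
    (∀ d, (dart d : ℕ) < j → M.IsLowDart d → s'.arr 23 (dart d) = s'.arr 23 (dart d.symm) ∧
      s'.arr 23 (dart d) = if s.arr 18 (s.arr 12 (dart d)) = dart d + 1 then 2 * M.height d.fst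
        else s.reg 20))
    (by decide) (by decide) (by simp) ?_).mono (by rw [h.reg_m]) fun s' hs => ?_
  · rintro j hj s' hf hi ⟨hI0, hI1, hI2⟩
    rw [h.reg_m] at hj
    obtain ⟨d, rfl⟩ := exists_dart_code dart hj
    have h' := h.frame hf (by decide) (by decide)
    have hhead : ∀ d, s'.arr 13 (dart d) = d.snd := by rw [hf.2 13 (by decide)]; exact h13
    have hH' : ∀ v : Fin n, s'.arr 9 v = 2 * M.height v := by rw [hf.2 9 (by decide)]; exact hH
    have h12' := hf.2 12 (by decide)
    have h18' := hf.2 18 (by decide)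
    have hlt : ∀ {d'}, (dart d' : ℕ) < dart d + 1 → d' ≠ d → (dart d' : ℕ) < dart d :=
      fun h1 h2 => ((code_lt_succ dart).1 h1).resolve_right h2
    have hlow := hM.isLowDart_iff d
    have hsymm : ∀ d' : M.G.Dart, M.IsLowDart d' → M.IsLowDart d → d' = d.symm → False := by
      rintro d' h1 h2 rfl
      rw [IsLowDart] at h1 h2
      simp at h1
      omega
    have hss : ∀ d' : M.G.Dart, d'.symm = d ↔ d' = d.symm := fun d' =>
      ⟨fun h => by rw [← h]; simp, fun h => by rw [h]; simp⟩
    have hsi : ∀ d' : M.G.Dart, d'.symm = d.symm ↔ d' = d := fun d' =>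
      SimpleGraph.Dart.symm_involutive.injective.eq_iff
    refine Halts.straight_le rfl (by decide) ?_
    by_cases hl : M.height d.snd < M.height d.fst
    · have key : ∀ (w : ℕ) (a : ℕ → ℕ), (∀ x, a (dart x) = if x = d.symm then w else
          if x = d then w else s'.arr 23 (dart x)) →
          (w = if s.arr 18 (s.arr 12 (dart d)) = dart d + 1 then 2 * M.height d.fst
            else s.reg 20) →
          (∀ x : M.G.Dart, (dart x : ℕ) < dart d + 1 → M.height x.snd = M.height x.fst →
            a (dart x) = 2 * M.height x.fst + 1) ∧
          (∀ x, (dart x : ℕ) < dart d + 1 → M.IsLowDart x → a (dart x) = a (dart x.symm) ∧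
            a (dart x) = if s.arr 18 (s.arr 12 (dart x)) = dart x + 1 then
              2 * M.height x.fst else s.reg 20) := by
        intro w a ha hw
        constructor
        · intro x hx hxh
          have h1 : x ≠ d := by rintro rfl; omega
          have h2 : x ≠ d.symm := by
            rintro rfl
            simp only [SimpleGraph.Dart.symm_toProd, Prod.fst_swap, Prod.snd_swap] at hxh
            omega
          rw [ha, if_neg h2, if_neg h1]
          exact hI1 x (hlt hx h1) hxh
        · intro x hx hxl
          have h2 : x ≠ d.symm := fun e => hsymm x hxl (hlow.2 hl) e
          by_cases h1 : x = d
          · subst h1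
            rw [ha, ha, if_neg h2, if_pos rfl, if_pos rfl]
            exact ⟨rfl, hw⟩
          · simp only [ha, hsi, hss, h1, h2, if_false]
            exact hI2 x (hlt hx h1) hxl
      by_cases hbest : s.arr 18 (s.arr 12 (dart d)) = dart d + 1
      · have := key (2 * M.height d.fst) (fun i => if i = dart d.symm then 2 * M.height d.fst else
          if i = dart d then 2 * M.height d.fst else s'.arr 23 i) (by simp [code_inj]) (by rw [if_pos hbest])
        simpa [exec, ifEq, hi, h'.tail, hhead, hH', hl, h'.symm, h12', h18', hbest, hI0] using this
      · have := key (s.reg 20) (fun i => if i = dart d.symm then s.reg 20 else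
          if i = dart d then s.reg 20 else s'.arr 23 i) (by simp [code_inj]) (by rw [if_neg hbest])
        rcases lt_or_gt_of_ne hbest with e | e
        · simpa [exec, ifEq, hi, h'.tail, hhead, hH', hl, h'.symm, h12', h18', e, hI0] using this
        · simpa [exec, ifEq, hi, h'.tail, hhead, hH', hl, h'.symm, h12', h18', e, e.le, e.not_gt, hI0] using this
    · have hnl : ¬ M.IsLowDart d := fun h => hl (hlow.1 h)
      by_cases hg : M.height d.fst < M.height d.snd
      · simp [exec, hi, h'.tail, hhead, hH', hl, hg, nop]
        refine ⟨hI0, fun x hx hxh => hI1 x (hlt (by omega) ?_) hxh,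
          fun x hx hxl => hI2 x (hlt (by omega) ?_) hxl⟩
        · rintro rfl; omega
        · rintro rfl; exact hnl hxl
      · simp [exec, hi, h'.tail, hhead, hH', hl, hg]
        refine ⟨hI0, fun x hx hxh => ?_, fun x hx hxl => ?_⟩
        · by_cases hxd : x = d
          · simp [hxd]
          · simpa [code_inj, hxd] using hI1 x (hlt (by omega) hxd) hxh
        · have h1 : x ≠ d := by rintro rfl; exact hnl hxl
          have h2 : x ≠ d.symm := by
            rintro rfl
            have := (hM.isLowDart_iff _).1 hxl
            simp only [SimpleGraph.Dart.symm_toProd, Prod.fst_swap, Prod.snd_swap] at this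
            omega
          simpa [code_inj, h1, hss, h2] using hI2 x (hlt (by omega) h1) hxl
  · rw [h.reg_m] at hs
    obtain ⟨⟨-, h1, h2⟩, -⟩ := hs
    refine ⟨fun d => h1 d (code_lt dart d), fun d hd => ?_⟩
    obtain ⟨h3, h4⟩ := h2 d (code_lt dart d) hd
    refine ⟨h3.symm, ?_⟩
    split_ifs at h4 with hbest
    · exact Or.inl ⟨h4, (hb d hd).1 hbest⟩
    · exact Or.inr ⟨h4, (hb d hd).2 hbest⟩

open Classical in
variable (M) in
/-- The other side of an edge of the dual tree. -/
noncomputable def acrossDual (d : M.G.Dart) : M.G.Dart := if d.edge ∈ M.blocked then d else d.symm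

/-- The array 19 for `acrossDual`. -/
def progAcross : RamProgram :=
  forUp 9 1 (load 16 2 9 ;; load 10 10 9 ;; load 11 10 16 ;; store 19 9 9 ;;
    ite 6 10 (nop 14) (ite 6 11 (nop 14)
      (load 12 1 9 ;; load 12 11 12 ;; copy 13 9 ;; succ 13 ;; ifEq 12 13 (nop 14)
        (load 12 13 9 ;; load 12 11 12 ;; copy 13 16 ;; succ 13 ;; ifEq 12 13 (nop 14)
          (store 19 9 16)))))

/-- With the tail as key, the minimal low dart at a vertex leads to the down vertex, which is unique
because numbers are different. -/
theorem HasArgmin.eq_iff {dart : M.G.Dart ≃ Fin m} {f : ℕ → ℕ}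
    (hf : HasArgmin dart (fun d => (d.fst : ℕ)) (fun _ => True) f) (d : M.G.Dart) :
    f d.fst = dart d + 1 ↔ M.IsDownVertex d.fst d.snd := by
  constructor
  · intro h
    obtain ⟨d₁, h1, h2, h3, h4⟩ := hf.eq_succ d.fst (by omega)
    obtain rfl : d = d₁ := by rwa [h3, Nat.add_right_cancel_iff, code_inj, eq_comm] at h
    exact ⟨⟨d.adj, h1⟩, fun w hw hw' => h4 ⟨(d.fst, w), hw⟩ trivial hw' rfl⟩
  · intro h
    have h0 : f d.fst ≠ 0 := fun h0 => hf.eq_zero _ h0 d trivial h.1.2 rfl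
    obtain ⟨d₁, h1, h2, h3, h4⟩ := hf.eq_succ d.fst h0
    have h2 := Fin.ext h2
    have h5 : M.IsDownVertex d.fst d₁.snd :=
      ⟨⟨h2 ▸ d₁.adj, h2 ▸ h1⟩, fun w hw hw' => h4 ⟨(d.fst, w), hw⟩ trivial hw' rfl⟩
    have : d₁ = d := SimpleGraph.Dart.ext _ _ (Prod.ext h2 (h5.unique h))
    rw [h3, this]

theorem edge_mem_blocked_iff {d : M.G.Dart} : d.edge ∈ M.blocked ↔
    M.OuterDart d ∨ M.OuterDart d.symm ∨ M.IsDownVertex d.fst d.snd ∨ M.IsDownVertex d.snd d.fst := by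
  constructor
  · rintro (⟨a, b, hab, h⟩ | ⟨d', hd', h⟩)
    · rcases Sym2.eq_iff.1 (show s(d.fst, d.snd) = s(a, b) from h) with ⟨rfl, rfl⟩ | ⟨rfl, rfl⟩
      · exact Or.inr (Or.inr (Or.inl hab))
      · exact Or.inr (Or.inr (Or.inr hab))
    · rcases SimpleGraph.dart_edge_eq_iff _ _ |>.1 h with rfl | rfl
      · exact Or.inl hd'
      · exact Or.inr (Or.inl hd')
  · rintro (h | h | h | h)
    · exact Or.inr ⟨d, h, rfl⟩
    · exact Or.inr ⟨_, h, by simp⟩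
    · exact Or.inl ⟨_, _, h, rfl⟩
    · exact Or.inl ⟨_, _, h, Sym2.eq_swap⟩

open Classical in
theorem halts_progAcross {dart : M.G.Dart ≃ Fin m} {s : RamState} (h : Given dart s)
    (h13 : ∀ d, s.arr 13 (dart d) = d.snd)
    (hout : ∀ d, s.arr 10 (dart d) = if M.OuterDart d then 1 else 0)
    (hdn : HasArgmin dart (fun d => (d.fst : ℕ)) (fun _ => True) (s.arr 11)) :
    Halts progAcross s (22 * m + 2) fun s' => ∀ d, s'.arr 19 (dart d) = dart (M.acrossDual d) := by
  refine (Halts.forUp (c := 20) (I := fun j s => ∀ d, (dart d : ℕ) < j →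
    s.arr 19 (dart d) = dart (M.acrossDual d)) (by decide) (by decide) (by simp) ?_).mono
    (by rw [h.reg_m]) fun s' hs d => hs.1 d (by rw [h.reg_m]; exact code_lt dart d)
  intro j hj s' hf hi hI
  rw [h.reg_m] at hj
  obtain ⟨d, rfl⟩ := exists_dart_code dart hj
  have h' := h.frame hf (by decide) (by decide)
  have hhead : ∀ d, s'.arr 13 (dart d) = d.snd := by rw [hf.2 13 (by decide)]; exact h13
  have hout' : ∀ d, s'.arr 10 (dart d) = if M.OuterDart d then 1 else 0 := by
    rw [hf.2 10 (by decide)]; exact hout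
  have hdn' : HasArgmin dart (fun d => (d.fst : ℕ)) (fun _ => True) (s'.arr 11) := by
    rw [hf.2 11 (by decide)]; exact hdn
  have hd1 := hdn'.eq_iff d
  have hd2 := hdn'.eq_iff d.symm
  simp only [SimpleGraph.Dart.symm_toProd, Prod.fst_swap, Prod.snd_swap] at hd2
  have key : ∀ a : ℕ → ℕ, (∀ x, a (dart x) = if x = d then (dart (M.acrossDual d) : ℕ) else
      s'.arr 19 (dart x)) → ∀ x, (dart x : ℕ) < dart d + 1 → a (dart x) = dart (M.acrossDual x) := by
    intro a ha x hx
    rw [ha]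
    split_ifs with hxd
    · rw [hxd]
    · exact hI x (((code_lt_succ dart).1 hx).resolve_right hxd)
  have hb := edge_mem_blocked_iff (d := d)
  refine Halts.straight_le rfl (by decide) (key _ fun x => ?_)
  rw [acrossDual]
  by_cases c1 : M.OuterDart d
  · rw [if_pos (hb.2 (Or.inl c1))]
    simp [exec, ifEq, hi, h'.symm, hout', c1, h'.zero, nop, code_inj]
  by_cases c2 : M.OuterDart d.symm
  · rw [if_pos (hb.2 (Or.inr (Or.inl c2)))]
    simp [exec, ifEq, hi, h'.symm, hout', c1, c2, h'.zero, nop, code_inj]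
  by_cases c3 : M.IsDownVertex d.fst d.snd
  · rw [if_pos (hb.2 (Or.inr (Or.inr (Or.inl c3))))]
    simp [exec, ifEq, hi, h'.symm, hout', c1, c2, h'.zero, nop, code_inj, h'.tail, hd1.2 c3]
  have c3' := mt hd1.1 c3
  by_cases c4 : M.IsDownVertex d.snd d.fst
  · rw [if_pos (hb.2 (Or.inr (Or.inr (Or.inr c4))))]
    rcases lt_or_gt_of_ne c3' with e | e <;>
    simp [exec, ifEq, hi, h'.symm, hout', c1, c2, h'.zero, nop, code_inj, h'.tail, hhead,
      hd2.2 c4, e, e.not_gt]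
  have c4' := mt hd2.1 c4
  have hnb : d.edge ∉ M.blocked := fun h => by
    rcases hb.1 h with h | h | h | h <;> contradiction
  rw [if_neg hnb]
  rcases lt_or_gt_of_ne c3' with e | e <;> rcases lt_or_gt_of_ne c4' with e' | e' <;>
    simp [exec, ifEq, hi, h'.symm, hout', c1, c2, h'.zero, nop, code_inj, h'.tail, hhead,
      e, e.not_gt, e', e'.not_gt] <;> by_cases hx : x = d <;> simp [hx]

end PlaneGraph

/-! ### The program: a spanning tree of the dual tree -/

open RamProgram

namespace PlaneGraph

variable {n m l : ℕ} {M : PlaneGraph (Fin n)}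

/-- The queue (array 20, length in register 21) and the parents (array 21) of a search tree. -/
structure HasTree (T : M.SearchTree) (dart : M.G.Dart ≃ Fin m) (s : RamState) : Prop where
  queue : ∀ j < s.reg 21, ∃ d, ¬ M.OuterDart d ∧ T.idx d = j ∧ s.arr 20 j = dart d
  inner : ∀ d, ¬ M.OuterDart d → T.idx d < s.reg 21 ∧ s.arr 20 (T.idx d) = dart d
  par : ∀ d, T.Node d → s.arr 21 (dart d) = dart (T.par d)
  idx_root : T.idx T.root = 0
  le : s.reg 21 ≤ m

theorem HasTree.frame {T : M.SearchTree} {dart : M.G.Dart ≃ Fin m} {s s' : RamState}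
    (h : HasTree T dart s) (h21 : s'.reg 21 = s.reg 21) (a20 : s'.arr 20 = s.arr 20)
    (a21 : s'.arr 21 = s.arr 21) : HasTree T dart s' := by
  constructor
  · rw [h21, a20]; exact h.queue
  · rw [h21, a20]; exact h.inner
  · rw [a21]; exact h.par
  · exact h.idx_root
  · rw [h21]; exact h.le

theorem HasTree.idx_inj {T : M.SearchTree} {dart : M.G.Dart ≃ Fin m} {s : RamState}
    (h : HasTree T dart s) {a b : M.G.Dart} (ha : ¬ M.OuterDart a) (hb : ¬ M.OuterDart b)
    (hab : T.idx a = T.idx b) : a = b := by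
  rw [← code_inj dart, ← (h.inner a ha).2, hab, (h.inner b hb).2]

/-- The queue for a search that starts from a dart of an inner face. -/
def progRoot : RamProgram :=
  const 21 0 ;; load 10 2 2 ;; copy 11 10 ;; succ 11 ;; store 22 10 11 ;; store 29 10 21 ;;
    store 20 21 10 ;; succ 21

/-- Breadth-first search in the dual tree. -/
def progTree : RamProgram := progRoot ;; progSearch 20 21 22 29 14 19

/-- Across a blocked edge `acrossDual` is the identity, which cannot be a parent step because
positions increase. So all parent steps are admissible, and since outer edges are blocked, the
search never enters the outer face. The visited set is closed under both kinds of steps and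
therefore contains all inner darts by `conn_blocked`. -/
theorem IsNice.exists_searchTree (hM : M.IsNice l) {dart : M.G.Dart ≃ Fin m} {q par vis pos : ℕ → ℕ}
    {t : ℕ} (hs : Search dart M.face M.acrossDual (· = M.outer.symm) q par vis pos t)
    (hc : ∀ d, vis (dart d) ≠ 0 → vis (dart (M.face d)) ≠ 0 ∧ vis (dart (M.acrossDual d)) ≠ 0) :
    ∃ T : M.SearchTree, T.idx = (fun d => pos (dart d)) ∧
      (∀ d, T.Node d → par (dart d) = dart (T.par d)) ∧ T.idx T.root = 0 ∧
      ∀ d, vis (dart d) ≠ 0 ↔ ¬ M.OuterDart d := by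
  classical
  have hfin : Finite M.G.Dart := finite_dart
  have hroot : ¬ M.OuterDart M.outer.symm := not_outerDart_symm hM.bic outerDart_outer
  have hvr : vis (dart M.outer.symm) ≠ 0 := by rw [hs.seed _ rfl]; omega
  have hpar : ∀ d, vis (dart d) ≠ 0 → d ≠ M.outer.symm → ∃ p, vis (dart p) ≠ 0 ∧
      pos (dart p) < pos (dart d) ∧ par (dart d) = dart p ∧
      (d = M.face p ∨ (d = p.symm ∧ d.edge ∉ M.blocked)) := by
    intro d hd hdr
    obtain ⟨p, h1, -, h2, h3, h4⟩ := hs.parent d hd hdr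
    refine ⟨p, h1, h2, h3, h4.imp_right fun h => ?_⟩
    rw [acrossDual] at h
    split_ifs at h with hb
    · exact absurd (h ▸ h2) (lt_irrefl _)
    · exact ⟨h, by rw [h, SimpleGraph.Dart.edge_symm]; exact hb⟩
  have hin : ∀ k d, pos (dart d) = k → vis (dart d) ≠ 0 → ¬ M.OuterDart d := by
    intro k
    induction k using Nat.strong_induction_on with
    | _ k ih =>
      intro d hk hd
      by_cases hdr : d = M.outer.symm
      · rw [hdr]; exact hroot
      · obtain ⟨p, h1, h2, h3, h4⟩ := hpar d hd hdr
        have hp := ih _ (hk ▸ h2) p rfl h1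
        rcases h4 with rfl | ⟨rfl, hb⟩
        · rwa [outerDart_face]
        · refine fun h => hb (Or.inr ⟨_, h, rfl⟩)
  -- Faces are finite cycles, so closure under `face` implies closure under its inverse.
  have hface : ∀ d, vis (dart (M.face d)) ≠ 0 → vis (dart d) ≠ 0 := by
    intro d hd
    obtain ⟨k, hk⟩ := (show M.face.SameCycle (M.face d) d from
      Equiv.Perm.sameCycle_apply_left.2 (Equiv.Perm.SameCycle.refl _ _)).exists_nat_pow_eq
    have : ∀ k, vis (dart ((M.face ^ k) (M.face d))) ≠ 0 := by
      intro k
      induction k with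
      | zero => simpa using hd
      | succ k ih => rw [pow_succ', Equiv.Perm.mul_apply]; exact (hc _ ih).1
    exact hk ▸ this k
  have hall : ∀ d, ¬ M.OuterDart d → vis (dart d) ≠ 0 := by
    intro d hd
    refine ((hM.conn_blocked hroot hd).lift (fun x y => vis (dart x) ≠ 0 ↔ vis (dart y) ≠ 0)
      ⟨fun _ => Iff.rfl, Iff.symm, Iff.trans⟩ (fun x => ⟨fun h => (hc x h).1, hface x⟩)
      fun x hx => ⟨fun h => ?_, fun h => ?_⟩).1 hvr
    · have := (hc x h).2
      rwa [acrossDual, if_neg hx] at this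
    · have := (hc _ h).2
      rwa [acrossDual, if_neg (by rwa [SimpleGraph.Dart.edge_symm]), SimpleGraph.Dart.symm_symm] at this
  choose! f hf using fun d (h : vis (dart d) ≠ 0 ∧ d ≠ M.outer.symm) => hpar d h.1 h.2
  refine ⟨⟨M.outer.symm, f, fun d => pos (dart d), hroot, fun a ha har => ?_, fun a ha har => ?_,
    fun a ha har => ?_⟩, rfl, fun d hd => (hf d ⟨hall d hd.1, hd.2⟩).2.2.1, ?_, fun d =>
    ⟨hin _ d rfl, hall d⟩⟩
  · exact hin _ _ rfl (hf a ⟨hall a ha, har⟩).1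
  · exact (hf a ⟨hall a ha, har⟩).2.1
  · exact (hf a ⟨hall a ha, har⟩).2.2.2
  · change pos (dart M.outer.symm) = 0
    obtain ⟨d, h1, h2, h3⟩ := hs.queue 0 (Nat.zero_lt_of_lt (hs.visited _ hvr).1)
    by_cases hdr : d = M.outer.symm
    · rw [← hdr, h3]
    · have := (hf d ⟨h2, hdr⟩).2.1
      omega

theorem halts_progTree (hM : M.IsNice l) {dart : M.G.Dart ≃ Fin m} {s : RamState} (h : Given dart s)
    (hface : ∀ d, s.arr 14 (dart d) = dart (M.face d))
    (hacross : ∀ d, s.arr 19 (dart d) = dart (M.acrossDual d)) (h22 : ∀ i, s.arr 22 i = 0) :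
    Halts progTree s (20 * m + 10) fun s' => ∃ T : M.SearchTree, HasTree T dart s' := by
  have h2 : s.arr 2 (s.reg 2) = dart M.outer.symm := by rw [h.reg_outer, h.symm]
  refine (Halts.straight (p := progRoot) (s := s) (Q := fun s' => s'.reg 6 = 0 ∧
    (∀ d, s'.arr 14 (dart d) = dart (M.face d)) ∧
    (∀ d, s'.arr 19 (dart d) = dart (M.acrossDual d)) ∧
    Search dart M.face M.acrossDual (· = M.outer.symm) (s'.arr 20) (s'.arr 21) (s'.arr 22)
      (s'.arr 29) (s'.reg 21)) rfl ?_).andThen (t' := 20 * m + 2)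
      (fun s₁ ⟨a1, a2, a3, a4⟩ f1 => ?_) ?_
  · refine ⟨by simp [progRoot, exec, h.zero], by simpa [progRoot, exec] using hface, by simpa [progRoot, exec] using hacross, ?_⟩
    have h0 : Search dart M.face M.acrossDual (fun _ => False) (s.arr 20) (s.arr 21) (s.arr 22)
        (s.arr 29) 0 := ⟨by simp, by simp [h22], by simp [h22], by simp⟩
    have := h0.push_seed (e := M.outer.symm) (seed' := (· = M.outer.symm)) (h22 _) (by simp)
      (q' := fun j => if j = 0 then (dart M.outer.symm : ℕ) else s.arr 20 j)
      (vis' := fun j => if j = dart M.outer.symm then (dart M.outer.symm : ℕ) + 1 else s.arr 22 j)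
      (pos' := fun j => if j = dart M.outer.symm then 0 else s.arr 29 j) (by simp)
      (by simp [code_inj]) (by simp [code_inj])
    convert this using 1 <;> first | (funext j; simp [progRoot, exec, h2]) | simp [progRoot, exec, h2]
  · refine (halts_progSearch (dart := dart) (by decide) a1 a4 a2 a3 (by decide) (by decide)).mono
      le_rfl fun s₂ ⟨b1, b2⟩ => ?_
    obtain ⟨T, h1, h2, h3, h4⟩ := hM.exists_searchTree b1 b2
    refine ⟨T, ⟨fun j hj => ?_, fun d hd => ?_, h2, h3, b1.le⟩⟩
    · obtain ⟨d, h5, h6, h7⟩ := b1.queue j hj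
      exact ⟨d, (h4 d).1 h6, by rw [h1]; exact h7, h5⟩
    · rw [h1]
      exact b1.visited d ((h4 d).2 hd)
  · simp [progRoot, cost]; omega

/-! ### Weights of the steps of the search tree -/

/-- A weight function on the nodes of a search tree, where the root has weight zero. -/
structure IsWeighting (T : M.SearchTree) (top : ℕ) (w : M.G.Dart → ℕ) : Prop where
  root : w T.root = 0
  one_le : ∀ a, T.Node a → 1 ≤ w a
  le_top : ∀ a, T.Node a → w a ≤ top
  not_cross : ∀ a, T.Node a → ¬ T.Cross a → w a = top
  horizontal : ∀ a, T.Cross a → M.height a.snd = M.height a.fst → w a = 2 * M.height a.fst + 1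
  slanted : ∀ a, T.Cross a → M.IsLowDart (M.orient a) →
    (w a = 2 * M.height (M.orient a).fst ∧ M.IsRepresentant (M.orient a).fst (M.orient a).snd) ∨
    (w a = top ∧ (M.IsRepresentant (M.orient a).fst (M.orient a).snd →
      ∃ H, M.IsCrest H ∧ (M.orient a).fst ∈ H))

/-- The weights of the nodes (array 24). -/
def progNodeWeights : RamProgram :=
  forUp 9 21 (load 10 20 9 ;; load 11 21 10 ;; load 12 19 11 ;;
    ifEq 12 10 (load 13 23 10) (copy 13 20) ;; store 24 10 13) ;; load 10 20 6 ;; store 24 10 6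

open Classical in
theorem IsNice.isWeighting (hM : M.IsNice l) (T : M.SearchTree) {dart : M.G.Dart ≃ Fin m} {top : ℕ}
    {w : ℕ → ℕ} (hw : HasWeights M dart top w) (htop : ∀ v, 2 * M.height v + 1 < top) :
    IsWeighting T top fun a => if a = T.root then 0 else if T.Cross a then w (dart a) else top := by
  have h1 : ∀ a, T.Cross a → M.IsLowDart (M.orient a) → w (dart a) = w (dart (M.orient a)) := by
    intro a _ hl
    rcases orient_eq a with h | h
    · rw [h]
    · have := (hw.slanted _ hl).1
      rw [← this, h, SimpleGraph.Dart.symm_symm]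
  have hsl : ∀ a, T.Cross a → M.IsLowDart (M.orient a) →
      (w (dart a) = 2 * M.height (M.orient a).fst ∧
        M.IsRepresentant (M.orient a).fst (M.orient a).snd) ∨
      (w (dart a) = top ∧ (M.IsRepresentant (M.orient a).fst (M.orient a).snd →
        ∃ H, M.IsCrest H ∧ (M.orient a).fst ∈ H)) := by
    intro a ha hl
    rw [h1 a ha hl]
    exact (hw.slanted _ hl).2
  have hb : ∀ a, T.Cross a → 1 ≤ w (dart a) ∧ w (dart a) ≤ top := by
    intro a ha
    by_cases hh : M.height a.snd = M.height a.fst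
    · rw [hw.horizontal a hh]
      have := htop a.fst
      omega
    · have h2 := htop (M.orient a).fst
      have h3 := one_le_height hM.outer (M.orient a).fst
      rcases hsl a ha (hM.isLowDart_orient hh) with h | h <;> omega
  constructor
  · simp
  · intro a ha
    rw [if_neg ha.2]
    split_ifs with h
    · exact (hb a h).1
    · have := htop a.fst
      omega
  · intro a ha
    rw [if_neg ha.2]
    split_ifs with h
    · exact (hb a h).2
    · exact le_rfl
  · intro a ha hc
    rw [if_neg ha.2, if_neg hc]
  · intro a ha hh
    rw [if_neg ha.1.2, if_pos ha]
    exact hw.horizontal a hh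
  · intro a ha hl
    simp only [if_neg ha.1.2, if_pos ha]
    exact hsl a ha hl

/-- The test by which the program recognizes crossing steps. At a blocked edge `acrossDual` returns
the parent itself, which is different from `a`. -/
theorem IsNice.acrossDual_par_eq_iff (hM : M.IsNice l) {T : M.SearchTree} {a : M.G.Dart}
    (ha : T.Node a) : M.acrossDual (T.par a) = a ↔ T.Cross a := by
  have hi := T.idx_lt a ha.1 ha.2
  constructor
  · intro h
    rw [acrossDual] at h
    split_ifs at h
    · rw [h] at hi
      exact absurd hi (lt_irrefl _)
    · exact ⟨ha, h.symm⟩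
  · intro h
    have hb := hM.edge_notMem_blocked h
    rw [cross_par h, acrossDual, if_neg (by rwa [SimpleGraph.Dart.edge_symm]),
      SimpleGraph.Dart.symm_symm]

theorem halts_progNodeWeights (hM : M.IsNice l) {dart : M.G.Dart ≃ Fin m} {s : RamState}
    (h : Given dart s) {T : M.SearchTree} (hT : HasTree T dart s)
    (hacross : ∀ d, s.arr 19 (dart d) = dart (M.acrossDual d))
    (hw : HasWeights M dart (s.reg 20) (s.arr 23)) (htop : ∀ v, 2 * M.height v + 1 < s.reg 20) :
    Halts progNodeWeights s (10 * m + 4) fun s' => ∃ w, IsWeighting T (s.reg 20) w ∧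
      ∀ d, ¬ M.OuterDart d → s'.arr 24 (dart d) = w d := by
  classical
  set W : M.G.Dart → ℕ := fun a => if a = T.root then 0 else
    if T.Cross a then s.arr 23 (dart a) else s.reg 20 with hW
  refine (Halts.forUp (c := 8) (i := 9) (N := 21) (s := s) (p := load 10 20 9 ;; load 11 21 10 ;;
    load 12 19 11 ;; ifEq 12 10 (load 13 23 10) (copy 13 20) ;; store 24 10 13)
    (I := fun j s' => s'.reg 20 = s.reg 20 ∧ ∀ d, T.Node d → T.idx d < j →
    s'.arr 24 (dart d) = W d) (by decide) (by decide) (by simp) ?_).andThen (t' := 2) ?_ ?_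
  · rintro j hj s' hf hi ⟨hI1, hI2⟩
    obtain ⟨d, hd, rfl, hq⟩ := hT.queue j hj
    have hT' := hT.frame (hf.1 21 (by decide)) (hf.2 20 (by decide)) (hf.2 21 (by decide))
    have hq' := (hT'.inner d hd).2
    have ha' : ∀ d, s'.arr 19 (dart d) = dart (M.acrossDual d) := by
      rw [hf.2 19 (by decide)]; exact hacross
    have h23 := hf.2 23 (by decide)
    have hlt : ∀ x, T.Node x → T.idx x < T.idx d + 1 → x ≠ d → T.idx x < T.idx d := by
      intro x hx hxd hne
      have : T.idx x ≠ T.idx d := fun e => hne (hT.idx_inj hx.1 hd e)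
      omega
    refine Halts.straight_le rfl (by decide) ?_
    -- The root has no parent entry, so whatever is stored for it during the loop is ignored; it is
    -- replaced by 0 afterwards.
    by_cases hr : d = T.root
    · have hkeep : ∀ v, s'.reg 20 = s.reg 20 ∧ ∀ x, T.Node x → T.idx x < T.idx d + 1 →
          (if (dart x : ℕ) = dart d then v else s'.arr 24 (dart x)) = W x := by
        refine fun v => ⟨hI1, fun x hx hxi => ?_⟩
        have hne : x ≠ d := fun e => hx.2 (e.trans hr)
        rw [if_neg (by rwa [code_inj])]
        exact hI2 x hx (hlt x hx hxi hne)
      simp only [exec, ifEq]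
      split_ifs <;> simpa [hi, hq'] using hkeep _
    · have hn : T.Node d := ⟨hd, hr⟩
      have hp := hT'.par d hn
      have key : s'.reg 20 = s.reg 20 ∧ ∀ x, T.Node x → T.idx x < T.idx d + 1 →
          (if (dart x : ℕ) = dart d then W d else s'.arr 24 (dart x)) = W x := by
        refine ⟨hI1, fun x hx hxi => ?_⟩
        by_cases hxd : x = d
        · rw [if_pos (by rw [hxd]), hxd]
        · rw [if_neg (by rwa [code_inj])]
          exact hI2 x hx (hlt x hx hxi hxd)
      by_cases hc : T.Cross d
      · have e := (hM.acrossDual_par_eq_iff hn).2 hc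
        have eW : W d = s.arr 23 (dart d) := by simp only [hW, if_neg hr, if_pos hc]
        rw [eW] at key
        simpa [exec, ifEq, hi, hq', hp, ha', e, h23] using key
      · have e : (dart (M.acrossDual (T.par d)) : ℕ) ≠ dart d := fun e =>
          hc ((hM.acrossDual_par_eq_iff hn).1 ((code_inj dart).1 e))
        have eW : W d = s'.reg 20 := by simp only [hW, if_neg hr, if_neg hc, hI1]
        rw [eW] at key
        rcases lt_or_gt_of_ne e with e | e
        · simpa [exec, ifEq, hi, hq', hp, ha', e] using key
        · simpa [exec, ifEq, hi, hq', hp, ha', e, e.not_gt] using key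
  · rintro s' ⟨⟨h1, h2⟩, hf⟩ -
    refine Halts.straight rfl ⟨W, hM.isWeighting T hw htop, fun d hd => ?_⟩
    have hT' := hT.frame (hf.1 21 (by decide)) (hf.2 20 (by decide)) (hf.2 21 (by decide))
    have h6 : s'.reg 6 = 0 := by rw [hf.1 6 (by decide), h.zero]
    have hr := (hT'.inner _ T.inner_root).2
    rw [hT.idx_root] at hr
    by_cases hdr : d = T.root
    · simp [exec, h6, hr, hdr, hW]
    · simp [exec, h6, hr, code_inj, hdr]
      exact h2 d ⟨hd, hdr⟩ (hT.inner d hd).1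
  · have := hT.le
    omega

end PlaneGraph

/-! ### The program: the selection of tree edges -/

open RamProgram

namespace PlaneGraph

/-! ### Representants of the parts of the search tree -/

namespace SearchTree

variable {V : Type*} [Finite V] {M : PlaneGraph V} {T : M.SearchTree} {P Q : Set M.G.Dart}

open Classical in
/-- The first ancestor of `x` that is the root or not in `P`. -/
noncomputable def rep (T : M.SearchTree) (P : Set M.G.Dart) (x : M.G.Dart) : M.G.Dart :=
  if _h : x ∈ P ∧ T.Node x then T.rep P (T.par x) else x
termination_by T.idx x
decreasing_by exact T.idx_lt _ _h.2.1 _h.2.2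

theorem rep_of_mem {x : M.G.Dart} (h : x ∈ P) (hx : T.Node x) : T.rep P x = T.rep P (T.par x) := by
  rw [rep, dif_pos ⟨h, hx⟩]

theorem rep_of_notMem {x : M.G.Dart} (h : ¬ (x ∈ P ∧ T.Node x)) : T.rep P x = x := by
  rw [rep, dif_neg h]

theorem rep_induction {p : M.G.Dart → Prop} (h1 : ∀ x, ¬ (x ∈ P ∧ T.Node x) → p x)
    (h2 : ∀ x, x ∈ P → T.Node x → p (T.par x) → p x) (x : M.G.Dart) : p x := by
  induction h : T.idx x using Nat.strong_induction_on generalizing x with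
  | _ k ih =>
    by_cases hx : x ∈ P ∧ T.Node x
    · exact h2 x hx.1 hx.2 (ih _ (h ▸ T.idx_lt x hx.2.1 hx.2.2) _ rfl)
    · exact h1 x hx

theorem joined_rep (x : M.G.Dart) : T.Joined P x (T.rep P x) := by
  refine rep_induction (p := fun x => T.Joined P x (T.rep P x)) (P := P) (T := T) (fun x hx => ?_) (fun x h hx ih => ?_) x
  · rw [rep_of_notMem hx]; exact (Joined.equivalence _).refl _
  · rw [rep_of_mem h hx]; exact (Joined.equivalence _).trans (Joined.step hx h) ih

theorem rep_notMem (x : M.G.Dart) : ¬ (T.rep P x ∈ P ∧ T.Node (T.rep P x)) := by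
  refine rep_induction (p := fun x => ¬ (T.rep P x ∈ P ∧ T.Node (T.rep P x))) (P := P) (T := T) (fun x hx => ?_) (fun x h hx ih => ?_) x
  · rwa [rep_of_notMem hx]
  · rwa [rep_of_mem h hx]

theorem joined_iff_rep {x y : M.G.Dart} : T.Joined P x y ↔ T.rep P x = T.rep P y := by
  constructor
  · intro h
    exact h.lift (fun x y => T.rep P x = T.rep P y) ⟨fun _ => rfl, Eq.symm, Eq.trans⟩
      fun a ha h => rep_of_mem h ha
  · intro h
    have h1 := joined_rep (T := T) (P := P) x
    rw [h] at h1
    exact (Joined.equivalence _).trans h1 ((Joined.equivalence _).symm (joined_rep y))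

theorem rep_congr (h : ∀ x, T.Node x → (x ∈ P ↔ x ∈ Q)) (x : M.G.Dart) : T.rep P x = T.rep Q x := by
  refine rep_induction (p := fun x => T.rep P x = T.rep Q x) (P := P) (T := T) (fun x hx => ?_) (fun x hP hx ih => ?_) x
  · rw [rep_of_notMem hx, rep_of_notMem fun h' => hx ⟨(h x h'.2).2 h'.1, h'.2⟩]
  · rw [rep_of_mem hP hx, rep_of_mem ((h x hx).1 hP) hx, ih]

/-- The part of `r` contains a dart whose tail is higher than an edge of weight `w`. -/
def High (T : M.SearchTree) (w : ℕ) (P : Set M.G.Dart) (r : M.G.Dart) : Prop :=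
  ∃ x, T.Joined P x r ∧ w < 2 * M.height x.fst

theorem high_congr {w : ℕ} {x y : M.G.Dart} (h : T.Joined P x y) : T.High w P x ↔ T.High w P y :=
  ⟨fun ⟨z, h1, h2⟩ => ⟨z, (Joined.equivalence _).trans h1 h, h2⟩,
    fun ⟨z, h1, h2⟩ => ⟨z, (Joined.equivalence _).trans h1 ((Joined.equivalence _).symm h), h2⟩⟩

theorem high_congr_set {w : ℕ} (h : ∀ x, T.Node x → (x ∈ P ↔ x ∈ Q)) (r : M.G.Dart) :
    T.High w P r ↔ T.High w Q r := by
  simp only [High, joined_iff_rep, rep_congr h]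

/-- Inserting `a` hangs its part below the part of its parent. Then `a` ceases to be a representant,
and among the others only the one of the parent's part can become high. -/
theorem high_insert {w : ℕ} {a r : M.G.Dart} (ha : T.Node a) (haP : a ∉ P)
    (hr : T.rep (insert a P) r = r) :
    T.High w (insert a P) r ↔ T.High w P r ∨ (r = T.rep P (T.par a) ∧ T.High w P a) := by
  have hrP : T.rep P r = r := by
    refine rep_of_notMem fun h => ?_
    have := rep_notMem (T := T) (P := insert a P) r
    rw [hr] at this
    exact this ⟨Or.inr h.1, h.2⟩
  have hE := Joined.equivalence (T := T) (insert a P)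
  constructor
  · rintro ⟨x, h1, h2⟩
    rcases joined_insert h1 with h | h | h
    · exact Or.inl ⟨x, h, h2⟩
    · refine Or.inr ⟨?_, x, h.1, h2⟩
      rw [joined_iff_rep.1 h.2, hrP]
    · have h3 := joined_iff_rep.1 h.2
      rw [hrP, rep_of_notMem fun h => haP h.1] at h3
      have := rep_notMem (T := T) (P := insert a P) r
      rw [hr, ← h3] at this
      exact absurd ⟨Set.mem_insert _ _, ha⟩ this
  · rintro (⟨x, h1, h2⟩ | ⟨rfl, x, h1, h2⟩)
    · exact ⟨x, h1.mono (Set.subset_insert _ _), h2⟩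
    · refine ⟨x, hE.trans (h1.mono (Set.subset_insert _ _)) (hE.trans
        (Joined.step ha (Set.mem_insert _ _)) ((joined_rep _).mono (Set.subset_insert _ _))), h2⟩

/-- The nodes of weight more than `w`, and those of weight `w` with an index of at least `i`. -/
def Above (T : M.SearchTree) (wt : M.G.Dart → ℕ) (w i : ℕ) : Set M.G.Dart :=
  {b | w < wt b ∨ (wt b = w ∧ i ≤ T.idx b)}

/-- The edges that join two parts that both contain a high dart. -/
def Chosen (T : M.SearchTree) (wt : M.G.Dart → ℕ) (top : ℕ) (a : M.G.Dart) : Prop :=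
  T.Node a ∧ wt a < top ∧ T.High (wt a) (T.Above wt (wt a) (T.idx a + 1)) a ∧
    T.High (wt a) (T.Above wt (wt a) (T.idx a + 1)) (T.par a)

end SearchTree

variable {n m l : ℕ} {M : PlaneGraph (Fin n)}

/-- The representants of the parts that result from the edges of weight more than `w`, where `w` is in
register 23 (array 25). -/
def progReps : RamProgram :=
  forUp 9 21 (load 10 20 9 ;; load 11 24 10 ;; load 12 21 10 ;; load 12 25 12 ;; store 26 10 6 ;;
    ite 23 11 (store 25 10 12) (store 25 10 10))

/-- The parts that contain a high dart are marked at their representant (array 26). -/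
def progMarks : RamProgram :=
  forUp 9 21 (load 10 20 9 ;; load 11 1 10 ;; load 11 9 11 ;;
    ite 23 11 (load 12 25 10 ;; store 26 12 7) (nop 13))

/-- The edges of weight `w` are processed; the selected edges are marked in array 27. -/
def progMerge : RamProgram :=
  forDown 9 21 6 (load 10 20 9 ;; load 11 24 10 ;;
    ifEq 11 23 (load 12 26 10 ;; ite 6 12 (load 13 21 10 ;; load 13 25 13 ;; load 14 26 13 ;;
      ite 6 14 (store 27 10 7) (store 26 13 7)) (nop 15)) (nop 15))

/-- The selection of edges. -/
def progSelect : RamProgram := forDown 23 20 7 (progReps ;; progMarks ;; progMerge)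

section

variable {dart : M.G.Dart ≃ Fin m} {s : RamState} {T : M.SearchTree} {wt : M.G.Dart → ℕ} {w : ℕ}

theorem HasTree.idx_lt_succ (hT : HasTree T dart s) {d x : M.G.Dart} (hd : ¬ M.OuterDart d)
    (hx : ¬ M.OuterDart x) : T.idx x < T.idx d + 1 ↔ T.idx x < T.idx d ∨ x = d := by
  constructor
  · intro h
    rcases Nat.lt_succ_iff_lt_or_eq.1 h with h | h
    · exact Or.inl h
    · exact Or.inr (hT.idx_inj hx hd h)
  · rintro (h | rfl) <;> omega

theorem halts_progReps (h : Given dart s) (hT : HasTree T dart s)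
    (hwt : ∀ d, ¬ M.OuterDart d → s.arr 24 (dart d) = wt d) (hroot : wt T.root = 0)
    (h23 : s.reg 23 = w) :
    Halts progReps s (9 * m + 2) fun s' =>
      ∀ d, ¬ M.OuterDart d → s'.arr 25 (dart d) = dart (T.rep {b | w < wt b} d) ∧
        s'.arr 26 (dart d) = 0 := by
  refine (Halts.forUp (c := 7) (I := fun j s' => ∀ d, ¬ M.OuterDart d → T.idx d < j →
    s'.arr 25 (dart d) = dart (T.rep {b | w < wt b} d) ∧ s'.arr 26 (dart d) = 0)
    (by decide) (by decide) (by simp) ?_).mono ?_ ?_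
  · rintro j hj s' hf hi hI
    obtain ⟨d, hd, rfl, hq⟩ := hT.queue j hj
    have h' := h.frame hf (by decide) (by decide)
    have hT' := hT.frame (hf.1 21 (by decide)) (hf.2 20 (by decide)) (hf.2 21 (by decide))
    have hq' := (hT'.inner d hd).2
    have hw' : s'.arr 24 (dart d) = wt d := by rw [hf.2 24 (by decide)]; exact hwt d hd
    have h23' : s'.reg 23 = w := by rw [hf.1 23 (by decide), h23]
    refine Halts.straight_le rfl (by decide) ?_
    intro x hx hxi
    rw [hT.idx_lt_succ hd hx] at hxi
    by_cases hlt : w < wt d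
    · have hn : T.Node d := ⟨hd, by rintro rfl; omega⟩
      have hp := hT'.par d hn
      have hIp := (hI _ (T.inner_par d hn.1 hn.2) (T.idx_lt d hn.1 hn.2)).1
      by_cases hxd : x = d
      · subst hxd
        simp [exec, hi, hq', hw', h23', hlt, h'.zero, hp, hIp]
        rw [← SearchTree.rep_of_mem (P := {b | w < wt b}) hlt hn]
      · simpa [exec, hi, hq', hw', h23', hlt, h'.zero, code_inj, hxd] using
          hI x hx (hxi.resolve_right hxd)
    · by_cases hxd : x = d
      · subst hxd
        simp [exec, hi, hq', hw', h23', hlt, h'.zero]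
        rw [SearchTree.rep_of_notMem (P := {b | w < wt b}) fun h => hlt h.1]
      · simpa [exec, hi, hq', hw', h23', hlt, h'.zero, code_inj, hxd] using
          hI x hx (hxi.resolve_right hxd)
  · have := hT.le
    omega
  · exact fun s' hs d hd => hs.1 d hd (hT.inner d hd).1

open Classical in
theorem halts_progMarks (h : Given dart s) (hT : HasTree T dart s)
    (hH : ∀ v : Fin n, s.arr 9 v = 2 * M.height v) (h23 : s.reg 23 = w) {P : Set M.G.Dart}
    (hrep : ∀ d, ¬ M.OuterDart d → s.arr 25 (dart d) = dart (T.rep P d))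
    (h0 : ∀ d, ¬ M.OuterDart d → s.arr 26 (dart d) = 0) :
    Halts progMarks s (8 * m + 2) fun s' => ∀ r, ¬ M.OuterDart r → T.rep P r = r →
      s'.arr 26 (dart r) = if T.High w P r then 1 else 0 := by
  refine (Halts.forUp (c := 6) (I := fun j s' => ∀ r, ¬ M.OuterDart r →
    s'.arr 26 (dart r) = if ∃ x, ¬ M.OuterDart x ∧ T.idx x < j ∧ T.rep P x = r ∧
      w < 2 * M.height x.fst then 1 else 0) (by decide) (by decide) (by simpa using h0) ?_).mono ?_ ?_
  · rintro j hj s' hf hi hI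
    obtain ⟨d, hd, rfl, hq⟩ := hT.queue j hj
    have h' := h.frame hf (by decide) (by decide)
    have hT' := hT.frame (hf.1 21 (by decide)) (hf.2 20 (by decide)) (hf.2 21 (by decide))
    have hq' := (hT'.inner d hd).2
    have hH' : ∀ v : Fin n, s'.arr 9 v = 2 * M.height v := by rw [hf.2 9 (by decide)]; exact hH
    have hrep' : s'.arr 25 (dart d) = dart (T.rep P d) := by rw [hf.2 25 (by decide)]; exact hrep d hd
    have h23' : s'.reg 23 = w := by rw [hf.1 23 (by decide), h23]
    have hex : ∀ r, (∃ x, ¬ M.OuterDart x ∧ T.idx x < T.idx d + 1 ∧ T.rep P x = r ∧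
        w < 2 * M.height x.fst) ↔ (∃ x, ¬ M.OuterDart x ∧ T.idx x < T.idx d ∧ T.rep P x = r ∧
        w < 2 * M.height x.fst) ∨ (r = T.rep P d ∧ w < 2 * M.height d.fst) := by
      intro r
      constructor
      · rintro ⟨x, h1, h2, h3, h4⟩
        rcases (hT.idx_lt_succ hd h1).1 h2 with h2 | rfl
        · exact Or.inl ⟨x, h1, h2, h3, h4⟩
        · exact Or.inr ⟨h3.symm, h4⟩
      · rintro (⟨x, h1, h2, h3, h4⟩ | ⟨h3, h4⟩)
        · exact ⟨x, h1, by omega, h3, h4⟩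
        · exact ⟨d, hd, by omega, h3.symm, h4⟩
    refine Halts.straight_le rfl (by decide) ?_
    intro r hr
    simp only [hex]
    by_cases hlt : w < 2 * M.height d.fst
    · by_cases hrd : r = T.rep P d
      · simp [exec, hi, hq', h'.tail, hH', h23', hlt, h'.one, hrep', hrd]
      · simpa [exec, hi, hq', h'.tail, hH', h23', hlt, h'.one, hrep', hrd, code_inj] using hI r hr
    · simpa [exec, hi, hq', h'.tail, hH', h23', hlt, nop] using hI r hr
  · have := hT.le
    omega
  · intro s' hs r hr hrr
    rw [hs.1 r hr]
    congr 1
    apply propext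
    constructor
    · rintro ⟨x, h1, h2, h3, h4⟩
      refine ⟨x, SearchTree.joined_iff_rep.2 (by rw [h3, hrr]), h4⟩
    · rintro ⟨x, h1, h2⟩
      have hx : ¬ M.OuterDart x := fun h => hr (h1.inner_iff.1 h)
      exact ⟨x, hx, (hT.inner x hx).1, by rw [SearchTree.joined_iff_rep.1 h1, hrr], h2⟩

theorem above_succ_iff (hT : HasTree T dart s) {a : M.G.Dart} (ha : ¬ M.OuterDart a) (x : M.G.Dart)
    (hx : T.Node x) : x ∈ T.Above wt w (T.idx a) ↔
      x ∈ T.Above wt w (T.idx a + 1) ∨ (x = a ∧ wt a = w) := by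
  constructor
  · rintro (h | ⟨h, h'⟩)
    · exact Or.inl (Or.inl h)
    · by_cases hxa : x = a
      · exact Or.inr ⟨hxa, hxa ▸ h⟩
      · have : T.idx x ≠ T.idx a := fun e => hxa (hT.idx_inj hx.1 ha e)
        exact Or.inl (Or.inr ⟨h, by omega⟩)
  · rintro ((h | ⟨h, h'⟩) | ⟨rfl, h⟩)
    · exact Or.inl h
    · exact Or.inr ⟨h, by omega⟩
    · exact Or.inr ⟨h, le_rfl⟩

/-- Steps of equal weight are processed by decreasing index, and ancestors have smaller indices.
Therefore no step of weight `w` above `a` has been processed before `a`, and the representants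
computed at the beginning of the weight are still correct where they are used. -/
theorem rep_above_par (a : M.G.Dart) (ha : T.Node a) :
    T.rep (T.Above wt w (T.idx a + 1)) (T.par a) = T.rep {b | w < wt b} (T.par a) := by
  have key : ∀ x, T.idx x ≤ T.idx a →
      T.rep (T.Above wt w (T.idx a + 1)) x = T.rep {b | w < wt b} x := by
    intro x
    refine SearchTree.rep_induction (p := fun x => T.idx x ≤ T.idx a →
      T.rep (T.Above wt w (T.idx a + 1)) x = T.rep {b | w < wt b} x) (P := {b | w < wt b}) (T := T) (fun x hx hi => ?_)
      (fun x hP hx ih hi => ?_) x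
    · rw [SearchTree.rep_of_notMem hx, SearchTree.rep_of_notMem]
      rintro ⟨h | h, hn⟩
      · exact hx ⟨h, hn⟩
      · omega
    · rw [SearchTree.rep_of_mem hP hx, SearchTree.rep_of_mem (Or.inl hP) hx]
      exact ih ((T.idx_lt x hx.1 hx.2).le.trans hi)
  exact key _ (T.idx_lt a ha.1 ha.2).le

-- Marks must be correct at current representants only. If the parts of `a` and of its parent are
-- both high, `a` is selected and the mark of the parent's part remains; if only that of `a` is
-- high, the mark is passed on to the representant `c` of the parent's part. The parts count as
-- joined in every case, also across a selected edge.
open Classical in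
theorem halts_progMerge (h : Given dart s) (hT : HasTree T dart s) {top : ℕ}
    (hwt : ∀ d, ¬ M.OuterDart d → s.arr 24 (dart d) = wt d) (hroot : wt T.root = 0)
    (h23 : s.reg 23 = w) (hw1 : 1 ≤ w) (hwtop : w < top)
    (hrep : ∀ d, ¬ M.OuterDart d → s.arr 25 (dart d) = dart (T.rep {b | w < wt b} d))
    (hfl : ∀ r, ¬ M.OuterDart r → T.rep {b | w < wt b} r = r →
      s.arr 26 (dart r) = if T.High w {b | w < wt b} r then 1 else 0)
    (hsel : ∀ d, ¬ M.OuterDart d →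
      s.arr 27 (dart d) = if T.Chosen wt top d ∧ w < wt d then 1 else 0) :
    Halts progMerge s (14 * m + 2) fun s' => ∀ d, ¬ M.OuterDart d →
      s'.arr 27 (dart d) = if T.Chosen wt top d ∧ w ≤ wt d then 1 else 0 := by
  refine (Halts.forDown (c := 12) (I := fun j s' =>
    (∀ r, ¬ M.OuterDart r → T.rep (T.Above wt w j) r = r →
      s'.arr 26 (dart r) = if T.High w (T.Above wt w j) r then 1 else 0) ∧
    ∀ d, ¬ M.OuterDart d → s'.arr 27 (dart d) =
      if T.Chosen wt top d ∧ d ∈ T.Above wt w j then 1 else 0)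
    (by decide) (by decide) ?_ ?_).mono ?_ ?_
  · have hab : ∀ x, ¬ M.OuterDart x → (x ∈ T.Above wt w (s.reg 21) ↔ x ∈ {b | w < wt b}) := by
      intro x hx
      have := (hT.inner x hx).1
      refine ⟨fun h => h.resolve_right fun h => by omega, Or.inl⟩
    have hab' : ∀ x, T.Node x → (x ∈ T.Above wt w (s.reg 21) ↔ x ∈ {b | w < wt b}) :=
      fun x hx => hab x hx.1
    simp only [SearchTree.rep_congr hab', SearchTree.high_congr_set hab', RamState.arr_setReg]
    refine ⟨hfl, fun d hd => ?_⟩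
    rw [hsel d hd, hab d hd]
    simp
  · rintro j - hj s' hf hi ⟨hI1, hI2⟩
    obtain ⟨a, ha, rfl, hq⟩ := hT.queue j hj
    have h' := h.frame hf (by decide) (by decide)
    have hT' := hT.frame (hf.1 21 (by decide)) (hf.2 20 (by decide)) (hf.2 21 (by decide))
    have hq' := (hT'.inner a ha).2
    have hw' : s'.arr 24 (dart a) = wt a := by rw [hf.2 24 (by decide)]; exact hwt a ha
    have h23' : s'.reg 23 = w := by rw [hf.1 23 (by decide), h23]
    simp only [RamState.arr_setReg] at hI1 hI2
    refine Halts.straight_le rfl (by decide) ?_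
    by_cases hwa : wt a = w
    · have hn : T.Node a := ⟨ha, by rintro rfl; omega⟩
      have hab : ∀ x, T.Node x → (x ∈ T.Above wt w (T.idx a) ↔
          x ∈ insert a (T.Above wt w (T.idx a + 1))) := by
        intro x hx
        rw [above_succ_iff hT ha x hx, Set.mem_insert_iff, or_comm, and_iff_left hwa]
      have haQ : a ∉ T.Above wt w (T.idx a + 1) := by
        rintro (h | h) <;> omega
      have hra : T.rep (T.Above wt w (T.idx a + 1)) a = a :=
        SearchTree.rep_of_notMem fun h => haQ h.1
      have hp := hT'.par a hn
      have hip := T.inner_par a hn.1 hn.2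
      set c := T.rep (T.Above wt w (T.idx a + 1)) (T.par a) with hc
      have hrep' : s'.arr 25 (dart (T.par a)) = dart c := by
        rw [hf.2 25 (by decide), hrep _ hip, hc, rep_above_par a hn]
      have hjc : T.Joined (T.Above wt w (T.idx a + 1)) (T.par a) c := SearchTree.joined_rep _
      have hrc : T.rep (T.Above wt w (T.idx a + 1)) c = c := by
        rw [← SearchTree.joined_iff_rep.1 hjc]
      have hic : ¬ M.OuterDart c := fun h => hip (hjc.inner_iff.2 h)
      have hfa := hI1 a ha hra
      have hfc := hI1 c hic hrc
      have hch : T.Chosen wt top a ↔ T.High w (T.Above wt w (T.idx a + 1)) a ∧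
          T.High w (T.Above wt w (T.idx a + 1)) c := by
        rw [SearchTree.Chosen, hwa, SearchTree.high_congr hjc]
        exact ⟨fun h => h.2.2, fun h => ⟨hn, hwtop, h⟩⟩
      have hreps : ∀ r, T.rep (insert a (T.Above wt w (T.idx a + 1))) r = r → r ≠ a ∧
          T.rep (T.Above wt w (T.idx a + 1)) r = r := by
        intro r hr
        have := SearchTree.rep_notMem (T := T) (P := insert a (T.Above wt w (T.idx a + 1))) r
        rw [hr] at this
        exact ⟨fun e => this ⟨Or.inl e, e ▸ hn⟩,
          SearchTree.rep_of_notMem fun h => this ⟨Or.inr h.1, h.2⟩⟩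
      have hselx : ∀ x, ¬ M.OuterDart x → x ≠ a → s'.arr 27 (dart x) =
          if T.Chosen wt top x ∧ x ∈ T.Above wt w (T.idx a) then 1 else 0 := by
        intro x hx hxa
        rw [hI2 x hx]
        congr 1
        apply propext
        refine and_congr_right fun hcx => ?_
        rw [above_succ_iff hT ha x hcx.1]
        simp [hxa]
      have haI : a ∈ T.Above wt w (T.idx a) := Or.inr ⟨hwa, le_rfl⟩
      have hsa : s'.arr 27 (dart a) = 0 := by
        rw [hI2 a ha, if_neg fun h => haQ h.2]
      have hfin : ∀ r, ¬ M.OuterDart r → T.rep (T.Above wt w (T.idx a)) r = r →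
          s'.arr 26 (dart r) = (if T.High w (T.Above wt w (T.idx a + 1)) r then 1 else 0) ∧
          (T.High w (T.Above wt w (T.idx a)) r ↔ T.High w (T.Above wt w (T.idx a + 1)) r ∨
            (r = c ∧ T.High w (T.Above wt w (T.idx a + 1)) a)) := by
        intro r hr hrr
        rw [SearchTree.rep_congr hab] at hrr
        exact ⟨hI1 r hr (hreps r hrr).2,
          by rw [SearchTree.high_congr_set hab, SearchTree.high_insert hn haQ hrr]⟩
      by_cases h1 : T.High w (T.Above wt w (T.idx a + 1)) a
      · by_cases h2 : T.High w (T.Above wt w (T.idx a + 1)) c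
        · rw [if_pos h1] at hfa
          rw [if_pos h2] at hfc
          simp [exec, ifEq, hi, hq', hw', hwa, h23', h'.zero, hfa, hp, hrep', hfc, h'.one]
          refine ⟨fun r hr hrr => ?_, fun x hx => ?_⟩
          · rw [(hfin r hr hrr).1]
            congr 1
            apply propext
            rw [(hfin r hr hrr).2]
            refine ⟨Or.inl, ?_⟩
            rintro (h | ⟨rfl, -⟩)
            · exact h
            · exact h2
          · by_cases hxa : x = a
            · subst hxa
              simp [hch, h1, h2, haI]
            · simpa [code_inj, hxa] using hselx x hx hxa
        · rw [if_pos h1] at hfa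
          rw [if_neg h2] at hfc
          simp [exec, ifEq, hi, hq', hw', hwa, h23', h'.zero, hfa, hp, hrep', hfc, h'.one]
          refine ⟨fun r hr hrr => ?_, fun x hx => ?_⟩
          · have := hfin r hr hrr
            rw [this.1]
            by_cases hrc' : r = c
            · rw [if_pos (by rw [hrc']), if_pos (this.2.2 (Or.inr ⟨hrc', h1⟩))]
            · rw [if_neg (by rwa [code_inj])]
              congr 1
              apply propext
              rw [this.2]
              simp [hrc']
          · by_cases hxa : x = a
            · subst hxa
              simp [hch, h2, hsa]
            · exact hselx x hx hxa
      · rw [if_neg h1] at hfa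
        simp [exec, ifEq, hi, hq', hw', hwa, h23', h'.zero, hfa, nop]
        refine ⟨fun r hr hrr => ?_, fun x hx => ?_⟩
        · rw [(hfin r hr hrr).1]
          congr 1
          apply propext
          rw [(hfin r hr hrr).2]
          simp [h1]
        · by_cases hxa : x = a
          · subst hxa
            simp [hch, h1, hsa]
          · exact hselx x hx hxa
    · have hab : ∀ x, T.Node x → (x ∈ T.Above wt w (T.idx a) ↔ x ∈ T.Above wt w (T.idx a + 1)) := by
        intro x hx
        rw [above_succ_iff hT ha x hx]
        simp [hwa]
      have key : (∀ r, ¬ M.OuterDart r → T.rep (T.Above wt w (T.idx a)) r = r →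
            s'.arr 26 (dart r) = if T.High w (T.Above wt w (T.idx a)) r then 1 else 0) ∧
          ∀ d, ¬ M.OuterDart d → s'.arr 27 (dart d) =
            if T.Chosen wt top d ∧ d ∈ T.Above wt w (T.idx a) then 1 else 0 := by
        simp only [SearchTree.rep_congr hab, SearchTree.high_congr_set hab]
        refine ⟨hI1, fun x hx => ?_⟩
        rw [hI2 x hx]
        congr 1
        apply propext
        exact and_congr_right fun hcx => (hab x hcx.1).symm
      rcases lt_or_gt_of_ne hwa with e | e
      · simpa [exec, ifEq, hi, hq', hw', h23', e, nop] using key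
      · simpa [exec, ifEq, hi, hq', hw', h23', e, e.not_gt, nop] using key
  · have := hT.le
    omega
  · rintro s' ⟨⟨j, ⟨hI1, hI2⟩, hj, -⟩, -⟩ d hd
    rw [h.zero] at hj
    rw [hI2 d hd]
    congr 1
    apply propext
    refine and_congr_right fun _ => ⟨?_, fun h => ?_⟩
    · rintro (h | h) <;> omega
    · rcases h.lt_or_eq with h | h
      · exact Or.inl h
      · exact Or.inr ⟨h.symm, by omega⟩

-- Weights run from `top - 1` down to 1, with three linear sweeps for each. Steps of weight `top`
-- are never candidates and belong to all sets of heavier steps; the root has weight 0 and is never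
-- processed.
open Classical in
theorem halts_progSelect (h : Given dart s) (hT : HasTree T dart s)
    (hH : ∀ v : Fin n, s.arr 9 v = 2 * M.height v) (hwt : IsWeighting T (s.reg 20) wt)
    (hpw : ∀ d, ¬ M.OuterDart d → s.arr 24 (dart d) = wt d) (h27 : ∀ i, s.arr 27 i = 0) :
    Halts progSelect s ((31 * m + 8) * s.reg 20 + 2) fun s' => ∀ d, ¬ M.OuterDart d →
      s'.arr 27 (dart d) = if T.Chosen wt (s.reg 20) d then 1 else 0 := by
  have hch : ∀ d, T.Chosen wt (s.reg 20) d → 1 ≤ wt d ∧ wt d < s.reg 20 :=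
    fun d hd => ⟨hwt.one_le d hd.1, hd.2.1⟩
  refine (Halts.forDown (c := 31 * m + 6) (I := fun j s' => ∀ d, ¬ M.OuterDart d →
    s'.arr 27 (dart d) = if T.Chosen wt (s.reg 20) d ∧ j ≤ wt d then 1 else 0)
    (by decide) (by decide) ?_ ?_).mono le_rfl ?_
  · intro d hd
    rw [if_neg fun hn => (hch d hn.1).2.not_ge hn.2]
    exact h27 _
  · rintro j hj1 hj s₀ f0 hi hI
    rw [h.one] at hj1
    have h0 := h.frame f0 (by decide) (by decide)
    have hT0 := hT.frame (f0.1 21 (by decide)) (f0.2 20 (by decide)) (f0.2 21 (by decide))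
    refine (halts_progReps h0 hT0 (w := j) (wt := wt) (by rw [f0.2 24 (by decide)]; exact hpw)
      hwt.root hi).andThen (t' := 22 * m + 4) (fun s₁ a1 f1 => ?_) (by omega)
    have h1 := h0.frame f1 (by decide) (by decide)
    have hT1 := hT0.frame (f1.1 21 (by decide)) (f1.2 20 (by decide)) (f1.2 21 (by decide))
    refine (halts_progMarks h1 hT1 (w := j) (P := {b | j < wt b}) ?_ ?_ (fun d hd => (a1 d hd).1)
      fun d hd => (a1 d hd).2).andThen (t' := 14 * m + 2) (fun s₂ a2 f2 => ?_) (by omega)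
    · rw [f1.2 9 (by decide), f0.2 9 (by decide)]; exact hH
    · rw [f1.1 23 (by decide), hi]
    have h2 := h1.frame f2 (by decide) (by decide)
    have hT2 := hT1.frame (f2.1 21 (by decide)) (f2.2 20 (by decide)) (f2.2 21 (by decide))
    refine halts_progMerge h2 hT2 ?_ hwt.root ?_ hj1 hj ?_ a2 ?_
    · rw [f2.2 24 (by decide), f1.2 24 (by decide), f0.2 24 (by decide)]; exact hpw
    · rw [f2.1 23 (by decide), f1.1 23 (by decide), hi]
    · rw [f2.2 25 (by decide)]; exact fun d hd => (a1 d hd).1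
    · rw [f2.2 27 (by decide), f1.2 27 (by decide)]; exact hI
  · rintro s' ⟨⟨j, hI, hj, -⟩, -⟩ d hd
    rw [h.one] at hj
    rw [hI d hd]
    congr 1
    apply propext
    exact ⟨fun h => h.1, fun h => ⟨h, hj.trans (hch d h).1⟩⟩

end

end PlaneGraph

/-! ### The program: the mountain connection tree -/

open RamProgram

namespace PlaneGraph

variable {n m l : ℕ} {M : PlaneGraph (Fin n)}

/-- The lexicographic order by decreasing first and decreasing second entry, written as one number:
the second summand is at most `N`. -/
theorem key_lt_iff {N t x y i j : ℕ} (hx : x ≤ t) (hy : y ≤ t) (hi : i ≤ N) (hj : j ≤ N) :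
    (t - x) * (N + 1) + (N - i) < (t - y) * (N + 1) + (N - j) ↔ y < x ∨ (x = y ∧ j < i) := by
  rcases lt_trichotomy x y with h | rfl | h
  · have : (t - y + 1) * (N + 1) ≤ (t - x) * (N + 1) := Nat.mul_le_mul_right _ (by omega)
    rw [Nat.add_mul] at this
    omega
  · omega
  · have : (t - x + 1) * (N + 1) ≤ (t - y) * (N + 1) := Nat.mul_le_mul_right _ (by omega)
    rw [Nat.add_mul] at this
    omega

/-- The processing order of the program, by decreasing weight and then decreasing index, expressed
by a single key. On nodes, the steps with a smaller key than `a` are those of `Above` at the weight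
of `a` and the index after `a`. -/
theorem exists_selection {dart : M.G.Dart ≃ Fin m} {s : RamState} {T : M.SearchTree}
    (hT : HasTree T dart s) {top : ℕ} {wt : M.G.Dart → ℕ} (hwt : IsWeighting T top wt)
    (htop : ∀ v, 2 * M.height v + 1 < top) :
    ∃ D : M.Selection, D.toSearchTree = T ∧ D.sel = {a | T.Chosen wt top a} := by
  have hi : ∀ a, T.Node a → T.idx a ≤ m := fun a ha => ((hT.inner a ha.1).1.trans_le hT.le).le
  have hkey : ∀ a b, T.Node a → T.Node b → ((top - wt a) * (m + 1) + (m - T.idx a) <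
      (top - wt b) * (m + 1) + (m - T.idx b) ↔ wt b < wt a ∨ (wt a = wt b ∧ T.idx b < T.idx a)) :=
    fun a b ha hb => key_lt_iff (hwt.le_top a ha) (hwt.le_top b hb) (hi a ha) (hi b hb)
  refine ⟨{ T with
    key := fun a => (top - wt a) * (m + 1) + (m - T.idx a)
    wt := wt
    top := top
    sel := {a | T.Chosen wt top a}
    key_inj := fun a b ha hb hab => ?_
    wt_anti := fun a b ha hb hab => ?_
    wt_of_not_cross := hwt.not_cross
    wt_horizontal := hwt.horizontal
    wt_slanted := hwt.slanted
    lt_top := htop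
    mem_sel := fun a => ?_ }, rfl, rfl⟩
  · have h1 := hkey a b ha hb
    have h2 := hkey b a hb ha
    rw [hab] at h1 h2
    simp only [lt_irrefl, false_iff] at h1 h2
    exact hT.idx_inj ha.1 hb.1 (by omega)
  · have h1 := hkey b a hb ha
    by_contra h
    have := h1.2 (Or.inl (not_le.1 h))
    omega
  · refine and_congr_right fun ha => and_congr_right fun _ => ?_
    have hab : ∀ x, T.Node x → (x ∈ T.Above wt (wt a) (T.idx a + 1) ↔
        x ∈ {b | (top - wt b) * (m + 1) + (m - T.idx b) <
          (top - wt a) * (m + 1) + (m - T.idx a)}) :=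
      fun x hx => (hkey x a hx ha).symm
    rw [SearchTree.high_congr_set hab, SearchTree.high_congr_set hab]
    rfl

/-- The nodes of the darts (array 6), the number of nodes (register 4), the number of edges
(register 5), and the edges (arrays 7 and 8). -/
def progNodes : RamProgram :=
  const 4 1 ;; const 5 0 ;; forUp 9 21 (load 10 20 9 ;; load 11 27 10 ;;
    ite 9 7 (store 6 10 6) (load 12 21 10 ;; load 12 6 12 ;;
      ite 6 11 (store 6 10 4 ;; store 7 5 4 ;; store 8 5 12 ;; succ 4 ;; succ 5) (store 6 10 12)))

/-- The nodes and the edges for the nodes of the search tree with an index less than `i`. -/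
structure HasNodes (T : M.SearchTree) (S : Set M.G.Dart) (dart : M.G.Dart ≃ Fin m) (i : ℕ)
    (s : RamState) : Prop where
  reg : s.reg 4 = s.reg 5 + 1
  root : 0 < i → s.arr 6 (dart T.root) = 0
  lt : ∀ x, ¬ M.OuterDart x → T.idx x < i → s.arr 6 (dart x) < s.reg 4
  step : ∀ a, T.Node a → T.idx a < i → a ∉ S → s.arr 6 (dart a) = s.arr 6 (dart (T.par a))
  joined : ∀ x y, ¬ M.OuterDart x → ¬ M.OuterDart y → T.idx x < i → T.idx y < i →
    s.arr 6 (dart x) = s.arr 6 (dart y) → T.Joined Sᶜ x y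
  edge : ∀ a ∈ S, T.idx a < i → ∃ j < s.reg 5, s.arr 7 j = s.arr 6 (dart a) ∧
    s.arr 8 j = s.arr 6 (dart (T.par a))
  exists_edge : ∀ j < s.reg 5, s.arr 7 j = j + 1 ∧ s.arr 8 j ≤ j ∧ ∃ a ∈ S, T.idx a < i ∧
    s.arr 7 j = s.arr 6 (dart a) ∧ s.arr 8 j = s.arr 6 (dart (T.par a))

-- In the order of the queue the parent is numbered before its children. A selected step opens a new
-- node and an edge to the node of the parent; every other step inherits the node of the parent.
open Classical in
theorem halts_progNodes {dart : M.G.Dart ≃ Fin m} {s : RamState} (h : Given dart s)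
    {T : M.SearchTree} (hT : HasTree T dart s) {S : Set M.G.Dart} (hS : ∀ a ∈ S, T.Node a)
    (h27 : ∀ d, ¬ M.OuterDart d → s.arr 27 (dart d) = if d ∈ S then 1 else 0) :
    Halts progNodes s (13 * m + 4) (HasNodes T S dart (s.reg 21)) := by
  refine (Halts.straight (p := const 4 1) (s := s) (Q := fun s' => s' = s.setReg 4 1) rfl rfl).andThen
    (t' := 13 * m + 3) (fun s₁ e1 _ => (Halts.straight (p := const 5 0) (s := s₁)
      (Q := fun s' => s' = s₁.setReg 5 0) rfl rfl).andThen
    (t' := 13 * m + 2) (fun s₂ e2 _ => ?_) (by simp [cost]; omega)) (by simp [cost]; omega)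
  subst e1 e2
  have g2 : Given dart ((s.setReg 4 1).setReg 5 0) :=
    (h.frame (frame_of_runsIn (RunsIn.const s 4 1)) (by decide) (by decide)).frame
      (frame_of_runsIn (RunsIn.const _ 5 0)) (by decide) (by decide)
  have hT2 : HasTree T dart ((s.setReg 4 1).setReg 5 0) := hT.frame (by simp) rfl rfl
  refine (Halts.forUp (c := 11) (I := HasNodes T S dart) (by decide) (by decide) ?_ ?_).mono ?_ ?_
  · constructor <;> simp
  · rintro j hj s' hf hi hI
    obtain ⟨d, hd, rfl, hq⟩ := hT2.queue j hj
    have h' := g2.frame hf (by decide) (by decide)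
    have hT' := hT2.frame (hf.1 21 (by decide)) (hf.2 20 (by decide)) (hf.2 21 (by decide))
    have hq' := (hT'.inner d hd).2
    have h27' : s'.arr 27 (dart d) = if d ∈ S then 1 else 0 := by
      rw [hf.2 27 (by decide)]; exact h27 d hd
    have hlt := fun {x} hx => hT.idx_lt_succ (x := x) hd hx
    have hne : ∀ x, ¬ M.OuterDart x → T.idx x < T.idx d → x ≠ d := by
      rintro x - hxi rfl
      exact lt_irrefl _ hxi
    have hpar : ∀ x, T.Node x → T.idx x < T.idx d + 1 → T.par x ≠ d := by
      rintro x hx hxi hxd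
      have := T.idx_lt x hx.1 hx.2
      rw [hxd] at this
      omega
    refine Halts.straight_le rfl (by decide) ?_
    by_cases h0 : T.idx d = 0
    · have hdr : d = T.root := hT.idx_inj hd T.inner_root (h0.trans hT.idx_root.symm)
      have hnode : ∀ x, T.Node x → ¬ T.idx x < T.idx d + 1 := by
        intro x hx hxi
        exact hx.2 ((hT.idx_inj hx.1 hd (by omega)).trans hdr)
      have hall : ∀ x, ¬ M.OuterDart x → T.idx x < T.idx d + 1 → x = d := by
        intro x hx hxi
        exact ((hlt hx).1 hxi).resolve_left (by omega)
      refine ⟨?_, fun _ => ?_, fun x hx hxi => ?_, fun a ha hai => absurd hai (hnode a ha),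
        fun x y hx hy hxi hyi _ => ?_, fun a ha hai => absurd hai (hnode a (hS a ha)),
        fun j hj => ?_⟩
      · simpa [exec, hi, hq', h0, h'.one, h'.zero] using hI.reg
      · simp [exec, hi, hq', ← hdr, h0 ▸ hq', h0, h'.one, h'.zero]
      · obtain rfl := hall x hx hxi
        simp [exec, hi, h0 ▸ hq', h0, h'.one, h'.zero, hI.reg]
      · rw [hall x hx hxi, hall y hy hyi]
        exact (SearchTree.Joined.equivalence _).refl _
      · have : j < s'.reg 5 := by simpa [exec, hi, h0, h'.one] using hj
        obtain ⟨-, -, a, ha, hai, -⟩ := hI.exists_edge j this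
        exact absurd (Nat.lt_succ_of_lt hai) (hnode a (hS a ha))
    · have hn : T.Node d := ⟨hd, by rintro rfl; exact h0 hT.idx_root⟩
      have hp := hT'.par d hn
      have hip := T.inner_par d hn.1 hn.2
      have hpi := T.idx_lt d hn.1 hn.2
      have hr : T.root ≠ d := fun e => hn.2 e.symm
      have hE := SearchTree.Joined.equivalence (T := T) Sᶜ
      by_cases hdS : d ∈ S
      · have hfresh : ∀ x, ¬ M.OuterDart x → T.idx x < T.idx d → s'.arr 6 (dart x) ≠ s'.reg 4 :=
          fun x hx hxi => (hI.lt x hx hxi).ne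
        have hpne := hpar
        simp only [exec]
        simp [hi, hq', h0, h'.one, h'.zero, h27', hdS, hp]
        refine ⟨?_, fun _ => ?_, fun x hx hxi => ?_, fun a ha hai haS => ?_,
          fun x y hx hy hxi hyi hxy => ?_, fun a ha hai => ?_, fun j hj => ?_⟩
        · simpa using hI.reg
        · simpa [code_inj, hr] using hI.root (by omega)
        · by_cases hxd : x = d
          · simp [hxd]
          · have := hI.lt x hx (((hlt hx).1 hxi).resolve_right hxd)
            simp [code_inj, hxd]
            omega
        · have had : a ≠ d := by rintro rfl; exact haS hdS
          simpa [code_inj, had, hpar a ha hai] using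
            hI.step a ha (((hlt ha.1).1 hai).resolve_right had) haS
        · by_cases hxd : x = d <;> by_cases hyd : y = d
          · rw [hxd, hyd]; exact hE.refl _
          · simp [code_inj, hxd, hyd] at hxy
            exact absurd hxy.symm (hfresh y hy (((hlt hy).1 hyi).resolve_right hyd))
          · simp [code_inj, hxd, hyd] at hxy
            exact absurd hxy (hfresh x hx (((hlt hx).1 hxi).resolve_right hxd))
          · simp [code_inj, hxd, hyd] at hxy
            exact hI.joined x y hx hy (((hlt hx).1 hxi).resolve_right hxd)
              (((hlt hy).1 hyi).resolve_right hyd) hxy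
        · have haN := hS a ha
          by_cases had : a = d
          · subst had
            refine ⟨s'.reg 5, by simp, by simp, ?_⟩
            simp [code_inj, hpar a haN hai]
          · obtain ⟨j, h1, h2, h3⟩ := hI.edge a ha (((hlt haN.1).1 hai).resolve_right had)
            refine ⟨j, by simp; omega, ?_, ?_⟩
            · simpa [code_inj, had, h1.ne] using h2
            · simpa [code_inj, hpar a haN hai, h1.ne] using h3
        · simp at hj
          by_cases hj5 : j = s'.reg 5
          · subst hj5
            have := hI.lt _ hip hpi
            have := hI.reg
            refine ⟨by simp [hI.reg], by simp; omega, d, hdS, by omega, by simp, ?_⟩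
            simp [code_inj, hpar d hn (by omega)]
          · obtain ⟨h1, h2, a, ha, hai, h3, h4⟩ := hI.exists_edge j (by omega)
            have haN := hS a ha
            refine ⟨by simpa [hj5] using h1, by simpa [hj5] using h2, a, ha, by omega, ?_, ?_⟩
            · simpa [hj5, code_inj, hne a haN.1 hai] using h3
            · simpa [hj5, code_inj, hpar a haN (by omega)] using h4
      · simp only [exec]
        simp [hi, hq', h0, h'.one, h'.zero, h27', hdS, hp]
        refine ⟨?_, fun _ => ?_, fun x hx hxi => ?_, fun a ha hai haS => ?_,
          fun x y hx hy hxi hyi hxy => ?_, fun a ha hai => ?_, fun j hj => ?_⟩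
        · simpa using hI.reg
        · simpa [code_inj, hr] using hI.root (by omega)
        · by_cases hxd : x = d
          · simpa [hxd] using hI.lt _ hip hpi
          · simpa [code_inj, hxd] using hI.lt x hx (((hlt hx).1 hxi).resolve_right hxd)
        · by_cases had : a = d
          · subst had
            simp [code_inj, hpar a ha hai]
          · simpa [code_inj, had, hpar a ha hai] using
              hI.step a ha (((hlt ha.1).1 hai).resolve_right had) haS
        · have hst : T.Joined Sᶜ d (T.par d) := SearchTree.Joined.step hn hdS
          by_cases hxd : x = d <;> by_cases hyd : y = d
          · rw [hxd, hyd]; exact hE.refl _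
          · simp [code_inj, hxd, hyd] at hxy
            rw [hxd]
            exact hE.trans hst (hI.joined _ y hip hy hpi (((hlt hy).1 hyi).resolve_right hyd) hxy)
          · simp [code_inj, hxd, hyd] at hxy
            rw [hyd]
            exact hE.trans (hI.joined x _ hx hip (((hlt hx).1 hxi).resolve_right hxd) hpi hxy)
              (hE.symm hst)
          · simp [code_inj, hxd, hyd] at hxy
            exact hI.joined x y hx hy (((hlt hx).1 hxi).resolve_right hxd)
              (((hlt hy).1 hyi).resolve_right hyd) hxy
        · have haN := hS a ha
          have had : a ≠ d := by rintro rfl; exact hdS ha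
          obtain ⟨j, h1, h2, h3⟩ := hI.edge a ha (((hlt haN.1).1 hai).resolve_right had)
          refine ⟨j, by simpa using h1, ?_, ?_⟩
          · simpa [code_inj, had] using h2
          · simpa [code_inj, hpar a haN hai] using h3
        · simp at hj
          obtain ⟨h1, h2, a, ha, hai, h3, h4⟩ := hI.exists_edge j (by omega)
          have haN := hS a ha
          refine ⟨by simpa using h1, by simpa using h2, a, ha, by omega, ?_, ?_⟩
          · simpa [code_inj, hne a haN.1 hai] using h3
          · simpa [code_inj, hpar a haN (by omega)] using h4
  · have := hT2.le
    omega
  · rintro s' ⟨hs, -⟩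
    simpa using hs

theorem HasNodes.eq_iff {dart : M.G.Dart ≃ Fin m} {s : RamState} {T : M.SearchTree} {S : Set M.G.Dart}
    {i : ℕ} (h : HasNodes T S dart i s) (hi : ∀ x, ¬ M.OuterDart x → T.idx x < i) {x y : M.G.Dart}
    (hx : ¬ M.OuterDart x) (hy : ¬ M.OuterDart y) :
    s.arr 6 (dart x) = s.arr 6 (dart y) ↔ T.Joined Sᶜ x y := by
  refine ⟨h.joined x y hx hy (hi x hx) (hi y hy), fun hxy => ?_⟩
  exact hxy.lift (fun x y => s.arr 6 (dart x) = s.arr 6 (dart y)) ⟨fun _ => rfl, Eq.symm, Eq.trans⟩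
    fun a ha haS => h.step a ha (hi a ha.1) haS

theorem HasNodes.exists_dart {dart : M.G.Dart ≃ Fin m} {s : RamState} {T : M.SearchTree}
    {S : Set M.G.Dart} {i : ℕ} (h : HasNodes T S dart i s) (hi : 0 < i) (hS : ∀ a ∈ S, T.Node a)
    {c : ℕ} (hc : c < s.reg 4) : ∃ x, ¬ M.OuterDart x ∧ s.arr 6 (dart x) = c := by
  rcases c with _ | j
  · exact ⟨T.root, T.inner_root, h.root hi⟩
  · obtain ⟨h1, -, a, ha, -, h2, -⟩ := h.exists_edge j (by have := h.reg; omega)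
    exact ⟨a, (hS a ha).1, by rw [← h2, h1]⟩

/-- By `conn_iff_joined`, equal node numbers mean equal components. The edge with index `j` joins
the new node `j + 1` to an older one, so the edges are pairwise different; there is one edge fewer
than nodes, and a connected graph with this property is a tree. -/
theorem HasNodes.outputsTree (hM : M.IsNice l) {dart : M.G.Dart ≃ Fin m} {s : RamState}
    {D : M.Selection} {i : ℕ} (h : HasNodes D.toSearchTree D.sel dart i s)
    (hi : ∀ x, ¬ M.OuterDart x → D.idx x < i) :
    s.OutputsTree M dart D.seps ∧ (M.mountainConnectionTree D.seps).IsTree := by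
  have hS : ∀ a ∈ D.sel, D.Node a := fun a ha => (hM.mem_sel_spec D ha).1
  have hi0 : 0 < i := Nat.zero_lt_of_lt (hi _ D.inner_root)
  have heq : ∀ x y (hx : ¬ M.OuterDart x) (hy : ¬ M.OuterDart y),
      M.comp D.seps x hx = M.comp D.seps y hy ↔ s.arr 6 (dart x) = s.arr 6 (dart y) := by
    intro x y hx hy
    rw [hM.comp_eq_iff D, hM.conn_iff_joined D hx hy, h.eq_iff hi hx hy]
  choose f hf hfC using fun C : M.Component D.seps => exists_comp C
  let g : M.Component D.seps → Fin (s.reg 4) := fun C =>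
    ⟨s.arr 6 (dart (f C)), h.lt _ (hf C) (hi _ (hf C))⟩
  have hg : Function.Bijective g := by
    constructor
    · intro C E hCE
      rw [hfC C, hfC E, heq]
      exact congrArg Fin.val hCE
    · intro c
      obtain ⟨x, hx, hxc⟩ := h.exists_dart hi0 hS c.2
      refine ⟨M.comp D.seps x hx, Fin.ext ?_⟩
      rw [← hxc]
      exact (heq _ _ (hf _) hx).1 (hfC _).symm
  have hgc : ∀ x (hx : ¬ M.OuterDart x), (g (M.comp D.seps x hx) : ℕ) = s.arr 6 (dart x) :=
    fun x hx => (heq _ _ (hf _) hx).1 (hfC _).symm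
  have hnd : ((List.range (s.reg 5)).map fun j => s(s.arr 7 j, s.arr 8 j)).Nodup := by
    refine List.Nodup.map_on ?_ List.nodup_range
    intro j hj k hk hjk
    obtain ⟨h1, h2, -⟩ := h.exists_edge j (List.mem_range.1 hj)
    obtain ⟨h3, h4, -⟩ := h.exists_edge k (List.mem_range.1 hk)
    rcases Sym2.eq_iff.1 hjk with ⟨h5, -⟩ | ⟨h5, h6⟩ <;> omega
  have hset : {e | e ∈ (List.range (s.reg 5)).map fun j => s(s.arr 7 j, s.arr 8 j)} =
      Sym2.map (fun C => (g C : ℕ)) '' (M.mountainConnectionTree D.seps).edgeSet := by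
    ext e
    simp only [List.mem_map, List.mem_range, Set.mem_image, Set.mem_ofPred_eq]
    constructor
    · rintro ⟨j, hj, rfl⟩
      obtain ⟨-, -, a, ha, -, h1, h2⟩ := h.exists_edge j hj
      refine ⟨_, (hM.mem_edgeSet_mountainConnectionTree D).2 ⟨a, ha, rfl⟩, ?_⟩
      rw [Sym2.map_mk]
      simp only [Prod.map, hgc, h1, h2]
    · rintro ⟨e, he, rfl⟩
      obtain ⟨a, ha, rfl⟩ := (hM.mem_edgeSet_mountainConnectionTree D).1 he
      obtain ⟨j, hj, h1, h2⟩ := h.edge a ha (hi a (hS a ha).1)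
      refine ⟨j, hj, ?_⟩
      rw [Sym2.map_mk]
      simp only [Prod.map, hgc, h1, h2]
  refine ⟨⟨Equiv.ofBijective g hg, fun d => (hgc d.1 d.2).symm, hnd, hset⟩, ?_⟩
  have hfin : Finite (M.Component D.seps) := Finite.of_injective g hg.1
  refine SimpleGraph.isTree_iff_connected_and_card.2 ⟨hM.connected_mountainConnectionTree D, ?_⟩
  have hinj : Function.Injective (Sym2.map fun C => (g C : ℕ)) :=
    Sym2.map.injective (Fin.val_injective.comp hg.1)
  have h1 : Nat.card (M.Component D.seps) = s.reg 4 := by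
    rw [Nat.card_congr (Equiv.ofBijective g hg), Nat.card_fin]
  have h2 : Nat.card (M.mountainConnectionTree D.seps).edgeSet = s.reg 5 := by
    rw [← Nat.card_image_of_injective hinj, ← hset]
    have : {e | e ∈ (List.range (s.reg 5)).map fun j => s(s.arr 7 j, s.arr 8 j)} =
        (((List.range (s.reg 5)).map fun j => s(s.arr 7 j, s.arr 8 j)).toFinset : Set (Sym2 ℕ)) := by
      ext; simp
    rw [this, Nat.card_coe_set_eq, Set.ncard_coe_finset, List.toFinset_card_of_nodup hnd]
    simp
  rw [h1, h2, h.reg]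

end PlaneGraph

/-! ### The program: the output of the crest separators -/

open RamProgram

namespace PlaneGraph

variable {n m l : ℕ} {M : PlaneGraph (Fin n)}

/-- The first `k` lists of the output are `L 0, …, L (k - 1)`, and the list `F` has been written behind
them; register 24 is the number of entries of array 5, and register 25 is `k`. -/
structure Writing (s : RamState) (k : ℕ) (L : ℕ → List ℕ) (F : List ℕ) : Prop where
  idx : s.reg 25 = k
  le : s.arr 4 k ≤ s.reg 24
  done : ∀ j < k, s.arr 4 (j + 1) ≤ s.arr 4 k ∧ s.outPath j = L j
  cur : (List.range (s.reg 24 - s.arr 4 k)).map (fun i => s.arr 5 (s.arr 4 k + i)) = F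

theorem Writing.push {s s' : RamState} {k : ℕ} {L : ℕ → List ℕ} {F : List ℕ} {v : ℕ}
    (h : Writing s k L F) (h25 : s'.reg 25 = s.reg 25) (h4 : s'.arr 4 = s.arr 4)
    (h24 : s'.reg 24 = s.reg 24 + 1) (h5 : ∀ i, s'.arr 5 i = if i = s.reg 24 then v else s.arr 5 i) :
    Writing s' k L (F ++ [v]) := by
  have hle := h.le
  refine ⟨h25.trans h.idx, by rw [h4, h24]; omega, fun j hj => ⟨by rw [h4]; exact (h.done j hj).1, ?_⟩, ?_⟩
  · rw [← (h.done j hj).2]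
    simp only [RamState.outPath, h4]
    refine List.map_congr_left fun i hi => ?_
    have := (h.done j hj).1
    rw [List.mem_range] at hi
    rw [h5, if_neg (by omega)]
  · rw [h4, h24, show s.reg 24 + 1 - s.arr 4 k = (s.reg 24 - s.arr 4 k) + 1 by omega, List.range_succ,
      List.map_append, ← h.cur]
    congr 1
    · refine List.map_congr_left fun i hi => ?_
      rw [List.mem_range] at hi
      rw [h5, if_neg (by omega)]
    · simp only [List.map_cons, List.map_nil]
      rw [h5, if_pos (by omega)]

theorem Writing.close {s s' : RamState} {k : ℕ} {L L' : ℕ → List ℕ} {F : List ℕ}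
    (h : Writing s k L F) (h25 : s'.reg 25 = k + 1) (h5 : s'.arr 5 = s.arr 5)
    (h24 : s'.reg 24 = s.reg 24) (h4 : ∀ i, s'.arr 4 i = if i = k + 1 then s.reg 24 else s.arr 4 i)
    (hL : ∀ j < k, L' j = L j) (hF : L' k = F) : Writing s' (k + 1) L' [] := by
  have hle := h.le
  refine ⟨h25, by rw [h4, h24]; simp, fun j hj => ?_, by rw [h4, h24]; simp⟩
  rw [h4 (k + 1), if_pos rfl, RamState.outPath, h5, h4 j, if_neg (by omega), h4 (j + 1)]
  rcases Nat.lt_succ_iff_lt_or_eq.1 hj with hj | rfl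
  · rw [if_neg (by omega), hL j hj]
    exact ⟨(h.done j hj).1.trans hle, (h.done j hj).2⟩
  · rw [if_pos rfl, hF, ← h.cur]
    exact ⟨le_rfl, rfl⟩

theorem Writing.congr {s s' : RamState} {k : ℕ} {L L' : ℕ → List ℕ} {F : List ℕ}
    (h : Writing s k L F) (h24 : s'.reg 24 = s.reg 24) (h25 : s'.reg 25 = s.reg 25)
    (h4 : s'.arr 4 = s.arr 4) (h5 : s'.arr 5 = s.arr 5) (hL : ∀ j < k, L' j = L j) :
    Writing s' k L' F := by
  refine ⟨h25.trans h.idx, by rw [h4, h24]; exact h.le, fun j hj => ?_, by rw [h4, h24, h5]; exact h.cur⟩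
  rw [RamState.outPath, h4, h5, hL j hj]
  exact h.done j hj

/-- Appends the down path of the vertex in register 10 to the output. -/
def progDownPath : RamProgram :=
  (store 5 24 10 ;; succ 24 ;; load 11 9 10) ;;
    RamProgram.while 8 11 (load 12 11 10 ;; pred 12 ;; load 10 13 12 ;; store 5 24 10 ;; succ 24 ;;
      load 11 9 10)

theorem downPath_of_height_eq_one {v : Fin n} (h : M.height v = 1) : M.downPath v = [v] := by
  rw [downPath, h]
  rfl

theorem IsNice.downPath_eq_cons (hM : M.IsNice l) {v : Fin n} (h : 2 ≤ M.height v) :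
    M.downPath v = v :: M.downPath (M.down v) := by
  have h1 := (hM.isDownVertex_down h).1.2
  obtain ⟨k, hk⟩ : ∃ k, M.height v = k + 2 := ⟨_, (Nat.sub_add_cancel h).symm⟩
  have h2 : M.height (M.down v) = k + 1 := by omega
  rw [downPath, downPath, hk, h2]
  rfl

/-- The arrays that are needed for the output of down paths. -/
structure HasDown (M : PlaneGraph (Fin n)) (dart : M.G.Dart ≃ Fin m) (s : RamState) : Prop where
  two : s.reg 8 = 2
  height : ∀ v : Fin n, s.arr 9 v = 2 * M.height v
  head : ∀ d, s.arr 13 (dart d) = d.snd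
  down : HasArgmin dart (fun d => (d.fst : ℕ)) (fun _ => True) (s.arr 11)

theorem HasDown.of_eq {dart : M.G.Dart ≃ Fin m} {s s' : RamState} (h : HasDown M dart s)
    (h8 : s'.reg 8 = s.reg 8) (h9 : s'.arr 9 = s.arr 9) (h13 : s'.arr 13 = s.arr 13)
    (h11 : s'.arr 11 = s.arr 11) : HasDown M dart s' :=
  ⟨h8 ▸ h.two, h9 ▸ h.height, h13 ▸ h.head, h11 ▸ h.down⟩

theorem HasDown.arr_down (hM : M.IsNice l) {dart : M.G.Dart ≃ Fin m} {s : RamState}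
    (h : HasDown M dart s) {v : Fin n} (hv : 2 ≤ M.height v) :
    ∃ d, s.arr 11 v = dart d + 1 ∧ d.snd = M.down v := by
  have hd := hM.isDownVertex_down hv
  exact ⟨⟨(v, M.down v), hd.1.1⟩, (h.down.eq_iff ⟨(v, M.down v), hd.1.1⟩).2 hd, rfl⟩

/-- The invariant splits the path into the prefix `P` and the vertex `u` written last. The measure
is the doubled height of `u`, at most `2 l`, and a round costs 7 steps with its test; this gives `14
l`. The loop ends on the coast, where the doubled height is 2. -/
theorem halts_progDownPath (hM : M.IsNice l) {dart : M.G.Dart ≃ Fin m} {s : RamState}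
    (h : HasDown M dart s) {k : ℕ} {L : ℕ → List ℕ} {F : List ℕ} (hW : Writing s k L F) {v : Fin n}
    (h10 : s.reg 10 = v) :
    Halts progDownPath s (14 * l + 4) fun s' =>
      Writing s' k L (F ++ (M.downPath v).map Fin.val) := by
  refine (Halts.straight (p := store 5 24 10 ;; succ 24 ;; load 11 9 10) (s := s)
    (Q := fun s' => s'.reg 10 = v ∧ s'.reg 11 = 2 * M.height v ∧ HasDown M dart s' ∧
      Writing s' k L (F ++ [(v : ℕ)])) rfl ?_).andThen (t' := 14 * l + 1) ?_ (by simp [cost]; omega)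
  · refine ⟨by simp [exec, h10], by simp [exec, h10, h.height],
      h.of_eq (by simp [exec]) (by simp [exec]) (by simp [exec]) (by simp [exec]),
      hW.push (by simp [exec]) (by simp [exec]) (by simp [exec]) fun i => by simp [exec, h10]⟩
  · rintro s₁ ⟨a1, a2, a3, a4⟩ -
    refine (Halts.while_loop (c := 6) (I := fun s' => HasDown M dart s' ∧ ∃ (u : Fin n) (P : List ℕ),
      s'.reg 10 = u ∧ s'.reg 11 = 2 * M.height u ∧ Writing s' k L (F ++ (P ++ [(u : ℕ)])) ∧
      (M.downPath v).map Fin.val = P ++ (M.downPath u).map Fin.val) (fun s' => s'.reg 11)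
      ⟨a3, v, [], a1, a2, a4, rfl⟩ ?_).mono ?_ ?_
    · rintro s₂ - ⟨b1, u, P, b2, b3, b4, b5⟩ hlt
      rw [b1.two, b3] at hlt
      have hu : 2 ≤ M.height u := by omega
      obtain ⟨d, hd, hdu⟩ := b1.arr_down hM hu
      have hh := (hM.isDownVertex_down hu).1.2
      refine Halts.straight rfl ⟨⟨b1.of_eq (by simp [exec]) (by simp [exec]) (by simp [exec])
        (by simp [exec]), M.down u, P ++ [(u : ℕ)], ?_, ?_, ?_, ?_⟩, ?_⟩
      · simp [exec, b2, hd, b1.head, hdu]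
      · simp [exec, b2, hd, b1.head, hdu, b1.height]
      · rw [← List.append_assoc F]
        exact b4.push (by simp [exec]) (by simp [exec]) (by simp [exec])
          fun i => by simp [exec, b2, hd, b1.head, hdu]
      · rw [b5, hM.downPath_eq_cons hu]
        simp
      · simp [exec, b2, hd, b1.head, hdu, b1.height, b3]
        omega
    · have := height_le hM.outer v
      rw [a2]
      omega
    · rintro s₂ ⟨⟨b1, u, P, b2, b3, b4, b5⟩, hn⟩
      rw [b1.two, b3] at hn
      have := one_le_height hM.outer u
      rw [b5, downPath_of_height_eq_one (by omega)]
      exact b4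

/-- Completes a list of the output. -/
def progClose : RamProgram := succ 25 ;; store 4 25 24

theorem halts_progClose {s : RamState} {k : ℕ} {L L' : ℕ → List ℕ} {F : List ℕ}
    (hW : Writing s k L F) (hL : ∀ j < k, L' j = L j) (hF : L' k = F) :
    Halts progClose s 2 fun s' => Writing s' (k + 1) L' [] := by
  have := hW.idx
  refine Halts.straight rfl (hW.close ?_ ?_ ?_ (fun i => ?_) hL hF) <;> simp [progClose, exec, this]

/-- Loads the ends of the edge of the dart in register 13 into registers 10 and 14, the higher one
into register 10, and their doubled heights into registers 15 and 16. -/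
def progEnds : RamProgram :=
  load 10 1 13 ;; load 14 13 13 ;; load 15 9 10 ;; load 16 9 14 ;;
    ite 15 16 (copy 17 10 ;; copy 10 14 ;; copy 14 17 ;; copy 17 15 ;; copy 15 16 ;; copy 16 17) (nop 17)

/-- Appends the crest separator of the edge of the dart in register 13 to the output. -/
def progSeparator : RamProgram :=
  progEnds ;; copy 18 10 ;; progDownPath ;; progClose ;;
    ite 16 15 (store 5 24 18 ;; succ 24) (nop 17) ;; copy 10 14 ;; progDownPath ;; progClose ;; succ 3

theorem halts_progSeparator (hM : M.IsNice l) {dart : M.G.Dart ≃ Fin m} {s : RamState}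
    (h : Given dart s) (hd : HasDown M dart s) {k : ℕ} {L L' : ℕ → List ℕ} (hW : Writing s k L [])
    {a : M.G.Dart} (h13 : s.reg 13 = dart a) (hL : ∀ j < k, L' j = L j)
    (h1 : L' k = (M.sepOf (M.orient a)).1.map Fin.val)
    (h2 : L' (k + 1) = (M.sepOf (M.orient a)).2.map Fin.val) :
    Halts progSeparator s (28 * l + 29) fun s' => Writing s' (k + 2) L' [] ∧
      s'.reg 3 = s.reg 3 + 1 := by
  set u := (M.orient a).fst with hu
  set v := (M.orient a).snd with hv
  refine (Halts.straight_le (t := 11) (p := progEnds) (s := s) (Q := fun s' => s'.reg 10 = u ∧ s'.reg 14 = v ∧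
    s'.reg 15 = 2 * M.height u ∧ s'.reg 16 = 2 * M.height v) rfl (by decide) ?_).andThen
    (t' := 28 * l + 18) ?_ (by omega)
  · by_cases hlt : M.height a.fst < M.height a.snd
    · have hor : M.orient a = a.symm := by rw [orient, if_pos hlt]
      rw [hu, hv, hor]
      simp [progEnds, exec, h13, h.tail, hd.head, hd.height, hlt]
    · have hor : M.orient a = a := by rw [orient, if_neg hlt]
      rw [hu, hv, hor]
      simp [progEnds, exec, h13, h.tail, hd.head, hd.height, hlt, nop]
  rintro s₁ ⟨a1, a2, a3, a4⟩ f1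
  have hd1 : HasDown M dart s₁ := hd.of_eq (f1.1 8 (by decide)) (f1.2 9 (by decide))
    (f1.2 13 (by decide)) (f1.2 11 (by decide))
  have hW1 : Writing s₁ k L' [] := hW.congr (f1.1 24 (by decide)) (f1.1 25 (by decide))
    (f1.2 4 (by decide)) (f1.2 5 (by decide)) hL
  refine (Halts.straight (p := copy 18 10) (s := s₁) (Q := fun s' => s' = s₁.setReg 18 u) rfl
    (by simp [exec, a1])).andThen (t' := 28 * l + 17) ?_ (by simp [cost]; omega)
  rintro s₂ rfl f2
  have hd2 : HasDown M dart (s₁.setReg 18 u) := hd1.of_eq (by simp) rfl rfl rfl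
  have hW2 : Writing (s₁.setReg 18 u) k L' [] := hW1.congr (by simp) (by simp) rfl rfl fun _ _ => rfl
  refine (halts_progDownPath hM hd2 hW2 (v := u) (by simp [a1])).andThen (t' := 14 * l + 13) ?_ (by omega)
  intro s₃ hW3 f3
  have hd3 : HasDown M dart s₃ := hd2.of_eq (f3.1 8 (by decide)) (f3.2 9 (by decide))
    (f3.2 13 (by decide)) (f3.2 11 (by decide))
  refine (halts_progClose hW3 (L' := L') (fun _ _ => rfl) (by rw [h1]; rfl)).andThen
    (t' := 14 * l + 11) ?_ (by omega)
  intro s₄ hW4 f4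
  have hd4 : HasDown M dart s₄ := hd3.of_eq (f4.1 8 (by decide)) (f4.2 9 (by decide))
    (f4.2 13 (by decide)) (f4.2 11 (by decide))
  have r : ∀ x ∈ [3, 14, 15, 16], s₄.reg x = s₁.reg x := by
    intro x hx
    have hx' : x ≠ 18 := by rintro rfl; simp at hx
    rw [f4.1 x (by revert x; decide), f3.1 x (by revert x; decide)]
    simp [hx']
  have r18 : s₄.reg 18 = u := by
    rw [f4.1 18 (by decide), f3.1 18 (by decide)]; simp
  -- The second path begins with `u` itself exactly if the top edge is slanted.
  refine (Halts.straight_le (t := 3) (p := RamProgram.ite 16 15 (store 5 24 18 ;; succ 24) (nop 17)) (s := s₄)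
    (Q := fun s' => Writing s' (k + 1) L' (if M.height v < M.height u then [(u : ℕ)] else [])) rfl
    (by decide) ?_).andThen (t' := 14 * l + 8) ?_ (by omega)
  · have e15 := r 15 (by simp)
    have e16 := r 16 (by simp)
    rw [a3] at e15
    rw [a4] at e16
    by_cases hlt : M.height v < M.height u
    · rw [if_pos hlt, ← List.nil_append [(u : ℕ)]]
      refine hW4.push ?_ ?_ ?_ fun i => ?_ <;> simp [exec, e15, e16, hlt, r18]
    · rw [if_neg hlt]
      refine hW4.congr ?_ ?_ ?_ ?_ fun _ _ => rfl <;> simp [exec, e15, e16, hlt, nop]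
  intro s₅ hW5 f5
  have hd5 : HasDown M dart s₅ := hd4.of_eq (f5.1 8 (by decide)) (f5.2 9 (by decide))
    (f5.2 13 (by decide)) (f5.2 11 (by decide))
  have r14 : s₅.reg 14 = v := by rw [f5.1 14 (by decide), r 14 (by simp), a2]
  refine (Halts.straight (p := copy 10 14) (s := s₅) (Q := fun s' => s' = s₅.setReg 10 v) rfl
    (by simp [exec, r14])).andThen (t' := 14 * l + 7) ?_ (by simp [cost]; omega)
  rintro s₆ rfl f6
  have hd6 : HasDown M dart (s₅.setReg 10 v) := hd5.of_eq (by simp) rfl rfl rfl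
  have hW6 := hW5.congr (s' := s₅.setReg 10 v) (L' := L') (by simp) (by simp) rfl rfl fun _ _ => rfl
  refine (halts_progDownPath hM hd6 hW6 (v := v) (by simp)).andThen (t' := 2 + 1) ?_ (by omega)
  intro s₇ hW7 f7
  refine (halts_progClose hW7 (L' := L') (fun _ _ => rfl) ?_).andThen (t' := 1) ?_ (by omega)
  · rw [h2, sepOf]
    split_ifs <;> simp [← hu, ← hv]
  intro s₈ hW8 f8
  have r3 : s₈.reg 3 = s.reg 3 := by
    rw [f8.1 3 (by decide), f7.1 3 (by decide), RamState.reg_setReg, if_neg (by decide),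
      f5.1 3 (by decide), r 3 (by simp), f1.1 3 (by decide)]
  refine Halts.straight rfl ⟨hW8.congr ?_ ?_ ?_ ?_ fun _ _ => rfl, ?_⟩ <;> simp [exec, r3]

/-- The output of the crest separators of all selected edges. -/
def progOutput : RamProgram :=
  forUp 9 21 (load 13 20 9 ;; load 14 27 13 ;; ite 6 14 progSeparator (nop 17))

variable (M) in
/-- The lists of the crest separators of the edges in a list. -/
noncomputable def sepLists (A : List M.G.Dart) (j : ℕ) : List ℕ :=
  if j % 2 = 0 then (M.sepOf (M.orient (A.getD (j / 2) M.outer))).1.map Fin.val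
  else (M.sepOf (M.orient (A.getD (j / 2) M.outer))).2.map Fin.val

open Classical in
theorem halts_progOutput (hM : M.IsNice l) {dart : M.G.Dart ≃ Fin m} {s : RamState}
    (h : Given dart s) (hd : HasDown M dart s) {T : M.SearchTree} (hT : HasTree T dart s)
    {S : Set M.G.Dart} (hS : ∀ a ∈ S, T.Node a)
    (h27 : ∀ d, ¬ M.OuterDart d → s.arr 27 (dart d) = if d ∈ S then 1 else 0)
    (h3 : s.reg 3 = 0) (h24 : s.reg 24 = 0) (h25 : s.reg 25 = 0) (h40 : s.arr 4 0 = 0) :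
    Halts progOutput s ((28 * l + 34) * m + 2) fun s' => ∃ A : List M.G.Dart, A.Nodup ∧
      (∀ a, a ∈ A ↔ a ∈ S) ∧ s'.reg 3 = A.length ∧ Writing s' (2 * A.length) (M.sepLists A) [] := by
  refine (Halts.forUp (c := 28 * l + 32) (I := fun i s' => ∃ A : List M.G.Dart, A.Nodup ∧
      (∀ a, a ∈ A ↔ a ∈ S ∧ T.idx a < i) ∧ s'.reg 3 = A.length ∧
      Writing s' (2 * A.length) (M.sepLists A) []) (by decide) (by decide) ?_ ?_).mono ?_ ?_
  · refine ⟨[], List.nodup_nil, by simp, by simp [h3], by simp [h25], by simp [h24, h40],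
      by simp, by simp [h24, h40]⟩
  · rintro j hj s₀ f0 hi ⟨A, hA1, hA2, hA3, hA4⟩
    obtain ⟨d, hd', rfl, hq⟩ := hT.queue j hj
    have h0 := h.frame f0 (by decide) (by decide)
    have hT0 := hT.frame (f0.1 21 (by decide)) (f0.2 20 (by decide)) (f0.2 21 (by decide))
    have hq' := (hT0.inner d hd').2
    have h27' : s₀.arr 27 (dart d) = if d ∈ S then 1 else 0 := by
      rw [f0.2 27 (by decide)]; exact h27 d hd'
    have hd0 : HasDown M dart s₀ := hd.of_eq (f0.1 8 (by decide)) (f0.2 9 (by decide))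
      (f0.2 13 (by decide)) (f0.2 11 (by decide))
    have hmem : ∀ a, (a ∈ S ∧ T.idx a < T.idx d + 1) ↔ (a ∈ S ∧ T.idx a < T.idx d) ∨
        (a = d ∧ d ∈ S) := by
      intro a
      constructor
      · rintro ⟨ha, hai⟩
        rcases (hT.idx_lt_succ hd' (hS a ha).1).1 hai with h | rfl
        · exact Or.inl ⟨ha, h⟩
        · exact Or.inr ⟨rfl, ha⟩
      · rintro (⟨ha, hai⟩ | ⟨rfl, ha⟩)
        · exact ⟨ha, by omega⟩
        · exact ⟨ha, by omega⟩
    refine (Halts.straight (p := load 13 20 9) (s := s₀) (Q := fun s' => s' = s₀.setReg 13 (dart d))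
      rfl (by simp [exec, hi, hq'])).andThen (t' := 28 * l + 31) ?_ (by simp [cost]; omega)
    rintro s₁ rfl -
    refine (Halts.straight (p := load 14 27 13) (s := s₀.setReg 13 (dart d)) (Q := fun s' => s' =
      (s₀.setReg 13 (dart d)).setReg 14 (if d ∈ S then 1 else 0))
      rfl (by simp [exec, h27'])).andThen (t' := 28 * l + 30) ?_ (by simp [cost]; omega)
    rintro s₂ rfl -
    refine Halts.ite (t := 28 * l + 29) (fun hlt => ?_) fun hlt => ?_
    · simp [h0.zero] at hlt
      have hdS : d ∈ S := by
        by_contra hdS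
        simp [hdS] at hlt
      set s₂ := (s₀.setReg 13 (dart d)).setReg 14 (if d ∈ S then 1 else 0) with hs2
      have g2 : Given dart s₂ := ⟨by simp [hs2, h0.reg_m], by simp [hs2, h0.reg_outer],
        by simp [hs2, h0.zero], by simp [hs2, h0.one], by simp [hs2, h0.two], h0.num, h0.tail,
        h0.symm, h0.rot⟩
      have hd2 : HasDown M dart s₂ := hd0.of_eq (by simp [hs2]) rfl rfl rfl
      have hW2 : Writing s₂ (2 * A.length) (M.sepLists A) [] :=
        hA4.congr (by simp [hs2]) (by simp [hs2]) rfl rfl fun _ _ => rfl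
      refine (halts_progSeparator hM g2 hd2 hW2 (a := d) (L' := M.sepLists (A ++ [d])) (by simp [hs2])
        ?_ ?_ ?_).mono le_rfl ?_
      · intro j hj
        have e : (A ++ [d]).getD (j / 2) M.outer = A.getD (j / 2) M.outer :=
          List.getD_append _ _ _ _ (by omega)
        rw [sepLists, sepLists, e]
      · have e : (A ++ [d]).getD (2 * A.length / 2) M.outer = d := by
          rw [Nat.mul_div_cancel_left _ (by decide)]
          simp
        rw [sepLists, e, if_pos (by omega)]
      · have e : (A ++ [d]).getD ((2 * A.length + 1) / 2) M.outer = d := by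
          rw [show (2 * A.length + 1) / 2 = A.length by omega]
          simp
        rw [sepLists, e, if_neg (by omega)]
      · rintro s₃ ⟨hW3, r3⟩
        refine ⟨A ++ [d], ?_, fun a => ?_, ?_, ?_⟩
        · rw [List.nodup_append]
          refine ⟨hA1, List.nodup_singleton _, ?_⟩
          rintro a ha b hb rfl
          rw [List.mem_singleton] at hb
          subst hb
          exact lt_irrefl _ ((hA2 a).1 ha).2
        · rw [List.mem_append, hA2, hmem, List.mem_singleton, and_iff_left hdS]
        · simp [r3, hs2, hA3]
        · rw [List.length_append, List.length_singleton, Nat.mul_add]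
          exact hW3.congr (by simp) (by simp) rfl rfl fun _ _ => rfl
    · have hdS : d ∉ S := by
        intro hdS
        simp [h0.zero, hdS] at hlt
      refine Halts.straight_le rfl (by simp [nop, cost]) ⟨A, hA1, fun a => ?_, ?_, ?_⟩
      · rw [hA2, hmem]
        simp [hdS]
      · simp [nop, exec, hA3]
      · exact hA4.congr (by simp [nop, exec]) (by simp [nop, exec]) rfl rfl fun _ _ => rfl
  · have : (28 * l + 32 + 2) * s.reg 21 ≤ (28 * l + 34) * m := Nat.mul_le_mul_left _ hT.le
    omega
  · rintro s' ⟨⟨A, hA1, hA2, hA3, hA4⟩, -⟩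
    exact ⟨A, hA1, fun a => by
      rw [hA2]; exact ⟨fun h => h.1, fun h => ⟨h, (hT.inner a (hS a h).1).1⟩⟩, hA3, hA4⟩

/-- No separator is written twice: `sepOf` is injective on darts, and no edge is crossed by two
steps of the search tree. The default dart of `getD` is never used, as all indices are below the
length. -/
theorem outputsSeparators (hM : M.IsNice l) (D : M.Selection) {s : RamState} {A : List M.G.Dart}
    (hA : A.Nodup) (hmem : ∀ a, a ∈ A ↔ a ∈ D.sel) (h3 : s.reg 3 = A.length)
    (hW : Writing s (2 * A.length) (M.sepLists A) []) : s.OutputsSeparators D.seps := by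
  have hget : ∀ i : Fin (s.reg 3), A.getD i M.outer = A[(i : ℕ)]'(h3 ▸ i.2) := fun i =>
    List.getD_eq_getElem _ _ _
  refine ⟨fun i => M.sepOf (M.orient (A.getD i M.outer)), fun i j hij => ?_, ?_, fun i => ?_⟩
  · have h1 := hM.sepOf_injective hij
    have hc : ∀ i : Fin (s.reg 3), D.Cross (A.getD i M.outer) := fun i =>
      (hM.mem_sel_spec D ((hmem _).1 (by rw [hget]; exact List.getElem_mem _))).2.2
    have h2 := SearchTree.eq_of_edge_eq (hc i) (hc j) (by rw [← edge_orient, h1, edge_orient])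
    rw [hget, hget, hA.getElem_inj_iff] at h2
    exact Fin.ext h2
  · ext X
    constructor
    · rintro ⟨i, rfl⟩
      exact ⟨_, (hmem _).1 (by rw [hget]; exact List.getElem_mem _), rfl⟩
    · rintro ⟨a, ha, rfl⟩
      obtain ⟨i, hi, rfl⟩ := List.getElem_of_mem ((hmem a).2 ha)
      exact ⟨⟨i, h3 ▸ hi⟩, by simp only [List.getD_eq_getElem _ _ hi]⟩
  · have hi := i.2
    rw [(hW.done (2 * i) (by omega)).2, (hW.done (2 * i + 1) (by omega)).2, sepLists, sepLists,
      if_pos (by omega), if_neg (by omega), show 2 * (i : ℕ) / 2 = i by omega,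
      show (2 * (i : ℕ) + 1) / 2 = i by omega]
    exact ⟨rfl, rfl⟩

end PlaneGraph

/-! ### The whole program -/

open RamProgram

namespace PlaneGraph

variable {n m l : ℕ} {M : PlaneGraph (Fin n)}

/-- The program that computes a good mountain structure and its mountain connection tree. -/
def progMountain : RamProgram :=
  (const 7 1 ;; const 8 2) ;; progFace ;; progCoast ;; progHeights ;; progArgmin 1 11 ;; progBest ;;
    progWeights ;; progAcross ;; progTree ;; progNodeWeights ;; progSelect ;; progNodes ;; progOutput

theorem halts_progMountain (hM : M.IsNice l) (dart : M.G.Dart ≃ Fin m) :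
    Halts progMountain (RamState.input M dart) (2500 * l * n) fun s =>
      ∃ D : M.Selection, s.OutputsSeparators D.seps ∧ s.OutputsTree M dart D.seps ∧
        (M.mountainConnectionTree D.seps).IsTree := by
  classical
  have hz : ∀ a, 4 ≤ a → ∀ i, (RamState.input M dart).arr a i = 0 := by
    intro a ha i
    simp only [RamState.input]
    split_ifs <;> first | rfl | omega
  have hr : ∀ x, 3 ≤ x → (RamState.input M dart).reg x = 0 := by
    intro x hx
    simp only [RamState.input]
    rw [if_neg (by omega), if_neg (by omega), if_neg (by omega)]
  refine Halts.mono (t := 2 + (7 * m + 2 + (6 * m + 4 + ((15 * m + 6) * (l + 1) + 3 + (18 * m + 2 +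
      (60 * m + 8 + (16 * m + 2 + (22 * m + 2 + (20 * m + 10 + (10 * m + 4 +
      ((31 * m + 8) * (2 * (l + 1)) + 2 + (13 * m + 4 + ((28 * l + 34) * m + 2)))))))))))))
    (Halts.seq (t := 2) (Halts.straight (p := const 7 1 ;; const 8 2) rfl ?_)) ?_ fun _ h => h
  rotate_left
  -- Expanding the sum of the bounds gives `105 l m + 283 m + 22 l + 69`. With `m ≤ 6 n` and `1 ≤
  -- l`, `1 ≤ n` this is at most `2419 l n`, which is rounded up to `2500 l n`.
  · have h1 : m ≤ 6 * n := by
      have := hM.card_dart_le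
      rwa [Nat.card_congr dart, Nat.card_fin, Nat.card_fin] at this
    have h2 : 1 ≤ l := (one_le_height hM.outer M.outer.fst).trans (height_le hM.outer _)
    have h3 : 1 ≤ n := Nat.zero_lt_of_lt M.outer.fst.2
    have h4 : l * m ≤ l * (6 * n) := Nat.mul_le_mul_left _ h1
    have h5 : n ≤ l * n := Nat.le_mul_of_pos_left _ h2
    have h6 : l ≤ l * n := Nat.le_mul_of_pos_right _ h3
    have e1 : (15 * m + 6) * (l + 1) = 15 * (l * m) + 15 * m + 6 * l + 6 := by ring
    have e2 : (31 * m + 8) * (2 * (l + 1)) = 62 * (l * m) + 62 * m + 16 * l + 16 := by ring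
    have e3 : (28 * l + 34) * m = 28 * (l * m) + 34 * m := by ring
    have e4 : 2500 * l * n = 2500 * (l * n) := by ring
    have e5 : l * (6 * n) = 6 * (l * n) := by ring
    rw [e1, e2, e3, e4]
    omega
  set s1 := exec (const 7 1 ;; const 8 2) (RamState.input M dart) with hs1
  have b1 : s1.arr = (RamState.input M dart).arr := rfl
  have r1 : ∀ x, x ≠ 7 → x ≠ 8 → s1.reg x = (RamState.input M dart).reg x := by
    intro x h7 h8
    simp [hs1, exec, h7, h8]
  have g1 : Given dart s1 := by
    constructor
    · simp [hs1, exec, RamState.input]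
    · simp [hs1, exec, RamState.input]
    · simp [hs1, exec, RamState.input]
    · simp [hs1, exec]
    · simp [hs1, exec]
    · intro v; simp [b1, RamState.input]
    · intro d; simp [b1, RamState.input, code_lt]
    · intro d; simp [b1, RamState.input, code_lt]
    · intro d; simp [b1, RamState.input, code_lt]
  refine (halts_progFace g1).andThen (fun s2 a2 f2 => ?_) le_rfl
  have g2 := g1.frame f2 (by decide) (by decide)
  refine (halts_progCoast g2 a2
      (fun i => by
        rw [f2.2 9 (by decide)]
        exact hz 9 (by decide) i)
      (fun i => by
        rw [f2.2 10 (by decide)]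
        exact hz 10 (by decide) i)).andThen (fun s3 a3 f3 => ?_) le_rfl
  have g3 := g2.frame f3 (by decide) (by decide)
  refine (halts_progHeights hM g3 ⟨
      (by
        rw [f3.2 13 (by decide)]
        exact a2.head),
      (by
        rw [f3.2 14 (by decide)]
        exact a2.face)⟩ a3).andThen (fun s4 a4 f4 => ?_) le_rfl
  have g4 := g3.frame f4 (by decide) (by decide)
  refine (halts_progArgmin (k := 1) (r := 11) (K := fun d => (d.fst : ℕ)) hM g4
      (by
        rw [f4.2 13 (by decide), f3.2 13 (by decide)]
        exact a2.head)
    a4.height g4.tail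
      (fun i => by
        rw [f4.2 11 (by decide), f3.2 11 (by decide), f2.2 11 (by decide)]
        exact hz 11 (by decide) i) (by decide)).andThen (fun s5 a5 f5 => ?_) le_rfl
  have g5 := g4.frame f5 (by decide) (by decide)
  refine (halts_progBest hM g5
      (by
        rw [f5.2 13 (by decide), f4.2 13 (by decide), f3.2 13 (by decide)]
        exact a2.head)
      (by
        rw [f5.2 9 (by decide)]
        exact a4.height)
      (fun i => by
        rw [f5.2 12 (by decide), f4.2 12 (by decide), f3.2 12 (by decide),
            f2.2 12 (by decide)]
        exact hz 12 (by decide) i)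
      (fun i => by
        rw [f5.2 18 (by decide), f4.2 18 (by decide), f3.2 18 (by decide),
            f2.2 18 (by decide)]
        exact hz 18 (by decide) i)
      (by
        rw [f5.1 21 (by decide), f4.1 21 (by decide), f3.1 21 (by decide),
            f2.1 21 (by decide), r1 21 (by decide) (by decide)]
        exact hr 21 (by decide))).andThen (fun s6 a6 f6 => ?_) le_rfl
  have g6 := g5.frame f6 (by decide) (by decide)
  refine (halts_progWeights hM g6
      (by
        rw [f6.2 13 (by decide), f5.2 13 (by decide), f4.2 13 (by decide),
            f3.2 13 (by decide)]
        exact a2.head)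
      (by
        rw [f6.2 9 (by decide), f5.2 9 (by decide)]
        exact a4.height) a6).andThen (fun s7 a7 f7 => ?_) le_rfl
  have g7 := g6.frame f7 (by decide) (by decide)
  refine (halts_progAcross g7
      (by
        rw [f7.2 13 (by decide), f6.2 13 (by decide), f5.2 13 (by decide),
            f4.2 13 (by decide), f3.2 13 (by decide)]
        exact a2.head)
      (by
        rw [f7.2 10 (by decide), f6.2 10 (by decide), f5.2 10 (by decide),
            f4.2 10 (by decide)]
        exact a3.out)
      (by
        rw [f7.2 11 (by decide), f6.2 11 (by decide)]
        exact a5)).andThen (fun s8 a8 f8 => ?_) le_rfl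
  have g8 := g7.frame f8 (by decide) (by decide)
  refine (halts_progTree hM g8
      (by
        rw [f8.2 14 (by decide), f7.2 14 (by decide), f6.2 14 (by decide),
            f5.2 14 (by decide), f4.2 14 (by decide), f3.2 14 (by decide)]
        exact a2.face) a8
      (fun i => by
        rw [f8.2 22 (by decide), f7.2 22 (by decide), f6.2 22 (by decide),
            f5.2 22 (by decide), f4.2 22 (by decide), f3.2 22 (by decide), f2.2 22 (by decide)]
        exact hz 22 (by decide) i)).andThen (fun s9 ⟨T, a9⟩ f9 => ?_) le_rfl
  have g9 := g8.frame f9 (by decide) (by decide)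
  have h20 : s9.reg 20 = s4.reg 20 := by
    rw [f9.1 20 (by decide), f8.1 20 (by decide), f7.1 20 (by decide), f6.1 20 (by decide),
      f5.1 20 (by decide)]
  have h20' : s6.reg 20 = s4.reg 20 := by rw [f6.1 20 (by decide), f5.1 20 (by decide)]
  rw [h20'] at a7
  refine (halts_progNodeWeights hM g9 a9 (by rw [f9.2 19 (by decide)]; exact a8)
      (by
        rw [h20, f9.2 23 (by decide), f8.2 23 (by decide)]
        exact a7)
      (by
        rw [h20]
        exact a4.lt_top)).andThen (fun s10 ⟨wt, hwt, a10⟩ f10 => ?_) le_rfl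
  have g10 := g9.frame f10 (by decide) (by decide)
  have hT10 := a9.frame (f10.1 21 (by decide)) (f10.2 20 (by decide)) (f10.2 21 (by decide))
  have h20'' : s10.reg 20 = s9.reg 20 := f10.1 20 (by decide)
  obtain ⟨D, hD, hsel⟩ := exists_selection hT10 hwt (by rw [h20]; exact a4.lt_top)
  subst hD
  refine (((halts_progSelect (wt := wt) g10 hT10
      (by
        rw [f10.2 9 (by decide), f9.2 9 (by decide), f8.2 9 (by decide), f7.2 9 (by decide),
            f6.2 9 (by decide), f5.2 9 (by decide)]
        exact a4.height)
      (by
        rw [h20'']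
        exact hwt) a10
      (fun i => by
        rw [f10.2 27 (by decide), f9.2 27 (by decide), f8.2 27 (by decide),
            f7.2 27 (by decide), f6.2 27 (by decide), f5.2 27 (by decide), f4.2 27 (by decide),
            f3.2 27 (by decide), f2.2 27 (by decide)]
        exact hz 27 (by decide) i)).mono (Nat.add_le_add_right
    (Nat.mul_le_mul_left _ (by rw [h20'', h20]; exact a4.top_le)) _) fun _ h => h)).andThen
    (fun s11 a11 f11 => ?_) le_rfl
  have g11 := g10.frame f11 (by decide) (by decide)
  have hT11 := hT10.frame (f11.1 21 (by decide)) (f11.2 20 (by decide)) (f11.2 21 (by decide))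
  have hS : ∀ a ∈ D.sel, D.Node a := fun a ha => (hM.mem_sel_spec D ha).1
  have h27 : ∀ d, ¬ M.OuterDart d → s11.arr 27 (dart d) = if d ∈ D.sel then 1 else 0 := by
    intro d hd
    rw [a11 d hd, hsel, h20'']
    rfl
  refine (halts_progNodes g11 hT11 hS h27).andThen (fun s12 a12 f12 => ?_) le_rfl
  have g12 := g11.frame f12 (by decide) (by decide)
  have hT12 := hT11.frame (f12.1 21 (by decide)) (f12.2 20 (by decide)) (f12.2 21 (by decide))
  refine (halts_progOutput hM g12 ⟨g12.two,
      (by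
        rw [f12.2 9 (by decide), f11.2 9 (by decide), f10.2 9 (by decide), f9.2 9 (by decide),
            f8.2 9 (by decide), f7.2 9 (by decide), f6.2 9 (by decide), f5.2 9 (by decide)]
        exact a4.height),
      (by
        rw [f12.2 13 (by decide), f11.2 13 (by decide), f10.2 13 (by decide),
            f9.2 13 (by decide), f8.2 13 (by decide), f7.2 13 (by decide), f6.2 13 (by decide),
            f5.2 13 (by decide), f4.2 13 (by decide), f3.2 13 (by decide)]
        exact a2.head),
      (by
        rw [f12.2 11 (by decide), f11.2 11 (by decide), f10.2 11 (by decide),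
            f9.2 11 (by decide), f8.2 11 (by decide), f7.2 11 (by decide), f6.2 11 (by decide)]
        exact a5)⟩ hT12 hS
      (by
        rw [f12.2 27 (by decide)]
        exact h27)
      (by
        rw [f12.1 3 (by decide), f11.1 3 (by decide), f10.1 3 (by decide), f9.1 3 (by decide),
            f8.1 3 (by decide), f7.1 3 (by decide), f6.1 3 (by decide), f5.1 3 (by decide),
            f4.1 3 (by decide), f3.1 3 (by decide), f2.1 3 (by decide),
            r1 3 (by decide) (by decide)]
        exact hr 3 (by decide))
      (by
        rw [f12.1 24 (by decide), f11.1 24 (by decide), f10.1 24 (by decide),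
            f9.1 24 (by decide), f8.1 24 (by decide), f7.1 24 (by decide), f6.1 24 (by decide),
            f5.1 24 (by decide), f4.1 24 (by decide), f3.1 24 (by decide), f2.1 24 (by decide),
            r1 24 (by decide) (by decide)]
        exact hr 24 (by decide))
      (by
        rw [f12.1 25 (by decide), f11.1 25 (by decide), f10.1 25 (by decide),
            f9.1 25 (by decide), f8.1 25 (by decide), f7.1 25 (by decide), f6.1 25 (by decide),
            f5.1 25 (by decide), f4.1 25 (by decide), f3.1 25 (by decide), f2.1 25 (by decide),
            r1 25 (by decide) (by decide)]
        exact hr 25 (by decide))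
      (by
        rw [f12.2 4 (by decide), f11.2 4 (by decide), f10.2 4 (by decide), f9.2 4 (by decide),
            f8.2 4 (by decide), f7.2 4 (by decide), f6.2 4 (by decide), f5.2 4 (by decide),
            f4.2 4 (by decide), f3.2 4 (by decide), f2.2 4 (by decide)]
        exact hz 4 (by decide) 0)).frame.mono le_rfl ?_
  rintro s13 ⟨⟨A, hA, hmem, h3, hW⟩, f13⟩
  have hN : HasNodes D.toSearchTree D.sel dart (s11.reg 21) s13 := by
    have e4 := f13.1 4 (by decide)
    have e5 := f13.1 5 (by decide)
    have e6 := f13.2 6 (by decide)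
    have e7 := f13.2 7 (by decide)
    have e8 := f13.2 8 (by decide)
    constructor
    · rw [e4, e5]; exact a12.reg
    · rw [e6]; exact a12.root
    · rw [e6, e4]; exact a12.lt
    · rw [e6]; exact a12.step
    · rw [e6]; exact a12.joined
    · rw [e5, e6, e7, e8]; exact a12.edge
    · rw [e5, e6, e7, e8]; exact a12.exists_edge
  obtain ⟨hT, hT'⟩ := hN.outputsTree hM fun x hx => (hT11.inner x hx).1
  exact ⟨D, outputsSeparators hM D hA hmem h3 hW, hT, hT'⟩

end PlaneGraph

theorem mainTheorem6 :
    ∃ (P : RamProgram) (c : ℕ), ∀ (n m l : ℕ) (M : PlaneGraph (Fin n)) (dart : M.G.Dart ≃ Fin m),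
      M.AlmostTriangulated → M.Biconnected → M.IsOuterplanar l →
      ∃ (k : ℕ) (s : RamState) (S : Set (List (Fin n) × List (Fin n))),
        RunsIn P (RamState.input M dart) k s ∧ k ≤ c * l * n ∧
        s.OutputsSeparators S ∧ s.OutputsTree M dart S ∧
        M.IsGoodMountainStructure S ∧
        (M.mountainConnectionTree S).IsTree ∧
        ∀ C : M.Component S, ∃ H, M.IsCrest H ∧ H ⊆ M.compVerts C ∧
          ∀ H', M.IsCrest H' → (H' ∩ M.compVerts C).Nonempty → H' = H := by
  refine ⟨PlaneGraph.progMountain, 2500, fun n m l M dart htri hbic hout => ?_⟩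
  have hM : M.IsNice l := ⟨htri, hbic, hout⟩
  obtain ⟨k, s, hrun, hk, D, hS, hT, htree⟩ := PlaneGraph.halts_progMountain hM dart
  exact ⟨k, s, D.seps, hrun, hk, hS, hT, hM.isGoodMountainStructure D, htree,
    hM.crest_of_component D⟩
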